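/- Let $\Gamma$ be a finite commutative group and $\Bbbk$ a commutative $\mathbb Q$-algebra. **Notation.** Let $X=\{x_0\}\sqcup\{x_\gamma\mid\gamma\in\Gamma\}$ (letters of degree $1$) and $Y=\{y_{n,\gamma}\mid n\ge 1,\gamma\in\Gamma\}$ ($y_{n,\gamma}$ of degree $n$), and let $\Bbbk\langle\langle X\rangle\rangle$, $\Bbbk\langle\langle Y\rangle\rangle$ be the degree completions of the free associative algebras, with their completed tensor squares; $(f|w)$ is the coefficient of the word $w$ in $f$. For $\sigma\in\Gamma$, $t_\sigma$ is the automorphism $x_0\mapsto x_0$, $x_\gamma\mapsto x_{\sigma\gamma}$ of $\Bbbk\langle\langle X\rangle\rangle$. For $G\in\Bbbk\langle\langle X\rangle\rangle$ invertible, $\mathrm{aut}_G$ is the continuous algebra automorphism $x_0\mapsto x_0$, $x_\sigma\mapsto t_\sigma(G)^{-1}x_\sigma t_\sigma(G)$, and $G\circledast H:=G\cdot\mathrm{aut}_G(H)=:S_G(H)$. Let $\mathsf{MT}(\Bbbk)$ be the set of series in $\Bbbk\langle\langle X\rangle\rangle$ with constant term $1$, and let $\exp(\hat{\mathfrak{Lib}}_\Bbbk(X))\subset\mathsf{MT}(\Bbbk)$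 be the set of exponentials of the elements of the degree completion of the Lie subalgebra of $\Bbbk\langle X\rangle$ generated by $X$. Let $\pi_Y:\Bbbk\langle\langle X\rangle\rangle\to\Bbbk\langle\langle Y\rangle\rangle$ be the continuous linear map that kills words ending in $x_0$ and sends $x_0^{n_1-1}x_{\sigma_1}\cdots x_0^{n_r-1}x_{\sigma_r}$ to $y_{n_1,\sigma_1}\cdots y_{n_r,\sigma_r}$, and let $\mathbf q$ be the continuous linear automorphism $y_{n_1,\sigma_1}\cdots y_{n_r,\sigma_r}\mapsto y_{n_1,\sigma_1}y_{n_2,\sigma_2\sigma_1^{-1}}\cdots y_{n_r,\sigma_r\sigma_{r-1}^{-1}}$ of $\Bbbk\langle\langle Y\rangle\rangle$. For $K\in\Bbbk\langle\langle Y\rangle\rangle$ let $\tilde K\in\Bbbk\langle\langle X\rangle\rangle$ be its image under $y_{n,\sigma}\mapsto x_0^{n-1}x_\sigma$, and for $g\in\mathsf{MT}(\Bbbk)$ put $S^Y_g:=\mathbf q\circ(K\mapsto\pi_Y(g\circledast\tilde K))\circ\mathbf q^{-1}$. Let $\Delta$ be the continuous algebra morphism $\Bbbk\langle\langle X\rangle\rangle\to\Bbbk\langle\langle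 X\rangle\rangle^{\hat\otimes2}$ for which all letters are primitive, and let the harmonic coproduct $\Delta_*:\Bbbk\langle\langle Y\rangle\rangle\to\Bbbk\langle\langle Y\rangle\rangle^{\hat\otimes2}$ be the continuous algebra morphism with $$\Delta_*(y_{n,\sigma})=y_{n,\sigma}\otimes1+1\otimes y_{n,\sigma}+\sum_{n'+n''=n,\ n',n''>0,\ \sigma'\sigma''=\sigma}y_{n',\sigma'}\otimes y_{n'',\sigma''}.$$ For $G\in\exp(\hat{\mathfrak{Lib}}_\Bbbk(X))$ put $$\Theta_\Bbbk(G):=\exp\Big(\sum_{n\ge1}\tfrac{(-1)^{n-1}}n(G|x_0^{n-1}x_1)x_1^n\Big)\cdot G\cdot\exp(-(G|x_0)x_0).$$ Let $\mathsf{DMR}_0(\Bbbk)$ be the set of invertible $G\in\Bbbk\langle\langle X\rangle\rangle$ with $(G|1)=1$, $(G|x_0)=(G|x_1)=(G|x_0x_1)=0$, $(G|x_\sigma)=(G|x_{\sigma^{-1}})$ for all $\sigma\in\Gamma$, $\Delta(G)=G\otimes G$ and $\Delta_*(G_\star)=G_\star\otimes G_\star$, where $G_\star:=\exp\big(\sum_{n\ge2}\frac{(-1)^{n-1}}n(\pi_Y(G)|y_{n,1})y_{1,1}^n\big)\cdot\mathbf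 q(\pi_Y(G))$, and put $$\widetilde{\mathsf{DMR}}_0(\Bbbk):=\{e^{\beta x_1}\cdot g\cdot e^{\alpha x_0}\mid\alpha,\beta\in\Bbbk,\ g\in\mathsf{DMR}_0(\Bbbk)\}.$$ **Theorem.** $(\mathsf{MT}(\Bbbk),\circledast)$ is a group and $\exp(\hat{\mathfrak{Lib}}_\Bbbk(X))$ is a subgroup of it; $\Theta_\Bbbk:(\exp(\hat{\mathfrak{Lib}}_\Bbbk(X)),\circledast)\to(\mathsf{MT}(\Bbbk),\circledast)$ is a group morphism; for $g\in\mathsf{MT}(\Bbbk)$ the map $S^Y_g$ is a continuous linear automorphism of $\Bbbk\langle\langle Y\rangle\rangle$ with $S^Y_g\circ\mathbf q\circ\pi_Y=\mathbf q\circ\pi_Y\circ S_g$, one has $S^Y_{g\circledast h}=S^Y_g\circ S^Y_h$, and $g\cdot u:=(S^Y_g)^{\otimes2}\circ u\circ(S^Y_g)^{-1}$ is an action of $\mathsf{MT}(\Bbbk)$ on the set $\mathrm{Hom}^{\mathrm{cont}}_\Bbbk(\Bbbk\langle\langle Y\rangle\rangle,\Bbbk\langle\langle Y\rangle\rangle^{\hat\otimes2})$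 of continuous $\Bbbk$-linear maps. The set $\widetilde{\mathsf{DMR}}_0(\Bbbk)$ is a subgroup of $(\exp(\hat{\mathfrak{Lib}}_\Bbbk(X)),\circledast)$, and it coincides with the stabilizer of $\Delta_*$ for the pull-back of this action by $\Theta_\Bbbk$, namely $$\widetilde{\mathsf{DMR}}_0(\Bbbk)=\{g\in\exp(\hat{\mathfrak{Lib}}_\Bbbk(X))\mid(S^Y_{\Theta_\Bbbk(g)})^{\otimes2}\circ\Delta_*=\Delta_*\circ S^Y_{\Theta_\Bbbk(g)}\}.$$ Equivalently, $\widetilde{\mathsf{DMR}}_0(\Bbbk)$ is the set of $g\in\exp(\hat{\mathfrak{Lib}}_\Bbbk(X))$ such that $S^Y_{\Theta_\Bbbk(g)}$ is an automorphism of the topological coalgebra $(\Bbbk\langle\langle Y\rangle\rangle,\Delta_*)$ (with counit the constant term). -/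

import Mathlib

namespace DoubleShuffle

/-! ### Graded index monoids and completed monoid algebras -/

/-- An alphabet whose letters carry positive integer degrees, with finitely many letters of each
degree. -/
class WeightedAlphabet (A : Type*) where
  wt : A → ℕ
  wt_pos : ∀ a, 0 < wt a
  finite_wt_le : ∀ n, {a | wt a ≤ n}.Finite

/-- A monoid graded by `ℕ`, with finitely many elements of each degree, the only one of degree `0`
being the unit. -/
class FinGraded (M : Type*) [Monoid M] where
  deg : M → ℕ
  deg_mul : ∀ a b, deg (a * b) = deg a + deg b
  eq_one_of_deg : ∀ a, deg a = 0 → a = 1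
  finite_deg_le : ∀ n, {a | deg a ≤ n}.Finite

open WeightedAlphabet FinGraded

lemma deg_one {M : Type*} [Monoid M] [FinGraded M] : deg (1 : M) = 0 := by
  have h := deg_mul (1 : M) 1
  rw [mul_one] at h
  omega

/-- The words in a weighted alphabet, graded by total weight. -/
instance instFinGradedFreeMonoid {A : Type*} [WeightedAlphabet A] : FinGraded (FreeMonoid A) where
  deg w := (w.toList.map wt).sum
  deg_mul a b := by simp
  eq_one_of_deg w h := by
    rcases hw : w.toList with _ | ⟨a, l⟩
    · exact FreeMonoid.toList.injective hw
    · rw [hw] at h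
      have := wt_pos a
      simp at h
      omega
  finite_deg_le n := by
    have key : ∀ l : List A, (l.map wt).sum ≤ n → l.length ≤ n ∧ ∀ a ∈ l, wt a ≤ n := by
      intro l hl
      constructor
      · have h1 : l.length ≤ (l.map wt).sum := by
          clear hl
          induction l with
          | nil => simp
          | cons a l ih =>
            have := wt_pos a
            simp
            omega
        omega
      · intro a ha
        exact (List.single_le_sum (by simp) _ (List.mem_map_of_mem ha)).trans hl
    have : Finite {a : A // wt a ≤ n} := (finite_wt_le (A := A) n).to_subtype
    refine ((List.finite_length_le {a : A // wt a ≤ n} n).image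
      (fun l => FreeMonoid.ofList (l.map Subtype.val))).subset ?_
    intro w hw
    obtain ⟨h1, h2⟩ := key w.toList hw
    refine ⟨w.toList.attach.map (fun x => ⟨x.1, h2 x.1 x.2⟩), by simpa using h1, ?_⟩
    simp [Function.comp_def]

/-- Pairs (indexing tensors `u ⊗ v`), graded by total degree. -/
instance instFinGradedProd {M N : Type*} [Monoid M] [Monoid N] [FinGraded M] [FinGraded N] :
    FinGraded (M × N) where
  deg p := deg p.1 + deg p.2
  deg_mul a b := by
    simp only [Prod.fst_mul, Prod.snd_mul, deg_mul]
    omega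
  eq_one_of_deg p h :=
    Prod.ext (eq_one_of_deg p.1 (by omega)) (eq_one_of_deg p.2 (by omega))
  finite_deg_le n := by
    refine ((finite_deg_le (M := M) n).prod (finite_deg_le (M := N) n)).subset ?_
    intro p hp
    simp only [Set.mem_ofPred_eq] at hp
    constructor <;> simp only [Set.mem_ofPred_eq] <;> omega

lemma finite_factorizations {M : Type*} [Monoid M] [FinGraded M] (m : M) :
    {p : M × M | p.1 * p.2 = m}.Finite := by
  refine (finite_deg_le (M := M × M) (deg m)).subset ?_
  rintro p rfl
  exact (deg_mul p.1 p.2).ge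

/-- The finite set of pairs `(a, b)` with `a * b = m`. -/
noncomputable def fac {M : Type*} [Monoid M] [FinGraded M] (m : M) : Finset (M × M) :=
  (finite_factorizations m).toFinset

lemma mem_fac {M : Type*} [Monoid M] [FinGraded M] {m : M} {p : M × M} :
    p ∈ fac m ↔ p.1 * p.2 = m := by
  simp [fac]

/-- The degree completion of the monoid algebra `𝕜[M]`: formal series `∑ f(m) m`, given by their
coefficient functions. For `M` the words in `A` this is `𝕜⟨⟨A⟩⟩`; for `M = N × N` it is the
completed tensor square of `Series N 𝕜`, the pair `(u, v)` standing for `u ⊗ v`. -/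
def Series (M 𝕜 : Type*) := M → 𝕜

namespace Series

variable {M N 𝕜 : Type*}

instance : CoeFun (Series M 𝕜) (fun _ => M → 𝕜) := ⟨fun f => f⟩

@[ext] lemma ext {f g : Series M 𝕜} (h : ∀ m, f m = g m) : f = g := funext h

variable [CommRing 𝕜]

instance : AddCommGroup (Series M 𝕜) := inferInstanceAs (AddCommGroup (M → 𝕜))

instance : Module 𝕜 (Series M 𝕜) := inferInstanceAs (Module 𝕜 (M → 𝕜))

/-- The topology of the degree completion: coefficientwise convergence, `𝕜` being discrete. -/
instance : TopologicalSpace (Series M 𝕜) := @Pi.topologicalSpace M (fun _ => 𝕜) (fun _ => ⊥)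

@[simp] lemma zero_apply (m : M) : (0 : Series M 𝕜) m = 0 := rfl

@[simp] lemma add_apply (f g : Series M 𝕜) (m : M) : (f + g) m = f m + g m := rfl

@[simp] lemma neg_apply (f : Series M 𝕜) (m : M) : (-f) m = -f m := rfl

@[simp] lemma smul_apply (c : 𝕜) (f : Series M 𝕜) (m : M) : (c • f) m = c * f m := rfl

@[simp] lemma sum_apply {ι : Type*} (s : Finset ι) (f : ι → Series M 𝕜) (m : M) :
    (∑ i ∈ s, f i) m = ∑ i ∈ s, f i m := Finset.sum_apply m s f

open Classical in
/-- The series reduced to the single element `m`. -/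
noncomputable def single (m : M) : Series M 𝕜 := fun m' => if m' = m then 1 else 0

lemma single_apply_ne_zero {m m' : M} (h : (single m : Series M 𝕜) m' ≠ 0) : m' = m := by
  by_contra h'
  exact h (by simp [single, h'])

/-- The tensor `f ⊗ g`. -/
def tensor (f : Series M 𝕜) (g : Series N 𝕜) : Series (M × N) 𝕜 := fun p => f p.1 * g p.2

section Ring

variable [Monoid M] [FinGraded M]

noncomputable instance : One (Series M 𝕜) := ⟨single 1⟩

/-- The product `(f * g)(m) = ∑_{ab = m} f(a) g(b)`. -/
noncomputable instance : Mul (Series M 𝕜) := ⟨fun f g m => ∑ p ∈ fac m, f p.1 * g p.2⟩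

lemma one_def : (1 : Series M 𝕜) = single 1 := rfl

lemma mul_apply (f g : Series M 𝕜) (m : M) : (f * g) m = ∑ p ∈ fac m, f p.1 * g p.2 := rfl

lemma one_mul_aux (f : Series M 𝕜) : 1 * f = f := by
  ext m
  rw [mul_apply, Finset.sum_eq_single (1, m)]
  · simp [one_def, single]
  · rintro ⟨a, b⟩ h1 h2
    rw [mem_fac] at h1
    simp only at h1
    have : a ≠ 1 := by
      rintro rfl
      exact h2 (by rw [← h1, one_mul])
    simp [one_def, single, this]
  · intro h
    exact absurd (mem_fac.2 (one_mul m)) h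

lemma mul_one_aux (f : Series M 𝕜) : f * 1 = f := by
  ext m
  rw [mul_apply, Finset.sum_eq_single (m, 1)]
  · simp [one_def, single]
  · rintro ⟨a, b⟩ h1 h2
    rw [mem_fac] at h1
    simp only at h1
    have : b ≠ 1 := by
      rintro rfl
      exact h2 (by rw [← h1, mul_one])
    simp [one_def, single, this]
  · intro h
    exact absurd (mem_fac.2 (mul_one m)) h

lemma mul_assoc_aux (f g h : Series M 𝕜) : f * g * h = f * (g * h) := by
  ext m
  simp only [mul_apply, Finset.sum_mul, Finset.mul_sum]
  rw [Finset.sum_sigma', Finset.sum_sigma']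
  refine Finset.sum_nbij' (fun x => ⟨(x.2.1, x.2.2 * x.1.2), (x.2.2, x.1.2)⟩)
    (fun x => ⟨(x.1.1 * x.2.1, x.2.2), (x.1.1, x.2.1)⟩) ?_ ?_ ?_ ?_ ?_
  · rintro ⟨⟨a, b⟩, ⟨c, d⟩⟩ hx
    simp only [Finset.mem_sigma, mem_fac] at hx ⊢
    rw [← hx.1, ← hx.2]
    simp [mul_assoc]
  · rintro ⟨⟨a, b⟩, ⟨c, d⟩⟩ hx
    simp only [Finset.mem_sigma, mem_fac] at hx ⊢
    rw [← hx.1, ← hx.2]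
    simp [mul_assoc]
  · rintro ⟨⟨a, b⟩, ⟨c, d⟩⟩ hx
    simp only [Finset.mem_sigma, mem_fac] at hx
    simp [hx.2]
  · rintro ⟨⟨a, b⟩, ⟨c, d⟩⟩ hx
    simp only [Finset.mem_sigma, mem_fac] at hx
    simp [hx.2]
  · rintro ⟨⟨a, b⟩, ⟨c, d⟩⟩ _
    simp [mul_assoc]

noncomputable instance : Ring (Series M 𝕜) where
  __ := (inferInstance : AddCommGroup (Series M 𝕜))
  mul_assoc := mul_assoc_aux
  one_mul := one_mul_aux
  mul_one := mul_one_aux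
  left_distrib f g h := by
    ext m
    simp [mul_apply, mul_add, Finset.sum_add_distrib]
  right_distrib f g h := by
    ext m
    simp [mul_apply, add_mul, Finset.sum_add_distrib]
  zero_mul f := by
    ext m
    simp [mul_apply]
  mul_zero f := by
    ext m
    simp [mul_apply]

noncomputable instance : Algebra 𝕜 (Series M 𝕜) :=
  Algebra.ofModule
    (fun c f g => by
      ext m
      simp [mul_apply, Finset.mul_sum, mul_assoc])
    (fun c f g => by
      ext m
      simp [mul_apply, Finset.mul_sum, mul_left_comm])

/-- The Lie bracket is the commutator. -/
noncomputable instance : LieRing (Series M 𝕜) := LieRing.ofAssociativeRing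

noncomputable instance : LieAlgebra 𝕜 (Series M 𝕜) := LieAlgebra.ofAssociativeAlgebra

/-- The homogeneous component of degree `n`. -/
def component (n : ℕ) (f : Series M 𝕜) : Series M 𝕜 := fun m => if deg m = n then f m else 0

/-- `∑_{n ≥ 0} c_n f^n`, for `f` with constant term `0`: as `f^n` then has no term of degree `< n`,
the coefficient at `m` is the finite sum over `n ≤ deg m`. -/
noncomputable def powSum (c : ℕ → 𝕜) (f : Series M 𝕜) : Series M 𝕜 :=
  fun m => ∑ n ∈ Finset.range (deg m + 1), c n * (f ^ n) m

/-- The exponential of a series with constant term `0`. -/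
noncomputable def exp [Algebra ℚ 𝕜] (f : Series M 𝕜) : Series M 𝕜 :=
  powSum (fun n => algebraMap ℚ 𝕜 (1 / (n.factorial : ℚ))) f

end Ring

/-! ### Continuous linear maps given by the images of the basis elements -/

section Maps

lemma finsum_eq (c : M → Series N 𝕜) (h : ∀ n, {m | c m n ≠ 0}.Finite) (f : Series M 𝕜) (n : N) :
    ∑ᶠ m, f m * c m n = ∑ m ∈ (h n).toFinset, f m * c m n := by
  apply finsum_eq_sum_of_support_subset
  intro m hm
  simp only [Set.Finite.coe_toFinset, Set.mem_ofPred_eq]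
  intro h0
  exact hm (by simp [h0])

/-- The continuous linear map `∑ f(m) m ↦ ∑ f(m) c(m)`, for a family `c` of series in which each
basis element occurs only finitely often. -/
noncomputable def mapOfImages (c : M → Series N 𝕜) (h : ∀ n, {m | c m n ≠ 0}.Finite) :
    Series M 𝕜 →L[𝕜] Series N 𝕜 where
  toFun f := fun n => ∑ᶠ m, f m * c m n
  map_add' f g := by
    ext n
    change ∑ᶠ m, (f m + g m) * c m n = ∑ᶠ m, f m * c m n + ∑ᶠ m, g m * c m n
    rw [← finsum_add_distrib]
    · simp only [add_mul]
    · exact (h n).subset fun m hm h0 => hm (by simp [h0])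
    · exact (h n).subset fun m hm h0 => hm (by simp [h0])
  map_smul' r f := by
    ext n
    have h1 := finsum_eq c h (r • f) n
    have h2 := finsum_eq c h f n
    change ∑ᶠ m, (r • f) m * c m n = r * ∑ᶠ m, f m * c m n
    rw [h1, h2, Finset.mul_sum]
    simp [mul_assoc]
  cont := by
    let _ : TopologicalSpace 𝕜 := ⊥
    have : DiscreteTopology 𝕜 := ⟨rfl⟩
    refine continuous_pi (A := fun _ : N => 𝕜) fun n => ?_
    simp only [finsum_eq c h]
    exact continuous_finsetSum _ fun m _ =>
      (continuous_apply (A := fun _ : M => 𝕜) m).mul continuous_const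

/-- The continuous linear map `∑ f(m) m ↦ ∑ f(m) r(m)`, for `r` not lowering degrees. -/
noncomputable def mapOfIndex [Monoid M] [FinGraded M] [Monoid N] [FinGraded N] (r : M → N)
    (h : ∀ m, deg m ≤ deg (r m)) : Series M 𝕜 →L[𝕜] Series N 𝕜 :=
  mapOfImages (fun m => single (r m)) fun n =>
    (finite_deg_le (deg n)).subset fun m hm => by
      rw [Set.mem_ofPred_eq, single_apply_ne_zero hm]
      exact h m

lemma lift_ne_zero {A : Type*} [WeightedAlphabet A] [Monoid N] [FinGraded N]
    (φ : A → Series N 𝕜) (h : ∀ a n, φ a n ≠ 0 → wt a ≤ deg n) (w : FreeMonoid A) :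
    ∀ n, (FreeMonoid.lift φ w) n ≠ 0 → deg w ≤ deg n := by
  induction w using FreeMonoid.inductionOn' with
  | one =>
    intro n _
    rw [deg_one]
    exact Nat.zero_le _
  | of_mul a w ih =>
    intro n hn
    rw [map_mul, FreeMonoid.lift_eval_of, mul_apply] at hn
    obtain ⟨p, hp, hne⟩ := Finset.exists_ne_zero_of_sum_ne_zero hn
    rw [mem_fac] at hp
    have h1 := h a p.1 (left_ne_zero_of_mul hne)
    have h2 := ih p.2 (right_ne_zero_of_mul hne)
    have h3 : deg (FreeMonoid.of a) = wt a := by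
      simp [deg]
    rw [← hp, deg_mul, deg_mul, h3]
    omega

/-- The continuous algebra morphism `𝕜⟨⟨A⟩⟩ → Series N 𝕜` sending each letter `a` to `φ a`, for
`φ a` without terms of degree less than that of `a`. -/
noncomputable def subst {A : Type*} [WeightedAlphabet A] [Monoid N] [FinGraded N]
    (φ : A → Series N 𝕜) (h : ∀ a n, φ a n ≠ 0 → wt a ≤ deg n) :
    Series (FreeMonoid A) 𝕜 →L[𝕜] Series N 𝕜 :=
  mapOfImages (fun w => FreeMonoid.lift φ w) fun n =>
    (finite_deg_le (deg n)).subset fun w hw => lift_ne_zero φ h w n hw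

lemma finite_of_continuous (S : Series M 𝕜 →L[𝕜] Series N 𝕜) (n : N) :
    {m | S (single m) n ≠ 0}.Finite := by
  let _ : TopologicalSpace 𝕜 := ⊥
  have : DiscreteTopology 𝕜 := ⟨rfl⟩
  have hc : Continuous fun f : M → 𝕜 => (S f : N → 𝕜) n :=
    (continuous_apply (A := fun _ : N => 𝕜) n).comp S.continuous
  have hopen : IsOpen {f : M → 𝕜 | (S f : N → 𝕜) n = 0} :=
    (isOpen_discrete ({0} : Set 𝕜)).preimage hc
  obtain ⟨I, u, hu, hsub⟩ := isOpen_pi_iff.1 hopen (0 : M → 𝕜)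
    (show S (0 : Series M 𝕜) n = 0 by simp)
  refine I.finite_toSet.subset fun m hm => ?_
  by_contra hmI
  refine hm (hsub fun i hi => ?_)
  have hne : i ≠ m := by
    rintro rfl
    exact hmI hi
  have : (single m : Series M 𝕜) i = 0 := by simp [single, hne]
  rw [this]
  exact (hu i hi).2

/-- The completed tensor square `S ⊗ S` of a continuous linear map `S`, sending `u ⊗ v` to
`S u ⊗ S v`. -/
noncomputable def tensorSq (S : Series M 𝕜 →L[𝕜] Series N 𝕜) :
    Series (M × M) 𝕜 →L[𝕜] Series (N × N) 𝕜 :=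
  mapOfImages (fun p => tensor (S (single p.1)) (S (single p.2))) fun n =>
    ((finite_of_continuous S n.1).prod (finite_of_continuous S n.2)).subset fun p hp =>
      ⟨left_ne_zero_of_mul (a := S (single p.1) n.1) (b := S (single p.2) n.2) hp,
        right_ne_zero_of_mul (a := S (single p.1) n.1) (b := S (single p.2) n.2) hp⟩

/-- Left multiplication by a series. -/
noncomputable def mulLeft [Monoid M] [FinGraded M] (g : Series M 𝕜) :
    Series M 𝕜 →L[𝕜] Series M 𝕜 where
  toFun f := g * f
  map_add' := mul_add g
  map_smul' r f := mul_smul_comm r g f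
  cont := by
    let _ : TopologicalSpace 𝕜 := ⊥
    have : DiscreteTopology 𝕜 := ⟨rfl⟩
    refine continuous_pi (A := fun _ : M => 𝕜) fun m => ?_
    exact continuous_finsetSum _ fun p _ =>
      continuous_const.mul (continuous_apply (A := fun _ : M => 𝕜) p.2)

/-- The continuous linear map `f ↦ f ∘ r`, i.e. `(f ∘ r | n) = (f | r(n))`. -/
def comap (r : N → M) : Series M 𝕜 →L[𝕜] Series N 𝕜 where
  toFun f := fun n => f (r n)
  map_add' _ _ := rfl
  map_smul' _ _ := rfl
  cont := by
    let _ : TopologicalSpace 𝕜 := ⊥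
    exact continuous_pi (A := fun _ : N => 𝕜) fun n =>
      continuous_apply (A := fun _ : M => 𝕜) (r n)

end Maps

end Series

open Series

/-! ### The alphabets -/

/-- The alphabet `X = {x_0} ⊔ {x_γ | γ ∈ Γ}`; all letters have degree `1`. -/
inductive AlphX (Γ : Type*)
  | zero : AlphX Γ
  | of (γ : Γ) : AlphX Γ

instance {Γ : Type*} [Finite Γ] : Finite (AlphX Γ) :=
  Finite.of_surjective (fun o : Option Γ => o.elim AlphX.zero AlphX.of) fun a => by
    cases a with
    | zero => exact ⟨none, rfl⟩
    | of γ => exact ⟨some γ, rfl⟩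

instance {Γ : Type*} [Finite Γ] : WeightedAlphabet (AlphX Γ) where
  wt _ := 1
  wt_pos _ := Nat.one_pos
  finite_wt_le _ := Set.toFinite _

/-- The alphabet `Y = {y_{n,γ} | n ≥ 1, γ ∈ Γ}`; the letter `y_{n,γ}` has degree `n`. -/
structure AlphY (Γ : Type*) where
  idx : ℕ+
  col : Γ

instance {Γ : Type*} [Finite Γ] : WeightedAlphabet (AlphY Γ) where
  wt y := y.idx
  wt_pos y := y.idx.pos
  finite_wt_le n := by
    refine (((Set.finite_Iic (n.succPNat)).prod (Set.finite_univ (α := Γ))).image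
      fun p => AlphY.mk p.1 p.2).subset ?_
    rintro ⟨i, γ⟩ h
    refine ⟨(i, γ), ⟨?_, trivial⟩, rfl⟩
    simp only [Set.mem_ofPred_eq] at h
    simp only [Set.mem_Iic, ← PNat.coe_le_coe, Nat.succPNat_coe]
    omega

/-- `𝕜⟨⟨X⟩⟩` -/
abbrev SerX (Γ 𝕜 : Type*) := Series (FreeMonoid (AlphX Γ)) 𝕜

/-- The completed tensor square of `𝕜⟨⟨X⟩⟩` -/
abbrev SerXX (Γ 𝕜 : Type*) := Series (FreeMonoid (AlphX Γ) × FreeMonoid (AlphX Γ)) 𝕜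

/-- `𝕜⟨⟨Y⟩⟩` -/
abbrev SerY (Γ 𝕜 : Type*) := Series (FreeMonoid (AlphY Γ)) 𝕜

/-- The completed tensor square of `𝕜⟨⟨Y⟩⟩` -/
abbrev SerYY (Γ 𝕜 : Type*) := Series (FreeMonoid (AlphY Γ) × FreeMonoid (AlphY Γ)) 𝕜

section Constructions

variable {Γ : Type*} [CommGroup Γ] [Finite Γ] {𝕜 : Type*} [CommRing 𝕜]

/-- The letter `x_0`. -/
noncomputable def x0 : SerX Γ 𝕜 := single (FreeMonoid.of AlphX.zero)

/-- The letter `x_γ`. -/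
noncomputable def x (γ : Γ) : SerX Γ 𝕜 := single (FreeMonoid.of (AlphX.of γ))

/-- The letter `y_{n,γ}`. -/
noncomputable def y (n : ℕ+) (γ : Γ) : SerY Γ 𝕜 := single (FreeMonoid.of ⟨n, γ⟩)

/-- The word `x_0^m x_γ`. -/
def wordX (m : ℕ) (γ : Γ) : FreeMonoid (AlphX Γ) :=
  FreeMonoid.of AlphX.zero ^ m * FreeMonoid.of (AlphX.of γ)

lemma deg_of {A : Type*} [WeightedAlphabet A] (a : A) : deg (FreeMonoid.of a) = wt a := by
  simp [deg]

lemma deg_wordX (m : ℕ) (γ : Γ) : deg (wordX m γ) = m + 1 := by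
  induction m with
  | zero => simp [wordX, deg_of, wt]
  | succ m ih =>
    rw [wordX, pow_succ', mul_assoc, deg_mul, ← wordX, ih, deg_of]
    simp only [wt]
    omega

/-! ### The twisted Magnus group -/

/-- The action of `σ ∈ Γ` on letters: `x_0 ↦ x_0`, `x_γ ↦ x_{σγ}`. -/
def shiftLetter (σ : Γ) : AlphX Γ → AlphX Γ
  | AlphX.zero => AlphX.zero
  | AlphX.of γ => AlphX.of (σ * γ)

/-- The automorphism `t_σ` of `𝕜⟨⟨X⟩⟩`. -/
noncomputable def t (σ : Γ) : SerX Γ 𝕜 →L[𝕜] SerX Γ 𝕜 :=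
  mapOfIndex (FreeMonoid.map (shiftLetter σ)) fun w => by
    simp [deg, wt, Function.comp_def]

/-- The images of the letters under `aut_G`: `x_0 ↦ x_0`, `x_σ ↦ t_σ(G)⁻¹ x_σ t_σ(G)`. -/
noncomputable def autLetter (G : SerX Γ 𝕜) : AlphX Γ → SerX Γ 𝕜
  | AlphX.zero => x0
  | AlphX.of σ => Ring.inverse (t σ G) * x σ * t σ G

lemma autLetter_ne_zero (G : SerX Γ 𝕜) (a : AlphX Γ) (u : FreeMonoid (AlphX Γ))
    (h : autLetter G a u ≠ 0) : wt a ≤ deg u := by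
  cases a with
  | zero =>
    rw [single_apply_ne_zero h, deg_of]
  | of σ =>
    simp only [autLetter, mul_apply] at h
    obtain ⟨p, hp, h1⟩ := Finset.exists_ne_zero_of_sum_ne_zero h
    obtain ⟨q, hq, h2⟩ := Finset.exists_ne_zero_of_sum_ne_zero (left_ne_zero_of_mul h1)
    have h3 := single_apply_ne_zero (right_ne_zero_of_mul h2)
    rw [mem_fac] at hp hq
    rw [← hp, ← hq, deg_mul, deg_mul, h3, deg_of]
    simp only [wt]
    omega

/-- The continuous algebra endomorphism `aut_G` of `𝕜⟨⟨X⟩⟩`, for `G` invertible. -/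
noncomputable def aut (G : SerX Γ 𝕜) : SerX Γ 𝕜 →L[𝕜] SerX Γ 𝕜 :=
  subst (autLetter G) (autLetter_ne_zero G)

/-- The continuous linear endomorphism `S_G : H ↦ G ⊛ H = G · aut_G(H)` of `𝕜⟨⟨X⟩⟩`. -/
noncomputable def SX (G : SerX Γ 𝕜) : SerX Γ 𝕜 →L[𝕜] SerX Γ 𝕜 := (mulLeft G).comp (aut G)

/-- The product `G ⊛ H = G · aut_G(H)`. -/
noncomputable def circ (G H : SerX Γ 𝕜) : SerX Γ 𝕜 := G * aut G H

variable (Γ 𝕜) in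
/-- The underlying set of the group `MT(𝕜)`: series with constant term `1`. -/
def MT : Type _ := {G : SerX Γ 𝕜 // G 1 = 1}

instance : CoeOut (MT Γ 𝕜) (SerX Γ 𝕜) := ⟨Subtype.val⟩

variable (Γ 𝕜) in
/-- The completed free Lie algebra: series all of whose homogeneous components lie in the Lie
subalgebra (for the commutator) generated by the letters. -/
def LibHat : Set (SerX Γ 𝕜) :=
  {f | ∀ n, component n f ∈
    LieSubalgebra.lieSpan 𝕜 (SerX Γ 𝕜) (insert x0 (Set.range x))}

/-! ### From `X` to `Y` -/

/-- The image in words over `X` of a word over `Y`, under `y_{n,σ} ↦ x_0^{n-1} x_σ`. -/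
def wordYX : FreeMonoid (AlphY Γ) →* FreeMonoid (AlphX Γ) :=
  FreeMonoid.lift fun a => wordX ((a.idx : ℕ) - 1) a.col

lemma deg_wordYX (w : FreeMonoid (AlphY Γ)) : deg (wordYX w) = deg w := by
  induction w using FreeMonoid.inductionOn' with
  | one => rw [map_one, deg_one, deg_one]
  | of_mul a w ih =>
    rw [map_mul, deg_mul, deg_mul, ih, deg_of, wordYX, FreeMonoid.lift_eval_of, deg_wordX]
    have := a.idx.pos
    simp only [wt]
    omega

/-- The embedding `K ↦ K̃` of `𝕜⟨⟨Y⟩⟩` in `𝕜⟨⟨X⟩⟩`, `y_{n,σ} ↦ x_0^{n-1} x_σ`. -/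
noncomputable def embYX : SerY Γ 𝕜 →L[𝕜] SerX Γ 𝕜 :=
  mapOfIndex wordYX fun w => (deg_wordYX w).ge

/-- The projection `π_Y : 𝕜⟨⟨X⟩⟩ → 𝕜⟨⟨Y⟩⟩`, zero on the words ending in `x_0` and left inverse to
the embedding: a word over `X` not ending in `x_0` is the image of a unique word `w` over `Y`, and
`(π_Y(f) | w)` is the coefficient of that word in `f`. -/
def piY : SerX Γ 𝕜 →L[𝕜] SerY Γ 𝕜 := comap wordYX

/-- `y_{s_1,σ_1} ⋯ y_{s_r,σ_r} ↦ y_{s_1,σ_1 τ⁻¹} y_{s_2,σ_2 σ_1⁻¹} ⋯ y_{s_r,σ_r σ_{r-1}⁻¹}` -/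
def qList : Γ → List (AlphY Γ) → List (AlphY Γ)
  | _, [] => []
  | τ, a :: l => ⟨a.idx, a.col * τ⁻¹⟩ :: qList a.col l

/-- `y_{s_1,σ_1} ⋯ y_{s_r,σ_r} ↦ y_{s_1,τ σ_1} y_{s_2,τ σ_1 σ_2} ⋯ y_{s_r,τ σ_1 ⋯ σ_r}` -/
def pList : Γ → List (AlphY Γ) → List (AlphY Γ)
  | _, [] => []
  | τ, a :: l => ⟨a.idx, τ * a.col⟩ :: pList (τ * a.col) l

lemma wt_qList (τ : Γ) (l : List (AlphY Γ)) :
    ((qList τ l).map wt).sum = (l.map wt).sum := by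
  induction l generalizing τ with
  | nil => rfl
  | cons a l ih => simp only [qList, List.map_cons, List.sum_cons, ih]; rfl

lemma wt_pList (τ : Γ) (l : List (AlphY Γ)) :
    ((pList τ l).map wt).sum = (l.map wt).sum := by
  induction l generalizing τ with
  | nil => rfl
  | cons a l ih => simp only [pList, List.map_cons, List.sum_cons, ih]; rfl

/-- The linear automorphism `𝐪` of `𝕜⟨⟨Y⟩⟩`,
`y_{s_1,σ_1} ⋯ y_{s_r,σ_r} ↦ y_{s_1,σ_1} y_{s_2,σ_2 σ_1⁻¹} ⋯ y_{s_r,σ_r σ_{r-1}⁻¹}`. -/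
noncomputable def q : SerY Γ 𝕜 →L[𝕜] SerY Γ 𝕜 :=
  mapOfIndex (fun w => FreeMonoid.ofList (qList 1 w.toList)) fun w => (wt_qList 1 w.toList).ge

/-- The inverse `𝐩` of `𝐪`,
`y_{s_1,σ_1} ⋯ y_{s_r,σ_r} ↦ y_{s_1,σ_1} y_{s_2,σ_1 σ_2} ⋯ y_{s_r,σ_1 ⋯ σ_r}`. -/
noncomputable def qInv : SerY Γ 𝕜 →L[𝕜] SerY Γ 𝕜 :=
  mapOfIndex (fun w => FreeMonoid.ofList (pList 1 w.toList)) fun w => (wt_pList 1 w.toList).ge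

/-- The endomorphism `S^Y_G = 𝐪 ∘ (K ↦ π_Y(G ⊛ K̃)) ∘ 𝐪⁻¹` of `𝕜⟨⟨Y⟩⟩`. -/
noncomputable def SY (G : SerX Γ 𝕜) : SerY Γ 𝕜 →L[𝕜] SerY Γ 𝕜 :=
  q ∘L piY ∘L SX G ∘L embYX ∘L qInv

/-! ### The coproducts -/

/-- `a ⊗ 1 + 1 ⊗ a` -/
noncomputable def primitive {M : Type*} [Monoid M] [FinGraded M] (a : Series M 𝕜) :
    Series (M × M) 𝕜 := tensor a 1 + tensor 1 a

lemma primitive_single_ne_zero {M : Type*} [Monoid M] [FinGraded M] (m : M) (p : M × M)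
    (h : primitive (single m : Series M 𝕜) p ≠ 0) : deg m = deg p := by
  by_cases h1 : tensor (single m : Series M 𝕜) 1 p = 0
  · have h2 : tensor 1 (single m : Series M 𝕜) p ≠ 0 := by
      intro h2
      exact h (by rw [primitive, Series.add_apply, h1, h2, add_zero])
    have h3 := single_apply_ne_zero (left_ne_zero_of_mul h2)
    have h4 := single_apply_ne_zero (right_ne_zero_of_mul h2)
    change deg m = deg p.1 + deg p.2
    rw [h3, h4, deg_one, zero_add]
  · have h3 := single_apply_ne_zero (left_ne_zero_of_mul h1)
    have h4 := single_apply_ne_zero (right_ne_zero_of_mul h1)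
    change deg m = deg p.1 + deg p.2
    rw [h3, h4, deg_one, add_zero]

/-- The coproduct `Δ` of `𝕜⟨⟨X⟩⟩`: the continuous algebra morphism for which the letters are
primitive. -/
noncomputable def DeltaX : SerX Γ 𝕜 →L[𝕜] SerXX Γ 𝕜 :=
  subst (fun a => primitive (single (FreeMonoid.of a))) fun a p h => by
    rw [← primitive_single_ne_zero _ _ h, deg_of]

/-- The pairs of letters `(y_{n',σ'}, y_{n'',σ''})` with `n' + n'' = n` and `σ' σ'' = σ`. -/
def splittings (a : AlphY Γ) : Set (AlphY Γ × AlphY Γ) :=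
  {p | p.1.idx + p.2.idx = a.idx ∧ p.1.col * p.2.col = a.col}

lemma finite_splittings (a : AlphY Γ) : (splittings a).Finite := by
  refine ((finite_wt_le (A := AlphY Γ) (wt a)).prod (finite_wt_le (A := AlphY Γ) (wt a))).subset ?_
  rintro ⟨b, c⟩ ⟨h, -⟩
  have h' : (b.idx : ℕ) + c.idx = a.idx := by
    rw [← PNat.add_coe, h]
  constructor <;> simp only [Set.mem_ofPred_eq, wt] <;> omega

/-- `y_{n,σ} ⊗ 1 + 1 ⊗ y_{n,σ} + ∑ y_{n',σ'} ⊗ y_{n'',σ''}`, the sum being over the `n', n'' ≥ 1`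
with `n' + n'' = n` and the `σ', σ''` with `σ' σ'' = σ`. -/
noncomputable def harmonicLetter (a : AlphY Γ) : SerYY Γ 𝕜 :=
  primitive (y a.idx a.col) +
    ∑ p ∈ (finite_splittings a).toFinset, tensor (y p.1.idx p.1.col) (y p.2.idx p.2.col)

lemma harmonicLetter_ne_zero (a : AlphY Γ) (p : FreeMonoid (AlphY Γ) × FreeMonoid (AlphY Γ))
    (h : (harmonicLetter a : SerYY Γ 𝕜) p ≠ 0) : wt a ≤ deg p := by
  by_cases h1 : primitive (y a.idx a.col : SerY Γ 𝕜) p = 0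
  · rw [harmonicLetter, Series.add_apply, h1, zero_add, Series.sum_apply] at h
    obtain ⟨s, hs, h2⟩ := Finset.exists_ne_zero_of_sum_ne_zero h
    have h3 := single_apply_ne_zero (left_ne_zero_of_mul h2)
    have h4 := single_apply_ne_zero (right_ne_zero_of_mul h2)
    rw [Set.Finite.mem_toFinset] at hs
    have h5 : (s.1.idx : ℕ) + s.2.idx = a.idx := by
      rw [← PNat.add_coe, hs.1]
    change wt a ≤ deg p.1 + deg p.2
    rw [h3, h4, deg_of, deg_of]
    simp only [wt]
    omega
  · rw [← primitive_single_ne_zero _ _ h1, deg_of]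

/-- The harmonic coproduct `Δ_*` of `𝕜⟨⟨Y⟩⟩`: the continuous algebra morphism given on letters by
`harmonicLetter`. -/
noncomputable def DeltaStar : SerY Γ 𝕜 →L[𝕜] SerYY Γ 𝕜 :=
  subst harmonicLetter harmonicLetter_ne_zero

variable (Γ 𝕜) in
/-- The continuous `𝕜`-linear maps from `𝕜⟨⟨Y⟩⟩` to its completed tensor square. -/
abbrev HomCont := SerY Γ 𝕜 →L[𝕜] SerYY Γ 𝕜

/-- An automorphism of the topological coalgebra `(𝕜⟨⟨Y⟩⟩, Δ_*)`: a continuous linear automorphism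
compatible with the coproduct and with the counit (the constant term). -/
def IsCoalgebraAut (S : SerY Γ 𝕜 →L[𝕜] SerY Γ 𝕜) : Prop :=
  S.IsInvertible ∧ tensorSq S ∘L DeltaStar = DeltaStar ∘L S ∧ ∀ K, S K 1 = K 1

/-! ### The groups -/

variable [Algebra ℚ 𝕜]

variable (Γ 𝕜) in
/-- The set `exp` of the completed free Lie algebra. -/
def expLib : Set (SerX Γ 𝕜) := Series.exp '' LibHat Γ 𝕜

/-- `Θ(G) = exp(∑_{n ≥ 1} ((-1)^{n-1}/n) (G | x_0^{n-1} x_1) x_1^n) · G · exp(-(G | x_0) x_0)` -/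
noncomputable def Theta (G : SerX Γ 𝕜) : SerX Γ 𝕜 :=
  Series.exp (powSum
      (fun n => if 1 ≤ n then algebraMap ℚ 𝕜 ((-1) ^ (n - 1) / n) * G (wordX (n - 1) 1) else 0)
      (x 1)) *
    G * Series.exp (-(G (FreeMonoid.of AlphX.zero) • x0))

/-- `G_⋆ = exp(∑_{n ≥ 2} ((-1)^{n-1}/n) (π_Y(G) | y_{n,1}) y_{1,1}^n) · 𝐪(π_Y(G))` -/
noncomputable def starMul (G : SerX Γ 𝕜) : SerY Γ 𝕜 :=
  Series.exp (powSum
      (fun n => if h : 2 ≤ n then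
        algebraMap ℚ 𝕜 ((-1) ^ (n - 1) / n) *
          piY G (FreeMonoid.of ⟨⟨n, by omega⟩, 1⟩) else 0)
      (y 1 1)) *
    q (piY G)

variable (Γ 𝕜) in
/-- The set `DMR_0(𝕜)`. -/
structure IsDMR0 (G : SerX Γ 𝕜) : Prop where
  isUnit : IsUnit G
  coeff_one : G 1 = 1
  coeff_x0 : G (FreeMonoid.of AlphX.zero) = 0
  coeff_x1 : G (FreeMonoid.of (AlphX.of 1)) = 0
  coeff_x0x1 : G (FreeMonoid.of AlphX.zero * FreeMonoid.of (AlphX.of 1)) = 0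
  coeff_symm : ∀ σ : Γ, G (FreeMonoid.of (AlphX.of σ)) - G (FreeMonoid.of (AlphX.of σ⁻¹)) = 0
  grouplike : DeltaX G = tensor G G
  grouplike_star : DeltaStar (starMul G) = tensor (starMul G) (starMul G)

variable (Γ 𝕜) in
/-- The set `{e^{β x_1} · g · e^{α x_0} | α, β ∈ 𝕜, g ∈ DMR_0(𝕜)}`. -/
def DMR0tilde : Set (SerX Γ 𝕜) :=
  {h | ∃ (α β : 𝕜) (g : SerX Γ 𝕜), IsDMR0 Γ 𝕜 g ∧
    h = Series.exp (β • x 1) * g * Series.exp (α • x0)}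

end Constructions

end DoubleShuffle

/-! The composite κ = 𝐪 ∘ π_Y (`kappa`) is a relabelling of the words over X that do not end in x_0
by words over Y. It satisfies κ(f x_σ t_σ(v)) = κ(f x_σ) κ(v) (`kappa_mul_x_mul`), and its kernel is
𝕜⟨⟨X⟩⟩x_0. As aut_G fixes x_0, S_G preserves this kernel and descends to S^Y_G, so the group and
action statements follow from S_{G⊛H} = S_G ∘ S_H (`SX_circ`). Exponentials of Lie series are the
group-like series (`mem_expLib`). The map Θ is a morphism because the coefficients of x_0 and of
x_0^{n-1}x_1 are additive under ⊛, while outer factors in x_1 on the left and in x_0 on the right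
simply multiply (`circ_dressed`).

The heart is the stabilizer. Both e^{βx_1} and e^{αx_0} stabilize Δ_*, so G may be normalized to
have no x_0 and no x_1 term. Then κ(Θ(G)) = G_⋆ (`kappa_Theta`), and group-likeness of G_⋆ is the
stabilizer identity evaluated at 1. The task is to recover the whole identity from its value at 1.

This is done by differentiating along the grading. Let E be the Euler derivation, k = Θ(G), and ξ
the series with S_k(ξ) = E(k). Then E S_k = S_k (s_ξ + E) with s_ξ(f) = ξf + d_ξ(f) (`euler_SX`).
Hence the failure `obst` of S^Y_k to be a coalgebra morphism and the failure `eps` of s^Y_ξ to be a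
coderivation satisfy [E, obst] = obst ∘ s^Y_ξ + (S^Y_k)^{⊗2} ∘ eps (`euler_obst`). Since positive
integers are invertible, an induction on the degree (`obst_eq_zero`) reduces the claim to one on
homogeneous components: if ψ is a Lie element of degree n subject to the low-degree conditions of
DMR_0, and η = ψ + c x_1^n, with c prescribed by the coefficient of x_0^{n-1}x_1 in ψ, has κ(η)
primitive for Δ_*, then s^Y_η is a coderivation (`eps_eq_zero_of_primitive`).

For that claim, η is killed by the derivation ∂ with x_0 ↦ 1 and x_σ ↦ 0, so every κ(ρ_0^i η), where
ρ_0 strips a final x_0, is again primitive (`primitive_kappa_iterate_rho`). Let `genD` be the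
symmetrized generating family indexed by k ∈ ℤ. For k > 0 its member is the sum over colours of the
values of the derivation part of s^Y_η on the y_{k,σ}. Its coproduct formula runs over all shifts of
k, whereas the coderivation property only involves positive ones. It therefore suffices that genD(k)
= 0 for k ≤ 0 (`IsDihedral.eps_eq_zero`); colours are separated by the colour grading.

The vanishing is proved on words of growing length. An antipode-type identity for Δ_*
(`antiMulMap_DeltaStar`) gives the lowest-length part of genD(-j) a parity under inversion of the
colours. The same identity applied to stripped words gives the opposite parity to the sum of two
rotations, once the index j is read as one more letter y_{j+1}. So the lowest part is antisymmetric
under rotation of cyclic words (`IsDihedral.genD_rotate`). The coproduct supplies a shuffle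
relation, and the two together force zero in length at least two (`eq_zero_of_cyclic`). Length one
follows from the harmonic relations for words with two coloured letters (`apply_wordX_add`), or from
the symmetry (G|x_σ) = (G|x_{σ⁻¹}) when n = 1.

Conversely, a normalized stabilizing G has `eps` equal to zero for its ξ. Evaluating this on the
letters y_{1,σ²} and y_{2,1} yields the conditions on (G|x_σ) and (G|x_0x_1), and evaluating `obst`
at 1 yields group-likeness of G_⋆ (`isDMR0_of_obst_Theta`). -/

set_option linter.unusedSectionVars false
namespace DoubleShuffle
open WeightedAlphabet FinGraded
namespace Series

/-! ### Continuous linear maps between spaces of series -/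

section Basic

variable {M N P 𝕜 : Type*} [CommRing 𝕜]

instance : IsTopologicalAddGroup (Series M 𝕜) := by
  let _ : TopologicalSpace 𝕜 := ⊥
  have : DiscreteTopology 𝕜 := ⟨rfl⟩
  exact inferInstanceAs (IsTopologicalAddGroup (M → 𝕜))

instance : ContinuousConstSMul 𝕜 (Series M 𝕜) := by
  let _ : TopologicalSpace 𝕜 := ⊥
  have : DiscreteTopology 𝕜 := ⟨rfl⟩
  exact inferInstanceAs (ContinuousConstSMul 𝕜 (M → 𝕜))

@[simp] lemma sub_apply (f g : Series M 𝕜) (m : M) : (f - g) m = f m - g m := rfl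

@[simp] lemma single_self (m : M) : (single m : Series M 𝕜) m = 1 := by simp [single]

lemma single_of_ne {m m' : M} (h : m' ≠ m) : (single m : Series M 𝕜) m' = 0 := by
  simp [single, h]

/-- The target of a coefficient functional is discrete, so by continuity the functional vanishes on
series with zero coefficients on some finite set of indices; only finitely many coefficients of `f`
matter. -/
lemma clm_apply_eq_sum (S : Series M 𝕜 →L[𝕜] Series N 𝕜) (f : Series M 𝕜) (n : N)
    (T : Finset M) (hT : ∀ m, S (single m) n ≠ 0 → m ∈ T) :
    S f n = ∑ m ∈ T, f m * S (single m) n := by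
  classical
  let _ : TopologicalSpace 𝕜 := ⊥
  have : DiscreteTopology 𝕜 := ⟨rfl⟩
  have hc : Continuous fun f : M → 𝕜 => (S f : N → 𝕜) n :=
    (continuous_apply (A := fun _ : N => 𝕜) n).comp S.continuous
  have hopen : IsOpen {f : M → 𝕜 | (S f : N → 𝕜) n = 0} :=
    (isOpen_discrete ({0} : Set 𝕜)).preimage hc
  obtain ⟨I, u, hu, hsub⟩ := isOpen_pi_iff.1 hopen (0 : M → 𝕜)
    (show S (0 : Series M 𝕜) n = 0 by simp)
  have key : ∀ g : Series M 𝕜, (∀ m ∈ I, g m = 0) → S g n = 0 := fun g hg =>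
    hsub (fun i hi => by rw [hg i hi]; exact (hu i hi).2)
  -- `I` is the finite set given by continuity, `T` the prescribed one. The truncation of `f` to the
  -- union differs from `f` by a series that vanishes on `I`.
  set J := I ∪ T with hJ
  have h1 : S (f - ∑ m ∈ J, f m • (single m : Series M 𝕜)) n = 0 := by
    refine key _ fun m hm => ?_
    rw [sub_apply, sum_apply, Finset.sum_eq_single m]
    · simp
    · intro b _ hb
      simp [single_of_ne hb.symm]
    · intro h
      exact absurd (Finset.mem_union_left _ hm) h
  rw [map_sub, sub_apply, sub_eq_zero, map_sum, sum_apply] at h1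
  rw [h1]
  simp only [map_smul, smul_apply]
  symm
  refine Finset.sum_subset Finset.subset_union_right fun m _ hm => ?_
  by_contra h
  exact hm (hT m (right_ne_zero_of_mul h))

/-- Reduces identities between operators on series to words. Together with its variants for tensors,
algebra morphisms and derivations it replaces density arguments throughout. -/
lemma clm_ext {S T : Series M 𝕜 →L[𝕜] Series N 𝕜} (h : ∀ m, S (single m) = T (single m)) :
    S = T := by
  ext f n
  rw [clm_apply_eq_sum S f n (finite_of_continuous S n).toFinset (by simp),
    clm_apply_eq_sum T f n (finite_of_continuous S n).toFinset (by simp [h])]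
  simp only [h]

lemma mapOfImages_single (c : M → Series N 𝕜) (h : ∀ n, {m | c m n ≠ 0}.Finite) (m : M) :
    mapOfImages c h (single m) = c m := by
  ext n
  change ∑ᶠ m', (single m : Series M 𝕜) m' * c m' n = c m n
  rw [finsum_eq_single _ m]
  · simp
  · intro m' hm'
    simp [single_of_ne hm']

@[simp] lemma comap_apply (r : N → M) (f : Series M 𝕜) (n : N) : comap r f n = f (r n) := rfl

/-- The coefficientwise multiplication by a scalar function. -/
def weight (c : M → 𝕜) : Series M 𝕜 →L[𝕜] Series M 𝕜 where
  toFun f := fun m => c m * f m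
  map_add' f g := by ext m; exact mul_add _ _ _
  map_smul' r f := by ext m; exact mul_left_comm _ _ _
  cont := by
    let _ : TopologicalSpace 𝕜 := ⊥
    have : DiscreteTopology 𝕜 := ⟨rfl⟩
    exact continuous_pi (A := fun _ : M => 𝕜) fun m =>
      continuous_const.mul (continuous_apply (A := fun _ : M => 𝕜) m)

@[simp] lemma weight_apply (c : M → 𝕜) (f : Series M 𝕜) (m : M) : weight c f m = c m * f m := rfl

lemma weight_single (c : M → 𝕜) (m : M) :
    weight c (single m) = c m • (single m : Series M 𝕜) := by
  ext m'
  by_cases h : m' = m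
  · subst h; simp
  · simp [single_of_ne h]

/-- `g ↦ f ⊗ g` -/
def tensorLeft (f : Series M 𝕜) : Series N 𝕜 →L[𝕜] Series (M × N) 𝕜 where
  toFun g := tensor f g
  map_add' g h := by ext p; simp [tensor, mul_add]
  map_smul' r g := by ext p; simp [tensor, mul_left_comm]
  cont := by
    let _ : TopologicalSpace 𝕜 := ⊥
    have : DiscreteTopology 𝕜 := ⟨rfl⟩
    exact continuous_pi (A := fun _ : M × N => 𝕜) fun p =>
      continuous_const.mul (continuous_apply (A := fun _ : N => 𝕜) p.2)

/-- `f ↦ f ⊗ g` -/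
def tensorRight (g : Series N 𝕜) : Series M 𝕜 →L[𝕜] Series (M × N) 𝕜 where
  toFun f := tensor f g
  map_add' f h := by ext p; simp [tensor, add_mul]
  map_smul' r f := by ext p; simp [tensor, mul_assoc]
  cont := by
    let _ : TopologicalSpace 𝕜 := ⊥
    have : DiscreteTopology 𝕜 := ⟨rfl⟩
    exact continuous_pi (A := fun _ : M × N => 𝕜) fun p =>
      (continuous_apply (A := fun _ : M => 𝕜) p.1).mul continuous_const

@[simp] lemma tensorLeft_apply (f : Series M 𝕜) (g : Series N 𝕜) :
    tensorLeft f g = tensor f g := rfl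

@[simp] lemma tensorRight_apply (f : Series M 𝕜) (g : Series N 𝕜) :
    tensorRight g f = tensor f g := rfl

lemma tensor_apply (f : Series M 𝕜) (g : Series N 𝕜) (p : M × N) :
    tensor f g p = f p.1 * g p.2 := rfl

lemma tensor_add (f : Series M 𝕜) (g h : Series N 𝕜) :
    tensor f (g + h) = tensor f g + tensor f h := map_add (tensorLeft f) g h

lemma add_tensor (f h : Series M 𝕜) (g : Series N 𝕜) :
    tensor (f + h) g = tensor f g + tensor h g := map_add (tensorRight g) f h

lemma tensor_sub (f : Series M 𝕜) (g h : Series N 𝕜) :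
    tensor f (g - h) = tensor f g - tensor f h := map_sub (tensorLeft f) g h

lemma sub_tensor (f h : Series M 𝕜) (g : Series N 𝕜) :
    tensor (f - h) g = tensor f g - tensor h g := map_sub (tensorRight g) f h

lemma tensor_smul (c : 𝕜) (f : Series M 𝕜) (g : Series N 𝕜) :
    tensor f (c • g) = c • tensor f g := map_smul (tensorLeft f) c g

lemma smul_tensor (c : 𝕜) (f : Series M 𝕜) (g : Series N 𝕜) :
    tensor (c • f) g = c • tensor f g := map_smul (tensorRight g) c f

lemma tensor_sum {ι : Type*} (s : Finset ι) (f : Series M 𝕜) (g : ι → Series N 𝕜) :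
    tensor f (∑ i ∈ s, g i) = ∑ i ∈ s, tensor f (g i) := map_sum (tensorLeft f) g s

lemma sum_tensor {ι : Type*} (s : Finset ι) (f : ι → Series M 𝕜) (g : Series N 𝕜) :
    tensor (∑ i ∈ s, f i) g = ∑ i ∈ s, tensor (f i) g := map_sum (tensorRight g) f s

@[simp] lemma tensor_zero (f : Series M 𝕜) : tensor f (0 : Series N 𝕜) = 0 :=
  map_zero (tensorLeft f)

@[simp] lemma zero_tensor (g : Series N 𝕜) : tensor (0 : Series M 𝕜) g = 0 :=
  map_zero (tensorRight g)

lemma tensor_single (a : M) (b : N) :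
    tensor (single a : Series M 𝕜) (single b) = single (a, b) := by
  ext ⟨u, v⟩
  by_cases hu : u = a
  · by_cases hv : v = b
    · subst hu hv; simp [tensor]
    · rw [single_of_ne (by simp [hv])]; simp [tensor, single_of_ne hv]
  · rw [single_of_ne (by simp [hu])]; simp [tensor, single_of_ne hu]

/-- Basis elements of the completed tensor product are pure tensors, so this plays the role of its
universal property. -/
lemma clm_ext_tensor {S T : Series (M × N) 𝕜 →L[𝕜] Series P 𝕜}
    (h : ∀ f g, S (tensor f g) = T (tensor f g)) : S = T :=
  clm_ext fun p => by rw [show p = (p.1, p.2) from rfl, ← tensor_single, h]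

/-- The completed tensor product of two continuous linear maps. -/
noncomputable def tmap {M' N' : Type*} (S : Series M 𝕜 →L[𝕜] Series N 𝕜)
    (T : Series M' 𝕜 →L[𝕜] Series N' 𝕜) :
    Series (M × M') 𝕜 →L[𝕜] Series (N × N') 𝕜 :=
  mapOfImages (fun p => tensor (S (single p.1)) (T (single p.2))) fun n =>
    ((finite_of_continuous S n.1).prod (finite_of_continuous T n.2)).subset fun p hp =>
      ⟨left_ne_zero_of_mul (a := S (single p.1) n.1) (b := T (single p.2) n.2) hp,
        right_ne_zero_of_mul (a := S (single p.1) n.1) (b := T (single p.2) n.2) hp⟩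

lemma tmap_tensor {M' N' : Type*} (S : Series M 𝕜 →L[𝕜] Series N 𝕜)
    (T : Series M' 𝕜 →L[𝕜] Series N' 𝕜) (f : Series M 𝕜) (g : Series M' 𝕜) :
    tmap S T (tensor f g) = tensor (S f) (T g) := by
  have h1 : ∀ a, (tmap S T).comp (tensorLeft (single a)) = (tensorLeft (S (single a))).comp T := by
    intro a
    refine clm_ext fun b => ?_
    simp only [ContinuousLinearMap.comp_apply, tensorLeft_apply, tensor_single]
    exact mapOfImages_single _ _ _
  have h2 : (tmap S T).comp (tensorRight g) = (tensorRight (T g)).comp S := by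
    refine clm_ext fun a => ?_
    simpa using DFunLike.congr_fun (h1 a) g
  simpa using DFunLike.congr_fun h2 f

lemma tensorSq_tensor (S : Series M 𝕜 →L[𝕜] Series N 𝕜) (f g : Series M 𝕜) :
    tensorSq S (tensor f g) = tensor (S f) (S g) := tmap_tensor S S f g

lemma tmap_comp_tmap {M' N' P' : Type*} (S : Series M 𝕜 →L[𝕜] Series N 𝕜)
    (T : Series M' 𝕜 →L[𝕜] Series N' 𝕜) (S' : Series N 𝕜 →L[𝕜] Series P 𝕜)
    (T' : Series N' 𝕜 →L[𝕜] Series P' 𝕜) :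
    (tmap S' T').comp (tmap S T) = tmap (S'.comp S) (T'.comp T) :=
  clm_ext_tensor fun f g => by simp [tmap_tensor]

lemma tmap_id : tmap (ContinuousLinearMap.id 𝕜 (Series M 𝕜)) (ContinuousLinearMap.id 𝕜 (Series N 𝕜))
    = ContinuousLinearMap.id 𝕜 _ :=
  clm_ext_tensor fun f g => by simp [tmap_tensor]

lemma tensorSq_comp (S : Series M 𝕜 →L[𝕜] Series N 𝕜) (T : Series N 𝕜 →L[𝕜] Series P 𝕜) :
    tensorSq (T.comp S) = (tensorSq T).comp (tensorSq S) := (tmap_comp_tmap S S T T).symm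

lemma tensorSq_id : tensorSq (ContinuousLinearMap.id 𝕜 (Series M 𝕜)) =
    ContinuousLinearMap.id 𝕜 _ := tmap_id

end Basic

/-! ### Multiplication -/

section Mul

variable {M N 𝕜 : Type*} [CommRing 𝕜] [Monoid M] [FinGraded M] [Monoid N] [FinGraded N]

@[simp] lemma mulLeft_apply (g f : Series M 𝕜) : mulLeft g f = g * f := rfl

/-- Right multiplication by a series. -/
noncomputable def mulRight (g : Series M 𝕜) : Series M 𝕜 →L[𝕜] Series M 𝕜 where
  toFun f := f * g
  map_add' a b := add_mul a b g
  map_smul' r f := smul_mul_assoc r f g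
  cont := by
    let _ : TopologicalSpace 𝕜 := ⊥
    have : DiscreteTopology 𝕜 := ⟨rfl⟩
    refine continuous_pi (A := fun _ : M => 𝕜) fun m => ?_
    exact continuous_finsetSum _ fun p _ =>
      (continuous_apply (A := fun _ : M => 𝕜) p.1).mul continuous_const

@[simp] lemma mulRight_apply (g f : Series M 𝕜) : mulRight g f = f * g := rfl

lemma single_mul_single (a b : M) : (single a : Series M 𝕜) * single b = single (a * b) := by
  ext m
  rw [mul_apply]
  by_cases h : a * b = m
  · rw [Finset.sum_eq_single (a, b)]
    · simp [h]
    · rintro ⟨c, d⟩ _ hne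
      by_cases hc : c = a
      · have : d ≠ b := by rintro rfl; exact hne (by rw [hc])
        simp [single_of_ne this]
      · simp [single_of_ne hc]
    · intro h'
      exact absurd (mem_fac.2 h) h'
  · rw [single_of_ne (Ne.symm h)]
    refine Finset.sum_eq_zero ?_
    rintro ⟨c, d⟩ hcd
    rw [mem_fac] at hcd
    by_cases hc : c = a
    · by_cases hd : d = b
      · subst hc hd; exact absurd hcd h
      · simp [single_of_ne hd]
    · simp [single_of_ne hc]

lemma fac_one : fac (1 : M) = {(1, 1)} := by
  ext ⟨a, b⟩
  rw [mem_fac, Finset.mem_singleton, Prod.mk.injEq]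
  constructor
  · intro h
    have h1 := deg_mul a b
    simp only at h
    rw [h, deg_one] at h1
    exact ⟨eq_one_of_deg _ (by omega), eq_one_of_deg _ (by omega)⟩
  · rintro ⟨rfl, rfl⟩
    simp

@[simp] lemma one_apply_one : (1 : Series M 𝕜) 1 = 1 := single_self 1

@[simp] lemma mul_apply_one (f g : Series M 𝕜) : (f * g) 1 = f 1 * g 1 := by
  simp [mul_apply, fac_one]

/-- Multiplication is separately continuous, so one variable is extended from words to series at a
time, through `mulLeft` and then `mulRight`. -/
lemma bilin_ext {S : Series M 𝕜 →L[𝕜] Series N 𝕜} {A B : Series M 𝕜 →L[𝕜] Series N 𝕜}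
    (h : ∀ a b, S (single (a * b)) = A (single a) * B (single b)) (f g : Series M 𝕜) :
    S (f * g) = A f * B g := by
  have h1 : ∀ a, S.comp (mulLeft (single a)) = (mulLeft (A (single a))).comp B := fun a =>
    clm_ext fun b => by simp [single_mul_single, h]
  have h2 : S.comp (mulRight g) = (mulRight (B g)).comp A :=
    clm_ext fun a => by simpa using DFunLike.congr_fun (h1 a) g
  simpa using DFunLike.congr_fun h2 f

lemma bilin_ext_anti {S : Series M 𝕜 →L[𝕜] Series N 𝕜} {A B : Series M 𝕜 →L[𝕜] Series N 𝕜}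
    (h : ∀ a b, S (single (a * b)) = A (single b) * B (single a)) (f g : Series M 𝕜) :
    S (f * g) = A g * B f := by
  have h1 : ∀ a, S.comp (mulLeft (single a)) = (mulRight (B (single a))).comp A := fun a =>
    clm_ext fun b => by simp [single_mul_single, h]
  have h2 : S.comp (mulRight g) = (mulLeft (A g)).comp B :=
    clm_ext fun a => by simpa using DFunLike.congr_fun (h1 a) g
  simpa using DFunLike.congr_fun h2 f

lemma tensor_mul_tensor (f f' : Series M 𝕜) (g g' : Series N 𝕜) :
    tensor f g * tensor f' g' = tensor (f * f') (g * g') := by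
  have h1 : ∀ a b a', (mulLeft (tensor (single a : Series M 𝕜) (single b : Series N 𝕜))).comp
      (tensorLeft (single a')) = (tensorLeft (single (a * a'))).comp (mulLeft (single b)) :=
    fun a b a' => clm_ext fun b' => by
      simp [single_mul_single, tensor_single]
  have h2 : ∀ a b, (mulLeft (tensor (single a : Series M 𝕜) (single b : Series N 𝕜))).comp
      (tensorRight g') = (tensorRight (single b * g')).comp (mulLeft (single a)) :=
    fun a b => clm_ext fun a' => by
      simpa [single_mul_single] using DFunLike.congr_fun (h1 a b a') g'
  have h3 : ∀ a, (mulRight (tensor f' g')).comp (tensorLeft (single a)) =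
      (tensorLeft (single a * f')).comp (mulRight g') :=
    fun a => clm_ext fun b => by
      simpa using DFunLike.congr_fun (h2 a b) f'
  have h4 : (mulRight (tensor f' g')).comp (tensorRight g) =
      (tensorRight (g * g')).comp (mulRight f') :=
    clm_ext fun a => by
      simpa using DFunLike.congr_fun (h3 a) g
  simpa using DFunLike.congr_fun h4 f

lemma tensor_one_one : tensor (1 : Series M 𝕜) (1 : Series N 𝕜) = 1 := tensor_single 1 1

/-! ### The degree filtration -/

variable (M 𝕜) in
/-- The series without terms of degree less than `n`. -/
def Filt (n : ℕ) : Submodule 𝕜 (Series M 𝕜) where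
  carrier := {f | ∀ m, deg m < n → f m = 0}
  add_mem' hf hg m hm := by simp [hf m hm, hg m hm]
  zero_mem' _ _ := rfl
  smul_mem' c f hf m hm := by simp [hf m hm]

lemma mem_filt {n : ℕ} {f : Series M 𝕜} : f ∈ Filt M 𝕜 n ↔ ∀ m, deg m < n → f m = 0 := Iff.rfl

lemma filt_anti {a b : ℕ} (h : a ≤ b) : Filt M 𝕜 b ≤ Filt M 𝕜 a :=
  fun _ hf m hm => hf m (by omega)

lemma filt_zero (f : Series M 𝕜) : f ∈ Filt M 𝕜 0 := fun _ hm => absurd hm (by omega)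

lemma mem_filt_one {f : Series M 𝕜} : f ∈ Filt M 𝕜 1 ↔ f 1 = 0 := by
  constructor
  · intro h
    exact h 1 (by rw [deg_one]; omega)
  · intro h m hm
    rw [eq_one_of_deg m (by omega), h]

lemma single_mem_filt (m : M) : (single m : Series M 𝕜) ∈ Filt M 𝕜 (deg m) := by
  intro m' hm'
  refine single_of_ne ?_
  rintro rfl
  omega

lemma mul_mem_filt {a b : ℕ} {f g : Series M 𝕜} (hf : f ∈ Filt M 𝕜 a) (hg : g ∈ Filt M 𝕜 b) :
    f * g ∈ Filt M 𝕜 (a + b) := by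
  intro m hm
  rw [mul_apply]
  refine Finset.sum_eq_zero fun p hp => ?_
  rw [mem_fac] at hp
  have h := deg_mul p.1 p.2
  rw [hp] at h
  by_cases h1 : deg p.1 < a
  · rw [hf _ h1, zero_mul]
  · rw [hg _ (by omega), mul_zero]

lemma mul_mem_filt_left {a : ℕ} {f : Series M 𝕜} (hf : f ∈ Filt M 𝕜 a) (g : Series M 𝕜) :
    f * g ∈ Filt M 𝕜 a := mul_mem_filt hf (filt_zero g)

lemma mul_mem_filt_right {a : ℕ} (g : Series M 𝕜) {f : Series M 𝕜} (hf : f ∈ Filt M 𝕜 a) :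
    g * f ∈ Filt M 𝕜 a := by simpa using mul_mem_filt (filt_zero g) hf

lemma pow_mem_filt {f : Series M 𝕜} (hf : f ∈ Filt M 𝕜 1) (n : ℕ) : f ^ n ∈ Filt M 𝕜 n := by
  induction n with
  | zero => exact filt_zero _
  | succ n ih => rw [pow_succ]; exact mul_mem_filt ih hf

lemma eq_zero_of_forall_mem_filt {f : Series M 𝕜} (h : ∀ n, f ∈ Filt M 𝕜 n) : f = 0 := by
  ext m
  exact h (deg m + 1) m (by omega)

lemma eq_of_forall_sub_mem_filt {f g : Series M 𝕜} (h : ∀ n, f - g ∈ Filt M 𝕜 n) : f = g :=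
  sub_eq_zero.1 (eq_zero_of_forall_mem_filt h)

lemma tensor_mem_filt {a b : ℕ} {f : Series M 𝕜} {g : Series N 𝕜} (hf : f ∈ Filt M 𝕜 a)
    (hg : g ∈ Filt N 𝕜 b) : tensor f g ∈ Filt (M × N) 𝕜 (a + b) := by
  rintro ⟨u, v⟩ hm
  change deg u + deg v < a + b at hm
  rw [tensor_apply]
  by_cases h1 : deg u < a
  · rw [hf _ h1, zero_mul]
  · rw [hg v (by omega), mul_zero]

/-- The linear maps raising degrees by at least `n`. -/
def Raises (S : Series M 𝕜 →L[𝕜] Series N 𝕜) (n : ℕ) : Prop :=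
  ∀ m, S (single m) ∈ Filt N 𝕜 (deg m + n)

lemma Raises.mem_filt {S : Series M 𝕜 →L[𝕜] Series N 𝕜} {n k : ℕ} (hS : Raises S n)
    {f : Series M 𝕜} (hf : f ∈ Filt M 𝕜 k) : S f ∈ Filt N 𝕜 (k + n) := by
  intro m hm
  rw [clm_apply_eq_sum S f m (finite_of_continuous S m).toFinset (by simp)]
  refine Finset.sum_eq_zero fun a _ => ?_
  by_cases h : deg a < k
  · rw [hf a h, zero_mul]
  · rw [hS a m (by omega), mul_zero]

lemma Raises.mono {S : Series M 𝕜 →L[𝕜] Series N 𝕜} {a b : ℕ} (hS : Raises S b) (h : a ≤ b) :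
    Raises S a := fun m => filt_anti (by omega) (hS m)

lemma Raises.comp {P : Type*} [Monoid P] [FinGraded P] {S : Series M 𝕜 →L[𝕜] Series N 𝕜}
    {T : Series N 𝕜 →L[𝕜] Series P 𝕜} {a b : ℕ} (hT : Raises T b) (hS : Raises S a) :
    Raises (T.comp S) (a + b) := fun m => by
  rw [← add_assoc]
  exact hT.mem_filt (hS m)

lemma Raises.add {S T : Series M 𝕜 →L[𝕜] Series N 𝕜} {a : ℕ} (hS : Raises S a)
    (hT : Raises T a) : Raises (S + T) a := fun m => add_mem (hS m) (hT m)

lemma Raises.sub {S T : Series M 𝕜 →L[𝕜] Series N 𝕜} {a : ℕ} (hS : Raises S a)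
    (hT : Raises T a) : Raises (S - T) a := fun m => sub_mem (hS m) (hT m)

lemma raises_id : Raises (ContinuousLinearMap.id 𝕜 (Series M 𝕜)) 0 := fun m => single_mem_filt m

lemma Raises.tmap {M' N' : Type*} [Monoid M'] [FinGraded M'] [Monoid N'] [FinGraded N']
    {S : Series M 𝕜 →L[𝕜] Series N 𝕜} {T : Series M' 𝕜 →L[𝕜] Series N' 𝕜} {a b : ℕ}
    (hS : Raises S a) (hT : Raises T b) : Raises (tmap S T) (a + b) := by
  rintro ⟨u, v⟩
  rw [← tensor_single, tmap_tensor]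
  exact filt_anti (le_of_eq (by change deg u + deg v + (a + b) = _; omega))
    (tensor_mem_filt (hS u) (hT v))

lemma eq_zero_of_forall_raises {S : Series M 𝕜 →L[𝕜] Series N 𝕜} (h : ∀ n, Raises S n) :
    S = 0 :=
  clm_ext fun m => eq_zero_of_forall_mem_filt fun n => filt_anti (by omega) (h n m)

lemma raises_mapOfIndex (r : M → N) (h : ∀ m, deg m ≤ deg (r m)) :
    Raises (mapOfIndex r h : Series M 𝕜 →L[𝕜] Series N 𝕜) 0 := fun m => by
  rw [mapOfIndex, mapOfImages_single]
  exact filt_anti (h m) (single_mem_filt _)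

/-- A continuous linear endomorphism that is the identity up to higher degrees is onto. -/
lemma surjective_of_raises {S : Series M 𝕜 →L[𝕜] Series M 𝕜}
    (hS : Raises (ContinuousLinearMap.id 𝕜 _ - S) 1) : Function.Surjective S := by
  set T := ContinuousLinearMap.id 𝕜 _ - S with hT
  intro g
  -- Iteration for the fixed-point equation f = g + T f, where T = id - S raises degrees and is
  -- therefore contracting.
  set u : ℕ → Series M 𝕜 := fun n => (fun h => g + T h)^[n] 0 with hu
  have hus : ∀ n, u (n + 1) = g + T (u n) := fun n => by
    simp only [hu, Function.iterate_succ_apply']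
  have hd : ∀ n, u (n + 1) - u n ∈ Filt M 𝕜 n := by
    intro n
    induction n with
    | zero => exact filt_zero _
    | succ n ih =>
      rw [hus (n + 1)]
      nth_rw 2 [hus n]
      rw [add_sub_add_left_eq_sub, ← map_sub]
      exact hS.mem_filt ih
  have hd' : ∀ n k, u (n + k) - u n ∈ Filt M 𝕜 n := by
    intro n k
    induction k with
    | zero => simp
    | succ k ih =>
      have := add_mem (filt_anti (by omega) (hd (n + k)) : _ ∈ Filt M 𝕜 n) ih
      rwa [sub_add_sub_cancel] at this
  -- The coefficient at `m` no longer changes from the iterate of index `deg m + 1` on.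
  let f : Series M 𝕜 := fun m => u (deg m + 1) m
  have hf : ∀ n, f - u n ∈ Filt M 𝕜 n := by
    intro n m hm
    obtain ⟨k, rfl⟩ := Nat.exists_eq_add_of_le (show deg m + 1 ≤ n by omega)
    have := hd' (deg m + 1) k m (by omega)
    rw [sub_apply] at this ⊢
    rw [← neg_sub, this, neg_zero]
  refine ⟨f, eq_of_forall_sub_mem_filt fun n => ?_⟩
  have h1 : S f = f - T f := by simp [hT]
  have h2 : S f - g = (f - u (n + 1)) - T (f - u n) := by
    rw [h1, map_sub, hus n]; abel
  rw [h2]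
  exact sub_mem (filt_anti (by omega) (hf (n + 1))) (filt_anti (by omega) (hS.mem_filt (hf n)))

/-! ### Units -/

/-- Left multiplication by such a series is the identity up to higher degrees, hence onto, which
gives a right inverse. The right inverse again has constant term 1 and so has a right inverse
itself, which must be the original series. -/
lemma isUnit_of_constCoeff {f : Series M 𝕜} (hf : f 1 = 1) : IsUnit f := by
  have h1 : (1 - f) ∈ Filt M 𝕜 1 := mem_filt_one.2 (by simp [hf])
  have h2 : ∀ g : Series M 𝕜, g 1 = 1 → ∃ h : Series M 𝕜, h 1 = 1 ∧ g * h = 1 := by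
    intro g hg
    obtain ⟨h, hh⟩ := surjective_of_raises (S := mulLeft g) (fun m => by
      have : (ContinuousLinearMap.id 𝕜 (Series M 𝕜) - mulLeft g) (single m) =
          (1 - g) * single m := by
        simp [sub_mul]
      rw [this, add_comm]
      exact mul_mem_filt (mem_filt_one.2 (by simp [hg])) (single_mem_filt m)) 1
    refine ⟨h, ?_, hh⟩
    have := congrArg (fun s : Series M 𝕜 => s 1) hh
    simpa [hg] using this
  obtain ⟨h, hh, hfh⟩ := h2 f hf
  obtain ⟨k, _, hhk⟩ := h2 h hh
  have : k = f := by
    calc k = f * h * k := by rw [hfh, one_mul]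
      _ = f := by rw [mul_assoc, hhk, mul_one]
  subst this
  exact ⟨⟨k, h, hfh, hhk⟩, rfl⟩

/-! ### The Euler derivation -/

variable (M 𝕜) in
/-- The derivation multiplying each homogeneous component by its degree. -/
noncomputable def euler : Series M 𝕜 →L[𝕜] Series M 𝕜 := weight fun m => (deg m : 𝕜)

lemma euler_apply (f : Series M 𝕜) (m : M) : euler M 𝕜 f m = deg m * f m := rfl

lemma euler_mul (f g : Series M 𝕜) : euler M 𝕜 (f * g) = euler M 𝕜 f * g + f * euler M 𝕜 g := by
  ext m
  simp only [euler_apply, mul_apply, add_apply, Finset.mul_sum, ← Finset.sum_add_distrib]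
  refine Finset.sum_congr rfl fun p hp => ?_
  rw [mem_fac] at hp
  rw [← hp, deg_mul]
  push_cast
  ring

lemma euler_one : euler M 𝕜 1 = 0 := by
  ext m
  rw [euler_apply]
  by_cases h : m = 1
  · subst h; simp [deg_one]
  · simp [one_def, single_of_ne h]

lemma euler_single (m : M) : euler M 𝕜 (single m) = (deg m : 𝕜) • single m := weight_single _ _

lemma euler_tensor (f : Series M 𝕜) (g : Series N 𝕜) :
    euler (M × N) 𝕜 (tensor f g) = tensor (euler M 𝕜 f) g + tensor f (euler N 𝕜 g) := by
  ext ⟨u, v⟩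
  simp only [euler_apply, tensor_apply, add_apply]
  rw [show deg (u, v) = deg u + deg v from rfl]
  push_cast
  ring

/-! ### Homogeneous components -/

lemma component_apply (n : ℕ) (f : Series M 𝕜) (m : M) :
    component n f m = if deg m = n then f m else 0 := rfl

end Mul

end Series
end DoubleShuffle

set_option linter.unusedSectionVars false
namespace DoubleShuffle
open WeightedAlphabet FinGraded
namespace Series

/-! ### Morphisms out of series in noncommuting letters -/

section Subst

variable {A : Type*} [WeightedAlphabet A] {N 𝕜 : Type*} [CommRing 𝕜] [Monoid N] [FinGraded N]

lemma mapOfIndex_single {M : Type*} [Monoid M] [FinGraded M] (r : M → N)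
    (h : ∀ m, deg m ≤ deg (r m)) (m : M) :
    mapOfIndex r h (single m : Series M 𝕜) = single (r m) := mapOfImages_single _ _ _

lemma subst_single (φ : A → Series N 𝕜) (h : ∀ a n, φ a n ≠ 0 → wt a ≤ deg n)
    (w : FreeMonoid A) : subst φ h (single w) = FreeMonoid.lift φ w := mapOfImages_single _ _ _

lemma subst_of (φ : A → Series N 𝕜) (h : ∀ a n, φ a n ≠ 0 → wt a ≤ deg n) (a : A) :
    subst φ h (single (FreeMonoid.of a)) = φ a := by
  rw [subst_single, FreeMonoid.lift_eval_of]

lemma subst_mul (φ : A → Series N 𝕜) (h : ∀ a n, φ a n ≠ 0 → wt a ≤ deg n)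
    (f g : Series (FreeMonoid A) 𝕜) : subst φ h (f * g) = subst φ h f * subst φ h g :=
  bilin_ext (fun a b => by simp [subst_single]) f g

lemma subst_one (φ : A → Series N 𝕜) (h : ∀ a n, φ a n ≠ 0 → wt a ≤ deg n) :
    subst φ h 1 = 1 := by
  rw [one_def, subst_single, map_one]

lemma raises_subst (φ : A → Series N 𝕜) (h : ∀ a n, φ a n ≠ 0 → wt a ≤ deg n) :
    Raises (subst φ h) 0 := fun w n hn => by
  rw [subst_single]
  by_contra hne
  have := lift_ne_zero φ h w n hne
  omega

lemma single_of_mul (a : A) (w : FreeMonoid A) :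
    (single (FreeMonoid.of a * w) : Series (FreeMonoid A) 𝕜) =
      single (FreeMonoid.of a) * single w := (single_mul_single _ _).symm

/-- Two continuous algebra morphisms agreeing on letters coincide. -/
lemma clm_ext_letters {S T : Series (FreeMonoid A) 𝕜 →L[𝕜] Series N 𝕜} (hS1 : S 1 = 1)
    (hT1 : T 1 = 1) (hS : ∀ f g, S (f * g) = S f * S g) (hT : ∀ f g, T (f * g) = T f * T g)
    (h : ∀ a, S (single (FreeMonoid.of a)) = T (single (FreeMonoid.of a))) : S = T := by
  refine clm_ext fun w => ?_
  induction w using FreeMonoid.inductionOn' with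
  | one => rw [← one_def, hS1, hT1]
  | of_mul a w ih => rw [single_of_mul, hS, hT, h, ih]

lemma map_inverse {M : Type*} [Monoid M] [FinGraded M] {S : Series M 𝕜 →L[𝕜] Series N 𝕜}
    (hS1 : S 1 = 1) (hS : ∀ f g, S (f * g) = S f * S g) {f : Series M 𝕜} (hf : IsUnit f) :
    S (Ring.inverse f) = Ring.inverse (S f) := by
  have h1 : S f * S (Ring.inverse f) = 1 := by rw [← hS, Ring.mul_inverse_cancel _ hf, hS1]
  have h2 : S (Ring.inverse f) * S f = 1 := by rw [← hS, Ring.inverse_mul_cancel _ hf, hS1]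
  exact (Ring.inverse_unit (⟨S f, S (Ring.inverse f), h1, h2⟩ : (Series N 𝕜)ˣ)).symm

lemma inverse_eq_of_mul {M : Type*} [Monoid M] [FinGraded M] {f g : Series M 𝕜} (h1 : f * g = 1)
    (h2 : g * f = 1) : Ring.inverse f = g :=
  Ring.inverse_unit (⟨f, g, h1, h2⟩ : (Series M 𝕜)ˣ)

lemma inverse_apply_one {M : Type*} [Monoid M] [FinGraded M] {f : Series M 𝕜} (hf : f 1 = 1) :
    Ring.inverse f 1 = 1 := by
  have := congrArg (fun s : Series M 𝕜 => s 1) (Ring.mul_inverse_cancel _ (isUnit_of_constCoeff hf))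
  simpa [hf] using this

/-- Telescoping: S(aw) - aw = (S(a) - a) S(w) + a (S(w) - w), and both terms gain a degree. -/
lemma raises_sub_id_of_letters {S : Series (FreeMonoid A) 𝕜 →L[𝕜] Series (FreeMonoid A) 𝕜}
    (hS1 : S 1 = 1) (hS : ∀ f g, S (f * g) = S f * S g)
    (h : ∀ a, S (single (FreeMonoid.of a)) - single (FreeMonoid.of a) ∈
      Filt (FreeMonoid A) 𝕜 (wt a + 1)) :
    Raises (S - ContinuousLinearMap.id 𝕜 _) 1 := by
  intro w
  simp only [_root_.sub_apply, ContinuousLinearMap.id_apply]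
  induction w using FreeMonoid.inductionOn' with
  | one => rw [← one_def, hS1, sub_self]; exact zero_mem _
  | of_mul a w ih =>
    have hw : S (single w) ∈ Filt (FreeMonoid A) 𝕜 (deg w) := by
      have := add_mem (filt_anti (by omega) ih) (single_mem_filt (𝕜 := 𝕜) w)
      rwa [sub_add_cancel] at this
    have e : S (single (FreeMonoid.of a * w)) - single (FreeMonoid.of a * w) =
        (S (single (FreeMonoid.of a)) - single (FreeMonoid.of a)) * S (single w) +
          single (FreeMonoid.of a) * (S (single w) - single w) := by
      rw [single_of_mul, hS]
      noncomm_ring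
    rw [e, deg_mul, deg_of]
    have h2 := mul_mem_filt (single_mem_filt (𝕜 := 𝕜) (FreeMonoid.of a)) ih
    rw [deg_of] at h2
    exact add_mem (filt_anti (by omega) (mul_mem_filt (h a) hw)) (filt_anti (by omega) h2)

end Subst

end Series

open Series

/-! ### The twisted Magnus group -/

section Magnus

variable {Γ : Type*} [CommGroup Γ] [Finite Γ] {𝕜 : Type*} [CommRing 𝕜]

lemma shiftLetter_mul (σ τ : Γ) (a : AlphX Γ) :
    shiftLetter σ (shiftLetter τ a) = shiftLetter (σ * τ) a := by
  cases a <;> simp [shiftLetter, mul_assoc]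

lemma shiftLetter_one (a : AlphX Γ) : shiftLetter (1 : Γ) a = a := by
  cases a <;> simp [shiftLetter]

/-- The action of `σ ∈ Γ` on words. -/
def shiftWord (σ : Γ) : FreeMonoid (AlphX Γ) →* FreeMonoid (AlphX Γ) :=
  FreeMonoid.map (shiftLetter σ)

lemma shiftWord_mul (σ τ : Γ) (w : FreeMonoid (AlphX Γ)) :
    shiftWord σ (shiftWord τ w) = shiftWord (σ * τ) w := by
  induction w using FreeMonoid.inductionOn' with
  | one => simp
  | of_mul a w ih =>
    simp only [shiftWord, map_mul, FreeMonoid.map_of, shiftLetter_mul] at *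
    rw [ih]

lemma shiftWord_one (w : FreeMonoid (AlphX Γ)) : shiftWord (1 : Γ) w = w := by
  induction w using FreeMonoid.inductionOn' with
  | one => simp
  | of_mul a w ih => simp [shiftWord, shiftLetter_one] at *; exact ih

lemma t_single (σ : Γ) (w : FreeMonoid (AlphX Γ)) :
    t σ (single w : SerX Γ 𝕜) = single (shiftWord σ w) := mapOfIndex_single _ _ _

lemma t_apply (σ : Γ) (f : SerX Γ 𝕜) (w : FreeMonoid (AlphX Γ)) :
    t σ f w = f (shiftWord σ⁻¹ w) := by
  have : t σ = comap (𝕜 := 𝕜) (shiftWord σ⁻¹) := clm_ext fun v => by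
    ext w
    rw [t_single, comap_apply]
    by_cases h : w = shiftWord σ v
    · subst h
      simp [shiftWord_mul, shiftWord_one]
    · rw [single_of_ne h, single_of_ne]
      rintro rfl
      exact h (by simp [shiftWord_mul, shiftWord_one])
  rw [this, comap_apply]

lemma t_mul (σ : Γ) (f g : SerX Γ 𝕜) : t σ (f * g) = t σ f * t σ g :=
  bilin_ext (fun a b => by simp [t_single, single_mul_single]) f g

lemma t_one (σ : Γ) : t σ (1 : SerX Γ 𝕜) = 1 := by
  rw [one_def, t_single, map_one]

lemma t_t (σ τ : Γ) (f : SerX Γ 𝕜) : t σ (t τ f) = t (σ * τ) f := by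
  ext w
  simp [t_apply, shiftWord_mul, mul_comm]

lemma t_one_left (f : SerX Γ 𝕜) : t (1 : Γ) f = f := by
  ext w
  simp [t_apply, shiftWord_one]

lemma t_x0 (σ : Γ) : t σ (x0 : SerX Γ 𝕜) = x0 := by
  rw [x0, t_single]; rfl

lemma t_x (σ τ : Γ) : t σ (x τ : SerX Γ 𝕜) = x (σ * τ) := by
  rw [x, t_single]; rfl

lemma raises_t (σ : Γ) : Raises (t σ : SerX Γ 𝕜 →L[𝕜] SerX Γ 𝕜) 0 := raises_mapOfIndex _ _

lemma t_apply_one (σ : Γ) (f : SerX Γ 𝕜) : t σ f 1 = f 1 := by rw [t_apply, map_one]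

lemma t_inverse (σ : Γ) {f : SerX Γ 𝕜} (hf : f 1 = 1) :
    t σ (Ring.inverse f) = Ring.inverse (t σ f) :=
  map_inverse (t_one σ) (t_mul σ) (isUnit_of_constCoeff hf)

lemma aut_mul (G f g : SerX Γ 𝕜) : aut G (f * g) = aut G f * aut G g := subst_mul _ _ f g

lemma aut_one (G : SerX Γ 𝕜) : aut G 1 = 1 := subst_one _ _

lemma aut_x0 (G : SerX Γ 𝕜) : aut G x0 = x0 := subst_of _ _ _

lemma aut_x (G : SerX Γ 𝕜) (σ : Γ) : aut G (x σ) = Ring.inverse (t σ G) * x σ * t σ G :=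
  subst_of _ _ _

lemma letterX_cases {P : SerX Γ 𝕜 → Prop} (h0 : P x0) (h : ∀ σ, P (x σ)) (a : AlphX Γ) :
    P (single (FreeMonoid.of a)) := by
  cases a with
  | zero => exact h0
  | of σ => exact h σ

lemma x0_mem_filt : (x0 : SerX Γ 𝕜) ∈ Filt _ 𝕜 1 := by
  have := single_mem_filt (𝕜 := 𝕜) (FreeMonoid.of (AlphX.zero : AlphX Γ))
  rwa [deg_of] at this

lemma x_mem_filt (σ : Γ) : (x σ : SerX Γ 𝕜) ∈ Filt _ 𝕜 1 := by
  have := single_mem_filt (𝕜 := 𝕜) (FreeMonoid.of (AlphX.of σ))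
  rwa [deg_of] at this

lemma inverse_t_mul {G : SerX Γ 𝕜} (hG : G 1 = 1) (σ : Γ) :
    Ring.inverse (t σ G) * t σ G = 1 :=
  Ring.inverse_mul_cancel _ (isUnit_of_constCoeff (by rw [t_apply_one, hG]))

lemma t_mul_inverse {G : SerX Γ 𝕜} (hG : G 1 = 1) (σ : Γ) :
    t σ G * Ring.inverse (t σ G) = 1 :=
  Ring.mul_inverse_cancel _ (isUnit_of_constCoeff (by rw [t_apply_one, hG]))

/-- Conjugation by t_σ(G) changes x_σ by a unit times the commutator of x_σ with t_σ(G) - 1, which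
has no constant term. -/
lemma raises_aut_sub_id {G : SerX Γ 𝕜} (hG : G 1 = 1) :
    Raises (aut G - ContinuousLinearMap.id 𝕜 _) 1 := by
  refine raises_sub_id_of_letters (aut_one G) (aut_mul G) fun a => ?_
  change _ ∈ Filt _ 𝕜 2
  refine letterX_cases (P := fun s => aut G s - s ∈ Filt _ 𝕜 2) ?_ (fun σ => ?_) a
  · rw [aut_x0, sub_self]; exact zero_mem _
  · rw [aut_x]
    have e : Ring.inverse (t σ G) * x σ * t σ G - x σ =
        Ring.inverse (t σ G) * (x σ * (t σ G - 1) - (t σ G - 1) * x σ) := by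
      have := inverse_t_mul hG σ
      calc _ = Ring.inverse (t σ G) * x σ * t σ G - (Ring.inverse (t σ G) * t σ G) * x σ := by
            rw [this, one_mul]
        _ = _ := by noncomm_ring
    have h1 : t σ G - 1 ∈ Filt _ 𝕜 1 := mem_filt_one.2 (by simp [t_apply_one, hG])
    rw [e]
    exact mul_mem_filt_right _ (sub_mem (mul_mem_filt (x_mem_filt σ) h1)
      (mul_mem_filt h1 (x_mem_filt σ)))

lemma raises_aut (G : SerX Γ 𝕜) : Raises (aut G) 0 := raises_subst _ _

lemma aut_surjective {G : SerX Γ 𝕜} (hG : G 1 = 1) : Function.Surjective (aut G) := by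
  refine surjective_of_raises fun m => ?_
  have := neg_mem (raises_aut_sub_id hG m)
  simpa using this

lemma aut_apply_one (G f : SerX Γ 𝕜) : aut G f 1 = f 1 := by
  have h : aut G (f - f 1 • 1) ∈ Filt _ 𝕜 (1 + 0) :=
    (raises_aut G).mem_filt (mem_filt_one.2 (by simp))
  have := h 1 (by rw [deg_one]; omega)
  rw [map_sub, map_smul, aut_one] at this
  simpa [sub_eq_zero] using this

lemma t_aut (σ : Γ) {G : SerX Γ 𝕜} (hG : G 1 = 1) (f : SerX Γ 𝕜) :
    t σ (aut G f) = aut G (t σ f) := by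
  have : (t σ).comp (aut G) = (aut G).comp (t σ) := by
    refine clm_ext_letters (by simp [aut_one, t_one]) (by simp [aut_one, t_one])
      (by simp [aut_mul, t_mul]) (by simp [aut_mul, t_mul]) fun a => ?_
    refine letterX_cases (P := fun s => (t σ).comp (aut G) s = (aut G).comp (t σ) s) ?_
      (fun τ => ?_) a
    · simp [aut_x0, t_x0]
    · simp [aut_x, t_x, t_mul, t_inverse σ (f := t τ G) (by rw [t_apply_one, hG]), t_t]
  exact DFunLike.congr_fun this f

lemma circ_apply_one {G H : SerX Γ 𝕜} (hG : G 1 = 1) (hH : H 1 = 1) : circ G H 1 = 1 := by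
  simp [circ, aut_apply_one, hG, hH]

lemma inverse_mul_rev {M : Type*} [Monoid M] [FinGraded M] {f g : Series M 𝕜} (hf : f 1 = 1)
    (hg : g 1 = 1) : Ring.inverse (f * g) = Ring.inverse g * Ring.inverse f := by
  have hf := isUnit_of_constCoeff hf
  have hg := isUnit_of_constCoeff hg
  refine inverse_eq_of_mul ?_ ?_
  · rw [mul_assoc, ← mul_assoc g, Ring.mul_inverse_cancel _ hg, one_mul,
      Ring.mul_inverse_cancel _ hf]
  · rw [mul_assoc, ← mul_assoc _ f, Ring.inverse_mul_cancel _ hf, one_mul,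
      Ring.inverse_mul_cancel _ hg]

/-- As aut_G commutes with t_σ, conjugating first by t_σ(H) and then applying aut_G amounts to
conjugating by t_σ(G · aut_G(H)). Associativity of ⊛ rests on this. -/
lemma aut_circ {G H : SerX Γ 𝕜} (hG : G 1 = 1) (hH : H 1 = 1) :
    aut (circ G H) = (aut G).comp (aut H) := by
  refine clm_ext_letters (by simp [aut_one]) (by simp [aut_one])
    (by simp [aut_mul]) (by simp [aut_mul]) fun a => ?_
  refine letterX_cases (P := fun s => aut (circ G H) s = (aut G).comp (aut H) s) ?_
    (fun σ => ?_) a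
  · simp [aut_x0]
  · have h1 : t σ H 1 = 1 := by rw [t_apply_one, hH]
    have h2 : t σ G 1 = 1 := by rw [t_apply_one, hG]
    rw [ContinuousLinearMap.comp_apply, aut_x H, aut_mul, aut_mul,
      map_inverse (aut_one G) (aut_mul G) (isUnit_of_constCoeff h1), aut_x, aut_x, circ, t_mul,
      t_aut σ hG, inverse_mul_rev h2 (by rw [aut_apply_one, h1])]
    simp only [mul_assoc]

lemma SX_apply (G f : SerX Γ 𝕜) : SX G f = G * aut G f := rfl

lemma SX_circ {G H : SerX Γ 𝕜} (hG : G 1 = 1) (hH : H 1 = 1) :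
    SX (circ G H) = (SX G).comp (SX H) := by
  ext1 f
  rw [SX_apply, aut_circ hG hH]
  simp [SX_apply, aut_mul, circ, mul_assoc]

lemma circ_assoc {G H K : SerX Γ 𝕜} (hG : G 1 = 1) (hH : H 1 = 1) :
    circ (circ G H) K = circ G (circ H K) :=
  DFunLike.congr_fun (SX_circ hG hH) K

lemma circ_one (G : SerX Γ 𝕜) : circ G 1 = G := by
  rw [circ, aut_one, mul_one]

lemma aut_one_left : aut (1 : SerX Γ 𝕜) = ContinuousLinearMap.id 𝕜 _ := by
  refine clm_ext_letters (aut_one _) rfl (aut_mul _) (fun _ _ => rfl) fun a => ?_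
  refine letterX_cases (P := fun s => aut 1 s = s) (aut_x0 _) (fun σ => ?_) a
  rw [aut_x, t_one]
  simp

lemma SX_one : SX (1 : SerX Γ 𝕜) = ContinuousLinearMap.id 𝕜 _ := by
  ext1 f
  simp [SX_apply, aut_one_left]

/-- Solves aut_G(H) = G⁻¹ by surjectivity of aut_G. Right inverses are all that the group axioms
need. -/
lemma exists_circ_eq_one {G : SerX Γ 𝕜} (hG : G 1 = 1) :
    ∃ H : SerX Γ 𝕜, H 1 = 1 ∧ circ G H = 1 := by
  obtain ⟨H, hH⟩ := aut_surjective hG (Ring.inverse G)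
  refine ⟨H, ?_, ?_⟩
  · rw [← aut_apply_one G H, hH, inverse_apply_one hG]
  · rw [circ, hH, Ring.mul_inverse_cancel _ (isUnit_of_constCoeff hG)]

/-- The group law `⊛` of `MT(𝕜)`. -/
noncomputable instance instGroupMT : Group (MT Γ 𝕜) :=
  letI : Mul (MT Γ 𝕜) := ⟨fun g h => ⟨circ g.1 h.1, circ_apply_one g.2 h.2⟩⟩
  letI : One (MT Γ 𝕜) := ⟨⟨1, one_apply_one⟩⟩
  letI : Inv (MT Γ 𝕜) := ⟨fun g => ⟨(exists_circ_eq_one g.2).choose,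
    (exists_circ_eq_one g.2).choose_spec.1⟩⟩
  Group.ofRightAxioms (fun g h _ => Subtype.ext (circ_assoc g.2 h.2))
    (fun g => Subtype.ext (circ_one g.1))
    (fun g => Subtype.ext (exists_circ_eq_one g.2).choose_spec.2)

lemma MT_mul_val (g h : MT Γ 𝕜) : (g * h).1 = circ g.1 h.1 := rfl

lemma MT_one_val : (1 : MT Γ 𝕜).1 = 1 := rfl

lemma SX_mul (g h : MT Γ 𝕜) : SX (g * h).1 = (SX g.1).comp (SX h.1) := SX_circ g.2 h.2

lemma SX_inv_SX (g : MT Γ 𝕜) (f : SerX Γ 𝕜) : SX (g⁻¹).1 (SX g.1 f) = f := by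
  have := SX_mul g⁻¹ g
  rw [inv_mul_cancel, MT_one_val, SX_one] at this
  exact (DFunLike.congr_fun this f).symm

lemma SX_SX_inv (g : MT Γ 𝕜) (f : SerX Γ 𝕜) : SX g.1 (SX (g⁻¹).1 f) = f := by
  have := SX_mul g g⁻¹
  rw [mul_inv_cancel, MT_one_val, SX_one] at this
  exact (DFunLike.congr_fun this f).symm

end Magnus
end DoubleShuffle

set_option linter.unusedSectionVars false
namespace DoubleShuffle
open WeightedAlphabet FinGraded
namespace Series

/-! ### Stripping letters -/

section Strip

variable {A : Type*} [WeightedAlphabet A] {𝕜 : Type*} [CommRing 𝕜]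

/-- `(rho a f | w) = (f | w a)` -/
def rho (a : A) : Series (FreeMonoid A) 𝕜 →L[𝕜] Series (FreeMonoid A) 𝕜 :=
  comap fun w => w * FreeMonoid.of a

/-- `(lam a f | w) = (f | a w)` -/
def lam (a : A) : Series (FreeMonoid A) 𝕜 →L[𝕜] Series (FreeMonoid A) 𝕜 :=
  comap fun w => FreeMonoid.of a * w

lemma rho_apply (a : A) (f : Series (FreeMonoid A) 𝕜) (w : FreeMonoid A) :
    rho a f w = f (w * FreeMonoid.of a) := rfl

lemma lam_apply (a : A) (f : Series (FreeMonoid A) 𝕜) (w : FreeMonoid A) :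
    lam a f w = f (FreeMonoid.of a * w) := rfl

lemma rho_lam (a b : A) (f : Series (FreeMonoid A) 𝕜) : rho a (lam b f) = lam b (rho a f) := by
  ext w
  simp [rho_apply, lam_apply, mul_assoc]

lemma of_mul_inj {a b : A} {u v : FreeMonoid A} :
    FreeMonoid.of a * u = FreeMonoid.of b * v ↔ a = b ∧ u = v := by
  constructor
  · intro h
    have := congrArg FreeMonoid.toList h
    simpa using this
  · rintro ⟨rfl, rfl⟩; rfl

lemma mul_of_inj {a b : A} {u v : FreeMonoid A} :
    u * FreeMonoid.of a = v * FreeMonoid.of b ↔ u = v ∧ a = b := by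
  constructor
  · intro h
    have := congrArg FreeMonoid.toList h
    simp only [FreeMonoid.toList_mul, FreeMonoid.toList_of] at this
    have := List.append_inj' this rfl
    simpa using this
  · rintro ⟨rfl, rfl⟩; rfl

lemma of_mul_ne_one (a : A) (u : FreeMonoid A) : FreeMonoid.of a * u ≠ 1 := by
  intro h
  have := congrArg FreeMonoid.toList h
  simp at this

lemma mul_of_ne_one (a : A) (u : FreeMonoid A) : u * FreeMonoid.of a ≠ 1 := by
  intro h
  have := congrArg FreeMonoid.toList h
  simp at this

lemma eq_one_or_mul_of (w : FreeMonoid A) : w = 1 ∨ ∃ v a, w = v * FreeMonoid.of a := by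
  rcases List.eq_nil_or_concat w.toList with h | ⟨l, a, h⟩
  · exact Or.inl (FreeMonoid.toList.injective h)
  · exact Or.inr ⟨FreeMonoid.ofList l, a, FreeMonoid.toList.injective (by rw [h]; simp)⟩

lemma eq_one_or_of_mul (w : FreeMonoid A) : w = 1 ∨ ∃ a v, w = FreeMonoid.of a * v := by
  induction w using FreeMonoid.inductionOn' with
  | one => exact Or.inl rfl
  | of_mul a w _ => exact Or.inr ⟨a, w, rfl⟩

lemma mul_single_apply (f : Series (FreeMonoid A) 𝕜) (a b : A) (w : FreeMonoid A)
    [Decidable (b = a)] :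
    (f * (single (FreeMonoid.of a) : Series (FreeMonoid A) 𝕜)) (w * FreeMonoid.of b) =
      if b = a then f w else 0 := by
  have : (rho b).comp (mulRight (single (FreeMonoid.of a))) =
      (if b = a then ContinuousLinearMap.id 𝕜 _ else 0 :
        Series (FreeMonoid A) 𝕜 →L[𝕜] Series (FreeMonoid A) 𝕜) := by
    refine clm_ext fun v => ?_
    ext u
    rw [ContinuousLinearMap.comp_apply, mulRight_apply, single_mul_single, rho_apply]
    split_ifs with h
    · subst h
      by_cases huv : u = v
      · subst huv; simp
      · rw [single_of_ne (by simpa [mul_of_inj] using huv)]; simp [single_of_ne huv]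
    · rw [single_of_ne (by simp [mul_of_inj, h])]; simp
  have := congrArg (fun s : Series (FreeMonoid A) 𝕜 => s w) (DFunLike.congr_fun this f)
  simp only [ContinuousLinearMap.comp_apply, mulRight_apply, rho_apply] at this
  rw [this]
  split_ifs <;> simp

lemma rho_mul_single (f : Series (FreeMonoid A) 𝕜) (a b : A) [Decidable (b = a)] :
    rho b (f * single (FreeMonoid.of a)) = if b = a then f else 0 := by
  ext w
  rw [rho_apply, mul_single_apply]
  split_ifs <;> simp

/-- In a factorization of w·a the right factor is either empty or ends in a. -/
lemma sum_fac_mul_of {R : Type*} [AddCommMonoid R] (w : FreeMonoid A) (a : A)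
    (F : FreeMonoid A × FreeMonoid A → R) :
    ∑ p ∈ fac (w * FreeMonoid.of a), F p =
      F (w * FreeMonoid.of a, 1) + ∑ p ∈ fac w, F (p.1, p.2 * FreeMonoid.of a) := by
  classical
  have h : fac (w * FreeMonoid.of a) = insert (w * FreeMonoid.of a, 1)
      ((fac w).image fun p => (p.1, p.2 * FreeMonoid.of a)) := by
    ext ⟨u, v⟩
    simp only [mem_fac, Finset.mem_insert, Prod.mk.injEq, Finset.mem_image, Prod.exists]
    constructor
    · intro h
      rcases eq_one_or_mul_of v with rfl | ⟨v', b, rfl⟩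
      · exact Or.inl ⟨by simpa using h, rfl⟩
      · rw [← mul_assoc, mul_of_inj] at h
        exact Or.inr ⟨u, v', h.1, rfl, by rw [h.2]⟩
    · rintro (⟨rfl, rfl⟩ | ⟨u', v', rfl, rfl, rfl⟩)
      · simp
      · simp [mul_assoc]
  rw [h, Finset.sum_insert, Finset.sum_image]
  · rintro ⟨u, v⟩ _ ⟨u', v'⟩ _ h
    simp only [Prod.mk.injEq, mul_of_inj] at h
    exact Prod.ext h.1 h.2.1
  · simp only [Finset.mem_image, Prod.mk.injEq, not_exists, not_and]
    rintro p _ _ h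
    exact mul_of_ne_one _ _ h

/-- The last letter of a product belongs to the right factor, unless that factor contributes only
its constant term. -/
lemma rho_mul (a : A) (f g : Series (FreeMonoid A) 𝕜) :
    rho a (f * g) = f * rho a g + g 1 • rho a f := by
  ext w
  rw [rho_apply, mul_apply, sum_fac_mul_of, add_apply, mul_apply, smul_apply, rho_apply, add_comm,
    mul_comm (g 1)]
  rfl

lemma single_mul_apply (f : Series (FreeMonoid A) 𝕜) (a b : A) (w : FreeMonoid A)
    [Decidable (b = a)] :
    ((single (FreeMonoid.of a) : Series (FreeMonoid A) 𝕜) * f) (FreeMonoid.of b * w) =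
      if b = a then f w else 0 := by
  have : (lam b).comp (mulLeft (single (FreeMonoid.of a))) =
      (if b = a then ContinuousLinearMap.id 𝕜 _ else 0 :
        Series (FreeMonoid A) 𝕜 →L[𝕜] Series (FreeMonoid A) 𝕜) := by
    refine clm_ext fun v => ?_
    ext u
    rw [ContinuousLinearMap.comp_apply, mulLeft_apply, single_mul_single, lam_apply]
    split_ifs with h
    · subst h
      by_cases huv : u = v
      · subst huv; simp
      · rw [single_of_ne (by simpa [of_mul_inj] using huv)]; simp [single_of_ne huv]
    · rw [single_of_ne (by simp [of_mul_inj, h])]; simp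
  have := congrArg (fun s : Series (FreeMonoid A) 𝕜 => s w) (DFunLike.congr_fun this f)
  simp only [ContinuousLinearMap.comp_apply, mulLeft_apply, lam_apply] at this
  rw [this]
  split_ifs <;> simp

lemma lam_single_mul (f : Series (FreeMonoid A) 𝕜) (a b : A) [Decidable (b = a)] :
    lam b (single (FreeMonoid.of a) * f) = if b = a then f else 0 := by
  ext w
  rw [lam_apply, single_mul_apply]
  split_ifs <;> simp

/-! ### Derivations -/

/-- The image of a word under the derivation sending each letter `a` to `φ a`. -/
noncomputable def derivWord (φ : A → Series (FreeMonoid A) 𝕜) : List A → Series (FreeMonoid A) 𝕜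
  | [] => 0
  | a :: l => φ a * single (FreeMonoid.ofList l) + single (FreeMonoid.of a) * derivWord φ l

/-- A derivation replaces one letter at a time, so a word loses no more degree than a single letter
may, namely `K`. This uniform bound makes the extension to series converge, also for derivations
lowering the degree. -/
lemma derivWord_mem_filt {φ : A → Series (FreeMonoid A) 𝕜} {K : ℕ}
    (h : ∀ a, φ a ∈ Filt (FreeMonoid A) 𝕜 (wt a - K)) (l : List A) :
    derivWord φ l ∈ Filt _ 𝕜 (deg (FreeMonoid.ofList l) - K) := by
  induction l with
  | nil => exact zero_mem _
  | cons a l ih =>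
    have e : FreeMonoid.ofList (a :: l) = FreeMonoid.of a * FreeMonoid.ofList l := rfl
    rw [e, deg_mul, deg_of, derivWord]
    refine add_mem (filt_anti (by omega) (mul_mem_filt (h a) (single_mem_filt _)))
      (filt_anti ?_ (mul_mem_filt (single_mem_filt _) ih))
    rw [deg_of]
    omega

/-- The continuous derivation sending each letter `a` to `φ a`. -/
noncomputable def deriv (φ : A → Series (FreeMonoid A) 𝕜) (K : ℕ)
    (h : ∀ a, φ a ∈ Filt (FreeMonoid A) 𝕜 (wt a - K)) :
    Series (FreeMonoid A) 𝕜 →L[𝕜] Series (FreeMonoid A) 𝕜 :=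
  mapOfImages (fun w => derivWord φ w.toList) fun n =>
    (finite_deg_le (deg n + K)).subset fun w hw => by
      by_contra hlt
      refine hw (derivWord_mem_filt h w.toList n ?_)
      rw [Set.mem_ofPred_eq] at hlt
      rw [FreeMonoid.ofList_toList]
      omega

section Deriv

variable (φ : A → Series (FreeMonoid A) 𝕜) (K : ℕ)
  (h : ∀ a, φ a ∈ Filt (FreeMonoid A) 𝕜 (wt a - K))

lemma deriv_one : deriv φ K h 1 = 0 := mapOfImages_single _ _ _

lemma deriv_of_mul_single (a : A) (w : FreeMonoid A) :
    deriv φ K h (single (FreeMonoid.of a * w)) =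
      φ a * single w + single (FreeMonoid.of a) * deriv φ K h (single w) := by
  rw [deriv, mapOfImages_single, mapOfImages_single]
  rfl

lemma deriv_of (a : A) : deriv φ K h (single (FreeMonoid.of a)) = φ a := by
  have := deriv_of_mul_single φ K h a 1
  rwa [mul_one, ← one_def, deriv_one, mul_zero, mul_one, add_zero] at this

lemma deriv_mul (f g : Series (FreeMonoid A) 𝕜) :
    deriv φ K h (f * g) = deriv φ K h f * g + f * deriv φ K h g := by
  set D := deriv φ K h with hD
  have h0 : ∀ u v : FreeMonoid A, D (single u * single v) =
      D (single u) * single v + single u * D (single v) := by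
    intro u v
    induction u using FreeMonoid.inductionOn' with
    | one => rw [← one_def, one_mul, one_mul, hD, deriv_one, zero_mul, zero_add]
    | of_mul a u ih =>
      rw [single_mul_single, mul_assoc, hD, deriv_of_mul_single, deriv_of_mul_single, ← hD,
        ← single_mul_single u v, ih, single_of_mul]
      noncomm_ring
  have h1 : ∀ u, D.comp (mulLeft (single u)) = mulLeft (D (single u)) + (mulLeft (single u)).comp D :=
    fun u => clm_ext fun v => by simpa using h0 u v
  have h2 : D.comp (mulRight g) = (mulRight g).comp D + mulRight (D g) :=
    clm_ext fun u => by simpa using DFunLike.congr_fun (h1 u) g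
  simpa using DFunLike.congr_fun h2 f

lemma raises_deriv (φ : A → Series (FreeMonoid A) 𝕜) {n : ℕ}
    (h : ∀ a, φ a ∈ Filt (FreeMonoid A) 𝕜 (wt a - K))
    (hn : ∀ a, φ a ∈ Filt (FreeMonoid A) 𝕜 (wt a + n)) : Raises (deriv φ K h) n := by
  intro w
  induction w using FreeMonoid.inductionOn' with
  | one => rw [← one_def, deriv_one]; exact zero_mem _
  | of_mul a w ih =>
    rw [deriv_of_mul_single, deg_mul, deg_of]
    refine add_mem (filt_anti (by omega) (mul_mem_filt (hn a) (single_mem_filt w)))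
      (filt_anti ?_ (mul_mem_filt (single_mem_filt _) ih))
    rw [deg_of]
    omega

end Deriv

/-- Two continuous `φ`-derivations agreeing on letters coincide. -/
lemma clm_ext_deriv {N : Type*} [Monoid N] [FinGraded N]
    {D D' φ ψ : Series (FreeMonoid A) 𝕜 →L[𝕜] Series N 𝕜}
    (hD1 : D 1 = 0) (hD1' : D' 1 = 0) (hD : ∀ f g, D (f * g) = D f * φ g + ψ f * D g)
    (hD' : ∀ f g, D' (f * g) = D' f * φ g + ψ f * D' g)
    (h : ∀ a, D (single (FreeMonoid.of a)) = D' (single (FreeMonoid.of a))) : D = D' := by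
  refine clm_ext fun w => ?_
  induction w using FreeMonoid.inductionOn' with
  | one => rw [← one_def, hD1, hD1']
  | of_mul a w ih => rw [single_of_mul, hD, hD', h, ih]

end Strip
end Series

open Series

/-! ### Words in `X` and words in `Y` -/

section Kappa

variable {Γ : Type*} [CommGroup Γ] [Finite Γ] {𝕜 : Type*} [CommRing 𝕜]

lemma qList_pList (τ : Γ) (l : List (AlphY Γ)) : qList τ (pList τ l) = l := by
  induction l generalizing τ with
  | nil => rfl
  | cons a l ih => simp [pList, qList, ih]

lemma pList_qList (τ : Γ) (l : List (AlphY Γ)) : pList τ (qList τ l) = l := by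
  induction l generalizing τ with
  | nil => rfl
  | cons a l ih => simp [pList, qList, ih]

/-- The word in `X` attached to a word in `Y`:
`y_{n_1,σ_1} ⋯ y_{n_r,σ_r} ↦ x_0^{n_1-1} x_{σ_1} x_0^{n_2-1} x_{σ_1 σ_2} ⋯ x_0^{n_r-1} x_{σ_1 ⋯ σ_r}`. -/
def psi (w : FreeMonoid (AlphY Γ)) : FreeMonoid (AlphX Γ) :=
  wordYX (FreeMonoid.ofList (pList 1 w.toList))

/-- The product of the colours of the letters of a word. -/
def col : FreeMonoid (AlphY Γ) →* Γ := FreeMonoid.lift AlphY.col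

lemma col_of (a : AlphY Γ) : col (FreeMonoid.of a) = a.col := FreeMonoid.lift_eval_of _ _

lemma shiftWord_wordX (σ τ : Γ) (m : ℕ) : shiftWord σ (wordX m τ) = wordX m (σ * τ) := by
  rw [wordX, map_mul, map_pow]; rfl

lemma wordYX_pList (τ : Γ) (l : List (AlphY Γ)) :
    wordYX (FreeMonoid.ofList (pList τ l)) = shiftWord τ (psi (FreeMonoid.ofList l)) := by
  induction l generalizing τ with
  | nil => simp [psi, pList]
  | cons a l ih =>
    have e : ∀ τ, wordYX (FreeMonoid.ofList (pList τ (a :: l))) =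
        wordX (a.idx - 1) (τ * a.col) * shiftWord (τ * a.col) (psi (FreeMonoid.ofList l)) := by
      intro τ
      rw [← ih, pList, FreeMonoid.ofList_cons, map_mul, wordYX, FreeMonoid.lift_eval_of]
    have e1 : psi (FreeMonoid.ofList (a :: l)) =
        wordX (a.idx - 1) a.col * shiftWord a.col (psi (FreeMonoid.ofList l)) := by
      have := e 1
      rwa [one_mul] at this
    rw [e, e1, map_mul, shiftWord_wordX, shiftWord_mul]

lemma psi_one : psi (1 : FreeMonoid (AlphY Γ)) = 1 := by
  simp [psi, pList]

lemma psi_of_mul (a : AlphY Γ) (w : FreeMonoid (AlphY Γ)) :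
    psi (FreeMonoid.of a * w) = wordX (a.idx - 1) a.col * shiftWord a.col (psi w) := by
  have := wordYX_pList a.col w.toList
  rw [FreeMonoid.ofList_toList] at this
  rw [← this, psi]
  change wordYX (FreeMonoid.ofList (pList 1 (a :: w.toList))) = _
  rw [pList, FreeMonoid.ofList_cons, map_mul, one_mul, wordYX, FreeMonoid.lift_eval_of]

lemma psi_of (a : AlphY Γ) : psi (FreeMonoid.of a) = wordX (a.idx - 1) a.col := by
  have := psi_of_mul a 1
  rwa [psi_one, map_one, mul_one, mul_one] at this

/-- Colours in `psi` are partial products, so the colours of the second factor are all multiplied by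
the total colour of the first. This twisted multiplicativity is the source of the operators t_σ in
the identities for `kappa`. -/
lemma psi_mul (u v : FreeMonoid (AlphY Γ)) : psi (u * v) = psi u * shiftWord (col u) (psi v) := by
  induction u using FreeMonoid.inductionOn' with
  | one => simp [psi_one, shiftWord_one]
  | of_mul a u ih =>
    rw [mul_assoc, psi_of_mul, ih, psi_of_mul, map_mul, map_mul, shiftWord_mul, col_of, mul_assoc]

lemma psi_mul_of (w : FreeMonoid (AlphY Γ)) (a : AlphY Γ) :
    psi (w * FreeMonoid.of a) = psi w * wordX (a.idx - 1) (col w * a.col) := by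
  rw [psi_mul, psi_of, shiftWord_wordX]

lemma deg_shiftWord (σ : Γ) (w : FreeMonoid (AlphX Γ)) : deg (shiftWord σ w) = deg w := by
  induction w using FreeMonoid.inductionOn' with
  | one => simp
  | of_mul a w ih =>
    rw [map_mul, deg_mul, deg_mul, ih]
    congr 1

lemma deg_psi (w : FreeMonoid (AlphY Γ)) : deg (psi w) = deg w := by
  rw [psi, deg_wordYX]
  exact wt_pList 1 w.toList

lemma wordX_cases (w : FreeMonoid (AlphX Γ)) :
    (∃ m, w = FreeMonoid.of AlphX.zero ^ m) ∨ ∃ m σ v, w = wordX m σ * v := by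
  induction w using FreeMonoid.inductionOn' with
  | one => exact Or.inl ⟨0, rfl⟩
  | of_mul a w ih =>
    cases a with
    | of σ => exact Or.inr ⟨0, σ, w, by simp [wordX]⟩
    | zero =>
      rcases ih with ⟨m, rfl⟩ | ⟨m, σ, v, rfl⟩
      · exact Or.inl ⟨m + 1, (pow_succ' _ _).symm⟩
      · exact Or.inr ⟨m + 1, σ, v, by simp [wordX, pow_succ', mul_assoc]⟩

/-- Induction adapted to `psi`: a word is cut after its first coloured letter x_σ, and its tail is
written as a shift by σ of a shorter word, which is possible since shifts are invertible. -/
lemma wordX_induction {P : FreeMonoid (AlphX Γ) → Prop}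
    (h0 : ∀ m, P (FreeMonoid.of AlphX.zero ^ m))
    (h : ∀ m σ v, P v → P (wordX m σ * shiftWord σ v)) (w : FreeMonoid (AlphX Γ)) : P w := by
  induction hn : deg w using Nat.strong_induction_on generalizing w with
  | _ n ih =>
    rcases wordX_cases w with ⟨m, rfl⟩ | ⟨m, σ, v, rfl⟩
    · exact h0 m
    · have e : v = shiftWord σ (shiftWord σ⁻¹ v) := by simp [shiftWord_mul, shiftWord_one]
      rw [e]
      refine h _ _ _ (ih _ ?_ _ rfl)
      rw [← hn, deg_shiftWord, deg_mul, deg_wordX]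
      omega

/-- Surjectivity of `psi` onto the words ending in a coloured letter; the colour of that letter is
the total colour of the word over Y. -/
lemma exists_psi_eq (v : FreeMonoid (AlphX Γ)) (σ : Γ) :
    ∃ w, psi w = v * FreeMonoid.of (AlphX.of σ) ∧ col w = σ := by
  induction v using wordX_induction generalizing σ with
  | h0 m =>
    refine ⟨FreeMonoid.of ⟨m.succPNat, σ⟩, ?_, col_of _⟩
    rw [psi_of, wordX]
    simp
  | h m τ v ih =>
    obtain ⟨w, h1, h2⟩ := ih (τ⁻¹ * σ)
    refine ⟨FreeMonoid.of ⟨m.succPNat, τ⟩ * w, ?_, by simp [col_of, h2]⟩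
    rw [psi_of_mul, h1, map_mul, mul_assoc]
    simp [shiftWord, shiftLetter]

lemma wordX_mul_inj {m m' : ℕ} {σ σ' : Γ} {u u' : FreeMonoid (AlphX Γ)}
    (h : wordX m σ * u = wordX m' σ' * u') : m = m' ∧ σ = σ' ∧ u = u' := by
  induction m generalizing m' with
  | zero =>
    cases m' with
    | zero => simpa [wordX, of_mul_inj] using h
    | succ m' => simp [wordX, pow_succ', mul_assoc, of_mul_inj] at h
  | succ m ih =>
    cases m' with
    | zero => simp [wordX, pow_succ', mul_assoc, of_mul_inj] at h
    | succ m' =>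
      have h' : wordX m σ * u = wordX m' σ' * u' := by
        simp only [wordX, pow_succ', mul_assoc, of_mul_inj, true_and] at h ⊢
        exact h
      have := ih h'
      exact ⟨by rw [this.1], this.2⟩

lemma psi_injective : Function.Injective (psi (Γ := Γ)) := by
  intro w w' h
  induction w using FreeMonoid.inductionOn' generalizing w' with
  | one =>
    rcases eq_one_or_of_mul w' with rfl | ⟨b, w', rfl⟩
    · rfl
    · have := congrArg deg h
      rw [psi_one, psi_of_mul, deg_mul, deg_one, deg_wordX] at this
      omega
  | of_mul a w ih =>
    rcases eq_one_or_of_mul w' with rfl | ⟨b, w', rfl⟩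
    · have := congrArg deg h
      rw [psi_one, psi_of_mul, deg_mul, deg_one, deg_wordX] at this
      omega
    · rw [psi_of_mul, psi_of_mul] at h
      obtain ⟨h1, h2, h3⟩ := wordX_mul_inj h
      have h4 : a = b := by
        obtain ⟨i, c⟩ := a
        obtain ⟨j, d⟩ := b
        simp only at h1 h2
        have hi := i.pos
        have hj := j.pos
        have : i = j := PNat.eq (by omega)
        rw [this, h2]
      subst h4
      have h5 := congrArg (shiftWord a.col⁻¹) h3
      simp only [shiftWord_mul, inv_mul_cancel, shiftWord_one] at h5
      rw [ih h5]

lemma psi_ne_mul_zero (w : FreeMonoid (AlphY Γ)) (v : FreeMonoid (AlphX Γ)) :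
    psi w ≠ v * FreeMonoid.of AlphX.zero := by
  rcases eq_one_or_mul_of w with rfl | ⟨w, a, rfl⟩
  · rw [psi_one]
    exact (mul_of_ne_one _ _).symm
  · rw [psi_mul_of, wordX, ← mul_assoc]
    intro h
    rw [mul_of_inj] at h
    cases h.2

/-- The composition `𝐪 ∘ π_Y`. -/
noncomputable def kappa : SerX Γ 𝕜 →L[𝕜] SerY Γ 𝕜 := q ∘L piY

/-- A permutation of the basis acts on coefficients through its inverse; `pList` inverts `qList`. -/
lemma q_eq_comap : (q : SerY Γ 𝕜 →L[𝕜] SerY Γ 𝕜) =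
    comap fun w => FreeMonoid.ofList (pList 1 w.toList) := by
  refine clm_ext fun v => ?_
  ext w
  have e : q (single v : SerY Γ 𝕜) = single (FreeMonoid.ofList (qList 1 v.toList)) :=
    mapOfIndex_single _ _ _
  rw [e, comap_apply]
  by_cases h : w = FreeMonoid.ofList (qList 1 v.toList)
  · subst h
    simp [pList_qList]
  · rw [single_of_ne h, single_of_ne]
    rintro rfl
    exact h (by simp [qList_pList])

lemma kappa_apply (f : SerX Γ 𝕜) (w : FreeMonoid (AlphY Γ)) : kappa f w = f (psi w) := by
  rw [kappa, q_eq_comap]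
  rfl

lemma kappa_apply_one (f : SerX Γ 𝕜) : kappa f 1 = f 1 := by rw [kappa_apply, psi_one]

lemma kappa_single_psi (w : FreeMonoid (AlphY Γ)) :
    kappa (single (psi w) : SerX Γ 𝕜) = single w := by
  ext w'
  rw [kappa_apply]
  by_cases h : w' = w
  · subst h; simp
  · rw [single_of_ne h, single_of_ne fun h' => h (psi_injective h')]

lemma kappa_one : kappa (1 : SerX Γ 𝕜) = 1 := by
  have := kappa_single_psi (Γ := Γ) (𝕜 := 𝕜) 1
  rwa [psi_one] at this

lemma kappa_mul_x0 (f : SerX Γ 𝕜) : kappa (f * x0) = 0 := by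
  have : kappa.comp (mulRight (x0 : SerX Γ 𝕜)) = 0 := clm_ext fun v => by
    ext w
    rw [ContinuousLinearMap.comp_apply, mulRight_apply, x0, single_mul_single, kappa_apply,
      single_of_ne (psi_ne_mul_zero w v)]
    rfl
  exact DFunLike.congr_fun this f

lemma wordX_word_cases (z : FreeMonoid (AlphX Γ)) :
    (∃ w, z = psi w) ∨ ∃ v, z = v * FreeMonoid.of AlphX.zero := by
  rcases eq_one_or_mul_of z with rfl | ⟨v, a, rfl⟩
  · exact Or.inl ⟨1, psi_one.symm⟩
  · cases a with
    | zero => exact Or.inr ⟨v, rfl⟩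
    | of σ =>
      obtain ⟨w, hw, _⟩ := exists_psi_eq v σ
      exact Or.inl ⟨w, hw.symm⟩

/-- On words this is `psi_mul`, the total colour of the left factor being σ. If the right factor
ends in x_0, both sides vanish. -/
lemma kappa_mul_x_mul (f v : SerX Γ 𝕜) (σ : Γ) :
    kappa (f * x σ * t σ v) = kappa (f * x σ) * kappa v := by
  have h1 : ∀ a, kappa.comp ((mulLeft (single a * x σ : SerX Γ 𝕜)).comp (t σ)) =
      (mulLeft (kappa (single a * x σ))).comp kappa := by
    intro a
    refine clm_ext fun z => ?_
    simp only [ContinuousLinearMap.comp_apply, mulLeft_apply, t_single]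
    rcases wordX_word_cases z with ⟨w, rfl⟩ | ⟨v, rfl⟩
    · obtain ⟨w', hw', hc⟩ := exists_psi_eq a σ
      rw [x, single_mul_single, ← hw', single_mul_single, ← hc, ← psi_mul, kappa_single_psi,
        kappa_single_psi, kappa_single_psi, single_mul_single]
    · rw [map_mul (shiftWord σ), ← single_mul_single, ← single_mul_single]
      change kappa (_ * (_ * x0)) = _ * kappa (_ * x0)
      rw [← mul_assoc, kappa_mul_x0, kappa_mul_x0, mul_zero]
  have h2 : kappa.comp (mulRight (x σ * t σ v)) = (mulRight (kappa v)).comp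
      (kappa.comp (mulRight (x σ))) := clm_ext fun a => by
    simpa [mul_assoc] using DFunLike.congr_fun (h1 a) v
  simpa [mul_assoc] using DFunLike.congr_fun h2 f

lemma single_wordX (m : ℕ) (σ : Γ) : (single (wordX m σ) : SerX Γ 𝕜) = x0 ^ m * x σ := by
  rw [wordX, ← single_mul_single, x]
  congr 1
  induction m with
  | zero => rfl
  | succ m ih => rw [pow_succ, pow_succ, ← single_mul_single, ih, x0]

lemma kappa_x0_pow_mul_x (m : ℕ) (σ : Γ) :
    kappa (x0 ^ m * x σ : SerX Γ 𝕜) = y m.succPNat σ := by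
  have := kappa_single_psi (𝕜 := 𝕜) (FreeMonoid.of (⟨m.succPNat, σ⟩ : AlphY Γ))
  rwa [psi_of, single_wordX] at this

lemma kappa_wordX_mul (m : ℕ) (σ : Γ) (v : SerX Γ 𝕜) :
    kappa (x0 ^ m * x σ * t σ v) = y m.succPNat σ * kappa v := by
  rw [kappa_mul_x_mul, kappa_x0_pow_mul_x]

lemma sec_single (w : FreeMonoid (AlphY Γ)) :
    embYX (qInv (single w : SerY Γ 𝕜)) = single (psi w) := by
  have e : qInv (single w : SerY Γ 𝕜) = single (FreeMonoid.ofList (pList 1 w.toList)) :=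
    mapOfIndex_single _ _ _
  rw [e]
  exact mapOfIndex_single _ _ _

lemma kappa_sec (K : SerY Γ 𝕜) : kappa (embYX (qInv K)) = K := by
  have : kappa.comp (embYX.comp qInv) = ContinuousLinearMap.id 𝕜 (SerY Γ 𝕜) :=
    clm_ext fun w => by simp [sec_single, kappa_single_psi]
  exact DFunLike.congr_fun this K

lemma kappa_surjective : Function.Surjective (kappa : SerX Γ 𝕜 →L[𝕜] SerY Γ 𝕜) :=
  fun K => ⟨_, kappa_sec K⟩

/-- A map preserving the kernel of `kappa` descends through `kappa`. -/
lemma kappa_comp_sec {S : SerX Γ 𝕜 →L[𝕜] SerX Γ 𝕜} (hS : ∀ f, S (f * x0) = S f * x0)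
    (f : SerX Γ 𝕜) : kappa (S (embYX (qInv (kappa f)))) = kappa (S f) := by
  have : kappa.comp (S.comp (embYX.comp (qInv.comp kappa))) = kappa.comp S :=
    clm_ext fun z => by
      simp only [ContinuousLinearMap.comp_apply]
      rcases wordX_word_cases z with ⟨w, rfl⟩ | ⟨v, rfl⟩
      · rw [kappa_single_psi, sec_single]
      · rw [← single_mul_single]
        change kappa (S (embYX (qInv (kappa (_ * x0))))) = kappa (S (_ * x0))
        rw [kappa_mul_x0, hS, kappa_mul_x0]
        simp
  exact DFunLike.congr_fun this f

lemma SX_mul_x0 (G f : SerX Γ 𝕜) : SX G (f * x0) = SX G f * x0 := by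
  simp [SX_apply, aut_mul, aut_x0, mul_assoc]

lemma SY_apply (G : SerX Γ 𝕜) (K : SerY Γ 𝕜) : SY G K = kappa (SX G (embYX (qInv K))) := rfl

/-- S_G commutes with right multiplication by x_0, since aut_G fixes x_0, and therefore descends to
the quotient by the kernel of `kappa`. -/
lemma SY_kappa (G f : SerX Γ 𝕜) : SY G (kappa f) = kappa (SX G f) :=
  kappa_comp_sec (SX_mul_x0 G) f

lemma clm_ext_kappa {N : Type*} {S T : SerY Γ 𝕜 →L[𝕜] Series N 𝕜}
    (h : ∀ f, S (kappa f) = T (kappa f)) : S = T := by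
  ext1 K
  rw [← kappa_sec K, h]

lemma SY_one : SY (1 : SerX Γ 𝕜) = ContinuousLinearMap.id 𝕜 _ :=
  clm_ext_kappa fun f => by simp [SY_kappa, SX_one]

lemma SY_mul (g h : MT Γ 𝕜) : SY (g * h).1 = (SY g.1).comp (SY h.1) :=
  clm_ext_kappa fun f => by simp [SY_kappa, SX_mul]

lemma SY_comp_inv (g : MT Γ 𝕜) : (SY g.1).comp (SY (g⁻¹).1) = ContinuousLinearMap.id 𝕜 _ := by
  rw [← SY_mul, mul_inv_cancel, MT_one_val, SY_one]

lemma SY_inv_comp (g : MT Γ 𝕜) : (SY (g⁻¹).1).comp (SY g.1) = ContinuousLinearMap.id 𝕜 _ := by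
  rw [← SY_mul, inv_mul_cancel, MT_one_val, SY_one]

lemma SY_isInvertible (g : MT Γ 𝕜) : (SY g.1).IsInvertible :=
  ContinuousLinearMap.IsInvertible.of_inverse (SY_comp_inv g) (SY_inv_comp g)

lemma SY_inverse (g : MT Γ 𝕜) : (SY g.1).inverse = SY (g⁻¹).1 :=
  ContinuousLinearMap.inverse_eq (SY_comp_inv g) (SY_inv_comp g)

lemma raises_kappa : Raises (kappa : SerX Γ 𝕜 →L[𝕜] SerY Γ 𝕜) 0 := fun z w hw => by
  rw [kappa_apply]
  refine single_mem_filt z _ ?_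
  rwa [deg_psi]

lemma raises_SY_sub_id {G : SerX Γ 𝕜} (hG : G 1 = 1) :
    Raises (SY G - ContinuousLinearMap.id 𝕜 _) 1 := by
  intro w
  have e : (SY G - ContinuousLinearMap.id 𝕜 (SerY Γ 𝕜)) (single w) =
      kappa ((G - 1) * aut G (single (psi w)) +
        (aut G - ContinuousLinearMap.id 𝕜 (SerX Γ 𝕜)) (single (psi w))) := by
    rw [_root_.sub_apply, SY_apply, sec_single, ContinuousLinearMap.id_apply,
      ← kappa_single_psi w, ← map_sub, SX_apply, _root_.sub_apply, ContinuousLinearMap.id_apply]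
    congr 1
    noncomm_ring
  rw [e]
  refine raises_kappa.mem_filt (k := deg w + 1) (add_mem ?_ ?_)
  · rw [add_comm, ← deg_psi]
    exact mul_mem_filt (mem_filt_one.2 (by simp [hG])) (raises_aut G _)
  · rw [← deg_psi]
    exact raises_aut_sub_id hG _

/-- The action of `MT(𝕜)` on continuous linear maps. -/
noncomputable instance instMulActionMT : MulAction (MT Γ 𝕜) (HomCont Γ 𝕜) where
  smul g u := tensorSq (SY g.1) ∘L u ∘L (SY g.1).inverse
  one_smul u := by
    change tensorSq (SY (1 : MT Γ 𝕜).1) ∘L u ∘L (SY (1 : MT Γ 𝕜).1).inverse = u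
    rw [SY_inverse, inv_one, MT_one_val, SY_one, tensorSq_id]
    rfl
  mul_smul g h u := by
    change tensorSq (SY (g * h).1) ∘L u ∘L (SY (g * h).1).inverse =
      tensorSq (SY g.1) ∘L (tensorSq (SY h.1) ∘L u ∘L (SY h.1).inverse) ∘L (SY g.1).inverse
    rw [SY_inverse, SY_inverse, SY_inverse, mul_inv_rev, SY_mul, SY_mul, tensorSq_comp]
    rfl

lemma MT_smul_def (g : MT Γ 𝕜) (u : HomCont Γ 𝕜) :
    g • u = tensorSq (SY g.1) ∘L u ∘L (SY g.1).inverse := rfl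

lemma MT_smul_eq_iff (g : MT Γ 𝕜) (u : HomCont Γ 𝕜) :
    g • u = u ↔ tensorSq (SY g.1) ∘L u = u ∘L SY g.1 := by
  rw [MT_smul_def, SY_inverse]
  constructor
  · intro h
    calc tensorSq (SY g.1) ∘L u
        = (tensorSq (SY g.1) ∘L u) ∘L ((SY (g⁻¹).1).comp (SY g.1)) := by
          rw [SY_inv_comp, ContinuousLinearMap.comp_id]
      _ = (tensorSq (SY g.1) ∘L u ∘L SY (g⁻¹).1) ∘L SY g.1 := rfl
      _ = _ := by rw [h]
  · intro h
    calc tensorSq (SY g.1) ∘L u ∘L SY (g⁻¹).1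
        = (tensorSq (SY g.1) ∘L u) ∘L SY (g⁻¹).1 := rfl
      _ = u ∘L ((SY g.1).comp (SY (g⁻¹).1)) := by rw [h]; rfl
      _ = u := by rw [SY_comp_inv, ContinuousLinearMap.comp_id]

end Kappa

end DoubleShuffle

set_option linter.unusedSectionVars false
namespace DoubleShuffle
open WeightedAlphabet FinGraded
namespace Series

/-! ### Power series in a series without constant term -/

section PowSum

variable {M N : Type*} [Monoid M] [FinGraded M] [Monoid N] [FinGraded N] {𝕜 : Type*} [CommRing 𝕜]

lemma powSum_apply_of_lt (c : ℕ → 𝕜) {f : Series M 𝕜} (hf : f ∈ Filt M 𝕜 1) {m : M} {n : ℕ}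
    (hm : deg m < n) : powSum c f m = ∑ i ∈ Finset.range n, c i * (f ^ i) m := by
  rw [powSum]
  refine Finset.sum_subset (fun i hi => ?_) fun i _ hi => ?_
  · rw [Finset.mem_range] at hi ⊢
    omega
  · rw [Finset.mem_range] at hi
    rw [pow_mem_filt hf i m (by omega), mul_zero]

lemma powSum_sub_mem_filt (c : ℕ → 𝕜) {f : Series M 𝕜} (hf : f ∈ Filt M 𝕜 1) (n : ℕ) :
    powSum c f - ∑ i ∈ Finset.range n, c i • f ^ i ∈ Filt M 𝕜 n := fun m hm => by
  rw [sub_apply, powSum_apply_of_lt c hf hm, sum_apply]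
  simp

lemma powSum_mem_filt {c : ℕ → 𝕜} {f : Series M 𝕜} (hf : f ∈ Filt M 𝕜 1) {n : ℕ}
    (hc : ∀ i < n, c i = 0) : powSum c f ∈ Filt M 𝕜 n := by
  have h := powSum_sub_mem_filt c hf n
  rwa [Finset.sum_eq_zero fun i hi => by rw [hc i (Finset.mem_range.1 hi), zero_smul],
    sub_zero] at h

lemma map_powSum {φ : Series M 𝕜 →L[𝕜] Series N 𝕜} (hφ : Raises φ 0) (h1 : φ 1 = 1)
    (hmul : ∀ f g, φ (f * g) = φ f * φ g) (c : ℕ → 𝕜) {f : Series M 𝕜} (hf : f ∈ Filt M 𝕜 1) :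
    φ (powSum c f) = powSum c (φ f) := by
  have hpow : ∀ i, φ (f ^ i) = φ f ^ i := by
    intro i
    induction i with
    | zero => simpa using h1
    | succ i ih => rw [pow_succ, pow_succ, hmul, ih]
  refine eq_of_forall_sub_mem_filt fun n => ?_
  have a1 := hφ.mem_filt (powSum_sub_mem_filt c hf n)
  have a2 := powSum_sub_mem_filt c (hφ.mem_filt hf) n
  simp only [map_sub, map_sum, map_smul, hpow] at a1
  simpa using sub_mem a1 a2

lemma powSum_mul_comm {f g : Series M 𝕜} (hf : f ∈ Filt M 𝕜 1) (h : f * g = g * f) (c : ℕ → 𝕜) :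
    powSum c f * g = g * powSum c f := by
  refine eq_of_forall_sub_mem_filt fun n => ?_
  have a := powSum_sub_mem_filt c hf n
  have e : (∑ i ∈ Finset.range n, c i • f ^ i) * g = g * ∑ i ∈ Finset.range n, c i • f ^ i := by
    rw [Finset.sum_mul, Finset.mul_sum]
    refine Finset.sum_congr rfl fun i _ => ?_
    rw [smul_mul_assoc, mul_smul_comm, ((show Commute f g from h).pow_left i).eq]
  have := sub_mem (mul_mem_filt_left a g) (mul_mem_filt_right g a)
  rw [sub_mul, mul_sub, e] at this
  simpa using this

lemma euler_pow {f : Series M 𝕜} (h : f * euler M 𝕜 f = euler M 𝕜 f * f) (n : ℕ) :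
    euler M 𝕜 (f ^ (n + 1)) = ((n + 1 : ℕ) : 𝕜) • (f ^ n * euler M 𝕜 f) := by
  induction n with
  | zero => simp
  | succ n ih =>
    rw [pow_succ, euler_mul, ih, smul_mul_assoc, mul_assoc, ← h, ← mul_assoc, ← pow_succ,
      Nat.cast_succ (n + 1), add_smul, one_smul]

lemma powSum_add (c d : ℕ → 𝕜) (f : Series M 𝕜) :
    powSum (fun n => c n + d n) f = powSum c f + powSum d f := by
  ext m
  simp [powSum, add_mul, Finset.sum_add_distrib]

lemma powSum_zero (f : Series M 𝕜) : powSum (fun _ => 0) f = 0 := by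
  ext m
  simp [powSum]

lemma powSum_single {f : Series M 𝕜} (hf : f ∈ Filt M 𝕜 1) (k : ℕ) (r : 𝕜) :
    powSum (fun n => if n = k then r else 0) f = r • f ^ k := by
  ext m
  rw [powSum_apply_of_lt _ hf (Nat.lt_succ_of_le (le_max_left (deg m) k))]
  rw [Finset.sum_eq_single k]
  · simp
  · intro b _ hb
    simp [hb]
  · intro h
    exact absurd (Finset.mem_range.2 (Nat.lt_succ_of_le (le_max_right _ _))) h

end PowSum

section PowSumEuler

variable {M N : Type*} [Monoid M] [FinGraded M] [Monoid N] [FinGraded N] {𝕜 : Type*} [CommRing 𝕜]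

lemma raises_euler : Raises (euler M 𝕜) 0 := fun m => by
  rw [euler_single]
  exact Submodule.smul_mem _ _ (single_mem_filt m)

lemma single_pow (m : M) (n : ℕ) : (single m : Series M 𝕜) ^ n = single (m ^ n) := by
  induction n with
  | zero => simp [one_def]
  | succ n ih => rw [pow_succ, pow_succ, ih, single_mul_single]

lemma deg_pow (m : M) (n : ℕ) : deg (m ^ n) = n * deg m := by
  induction n with
  | zero => simp [deg_one]
  | succ n ih => rw [pow_succ, deg_mul, ih]; ring

lemma euler_powSum_single {m : M} (hm : deg m = 1) (c : ℕ → 𝕜) :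
    euler M 𝕜 (powSum c (single m)) = powSum (fun n => (n : 𝕜) * c n) (single m) := by
  ext m'
  rw [euler_apply, powSum, powSum, Finset.mul_sum]
  refine Finset.sum_congr rfl fun n _ => ?_
  rw [single_pow]
  by_cases h : m' = m ^ n
  · subst h
    rw [deg_pow, hm]
    simp
  · simp [single_of_ne h]

end PowSumEuler

/-! ### The exponential -/

section Exp

variable {M N : Type*} [Monoid M] [FinGraded M] [Monoid N] [FinGraded N]
  {𝕜 : Type*} [CommRing 𝕜] [Algebra ℚ 𝕜]

lemma exp_apply_one (f : Series M 𝕜) : exp f 1 = 1 := by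
  simp [exp, powSum, deg_one, one_apply_one]

lemma exp_zero : exp (0 : Series M 𝕜) = 1 := by
  ext m
  rw [exp, powSum, Finset.sum_eq_single 0]
  · simp
  · intro b _ hb
    simp [hb]
  · simp

lemma map_exp {φ : Series M 𝕜 →L[𝕜] Series N 𝕜} (hφ : Raises φ 0) (h1 : φ 1 = 1)
    (hmul : ∀ f g, φ (f * g) = φ f * φ g) {f : Series M 𝕜} (hf : f ∈ Filt M 𝕜 1) :
    φ (exp f) = exp (φ f) := map_powSum hφ h1 hmul _ hf

/-- The truncated product splits into the pairs of exponents with sum below n, which the binomial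
theorem assembles into powers of f + g, and the remaining pairs, which lie in degree at least n. -/
lemma exp_add {f g : Series M 𝕜} (hf : f ∈ Filt M 𝕜 1) (hg : g ∈ Filt M 𝕜 1)
    (h : f * g = g * f) : exp (f + g) = exp f * exp g := by
  set c : ℕ → 𝕜 := fun n => algebraMap ℚ 𝕜 (1 / (n.factorial : ℚ)) with hc
  refine eq_of_forall_sub_mem_filt fun n => ?_
  have a1 := powSum_sub_mem_filt c hf n
  have a2 := powSum_sub_mem_filt c hg n
  have a3 := powSum_sub_mem_filt c (add_mem hf hg) n
  change exp f - _ ∈ _ at a1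
  change exp g - _ ∈ _ at a2
  change exp (f + g) - _ ∈ _ at a3
  set F := ∑ i ∈ Finset.range n, c i • f ^ i
  set G := ∑ i ∈ Finset.range n, c i • g ^ i
  have a4 : F * G - ∑ i ∈ Finset.range n, c i • (f + g) ^ i ∈ Filt M 𝕜 n := by
    have e1 : F * G = ∑ p ∈ Finset.range n ×ˢ Finset.range n,
        (c p.1 * c p.2) • (f ^ p.1 * g ^ p.2) := by
      rw [Finset.sum_mul_sum, Finset.sum_product]
      refine Finset.sum_congr rfl fun i _ => Finset.sum_congr rfl fun j _ => ?_
      rw [smul_mul_assoc, mul_smul_comm, smul_smul]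
    have e2 : ∑ i ∈ Finset.range n, c i • (f + g) ^ i =
        ∑ p ∈ (Finset.range n ×ˢ Finset.range n).filter (fun p => p.1 + p.2 < n),
          (c p.1 * c p.2) • (f ^ p.1 * g ^ p.2) := by
      rw [← Finset.sum_fiberwise_of_maps_to (t := Finset.range n)
        (g := fun p : ℕ × ℕ => p.1 + p.2)
        (fun p hp => Finset.mem_range.2 (Finset.mem_filter.1 hp).2)]
      refine Finset.sum_congr rfl fun i hi => ?_
      rw [Finset.mem_range] at hi
      have e3 : ((Finset.range n ×ˢ Finset.range n).filter (fun p => p.1 + p.2 < n)).filter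
          (fun p => p.1 + p.2 = i) = Finset.HasAntidiagonal.antidiagonal i := by
        ext p
        simp only [Finset.mem_filter, Finset.mem_product, Finset.mem_range,
          Finset.HasAntidiagonal.mem_antidiagonal]
        omega
      rw [e3, Commute.add_pow' h, Finset.smul_sum]
      refine Finset.sum_congr rfl fun p hp => ?_
      rw [Finset.HasAntidiagonal.mem_antidiagonal] at hp
      rw [← Nat.cast_smul_eq_nsmul 𝕜, smul_smul]
      congr 1
      simp only [hc]
      rw [← map_natCast (algebraMap ℚ 𝕜), ← map_mul, ← map_mul]
      congr 1
      subst hp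
      have h1 := Nat.add_choose_mul_factorial_mul_factorial p.1 p.2
      rw [← Nat.choose_symm_add] at h1
      have h2 : ((p.1 + p.2).factorial : ℚ) ≠ 0 := by positivity
      have h3 : (p.1.factorial : ℚ) ≠ 0 := by positivity
      have h4 : (p.2.factorial : ℚ) ≠ 0 := by positivity
      field_simp
      exact_mod_cast h1
    rw [e1, e2, ← Finset.sum_filter_add_sum_filter_not _ (fun p => p.1 + p.2 < n),
      add_sub_cancel_left]
    refine sum_mem fun p hp => Submodule.smul_mem _ _ ?_
    have := (Finset.mem_filter.1 hp).2
    exact filt_anti (by omega) (mul_mem_filt (pow_mem_filt hf _) (pow_mem_filt hg _))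
  have e : exp (f + g) - exp f * exp g = (exp (f + g) - ∑ i ∈ Finset.range n, c i • (f + g) ^ i) -
      (F * G - ∑ i ∈ Finset.range n, c i • (f + g) ^ i) - (exp f - F) * exp g -
      F * (exp g - G) := by noncomm_ring
  rw [e]
  exact sub_mem (sub_mem (sub_mem a3 a4) (mul_mem_filt_left a1 _)) (mul_mem_filt_right _ a2)

lemma exp_mul_exp_neg {f : Series M 𝕜} (hf : f ∈ Filt M 𝕜 1) : exp f * exp (-f) = 1 := by
  rw [← exp_add hf (neg_mem hf) (by simp), add_neg_cancel, exp_zero]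

lemma exp_neg_mul_exp {f : Series M 𝕜} (hf : f ∈ Filt M 𝕜 1) : exp (-f) * exp f = 1 := by
  simpa using exp_mul_exp_neg (neg_mem hf)

lemma pow_sub_pow_mem_filt {f g : Series M 𝕜} (hf : f ∈ Filt M 𝕜 1) (hg : g ∈ Filt M 𝕜 1) {n : ℕ}
    (h : f - g ∈ Filt M 𝕜 n) (k : ℕ) : f ^ (k + 1) - g ^ (k + 1) ∈ Filt M 𝕜 (n + k) := by
  induction k with
  | zero => simpa using h
  | succ k ih =>
    have e : f ^ (k + 1 + 1) - g ^ (k + 1 + 1) =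
        f ^ (k + 1) * (f - g) + (f ^ (k + 1) - g ^ (k + 1)) * g := by
      rw [pow_succ f, pow_succ g]
      noncomm_ring
    rw [e]
    refine add_mem (filt_anti ?_ (mul_mem_filt (pow_mem_filt hf _) h))
      (filt_anti ?_ (mul_mem_filt ih hg)) <;> omega

/-- Differences of powers with exponent at least two gain a further degree over f - g, so exp is a
translation to leading order. Its injectivity and its surjectivity onto series with constant term 1
both come from this estimate. -/
lemma exp_sub_exp_mem_filt {f g : Series M 𝕜} (hf : f ∈ Filt M 𝕜 1) (hg : g ∈ Filt M 𝕜 1) {n : ℕ}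
    (h : f - g ∈ Filt M 𝕜 n) : exp f - exp g - (f - g) ∈ Filt M 𝕜 (n + 1) := by
  set c : ℕ → 𝕜 := fun n => algebraMap ℚ 𝕜 (1 / (n.factorial : ℚ)) with hc
  have a1 := powSum_sub_mem_filt c hf (n + 2)
  have a2 := powSum_sub_mem_filt c hg (n + 2)
  change exp f - _ ∈ _ at a1
  change exp g - _ ∈ _ at a2
  have e : exp f - exp g - (f - g) = (exp f - ∑ i ∈ Finset.range (n + 2), c i • f ^ i) -
      (exp g - ∑ i ∈ Finset.range (n + 2), c i • g ^ i) +
      ∑ i ∈ Finset.range n, c (i + 2) • (f ^ (i + 1 + 1) - g ^ (i + 1 + 1)) := by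
    simp only [Finset.sum_range_succ' _ (n + 1), Finset.sum_range_succ' _ n, smul_sub,
      Finset.sum_sub_distrib]
    have h0 : c 0 = 1 := by simp [hc]
    have h1 : c (0 + 1) = 1 := by simp [hc]
    simp only [h0, h1, one_smul, zero_add, pow_one, pow_zero, add_assoc]
    abel
  rw [e]
  refine add_mem (sub_mem (filt_anti (by omega) a1) (filt_anti (by omega) a2))
    (sum_mem fun i _ => Submodule.smul_mem _ _ ?_)
  exact filt_anti (by omega) (pow_sub_pow_mem_filt hf hg h (i + 1))

lemma exp_injOn {f g : Series M 𝕜} (hf : f ∈ Filt M 𝕜 1) (hg : g ∈ Filt M 𝕜 1)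
    (h : exp f = exp g) : f = g := by
  refine eq_of_forall_sub_mem_filt fun n => ?_
  induction n with
  | zero => exact filt_zero _
  | succ n ih =>
    have := exp_sub_exp_mem_filt hf hg ih
    rw [h, sub_self, zero_sub] at this
    simpa using neg_mem this

/-- A sequence of series converging coefficientwise in increasing degrees has a limit. -/
lemma exists_limit (u : ℕ → Series M 𝕜) (h : ∀ n, u (n + 1) - u n ∈ Filt M 𝕜 n) :
    ∃ f, ∀ n, f - u n ∈ Filt M 𝕜 n := by
  have h' : ∀ n k, u (n + k) - u n ∈ Filt M 𝕜 n := by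
    intro n k
    induction k with
    | zero => simp
    | succ k ih =>
      have := add_mem (filt_anti (by omega) (h (n + k)) : _ ∈ Filt M 𝕜 n) ih
      rwa [sub_add_sub_cancel] at this
  refine ⟨fun m => u (deg m + 1) m, fun n m hm => ?_⟩
  have a := h' (deg m + 1) (n - (deg m + 1)) m (by omega)
  rw [show deg m + 1 + (n - (deg m + 1)) = n by omega] at a
  rw [sub_apply] at a
  change u (deg m + 1) m - u n m = 0
  rw [← neg_eq_zero, neg_sub]
  exact a

lemma exists_exp_eq {g : Series M 𝕜} (hg : g 1 = 1) : ∃ f ∈ Filt M 𝕜 1, exp f = g := by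
  -- Successive correction by the error g - exp f gains one degree per step, so the logarithm is
  -- constructed without its power series.
  let u : ℕ → Series M 𝕜 := fun n => Nat.rec 0 (fun _ f => f + (g - exp f)) n
  have hu : ∀ n, u (n + 1) = u n + (g - exp (u n)) := fun _ => rfl
  have key : ∀ n, u n ∈ Filt M 𝕜 1 ∧ g - exp (u n) ∈ Filt M 𝕜 (n + 1) := by
    intro n
    induction n with
    | zero =>
      refine ⟨zero_mem _, mem_filt_one.2 ?_⟩
      rw [sub_apply, hg, exp_apply_one, sub_self]
    | succ n ih =>
      have h1 : u (n + 1) ∈ Filt M 𝕜 1 := by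
        rw [hu]
        exact add_mem ih.1 (filt_anti (by omega) ih.2)
      refine ⟨h1, ?_⟩
      have h2 := exp_sub_exp_mem_filt h1 ih.1 (n := n + 1) (by
        rw [hu, add_sub_cancel_left]
        exact ih.2)
      have e : exp (u (n + 1)) - exp (u n) - (u (n + 1) - u n) = -(g - exp (u (n + 1))) := by
        rw [hu n]
        abel
      rw [e] at h2
      simpa using neg_mem h2
  obtain ⟨f, hf⟩ := exists_limit u fun n => by
    rw [hu, add_sub_cancel_left]
    exact filt_anti (by omega) (key n).2
  have hf1 : f ∈ Filt M 𝕜 1 := by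
    have := add_mem (hf 1) (key 1).1
    rwa [sub_add_cancel] at this
  refine ⟨f, hf1, eq_of_forall_sub_mem_filt fun n => ?_⟩
  have a1 := exp_sub_exp_mem_filt hf1 (key n).1 (hf n)
  have e : exp f - g = (exp f - exp (u n) - (f - u n)) + (f - u n) - (g - exp (u n)) := by abel
  rw [e]
  exact sub_mem (add_mem (filt_anti (by omega) a1) (hf n)) (filt_anti (by omega) (key n).2)

/-- The commutation hypothesis gives the usual derivative of a power. Differentiation shifts the
summation index by one, whence the truncations at n + 1 and at n. -/
lemma euler_exp {f : Series M 𝕜} (hf : f ∈ Filt M 𝕜 1) (h : f * euler M 𝕜 f = euler M 𝕜 f * f) :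
    euler M 𝕜 (exp f) = exp f * euler M 𝕜 f := by
  set c : ℕ → 𝕜 := fun n => algebraMap ℚ 𝕜 (1 / (n.factorial : ℚ)) with hc
  refine eq_of_forall_sub_mem_filt fun n => ?_
  have a1 := raises_euler.mem_filt (powSum_sub_mem_filt c hf (n + 1))
  have a2 := mul_mem_filt_left (powSum_sub_mem_filt c hf n) (euler M 𝕜 f)
  change euler M 𝕜 (exp f - _) ∈ _ at a1
  change (exp f - _) * _ ∈ _ at a2
  have e : euler M 𝕜 (∑ i ∈ Finset.range (n + 1), c i • f ^ i) =
      (∑ i ∈ Finset.range n, c i • f ^ i) * euler M 𝕜 f := by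
    rw [Finset.sum_range_succ', map_add, pow_zero, map_smul, euler_one, smul_zero, add_zero,
      map_sum, Finset.sum_mul]
    refine Finset.sum_congr rfl fun i _ => ?_
    rw [map_smul, euler_pow h, smul_smul, smul_mul_assoc]
    congr 1
    simp only [hc]
    rw [← map_natCast (algebraMap ℚ 𝕜), ← map_mul]
    congr 1
    rw [Nat.factorial_succ]
    have : (i.factorial : ℚ) ≠ 0 := by positivity
    push_cast
    field_simp
  rw [map_sub, e] at a1
  rw [sub_mul] at a2
  have := sub_mem (filt_anti (by omega) a1 : _ ∈ Filt M 𝕜 n) a2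
  simpa using this

end Exp

end Series

end DoubleShuffle

set_option linter.unusedSectionVars false
namespace DoubleShuffle
open WeightedAlphabet FinGraded
open Series

/-! ### Group-like series for the coproduct Δ. -/

section GroupLike

variable {Γ : Type*} [CommGroup Γ] [Finite Γ] {𝕜 : Type*} [CommRing 𝕜]

namespace Series

variable {M : Type*} [Monoid M] [FinGraded M]

lemma tensor_mul_one (f g : Series M 𝕜) :
    tensor (f * g) (1 : Series M 𝕜) = tensor f 1 * tensor g 1 := by
  rw [tensor_mul_tensor, mul_one]

lemma one_tensor_mul (f g : Series M 𝕜) :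
    tensor (1 : Series M 𝕜) (f * g) = tensor 1 f * tensor 1 g := by
  rw [tensor_mul_tensor, mul_one]

lemma raises_tensorLeft_one : Raises (tensorLeft (1 : Series M 𝕜) : Series M 𝕜 →L[𝕜] _) 0 :=
  fun m => by
    have := tensor_mem_filt (filt_zero (1 : Series M 𝕜)) (single_mem_filt (𝕜 := 𝕜) m)
    rwa [zero_add] at this

lemma raises_tensorRight_one : Raises (tensorRight (1 : Series M 𝕜) : Series M 𝕜 →L[𝕜] _) 0 :=
  fun m => tensor_mem_filt (single_mem_filt (𝕜 := 𝕜) m) (filt_zero (1 : Series M 𝕜))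

lemma exp_primitive [Algebra ℚ 𝕜] {f : Series M 𝕜} (hf : f ∈ Filt M 𝕜 1) :
    exp (primitive f) = tensor (exp f) (exp f) := by
  have h1 := map_exp raises_tensorLeft_one (tensor_one_one (M := M) (N := M)) one_tensor_mul hf
  have h2 := map_exp raises_tensorRight_one (tensor_one_one (M := M) (N := M)) tensor_mul_one hf
  rw [tensorLeft_apply] at h1
  rw [tensorRight_apply] at h2
  rw [tensorLeft_apply] at h1
  rw [tensorRight_apply] at h2
  rw [primitive, exp_add, ← h1, ← h2, tensor_mul_tensor, mul_one, one_mul]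
  · exact tensor_mem_filt hf (filt_zero 1)
  · simpa using tensor_mem_filt (filt_zero 1) hf
  · simp [tensor_mul_tensor]

lemma primitive_mem_filt {f : Series M 𝕜} {n : ℕ} (hf : f ∈ Filt M 𝕜 n) :
    primitive f ∈ Filt (M × M) 𝕜 n :=
  add_mem (tensor_mem_filt hf (filt_zero 1)) (by simpa using tensor_mem_filt (filt_zero 1) hf)

lemma inverse_tensor {f g : Series M 𝕜} (hf : f 1 = 1) (hg : g 1 = 1) :
    Ring.inverse (tensor f g) = tensor (Ring.inverse f) (Ring.inverse g) := by
  refine inverse_eq_of_mul ?_ ?_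
  · rw [tensor_mul_tensor, Ring.mul_inverse_cancel _ (isUnit_of_constCoeff hf),
      Ring.mul_inverse_cancel _ (isUnit_of_constCoeff hg), tensor_one_one]
  · rw [tensor_mul_tensor, Ring.inverse_mul_cancel _ (isUnit_of_constCoeff hf),
      Ring.inverse_mul_cancel _ (isUnit_of_constCoeff hg), tensor_one_one]

lemma tensorSq_mul {N : Type*} [Monoid N] [FinGraded N] {S : Series M 𝕜 →L[𝕜] Series N 𝕜}
    (hS : ∀ f g, S (f * g) = S f * S g) (F G : Series (M × M) 𝕜) :
    tensorSq S (F * G) = tensorSq S F * tensorSq S G := by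
  refine bilin_ext (fun a b => ?_) F G
  rw [← single_mul_single, ← tensor_single, ← tensor_single, tensor_mul_tensor, tensorSq_tensor,
    tensorSq_tensor, tensorSq_tensor, hS, hS, tensor_mul_tensor]

lemma primitive_commutator (f g : Series M 𝕜) :
    primitive f * primitive g - primitive g * primitive f = primitive (f * g - g * f) := by
  simp only [primitive, mul_add, add_mul, tensor_mul_tensor, mul_one, one_mul, sub_tensor,
    tensor_sub]
  abel

end Series

lemma DeltaX_mul (f g : SerX Γ 𝕜) : DeltaX (f * g) = DeltaX f * DeltaX g := subst_mul _ _ f g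

lemma DeltaX_one : DeltaX (1 : SerX Γ 𝕜) = 1 := subst_one _ _

lemma DeltaX_of (a : AlphX Γ) : DeltaX (single (FreeMonoid.of a) : SerX Γ 𝕜) =
    primitive (single (FreeMonoid.of a)) := subst_of _ _ a

lemma DeltaX_x0 : DeltaX (x0 : SerX Γ 𝕜) = primitive x0 := DeltaX_of _

lemma DeltaX_x (σ : Γ) : DeltaX (x σ : SerX Γ 𝕜) = primitive (x σ) := DeltaX_of _

lemma raises_DeltaX : Raises (DeltaX : SerX Γ 𝕜 →L[𝕜] SerXX Γ 𝕜) 0 := raises_subst _ _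

lemma DeltaX_t (σ : Γ) (f : SerX Γ 𝕜) : DeltaX (t σ f) = tensorSq (t σ) (DeltaX f) := by
  have : DeltaX.comp (t σ) = (tensorSq (t σ)).comp (DeltaX : SerX Γ 𝕜 →L[𝕜] SerXX Γ 𝕜) := by
    refine clm_ext_letters (by simp [t_one, DeltaX_one, ← tensor_one_one])
      (by simp [t_one, DeltaX_one, ← tensor_one_one, tensorSq_tensor])
      (fun f g => by simp [t_mul, DeltaX_mul])
      (fun f g => by simp [DeltaX_mul, tensorSq_mul (t_mul σ)]) fun a => ?_
    rw [ContinuousLinearMap.comp_apply, ContinuousLinearMap.comp_apply, t_single, DeltaX_of,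
      primitive, map_add, tensorSq_tensor, tensorSq_tensor, t_one, t_single]
    exact DeltaX_of _
  exact DFunLike.congr_fun this f

/-- Group-like series with constant term `1`, for the coproduct `Δ`. -/
def IsGroupLike (G : SerX Γ 𝕜) : Prop := G 1 = 1 ∧ DeltaX G = tensor G G

lemma IsGroupLike.t {G : SerX Γ 𝕜} (hG : IsGroupLike G) (σ : Γ) : IsGroupLike (t σ G) :=
  ⟨by rw [t_apply_one, hG.1], by rw [DeltaX_t, hG.2, tensorSq_tensor]⟩

lemma IsGroupLike.inverse {G : SerX Γ 𝕜} (hG : IsGroupLike G) : IsGroupLike (Ring.inverse G) := by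
  refine ⟨inverse_apply_one hG.1, ?_⟩
  rw [map_inverse DeltaX_one DeltaX_mul (isUnit_of_constCoeff hG.1), hG.2,
    inverse_tensor hG.1 hG.1]

lemma isGroupLike_one : IsGroupLike (1 : SerX Γ 𝕜) :=
  ⟨one_apply_one, by rw [DeltaX_one, tensor_one_one]⟩

lemma IsGroupLike.DeltaX_conj {G f : SerX Γ 𝕜} (hG : IsGroupLike G)
    (hf : DeltaX f = primitive f) :
    DeltaX (Ring.inverse G * f * G) = primitive (Ring.inverse G * f * G) := by
  have hu := isUnit_of_constCoeff hG.1
  rw [DeltaX_mul, DeltaX_mul, hG.inverse.2, hf, hG.2, primitive, primitive, mul_add, add_mul]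
  simp only [tensor_mul_tensor, mul_one, Ring.inverse_mul_cancel _ hu]

/-- Conjugation by a group-like series preserves primitive elements, so aut_G sends letters to
primitive elements and is a morphism of coalgebras. -/
lemma IsGroupLike.DeltaX_aut {G : SerX Γ 𝕜} (hG : IsGroupLike G) (f : SerX Γ 𝕜) :
    DeltaX (aut G f) = tensorSq (aut G) (DeltaX f) := by
  have : DeltaX.comp (aut G) = (tensorSq (aut G)).comp (DeltaX : SerX Γ 𝕜 →L[𝕜] SerXX Γ 𝕜) := by
    refine clm_ext_letters (by simp [aut_one, DeltaX_one, ← tensor_one_one])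
      (by simp [aut_one, DeltaX_one, ← tensor_one_one, tensorSq_tensor])
      (fun f g => by simp [aut_mul, DeltaX_mul])
      (fun f g => by simp [DeltaX_mul, tensorSq_mul (aut_mul G)]) fun a => ?_
    rw [ContinuousLinearMap.comp_apply, ContinuousLinearMap.comp_apply, DeltaX_of,
      primitive, map_add, tensorSq_tensor, tensorSq_tensor, aut_one]
    cases a with
    | zero =>
      change DeltaX (aut G x0) = tensor (aut G x0) 1 + tensor 1 (aut G x0)
      rw [aut_x0, DeltaX_x0, primitive]
    | of σ =>
      change DeltaX (aut G (x σ)) = tensor (aut G (x σ)) 1 + tensor 1 (aut G (x σ))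
      rw [aut_x, (hG.t σ).DeltaX_conj (DeltaX_x σ), primitive]
  exact DFunLike.congr_fun this f

lemma IsGroupLike.DeltaX_SX {G : SerX Γ 𝕜} (hG : IsGroupLike G) (f : SerX Γ 𝕜) :
    DeltaX (SX G f) = tensorSq (SX G) (DeltaX f) := by
  have : (mulLeft (tensor G G)).comp (tensorSq (aut G)) = tensorSq (SX G) :=
    clm_ext_tensor fun f g => by
      simp [tensorSq_tensor, tensor_mul_tensor, SX_apply]
  rw [← this, SX_apply, DeltaX_mul, hG.2, hG.DeltaX_aut]
  rfl

lemma IsGroupLike.circ {G H : SerX Γ 𝕜} (hG : IsGroupLike G) (hH : IsGroupLike H) :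
    IsGroupLike (circ G H) :=
  ⟨circ_apply_one hG.1 hH.1, by
    change DeltaX (SX G H) = tensor (SX G H) (SX G H)
    rw [hG.DeltaX_SX, hH.2, tensorSq_tensor]⟩

variable (Γ 𝕜) in
/-- The subgroup of group-like series of `MT(𝕜)`. -/
noncomputable def groupLike : Subgroup (MT Γ 𝕜) where
  carrier := {G | IsGroupLike G.1}
  one_mem' := isGroupLike_one
  mul_mem' hG hH := hG.circ hH
  inv_mem' {G} hG := by
    have hG' : IsGroupLike G.1 := hG
    refine ⟨(G⁻¹).2, ?_⟩
    have h1 : SX G.1 (G⁻¹).1 = 1 := by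
      have := congrArg Subtype.val (mul_inv_cancel G)
      rwa [MT_mul_val, MT_one_val] at this
    have h2 := hG'.DeltaX_SX (G⁻¹).1
    have h3 : tensorSq (SX G.1) (tensor (G⁻¹).1 (G⁻¹).1) = 1 := by
      rw [tensorSq_tensor, h1, tensor_one_one]
    rw [h1, DeltaX_one, ← h3] at h2
    have h4 : (SX (G⁻¹).1).comp (SX G.1) = ContinuousLinearMap.id 𝕜 (SerX Γ 𝕜) :=
      ContinuousLinearMap.ext fun f => SX_inv_SX G f
    -- Applying the tensor square of S for the inverse undoes that of S_G, so Δ(G⁻¹) and G⁻¹ ⊗ G⁻¹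
    -- (inverse for ⊛) agree because their images under the tensor square of S_G do.
    have h5 := congrArg (tensorSq (SX (G⁻¹).1)) h2
    rw [← ContinuousLinearMap.comp_apply, ← ContinuousLinearMap.comp_apply, ← tensorSq_comp, h4,
      tensorSq_id] at h5
    exact h5.symm

end GroupLike

/-! ### Primitive series and Lie series -/

section Friedrichs

variable {Γ : Type*} [CommGroup Γ] [Finite Γ] {𝕜 : Type*} [CommRing 𝕜]

/-- The antipode of `𝕜⟨⟨A⟩⟩`, for primitive letters. -/
noncomputable def antipode {A : Type*} [WeightedAlphabet A] :
    Series (FreeMonoid A) 𝕜 →L[𝕜] Series (FreeMonoid A) 𝕜 :=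
  mapOfImages (fun w => (-1 : 𝕜) ^ w.length • single w.reverse) fun n =>
    (Set.finite_singleton n.reverse).subset fun w hw => by
      have h1 := right_ne_zero_of_mul (a := (-1 : 𝕜) ^ w.length) hw
      rw [Set.mem_singleton_iff, single_apply_ne_zero h1, FreeMonoid.reverse_reverse]

lemma antipode_one {A : Type*} [WeightedAlphabet A] :
    antipode (1 : Series (FreeMonoid A) 𝕜) = 1 := by
  rw [one_def, antipode, mapOfImages_single, FreeMonoid.length_one, pow_zero, one_smul]
  rfl

lemma antipode_mul {A : Type*} [WeightedAlphabet A] (f g : Series (FreeMonoid A) 𝕜) :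
    antipode (f * g) = antipode g * antipode f := by
  refine bilin_ext_anti (fun u v => ?_) f g
  rw [antipode, mapOfImages_single, mapOfImages_single, mapOfImages_single, smul_mul_smul_comm,
    single_mul_single, FreeMonoid.reverse_mul, ← pow_add, FreeMonoid.length_mul, add_comm]

lemma antipode_of {A : Type*} [WeightedAlphabet A] (a : A) :
    antipode (single (FreeMonoid.of a) : Series (FreeMonoid A) 𝕜) =
      -single (FreeMonoid.of a) := by
  rw [antipode, mapOfImages_single]
  simp

/-- The multiplication `u ⊗ v ↦ u v`. -/
noncomputable def mulMap {M : Type*} [Monoid M] [FinGraded M] :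
    Series (M × M) 𝕜 →L[𝕜] Series M 𝕜 :=
  mapOfIndex (fun p : M × M => p.1 * p.2) fun p => (deg_mul p.1 p.2).ge

lemma mulMap_tensor {M : Type*} [Monoid M] [FinGraded M] (f g : Series M 𝕜) :
    mulMap (tensor f g) = f * g := by
  have h1 : ∀ a, mulMap.comp (tensorLeft (single a)) = mulLeft (single a : Series M 𝕜) :=
    fun a => clm_ext fun b => by
      rw [ContinuousLinearMap.comp_apply, tensorLeft_apply, tensor_single, mulLeft_apply,
        single_mul_single]
      exact mapOfIndex_single _ _ _
  have h2 : mulMap.comp (tensorRight g) = mulRight (g : Series M 𝕜) :=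
    clm_ext fun a => DFunLike.congr_fun (h1 a) g
  exact DFunLike.congr_fun h2 f

/-- The left-normed brackets of letters. -/
noncomputable def bracketWord {A : Type*} [WeightedAlphabet A] :
    List A → Series (FreeMonoid A) 𝕜
  | [] => 0
  | [a] => single (FreeMonoid.of a)
  | a :: l => bracketWord l * single (FreeMonoid.of a) - single (FreeMonoid.of a) * bracketWord l

/-- Convolution of the antipode with the identity is the counit. Appending a primitive letter
replaces the value by its commutator with that letter; the value 1 at the empty word commutes with
everything, so all later values are zero. -/
lemma mulMap_antipode_id (w : FreeMonoid (AlphX Γ)) :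
    mulMap (tmap antipode (ContinuousLinearMap.id 𝕜 (SerX Γ 𝕜)) (DeltaX (single w))) =
      (single w : SerX Γ 𝕜) 1 • 1 := by
  have key : ∀ (a : AlphX Γ) (F : SerXX Γ 𝕜),
      mulMap (tmap antipode (ContinuousLinearMap.id 𝕜 (SerX Γ 𝕜))
        (F * primitive (single (FreeMonoid.of a)))) =
      mulMap (tmap antipode (ContinuousLinearMap.id 𝕜 (SerX Γ 𝕜)) F) * single (FreeMonoid.of a) -
      single (FreeMonoid.of a) *
        mulMap (tmap antipode (ContinuousLinearMap.id 𝕜 (SerX Γ 𝕜)) F) := by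
    intro a F
    set P := mulMap.comp (tmap antipode (ContinuousLinearMap.id 𝕜 (SerX Γ 𝕜)))
    have : P.comp (mulRight (primitive (single (FreeMonoid.of a)))) =
        (mulRight (single (FreeMonoid.of a)) - mulLeft (single (FreeMonoid.of a))).comp P := by
      refine clm_ext_tensor fun f g => ?_
      simp only [P, ContinuousLinearMap.comp_apply, mulRight_apply, primitive, mul_add,
        tensor_mul_tensor, map_add, tmap_tensor, mulMap_tensor, antipode_mul, antipode_of,
        mul_one, ContinuousLinearMap.id_apply, _root_.sub_apply, mulLeft_apply]
      noncomm_ring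
    exact DFunLike.congr_fun this F
  rcases eq_one_or_mul_of w with rfl | ⟨v, b, rfl⟩
  · rw [← one_def, DeltaX_one, ← tensor_one_one, tmap_tensor, mulMap_tensor, antipode_one,
      one_apply_one]
    simp
  · rw [single_of_ne (mul_of_ne_one b v).symm, zero_smul]
    have : ∀ (l : List (AlphX Γ)) (b : AlphX Γ),
        mulMap (tmap antipode (ContinuousLinearMap.id 𝕜 (SerX Γ 𝕜))
          (DeltaX (single (FreeMonoid.ofList l.reverse * FreeMonoid.of b)))) = 0 := by
      intro l
      induction l with
      | nil =>
        intro b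
        rw [← single_mul_single, DeltaX_mul, DeltaX_of, key]
        have e : (single (FreeMonoid.ofList ([] : List (AlphX Γ)).reverse) : SerX Γ 𝕜) = 1 := rfl
        rw [e, DeltaX_one, ← tensor_one_one, tmap_tensor, mulMap_tensor, antipode_one]
        simp
      | cons c l ih =>
        intro b
        have e : FreeMonoid.ofList (c :: l).reverse =
            FreeMonoid.ofList l.reverse * FreeMonoid.of c := by simp
        rw [e, ← single_mul_single, DeltaX_mul, DeltaX_of, key, ih c, zero_mul, mul_zero, sub_zero]
    have := this v.toList.reverse b
    rwa [List.reverse_reverse] at this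

/-- Convolution of the antipode with the degree derivation is the Dynkin operator. Appending a
letter takes the commutator with it, plus a term from `mulMap_antipode_id` that survives only at the
empty word and starts the bracket. -/
lemma mulMap_antipode_euler (l : List (AlphX Γ)) :
    mulMap (tmap antipode (euler _ 𝕜) (DeltaX (single (FreeMonoid.ofList l.reverse)))) =
      (bracketWord l : SerX Γ 𝕜) := by
  have key : ∀ (a : AlphX Γ) (F : SerXX Γ 𝕜),
      mulMap (tmap antipode (euler _ 𝕜) (F * primitive (single (FreeMonoid.of a)))) =
      mulMap (tmap antipode (euler _ 𝕜) F) * single (FreeMonoid.of a) -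
      single (FreeMonoid.of a) * mulMap (tmap antipode (euler _ 𝕜) F) +
      mulMap (tmap antipode (ContinuousLinearMap.id 𝕜 (SerX Γ 𝕜)) F) *
        single (FreeMonoid.of a) := by
    intro a F
    set P := mulMap.comp (tmap antipode (euler (FreeMonoid (AlphX Γ)) 𝕜))
    set Q := mulMap.comp (tmap antipode (ContinuousLinearMap.id 𝕜 (SerX Γ 𝕜)))
    have : P.comp (mulRight (primitive (single (FreeMonoid.of a)))) =
        (mulRight (single (FreeMonoid.of a)) - mulLeft (single (FreeMonoid.of a))).comp P +
          (mulRight (single (FreeMonoid.of a))).comp Q := by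
      refine clm_ext_tensor fun f g => ?_
      have e : euler (FreeMonoid (AlphX Γ)) 𝕜 (single (FreeMonoid.of a)) =
          single (FreeMonoid.of a) := by
        rw [euler_single, deg_of]
        simp [wt]
      simp only [P, Q, ContinuousLinearMap.comp_apply, mulRight_apply, primitive, mul_add,
        tensor_mul_tensor, map_add, tmap_tensor, mulMap_tensor, antipode_mul, antipode_of,
        mul_one, ContinuousLinearMap.id_apply, _root_.sub_apply, _root_.add_apply, mulLeft_apply,
        euler_mul, e]
      noncomm_ring
    exact DFunLike.congr_fun this F
  induction l with
  | nil =>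
    have e : (single (FreeMonoid.ofList ([] : List (AlphX Γ)).reverse) : SerX Γ 𝕜) = 1 := rfl
    rw [e, DeltaX_one, ← tensor_one_one, tmap_tensor, mulMap_tensor, euler_one, mul_zero]
    rfl
  | cons a l ih =>
    have e : FreeMonoid.ofList (a :: l).reverse =
        FreeMonoid.ofList l.reverse * FreeMonoid.of a := by simp
    rw [e, ← single_mul_single, DeltaX_mul, DeltaX_of, key, ih, mulMap_antipode_id]
    cases l with
    | nil =>
      have e : (single (FreeMonoid.ofList ([] : List (AlphX Γ)).reverse) : SerX Γ 𝕜) = 1 := rfl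
      rw [e, one_apply_one]
      simp [bracketWord]
    | cons b l =>
      have e2 : (bracketWord (a :: b :: l) : SerX Γ 𝕜) = bracketWord (b :: l) *
          single (FreeMonoid.of a) - single (FreeMonoid.of a) * bracketWord (b :: l) := rfl
      rw [single_of_ne, zero_smul, zero_mul, add_zero, e2]
      · intro h
        have := congrArg (fun w => (FreeMonoid.toList w).length) h
        simp at this

lemma bracketWord_mem (l : List (AlphX Γ)) : (bracketWord l : SerX Γ 𝕜) ∈
    LieSubalgebra.lieSpan 𝕜 (SerX Γ 𝕜) (insert x0 (Set.range x)) := by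
  have hX : ∀ a : AlphX Γ, (single (FreeMonoid.of a) : SerX Γ 𝕜) ∈
      LieSubalgebra.lieSpan 𝕜 (SerX Γ 𝕜) (insert x0 (Set.range x)) := by
    intro a
    refine LieSubalgebra.subset_lieSpan ?_
    cases a with
    | zero => exact Set.mem_insert _ _
    | of σ => exact Set.mem_insert_of_mem _ ⟨σ, rfl⟩
  induction l with
  | nil => exact zero_mem _
  | cons a l ih =>
    cases l with
    | nil => exact hX a
    | cons b l =>
      exact LieSubalgebra.lie_mem _ ih (hX a)

lemma lieSpan_le_filt {f : SerX Γ 𝕜}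
    (hf : f ∈ LieSubalgebra.lieSpan 𝕜 (SerX Γ 𝕜) (insert x0 (Set.range x))) :
    f ∈ Filt _ 𝕜 1 ∧ DeltaX f = primitive f := by
  induction hf using LieSubalgebra.lieSpan_induction with
  | mem f hf =>
    rcases hf with rfl | ⟨σ, rfl⟩
    · exact ⟨x0_mem_filt, DeltaX_x0⟩
    · exact ⟨x_mem_filt σ, DeltaX_x σ⟩
  | zero => exact ⟨zero_mem _, by simp [primitive]⟩
  | add f g _ _ hf hg =>
    refine ⟨add_mem hf.1 hg.1, ?_⟩
    rw [map_add, hf.2, hg.2, primitive, primitive, primitive, tensor_add, add_tensor]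
    abel
  | smul c f _ hf =>
    refine ⟨Submodule.smul_mem _ c hf.1, ?_⟩
    rw [map_smul, hf.2, primitive, primitive, smul_add, tensor_smul, smul_tensor]
  | lie f g _ _ hf hg =>
    rw [LieRing.of_associative_ring_bracket]
    refine ⟨sub_mem (mul_mem_filt_left hf.1 g) (mul_mem_filt_left hg.1 f), ?_⟩
    rw [map_sub, DeltaX_mul, DeltaX_mul, hf.2, hg.2, primitive_commutator]

/-- A continuous linear map preserving degrees. -/
def Series.Homog {M N : Type*} [Monoid M] [FinGraded M] [Monoid N] [FinGraded N]
    (S : Series M 𝕜 →L[𝕜] Series N 𝕜) : Prop :=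
  ∀ m n, S (single m) n ≠ 0 → deg m = deg n

section Component

variable {M N : Type*} [Monoid M] [FinGraded M] [Monoid N] [FinGraded N]

/-- The projection on the component of degree `n`. -/
noncomputable def Series.comp (n : ℕ) : Series M 𝕜 →L[𝕜] Series M 𝕜 :=
  weight fun m => if deg m = n then 1 else 0

lemma Series.comp_apply_eq (n : ℕ) (f : Series M 𝕜) : Series.comp n f = component n f := by
  ext m
  simp [Series.comp, weight_apply, component_apply]

lemma Series.Homog.map_component {S : Series M 𝕜 →L[𝕜] Series N 𝕜} (hS : Homog S) (n : ℕ)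
    (f : Series M 𝕜) : S (component n f) = component n (S f) := by
  have : S.comp (Series.comp n) = (Series.comp n).comp S := clm_ext fun m => by
    ext k
    rw [ContinuousLinearMap.comp_apply, ContinuousLinearMap.comp_apply, Series.comp, weight_single,
      map_smul, Series.comp, weight_apply, smul_apply]
    by_cases h : S (single m) k = 0
    · simp [h]
    · rw [hS m k h]
  rw [← Series.comp_apply_eq, ← Series.comp_apply_eq]
  exact DFunLike.congr_fun this f

lemma Series.eq_of_component {f g : Series M 𝕜} (h : ∀ n, component n f = component n g) :
    f = g := by
  ext m
  have := congrArg (fun s : Series M 𝕜 => s m) (h (deg m))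
  simpa [component_apply] using this

lemma Series.tensorLeft_homog : Homog (tensorLeft (1 : Series M 𝕜) : Series M 𝕜 →L[𝕜] _) := by
  intro m n h
  rw [tensorLeft_apply, one_def, tensor_single] at h
  rw [single_apply_ne_zero h]
  change deg m = deg (1 : M) + deg m
  rw [deg_one, zero_add]

lemma Series.tensorRight_homog : Homog (tensorRight (1 : Series M 𝕜) : Series M 𝕜 →L[𝕜] _) := by
  intro m n h
  rw [tensorRight_apply, one_def, tensor_single] at h
  rw [single_apply_ne_zero h]
  change deg m = deg m + deg (1 : M)
  rw [deg_one, add_zero]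

lemma Series.primitive_component (n : ℕ) (f : Series M 𝕜) :
    primitive (component n f) = component n (primitive f) := by
  have h1 := Series.tensorLeft_homog.map_component n f
  have h2 := Series.tensorRight_homog.map_component n f
  rw [tensorLeft_apply, tensorLeft_apply] at h1
  rw [tensorRight_apply, tensorRight_apply] at h2
  rw [primitive, h1, h2, ← Series.comp_apply_eq, ← Series.comp_apply_eq, ← Series.comp_apply_eq,
    primitive, map_add]

/-- A continuous algebra morphism mapping letters to homogeneous series preserves degrees. -/
lemma Series.homog_of_mul {A : Type*} [WeightedAlphabet A]
    {S : Series (FreeMonoid A) 𝕜 →L[𝕜] Series N 𝕜} (h1 : S 1 = 1)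
    (hS : ∀ f g, S (f * g) = S f * S g)
    (h : ∀ a n, S (single (FreeMonoid.of a)) n ≠ 0 → wt a = deg n) : Homog S := by
  intro w
  induction w using FreeMonoid.inductionOn' with
  | one =>
    intro n hn
    rw [← one_def, h1] at hn
    rw [single_apply_ne_zero hn, deg_one, deg_one]
  | of_mul a w ih =>
    intro n hn
    rw [single_of_mul, hS, mul_apply] at hn
    obtain ⟨p, hp, hne⟩ := Finset.exists_ne_zero_of_sum_ne_zero hn
    rw [mem_fac] at hp
    rw [← hp, deg_mul, deg_mul, deg_of, h a _ (left_ne_zero_of_mul hne),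
      ih _ (right_ne_zero_of_mul hne)]

end Component

lemma homog_DeltaX : Homog (DeltaX : SerX Γ 𝕜 →L[𝕜] SerXX Γ 𝕜) :=
  Series.homog_of_mul DeltaX_one DeltaX_mul fun a n hn => by
    rw [DeltaX_of] at hn
    rw [← primitive_single_ne_zero _ _ hn, deg_of]

variable [Algebra ℚ 𝕜]

/-- Friedrichs' criterion, obtained from the Dynkin–Specht–Wever argument in each degree. -/
lemma mem_LibHat {f : SerX Γ 𝕜} :
    f ∈ LibHat Γ 𝕜 ↔ f ∈ Filt _ 𝕜 1 ∧ DeltaX f = primitive f := by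
  constructor
  · intro h
    constructor
    · refine mem_filt_one.2 ?_
      have := mem_filt_one.1 (lieSpan_le_filt (h 0)).1
      rwa [component_apply, if_pos deg_one] at this
    · refine Series.eq_of_component fun n => ?_
      rw [← homog_DeltaX.map_component, (lieSpan_le_filt (h n)).2, Series.primitive_component]
  · rintro ⟨h1, h2⟩ n
    by_cases hn : n = 0
    · have e : component n f = 0 := by
        ext m
        rw [component_apply]
        split_ifs with hm
        · exact h1 m (by omega)
        · rfl
      rw [e]
      exact zero_mem _
    set g := component n f with hg
    -- On a primitive element the Dynkin operator is multiplication by the degree, since the term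
    -- E(1) vanishes; on words its values are brackets. Dividing by n exhibits g as a Lie element.
    have h3 : euler _ 𝕜 g = mulMap (tmap antipode (euler _ 𝕜) (DeltaX g)) := by
      rw [hg, homog_DeltaX.map_component, h2, ← Series.primitive_component, ← hg, primitive,
        map_add, map_add, tmap_tensor, tmap_tensor, mulMap_tensor, mulMap_tensor,
        euler_one, antipode_one, mul_zero, one_mul, zero_add]
    have h4 : euler _ 𝕜 g = (n : 𝕜) • g := by
      ext m
      rw [euler_apply, Series.smul_apply, hg, component_apply]
      split_ifs with hm
      · rw [hm]
      · simp
    have h5 : g = ∑ w ∈ (finite_deg_le n).toFinset, g w • (single w : SerX Γ 𝕜) := by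
      ext m
      rw [Series.sum_apply, Finset.sum_eq_single m]
      · simp
      · intro b _ hb
        rw [Series.smul_apply, single_of_ne (Ne.symm hb), mul_zero]
      · intro hm
        have : deg m ≠ n := fun h => hm (by simp [h])
        rw [Series.smul_apply, hg, component_apply, if_neg this, zero_mul]
    have h6 : g = algebraMap ℚ 𝕜 (1 / n) • (n : 𝕜) • g := by
      rw [smul_smul, ← map_natCast (algebraMap ℚ 𝕜), ← map_mul,
        one_div_mul_cancel (by exact_mod_cast hn), map_one, one_smul]
    rw [h6, ← h4, h3, h5]
    simp only [map_sum, map_smul]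
    refine SMulMemClass.smul_mem _ (sum_mem fun w _ => SMulMemClass.smul_mem _ ?_)
    have := mulMap_antipode_euler (𝕜 := 𝕜) w.toList.reverse
    rw [List.reverse_reverse, FreeMonoid.ofList_toList] at this
    rw [this]
    exact bracketWord_mem _

/-- The exponentials of Lie series are the group-like series. -/
lemma mem_expLib {G : SerX Γ 𝕜} : G ∈ expLib Γ 𝕜 ↔ IsGroupLike G := by
  constructor
  · rintro ⟨f, hf, rfl⟩
    rw [mem_LibHat] at hf
    refine ⟨exp_apply_one f, ?_⟩
    rw [map_exp raises_DeltaX DeltaX_one DeltaX_mul hf.1, hf.2, exp_primitive hf.1]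
  · rintro ⟨h1, h2⟩
    obtain ⟨f, hf, rfl⟩ := exists_exp_eq h1
    refine ⟨f, mem_LibHat.2 ⟨hf, ?_⟩, rfl⟩
    rw [map_exp raises_DeltaX DeltaX_one DeltaX_mul hf, ← exp_primitive hf] at h2
    have h3 := raises_DeltaX.mem_filt hf
    exact exp_injOn h3 (primitive_mem_filt hf) h2

end Friedrichs

/-! ### Conjugation and exponentials of power series in one element. -/

namespace Series

variable {M N : Type*} [Monoid M] [FinGraded M] [Monoid N] [FinGraded N] {𝕜 : Type*} [CommRing 𝕜]

lemma weight_mul {c : M → 𝕜} (hc : ∀ a b, c (a * b) = c a * c b) (f g : Series M 𝕜) :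
    weight c (f * g) = weight c f * weight c g :=
  bilin_ext (fun a b => by
    rw [weight_single, weight_single, weight_single, hc, smul_mul_smul_comm, single_mul_single]) f g

lemma powSum_mem_filt_one {c : ℕ → 𝕜} (hc : c 0 = 0) {f : Series M 𝕜} (hf : f ∈ Filt M 𝕜 1) :
    powSum c f ∈ Filt M 𝕜 1 :=
  powSum_mem_filt hf fun i hi => by rwa [Nat.lt_one_iff.1 hi]

/-- Conjugation `f ↦ G⁻¹ f G`. -/
noncomputable def conj (G : Series M 𝕜) : Series M 𝕜 →L[𝕜] Series M 𝕜 :=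
  (mulLeft (Ring.inverse G)).comp (mulRight G)

lemma conj_apply (G f : Series M 𝕜) : conj G f = Ring.inverse G * (f * G) := rfl

lemma conj_mul {G : Series M 𝕜} (hG : G 1 = 1) (f g : Series M 𝕜) :
    conj G (f * g) = conj G f * conj G g := by
  have h := Ring.mul_inverse_cancel _ (isUnit_of_constCoeff hG)
  calc conj G (f * g) = Ring.inverse G * f * 1 * g * G := by rw [conj_apply]; noncomm_ring
    _ = _ := by rw [← h, conj_apply, conj_apply]; noncomm_ring

lemma conj_one {G : Series M 𝕜} (hG : G 1 = 1) : conj G 1 = 1 := by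
  rw [conj_apply, one_mul, Ring.inverse_mul_cancel _ (isUnit_of_constCoeff hG)]

lemma raises_conj (G : Series M 𝕜) : Raises (conj G) 0 := fun m =>
  mul_mem_filt_right _ (mul_mem_filt_left (single_mem_filt m) _)

lemma conj_of_commute {G : Series M 𝕜} (hG : G 1 = 1) {f : Series M 𝕜} (h : G * f = f * G) :
    conj G f = f := by
  rw [conj_apply, ← h, ← mul_assoc, Ring.inverse_mul_cancel _ (isUnit_of_constCoeff hG), one_mul]

variable [Algebra ℚ 𝕜]

lemma map_exp_powSum {φ : Series M 𝕜 →L[𝕜] Series N 𝕜} (hφ : Raises φ 0) (h1 : φ 1 = 1)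
    (hmul : ∀ f g, φ (f * g) = φ f * φ g) {c : ℕ → 𝕜} (hc : c 0 = 0) {f : Series M 𝕜}
    (hf : f ∈ Filt M 𝕜 1) : φ (exp (powSum c f)) = exp (powSum c (φ f)) := by
  rw [map_exp hφ h1 hmul (powSum_mem_filt_one hc hf), map_powSum hφ h1 hmul c hf]

lemma exp_powSum_mul_comm {f g : Series M 𝕜} (hf : f ∈ Filt M 𝕜 1) (h : f * g = g * f)
    {c : ℕ → 𝕜} (hc : c 0 = 0) : exp (powSum c f) * g = g * exp (powSum c f) :=
  powSum_mul_comm (powSum_mem_filt_one hc hf) (powSum_mul_comm hf h c) _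

lemma exp_powSum_add {f : Series M 𝕜} (hf : f ∈ Filt M 𝕜 1) {c d : ℕ → 𝕜} (hc : c 0 = 0)
    (hd : d 0 = 0) :
    exp (powSum (fun n => c n + d n) f) = exp (powSum c f) * exp (powSum d f) := by
  rw [powSum_add, exp_add (powSum_mem_filt_one hc hf) (powSum_mem_filt_one hd hf)]
  exact powSum_mul_comm hf (powSum_mul_comm hf rfl d).symm c

lemma exp_smul_single_apply_of_ne {m w : M} (h : ∀ i : ℕ, w ≠ m ^ i) (r : 𝕜) :
    exp (r • (single m : Series M 𝕜)) w = 0 := by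
  rw [exp, powSum]
  refine Finset.sum_eq_zero fun i _ => ?_
  rw [smul_pow, single_pow, smul_apply, single_of_ne (h i), mul_zero, mul_zero]

lemma exp_smul_single_apply {m : M} (hm : deg m = 1) (r : 𝕜) :
    exp (r • (single m : Series M 𝕜)) m = r := by
  have h : ∀ i, i ≠ 1 → m ≠ m ^ i := by
    intro i hi h
    have := congrArg deg h
    rw [deg_pow, hm] at this
    omega
  rw [exp, powSum, Finset.sum_eq_single 1]
  · simp
  · intro i _ hi
    rw [smul_pow, single_pow, smul_apply, single_of_ne (h i hi), mul_zero, mul_zero]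
  · intro h
    rw [hm] at h
    simp at h

end Series

/-! ### The morphism Θ. -/

section Theta

variable {Γ : Type*} [CommGroup Γ] [Finite Γ] {𝕜 : Type*} [CommRing 𝕜]

/-- The indicator function of the words in the letter `x_0`. -/
noncomputable def onlyX0 : FreeMonoid (AlphX Γ) →* 𝕜 :=
  FreeMonoid.lift fun a => match a with
    | AlphX.zero => 1
    | AlphX.of _ => 0

lemma onlyX0_pow (m : ℕ) : (onlyX0 (FreeMonoid.of (AlphX.zero : AlphX Γ) ^ m) : 𝕜) = 1 := by
  rw [map_pow, onlyX0, FreeMonoid.lift_eval_of, one_pow]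

lemma onlyX0_wordX (m : ℕ) (σ : Γ) (v : FreeMonoid (AlphX Γ)) :
    (onlyX0 (wordX m σ * v) : 𝕜) = 0 := by
  have : (onlyX0 (FreeMonoid.of (AlphX.of σ)) : 𝕜) = 0 := FreeMonoid.lift_eval_of _ _
  rw [map_mul, wordX, map_mul, this, mul_zero, zero_mul]

/-- The algebra morphism killing the letters other than `x_0`. -/
noncomputable def killX : SerX Γ 𝕜 →L[𝕜] SerX Γ 𝕜 := weight onlyX0

lemma killX_mul (f g : SerX Γ 𝕜) : killX (f * g) = killX f * killX g :=
  weight_mul (map_mul onlyX0) f g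

lemma killX_single_pow (m : ℕ) :
    killX (single (FreeMonoid.of AlphX.zero ^ m) : SerX Γ 𝕜) =
      single (FreeMonoid.of AlphX.zero ^ m) := by
  rw [killX, weight_single, onlyX0_pow, one_smul]

lemma killX_single_wordX (m : ℕ) (σ : Γ) (v : FreeMonoid (AlphX Γ)) :
    killX (single (wordX m σ * v) : SerX Γ 𝕜) = 0 := by
  rw [killX, weight_single, onlyX0_wordX, zero_smul]

lemma killX_one : killX (1 : SerX Γ 𝕜) = 1 := killX_single_pow 0

lemma killX_x0 : killX (x0 : SerX Γ 𝕜) = x0 := by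
  have := killX_single_pow (Γ := Γ) (𝕜 := 𝕜) 1
  rwa [pow_one] at this

lemma killX_x (σ : Γ) : killX (x σ : SerX Γ 𝕜) = 0 := by
  have := killX_single_wordX (Γ := Γ) (𝕜 := 𝕜) 0 σ 1
  rwa [mul_one, single_wordX, pow_zero, one_mul] at this

lemma killX_apply_pow (f : SerX Γ 𝕜) (m : ℕ) :
    killX f (FreeMonoid.of AlphX.zero ^ m) = f (FreeMonoid.of AlphX.zero ^ m) := by
  rw [killX, weight_apply, onlyX0_pow, one_mul]

lemma killX_t (σ : Γ) (f : SerX Γ 𝕜) : killX (t σ f) = killX f := by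
  have : killX.comp (t σ) = (killX : SerX Γ 𝕜 →L[𝕜] SerX Γ 𝕜) := clm_ext fun w => by
    rw [ContinuousLinearMap.comp_apply, t_single]
    rcases wordX_cases w with ⟨m, rfl⟩ | ⟨m, τ, v, rfl⟩
    · rw [map_pow]
      rfl
    · rw [map_mul, shiftWord_wordX, killX_single_wordX, killX_single_wordX]
  exact DFunLike.congr_fun this f

lemma killX_mul_x0 (f : SerX Γ 𝕜) : killX f * x0 = x0 * killX f := by
  have : (mulRight x0).comp killX = (mulLeft x0).comp (killX : SerX Γ 𝕜 →L[𝕜] SerX Γ 𝕜) :=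
    clm_ext fun w => by
      rw [ContinuousLinearMap.comp_apply, ContinuousLinearMap.comp_apply, mulRight_apply,
        mulLeft_apply]
      rcases wordX_cases w with ⟨m, rfl⟩ | ⟨m, τ, v, rfl⟩
      · rw [killX_single_pow, x0, single_mul_single, single_mul_single, ← pow_succ, ← pow_succ']
      · rw [killX_single_wordX, zero_mul, mul_zero]
  exact DFunLike.congr_fun this f

/-- The series `∑ (f | x_0^m x_1) x_0^m`. -/
noncomputable def depthOne : SerX Γ 𝕜 →L[𝕜] SerX Γ 𝕜 := killX.comp (rho (AlphX.of 1))

lemma depthOne_apply_pow (f : SerX Γ 𝕜) (m : ℕ) :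
    depthOne f (FreeMonoid.of AlphX.zero ^ m) = f (wordX m 1) := killX_apply_pow _ m

lemma depthOne_mul (f g : SerX Γ 𝕜) :
    depthOne (f * g) = killX f * depthOne g + g 1 • depthOne f := by
  rw [depthOne, ContinuousLinearMap.comp_apply, rho_mul, map_add, killX_mul, map_smul]
  rfl

lemma rho_of (a b : AlphX Γ) [Decidable (b = a)] :
    rho b (single (FreeMonoid.of a) : SerX Γ 𝕜) = if b = a then 1 else 0 := by
  have := rho_mul_single (1 : SerX Γ 𝕜) a b
  rwa [one_mul] at this

lemma depthOne_x0 : depthOne (x0 : SerX Γ 𝕜) = 0 := by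
  classical
  rw [depthOne, ContinuousLinearMap.comp_apply, x0, rho_of, if_neg (by simp), map_zero]

lemma depthOne_one : depthOne (1 : SerX Γ 𝕜) = 0 := by
  have h := depthOne_mul (1 : SerX Γ 𝕜) 1
  rw [mul_one, killX_one, one_mul, one_apply_one, one_smul] at h
  simpa using h

/-- After removal of the final x_1 and of all other coloured letters, only the x_0-part of t_σ(G)⁻¹
survives in the image of a letter x_σ. This part does not depend on σ and commutes with x_0, so it
can be moved to the front and cancelled. -/
lemma killX_mul_depthOne_aut {G : SerX Γ 𝕜} (hG : G 1 = 1) (f : SerX Γ 𝕜) :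
    killX G * depthOne (aut G f) = depthOne f := by
  have hx : ∀ σ, killX G * depthOne (aut G (x σ)) = depthOne (x σ) := by
    intro σ
    have h1 : (x σ * t σ G : SerX Γ 𝕜) 1 = 0 := by
      rw [mul_apply_one, mem_filt_one.1 (x_mem_filt σ), zero_mul]
    rw [aut_x, mul_assoc, depthOne_mul, depthOne_mul, h1, killX_x, zero_mul, zero_add, zero_smul,
      add_zero, t_apply_one, hG, one_smul, ← mul_assoc, ← killX_t σ G, ← killX_mul,
      t_mul_inverse hG, killX_one, one_mul]
  have : (mulLeft (killX G)).comp (depthOne.comp (aut G)) = depthOne := by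
    refine clm_ext fun w => ?_
    simp only [ContinuousLinearMap.comp_apply, mulLeft_apply]
    induction w using FreeMonoid.inductionOn' with
    | one => rw [← one_def, aut_one, depthOne_one, mul_zero]
    | of_mul a w ih =>
      rw [single_of_mul, aut_mul, depthOne_mul, depthOne_mul, aut_apply_one]
      revert a
      refine letterX_cases (P := fun l => killX G * (killX (aut G l) * depthOne (aut G (single w)) +
        (single w : SerX Γ 𝕜) 1 • depthOne (aut G l)) = killX l * depthOne (single w) +
        (single w : SerX Γ 𝕜) 1 • depthOne l) ?_ fun σ => ?_
      · rw [aut_x0, depthOne_x0, killX_x0, smul_zero, add_zero, add_zero, ← mul_assoc,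
          killX_mul_x0, mul_assoc, ih]
      · rw [aut_x, killX_mul, killX_mul, killX_x, mul_zero, zero_mul, zero_mul, zero_mul, zero_add,
          zero_add, mul_smul_comm, ← aut_x, hx]
  exact DFunLike.congr_fun this f

lemma depthOne_SX {G : SerX Γ 𝕜} (hG : G 1 = 1) (f : SerX Γ 𝕜) :
    depthOne (SX G f) = depthOne f + f 1 • depthOne G := by
  rw [SX_apply, depthOne_mul, killX_mul_depthOne_aut hG, aut_apply_one]

/-- Coefficientwise form of `depthOne_SX`; it makes the exponent in Θ additive. -/
lemma circ_apply_wordX {G H : SerX Γ 𝕜} (hG : G 1 = 1) (hH : H 1 = 1) (m : ℕ) :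
    circ G H (wordX m 1) = G (wordX m 1) + H (wordX m 1) := by
  have := congrArg (fun s : SerX Γ 𝕜 => s (FreeMonoid.of AlphX.zero ^ m)) (depthOne_SX hG H)
  simp only [Series.add_apply, depthOne_apply_pow, hH, one_smul] at this
  rw [add_comm]
  exact this

lemma mul_apply_of {A : Type*} [WeightedAlphabet A] (f g : Series (FreeMonoid A) 𝕜) (a : A) :
    (f * g) (FreeMonoid.of a) = f 1 * g (FreeMonoid.of a) + f (FreeMonoid.of a) * g 1 := by
  have := congrArg (fun s : Series (FreeMonoid A) 𝕜 => s 1) (rho_mul a f g)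
  simp only [rho_apply, one_mul, Series.add_apply, mul_apply_one, Series.smul_apply] at this
  rw [this, mul_comm (g 1)]

lemma killX_aut (G f : SerX Γ 𝕜) : killX (aut G f) = killX f := by
  have : killX.comp (aut G) = (killX : SerX Γ 𝕜 →L[𝕜] SerX Γ 𝕜) :=
    clm_ext_letters (by simp [aut_one, killX_one]) killX_one (by simp [aut_mul, killX_mul])
      killX_mul (letterX_cases (P := fun l => (killX.comp (aut G)) l = killX l)
        (by simp [aut_x0]) (fun σ => by simp [aut_x, killX_mul, killX_x]))
  exact DFunLike.congr_fun this f

lemma circ_apply_x0 {G H : SerX Γ 𝕜} (hG : G 1 = 1) (hH : H 1 = 1) :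
    circ G H (FreeMonoid.of AlphX.zero) =
      G (FreeMonoid.of AlphX.zero) + H (FreeMonoid.of AlphX.zero) := by
  have h1 := killX_apply_pow (aut G H) 1
  rw [killX_aut, killX_apply_pow, pow_one] at h1
  rw [circ, mul_apply_of, hG, ← h1, aut_apply_one, hH, one_mul, mul_one, add_comm]

/-- The left factor cancels, since t_σ(A) commutes with x_σ. The right factor is fixed by every t_σ
and commutes with x_0, so it acts on all letters by one and the same conjugation. -/
lemma aut_mul_mul {A G B : SerX Γ 𝕜} (hA1 : A 1 = 1) (hG : G 1 = 1) (hB1 : B 1 = 1)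
    (hA : ∀ σ, t σ A * x σ = x σ * t σ A) (hBt : ∀ σ, t σ B = B) (hB : B * x0 = x0 * B)
    (f : SerX Γ 𝕜) : aut (A * G * B) f = conj B (aut G f) := by
  have : aut (A * G * B) = (conj B).comp (aut G) := by
    refine clm_ext_letters (aut_one _) (by simp [aut_one, conj_one hB1]) (aut_mul _)
      (by simp [aut_mul, conj_mul hB1]) (letterX_cases
        (P := fun l => aut (A * G * B) l = ((conj B).comp (aut G)) l) ?_ fun σ => ?_)
    · rw [ContinuousLinearMap.comp_apply, aut_x0, aut_x0, conj_of_commute hB1 hB]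
    · have h1 : ∀ f : SerX Γ 𝕜, f 1 = 1 → t σ f 1 = 1 := fun f hf => by rw [t_apply_one, hf]
      have h2 := inverse_t_mul hA1 σ
      rw [ContinuousLinearMap.comp_apply, aut_x, aut_x, conj_apply, t_mul, t_mul, hBt,
        inverse_mul_rev (by rw [mul_apply_one, h1 A hA1, h1 G hG, one_mul]) hB1,
        inverse_mul_rev (h1 A hA1) (h1 G hG)]
      calc Ring.inverse B * (Ring.inverse (t σ G) * Ring.inverse (t σ A)) * x σ *
            (t σ A * t σ G * B)
          = Ring.inverse B * Ring.inverse (t σ G) * Ring.inverse (t σ A) * (x σ * t σ A) *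
            t σ G * B := by noncomm_ring
        _ = Ring.inverse B * Ring.inverse (t σ G) * (Ring.inverse (t σ A) * t σ A) * x σ *
            t σ G * B := by rw [← hA]; noncomm_ring
        _ = _ := by rw [h2]; noncomm_ring
  exact DFunLike.congr_fun this f

variable [Algebra ℚ 𝕜]

lemma t_exp_powSum {c : ℕ → 𝕜} (hc : c 0 = 0) (σ : Γ) :
    t σ (exp (powSum c (x (1 : Γ)))) = exp (powSum c (x σ)) := by
  rw [map_exp_powSum (raises_t σ) (t_one σ) (t_mul σ) hc (x_mem_filt 1), t_x, mul_one]

lemma t_exp_powSum_comm {c : ℕ → 𝕜} (hc : c 0 = 0) (σ : Γ) :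
    t σ (exp (powSum c (x (1 : Γ)))) * x σ = x σ * t σ (exp (powSum c (x (1 : Γ)))) := by
  rw [t_exp_powSum hc, exp_powSum_mul_comm (x_mem_filt σ) rfl hc]

lemma aut_exp_powSum {c : ℕ → 𝕜} (hc : c 0 = 0) {G : SerX Γ 𝕜} (hG : G 1 = 1) :
    aut G (exp (powSum c (x (1 : Γ)))) = conj G (exp (powSum c (x (1 : Γ)))) := by
  rw [map_exp_powSum (raises_aut G) (aut_one G) (aut_mul G) hc (x_mem_filt 1),
    map_exp_powSum (raises_conj G) (conj_one hG) (conj_mul hG) hc (x_mem_filt 1), aut_x,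
    t_one_left, conj_apply, mul_assoc]

lemma smul_x0_mem_filt (α : 𝕜) : α • (x0 : SerX Γ 𝕜) ∈ Filt _ 𝕜 1 :=
  Submodule.smul_mem _ _ x0_mem_filt

lemma t_exp_x0 (σ : Γ) (α : 𝕜) : t σ (exp (α • (x0 : SerX Γ 𝕜))) = exp (α • x0) := by
  rw [map_exp (raises_t σ) (t_one σ) (t_mul σ) (smul_x0_mem_filt α), map_smul, t_x0]

lemma aut_exp_x0 (G : SerX Γ 𝕜) (α : 𝕜) : aut G (exp (α • (x0 : SerX Γ 𝕜))) = exp (α • x0) := by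
  rw [map_exp (raises_aut G) (aut_one G) (aut_mul G) (smul_x0_mem_filt α), map_smul, aut_x0]

lemma exp_x0_comm (α : 𝕜) : exp (α • (x0 : SerX Γ 𝕜)) * x0 = x0 * exp (α • x0) :=
  powSum_mul_comm (smul_x0_mem_filt α) (by rw [smul_mul_assoc, mul_smul_comm]) _

lemma aut_dressed {c : ℕ → 𝕜} (hc : c 0 = 0) {G : SerX Γ 𝕜} (hG : G 1 = 1) (α : 𝕜)
    (f : SerX Γ 𝕜) : aut (exp (powSum c (x 1)) * G * exp (α • x0)) f =
      conj (exp (α • x0)) (aut G f) :=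
  aut_mul_mul (exp_apply_one _) hG (exp_apply_one _) (t_exp_powSum_comm hc) (fun σ => t_exp_x0 σ α)
    (exp_x0_comm α) f

/-- As t_1 = id, aut_G conjugates series in x_1 by G, which moves the second left factor to the left
of G; series in x_0 are fixed and collect on the right. -/
lemma circ_dressed {c d : ℕ → 𝕜} (hc : c 0 = 0) (hd : d 0 = 0) {G H : SerX Γ 𝕜} (hG : G 1 = 1)
    (α β : 𝕜) :
    circ (exp (powSum c (x 1)) * G * exp (α • x0)) (exp (powSum d (x 1)) * H * exp (β • x0)) =
      exp (powSum (fun n => c n + d n) (x 1)) * circ G H * exp ((α + β) • x0) := by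
  have hB : (exp (α • x0 : SerX Γ 𝕜)) 1 = 1 := exp_apply_one _
  have h1 := Ring.mul_inverse_cancel _ (isUnit_of_constCoeff hG)
  have h2 := Ring.mul_inverse_cancel _ (isUnit_of_constCoeff hB)
  have h3 : exp (α • (x0 : SerX Γ 𝕜)) * exp (β • x0) = exp ((α + β) • x0) := by
    rw [add_smul, exp_add (smul_x0_mem_filt α) (smul_x0_mem_filt β)]
    rw [smul_mul_smul_comm, smul_mul_smul_comm, mul_comm α]
  have h4 : exp (β • (x0 : SerX Γ 𝕜)) * exp (α • x0) = exp (α • x0) * exp (β • x0) := by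
    rw [h3, add_comm, add_smul, exp_add (smul_x0_mem_filt β) (smul_x0_mem_filt α)]
    rw [smul_mul_smul_comm, smul_mul_smul_comm, mul_comm α]
  rw [circ, aut_dressed hc hG, aut_mul, aut_mul, aut_exp_x0, aut_exp_powSum hd hG, circ,
    exp_powSum_add (x_mem_filt 1) hc hd, ← h3, conj_apply, conj_apply]
  set A := exp (powSum c (x (1 : Γ)) : SerX Γ 𝕜)
  set A' := exp (powSum d (x (1 : Γ)) : SerX Γ 𝕜)
  set B := exp (α • x0 : SerX Γ 𝕜)
  set B' := exp (β • x0 : SerX Γ 𝕜)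
  calc A * G * B * (Ring.inverse B * (Ring.inverse G * (A' * G) * aut G H * B' * B))
      = A * G * (B * Ring.inverse B) * Ring.inverse G * A' * G * aut G H * (B' * B) := by
        noncomm_ring
    _ = A * (G * Ring.inverse G) * A' * G * aut G H * (B' * B) := by rw [h2]; noncomm_ring
    _ = _ := by rw [h1, h4]; noncomm_ring

/-- The coefficients `(-1)^{n-1}/n (G | x_0^{n-1} x_1)`. -/
noncomputable def thetaCoeff (G : SerX Γ 𝕜) : ℕ → 𝕜 := fun n =>
  if 1 ≤ n then algebraMap ℚ 𝕜 ((-1) ^ (n - 1) / n) * G (wordX (n - 1) 1) else 0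

lemma thetaCoeff_zero (G : SerX Γ 𝕜) : thetaCoeff G 0 = 0 := rfl

lemma Theta_eq (G : SerX Γ 𝕜) : Theta G = exp (powSum (thetaCoeff G) (x 1)) * G *
    exp ((-G (FreeMonoid.of AlphX.zero)) • x0) := by
  rw [neg_smul]
  rfl

lemma Theta_apply_one {G : SerX Γ 𝕜} (hG : G 1 = 1) : Theta G 1 = 1 := by
  rw [Theta_eq, mul_apply_one, mul_apply_one, exp_apply_one, exp_apply_one, hG, one_mul, one_mul]

lemma Theta_circ {G H : SerX Γ 𝕜} (hG : G 1 = 1) (hH : H 1 = 1) :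
    Theta (circ G H) = circ (Theta G) (Theta H) := by
  rw [Theta_eq, Theta_eq, Theta_eq, circ_dressed (thetaCoeff_zero G) (thetaCoeff_zero H) hG,
    circ_apply_x0 hG hH, neg_add]
  congr 4
  funext n
  simp only [thetaCoeff]
  split_ifs
  · rw [circ_apply_wordX hG hH, mul_add]
  · simp

/-! ### The elements `e^{βx_1}` and `e^{αx_0}` -/

lemma isGroupLike_exp {f : SerX Γ 𝕜} (hf : f ∈ Filt _ 𝕜 1) (h : DeltaX f = primitive f) :
    IsGroupLike (exp f) :=
  ⟨exp_apply_one f, by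
    rw [map_exp raises_DeltaX DeltaX_one DeltaX_mul hf, h, exp_primitive hf]⟩

lemma primitive_smul {M : Type*} [Monoid M] [FinGraded M] (r : 𝕜) (f : Series M 𝕜) :
    primitive (r • f) = r • primitive f := by
  rw [primitive, primitive, smul_add, tensor_smul, smul_tensor]

lemma isGroupLike_exp_x0 (α : 𝕜) : IsGroupLike (exp (α • x0 : SerX Γ 𝕜)) :=
  isGroupLike_exp (smul_x0_mem_filt α) (by rw [map_smul, DeltaX_x0, primitive_smul])

lemma smul_x1_mem_filt (β : 𝕜) : β • (x 1 : SerX Γ 𝕜) ∈ Filt _ 𝕜 1 :=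
  Submodule.smul_mem _ _ (x_mem_filt 1)

lemma isGroupLike_exp_x1 (β : 𝕜) : IsGroupLike (exp (β • x 1 : SerX Γ 𝕜)) :=
  isGroupLike_exp (smul_x1_mem_filt β) (by rw [map_smul, DeltaX_x, primitive_smul])

lemma aut_exp_x1 (β : 𝕜) : aut (exp (β • x 1 : SerX Γ 𝕜)) = ContinuousLinearMap.id 𝕜 _ := by
  have h : exp (β • x 1 : SerX Γ 𝕜) = exp (powSum (fun n => if n = 1 then β else 0) (x 1)) := by
    rw [powSum_single (x_mem_filt 1), pow_one]
  have h0 : exp ((0 : 𝕜) • (x0 : SerX Γ 𝕜)) = 1 := by rw [zero_smul, exp_zero]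
  ext1 f
  have := aut_dressed (c := fun n => if n = 1 then β else 0) (by simp) (one_apply_one (M := _))
    (0 : 𝕜) f
  rw [h0, mul_one, mul_one, ← h, aut_one_left] at this
  rw [this, conj_of_commute one_apply_one (by simp)]

lemma circ_exp_x1 (β : 𝕜) (G : SerX Γ 𝕜) : circ (exp (β • x 1)) G = exp (β • x 1) * G := by
  rw [circ, aut_exp_x1]
  rfl

lemma circ_exp_x0 (α : 𝕜) (G : SerX Γ 𝕜) : circ G (exp (α • x0)) = G * exp (α • x0) := by
  rw [circ, aut_exp_x0]

lemma deg_letterX (a : AlphX Γ) : deg (FreeMonoid.of a) = 1 := by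
  rw [deg_of]
  rfl

lemma exp_x0_apply_wordX (α : 𝕜) (m : ℕ) (σ : Γ) : exp (α • x0 : SerX Γ 𝕜) (wordX m σ) = 0 := by
  refine exp_smul_single_apply_of_ne (fun i h => ?_) α
  have h1 := onlyX0_wordX (𝕜 := ℤ) m σ 1
  rw [mul_one, h, onlyX0_pow] at h1
  exact one_ne_zero h1

lemma exp_x0_apply_x0 (α : 𝕜) : exp (α • x0 : SerX Γ 𝕜) (FreeMonoid.of AlphX.zero) = α :=
  exp_smul_single_apply (deg_letterX _) α

lemma exp_x1_apply_x1 (β : 𝕜) : exp (β • x 1 : SerX Γ 𝕜) (FreeMonoid.of (AlphX.of 1)) = β :=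
  exp_smul_single_apply (deg_letterX _) β

lemma exp_x1_apply_x0 (β : 𝕜) (w : FreeMonoid (AlphX Γ)) :
    exp (β • x 1 : SerX Γ 𝕜) (FreeMonoid.of AlphX.zero * w) = 0 := by
  refine exp_smul_single_apply_of_ne (fun i h => ?_) β
  cases i with
  | zero => exact of_mul_ne_one _ _ h
  | succ i =>
    rw [pow_succ', of_mul_inj] at h
    cases h.1

lemma exp_x1_apply_zero (β : 𝕜) : exp (β • x 1 : SerX Γ 𝕜) (FreeMonoid.of AlphX.zero) = 0 := by
  have := exp_x1_apply_x0 (Γ := Γ) β 1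
  rwa [mul_one] at this

lemma Theta_exp_x0 (α : 𝕜) : Theta (exp (α • x0 : SerX Γ 𝕜)) = 1 := by
  have h : thetaCoeff (exp (α • x0 : SerX Γ 𝕜)) = fun _ => 0 := by
    funext n
    simp [thetaCoeff, exp_x0_apply_wordX]
  rw [Theta_eq, h, powSum_zero, exp_zero, one_mul, exp_x0_apply_x0, neg_smul,
    exp_mul_exp_neg (smul_x0_mem_filt α)]

/-- The factor 2 has two sources: β from the series itself and β from the coefficient of x_1 in the
exponent of Θ; all higher coefficients in that exponent vanish. -/
lemma Theta_exp_x1 (β : 𝕜) : Theta (exp (β • x 1 : SerX Γ 𝕜)) = exp ((2 * β) • x 1) := by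
  have h : thetaCoeff (exp (β • x 1 : SerX Γ 𝕜)) = fun n => if n = 1 then β else 0 := by
    funext n
    rcases n with _ | _ | n
    · rfl
    · have := exp_x1_apply_x1 (Γ := Γ) β
      simp [thetaCoeff, wordX, this]
    · simp [thetaCoeff, wordX, pow_succ', mul_assoc, exp_x1_apply_x0]
  rw [Theta_eq, h, exp_x1_apply_zero, neg_zero, zero_smul, exp_zero, mul_one,
    powSum_single (x_mem_filt 1), pow_one, two_mul, add_smul,
    exp_add (smul_x1_mem_filt β) (smul_x1_mem_filt β) rfl]

lemma Theta_one : Theta (1 : SerX Γ 𝕜) = 1 := by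
  have := Theta_exp_x0 (Γ := Γ) (0 : 𝕜)
  rwa [zero_smul, exp_zero] at this

variable (Γ 𝕜) in
/-- The group morphism `Θ`. -/
noncomputable def ThetaHom : groupLike Γ 𝕜 →* MT Γ 𝕜 where
  toFun g := ⟨Theta g.1.1, Theta_apply_one g.1.2⟩
  map_one' := Subtype.ext Theta_one
  map_mul' g h := Subtype.ext (Theta_circ g.1.2 h.1.2)

lemma Theta_of_apply_x0 {G : SerX Γ 𝕜} (h : G (FreeMonoid.of AlphX.zero) = 0) :
    Theta G = exp (powSum (thetaCoeff G) (x 1)) * G := by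
  rw [Theta_eq, h, neg_zero, zero_smul, exp_zero, mul_one]

end Theta

/-! ### The logarithmic derivative -/

section LogDerivative

variable {Γ : Type*} [CommGroup Γ] [Finite Γ] {𝕜 : Type*} [CommRing 𝕜]

lemma Series.Homog.map_euler {M N : Type*} [Monoid M] [FinGraded M] [Monoid N] [FinGraded N]
    {S : Series M 𝕜 →L[𝕜] Series N 𝕜} (hS : Homog S) (f : Series M 𝕜) :
    S (euler M 𝕜 f) = euler N 𝕜 (S f) := by
  have : S.comp (euler M 𝕜) = (euler N 𝕜).comp S := clm_ext fun m => by
    ext n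
    rw [ContinuousLinearMap.comp_apply, ContinuousLinearMap.comp_apply, euler_single, map_smul,
      euler_apply, Series.smul_apply]
    by_cases h : S (single m) n = 0
    · rw [h, mul_zero, mul_zero]
    · rw [hS m n h]
  exact DFunLike.congr_fun this f

lemma homog_t (σ : Γ) : Homog (t σ : SerX Γ 𝕜 →L[𝕜] SerX Γ 𝕜) := fun w w' h => by
  rw [t_single] at h
  rw [single_apply_ne_zero h, deg_shiftWord]

lemma homog_kappa : Homog (kappa : SerX Γ 𝕜 →L[𝕜] SerY Γ 𝕜) := fun w w' h => by
  rw [kappa_apply] at h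
  rw [← single_apply_ne_zero h, deg_psi]

/-- The images of the letters under the derivation `x_0 ↦ 0`, `x_σ ↦ [x_σ, t_σ(ξ)]`. -/
noncomputable def derLetter (ξ : SerX Γ 𝕜) : AlphX Γ → SerX Γ 𝕜
  | AlphX.zero => 0
  | AlphX.of σ => x σ * t σ ξ - t σ ξ * x σ

lemma derLetter_mem_filt {ξ : SerX Γ 𝕜} {n : ℕ} (hξ : ξ ∈ Filt _ 𝕜 n) (a : AlphX Γ) :
    derLetter ξ a ∈ Filt _ 𝕜 (wt a + n) := by
  cases a with
  | zero => exact zero_mem _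
  | of σ =>
    have h := (raises_t σ).mem_filt hξ
    change _ ∈ Filt _ 𝕜 (1 + n)
    refine sub_mem (mul_mem_filt (x_mem_filt σ) h) ?_
    rw [add_comm]
    exact mul_mem_filt h (x_mem_filt σ)

/-- The derivation `x_0 ↦ 0`, `x_σ ↦ [x_σ, t_σ(ξ)]`. -/
noncomputable def derX (ξ : SerX Γ 𝕜) : SerX Γ 𝕜 →L[𝕜] SerX Γ 𝕜 :=
  deriv (derLetter ξ) 0 (derLetter_mem_filt (filt_zero ξ))

lemma derX_mul (ξ f g : SerX Γ 𝕜) : derX ξ (f * g) = derX ξ f * g + f * derX ξ g :=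
  deriv_mul _ _ _ f g

lemma derX_one (ξ : SerX Γ 𝕜) : derX ξ 1 = 0 := deriv_one _ _ _

lemma derX_x0 (ξ : SerX Γ 𝕜) : derX ξ x0 = 0 := deriv_of _ _ _ _

lemma derX_x (ξ : SerX Γ 𝕜) (σ : Γ) : derX ξ (x σ) = x σ * t σ ξ - t σ ξ * x σ :=
  deriv_of _ _ _ _

lemma raises_derX {ξ : SerX Γ 𝕜} {n : ℕ} (hξ : ξ ∈ Filt _ 𝕜 n) : Raises (derX ξ) n :=
  raises_deriv 0 _ _ (derLetter_mem_filt hξ)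

lemma derX_sub (ξ η f : SerX Γ 𝕜) : derX (ξ - η) f = derX ξ f - derX η f := by
  have : derX (ξ - η) = derX ξ - derX η := by
    refine clm_ext_deriv (φ := ContinuousLinearMap.id 𝕜 _) (ψ := ContinuousLinearMap.id 𝕜 _)
      (derX_one _) (by simp [derX_one]) (derX_mul _)
      (fun f g => ?_) (letterX_cases (P := fun l => derX (ξ - η) l = (derX ξ - derX η) l) ?_ ?_)
    · simp only [_root_.sub_apply, derX_mul, ContinuousLinearMap.id_apply]
      noncomm_ring
    · simp [derX_x0]
    · intro σ
      rw [_root_.sub_apply, derX_x, derX_x, derX_x, map_sub]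
      noncomm_ring
  rw [this]
  rfl

lemma t_derX (σ : Γ) (ξ f : SerX Γ 𝕜) : t σ (derX ξ f) = derX ξ (t σ f) := by
  have : (t σ).comp (derX ξ) = (derX ξ).comp (t σ) := by
    refine clm_ext_deriv (φ := t σ) (ψ := t σ) (by simp [derX_one]) (by simp [derX_one, t_one])
      (fun f g => by simp [derX_mul, t_mul]) (fun f g => by simp [derX_mul, t_mul])
      (letterX_cases (P := fun l => ((t σ).comp (derX ξ)) l = ((derX ξ).comp (t σ)) l) ?_ ?_)
    · simp [derX_x0, t_x0]
    · intro τ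
      simp [derX_x, t_x, t_mul, t_t]
  exact DFunLike.congr_fun this f

/-- The infinitesimal version `f ↦ ξ f + d_ξ(f)` of `S_G`. -/
noncomputable def sX (ξ : SerX Γ 𝕜) : SerX Γ 𝕜 →L[𝕜] SerX Γ 𝕜 := mulLeft ξ + derX ξ

lemma sX_apply (ξ f : SerX Γ 𝕜) : sX ξ f = ξ * f + derX ξ f := rfl

lemma sX_sub (ξ η f : SerX Γ 𝕜) : sX (ξ - η) f = sX ξ f - sX η f := by
  rw [sX_apply, sX_apply, sX_apply, derX_sub]
  noncomm_ring

lemma raises_sX {ξ : SerX Γ 𝕜} {n : ℕ} (hξ : ξ ∈ Filt _ 𝕜 n) : Raises (sX ξ) n :=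
  Raises.add (fun m => by
    rw [add_comm]
    exact mul_mem_filt hξ (single_mem_filt m)) (raises_derX hξ)

lemma sX_mul_x0 (ξ f : SerX Γ 𝕜) : sX ξ (f * x0) = sX ξ f * x0 := by
  rw [sX_apply, sX_apply, derX_mul, derX_x0]
  noncomm_ring

lemma euler_x0 : euler _ 𝕜 (x0 : SerX Γ 𝕜) = x0 := by
  rw [x0, euler_single, deg_letterX, Nat.cast_one, one_smul]

lemma euler_x (σ : Γ) : euler _ 𝕜 (x σ : SerX Γ 𝕜) = x σ := by
  rw [x, euler_single, deg_letterX, Nat.cast_one, one_smul]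

/-- Both sides are derivations along aut_k, so letters suffice. The hypothesis says E(k) = k
aut_k(ξ), and differentiating the conjugation of x_σ by t_σ(k) produces the bracket with t_σ(ξ). -/
lemma euler_aut {k ξ : SerX Γ 𝕜} (hk : k 1 = 1) (hξ : SX k ξ = euler _ 𝕜 k) (f : SerX Γ 𝕜) :
    euler _ 𝕜 (aut k f) = aut k (derX ξ f + euler _ 𝕜 f) := by
  have : (euler _ 𝕜).comp (aut k) = (aut k).comp (derX ξ + euler _ 𝕜) := by
    refine clm_ext_deriv (φ := aut k) (ψ := aut k) (by simp [aut_one, euler_one])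
      (by simp [derX_one, euler_one])
      (fun f g => by simp [aut_mul, euler_mul]) (fun f g => ?_)
      (letterX_cases (P := fun l => ((euler _ 𝕜).comp (aut k)) l =
        ((aut k).comp (derX ξ + euler _ 𝕜)) l) ?_ ?_)
    · simp only [ContinuousLinearMap.comp_apply, _root_.add_apply, derX_mul, euler_mul, map_add,
        aut_mul]
      noncomm_ring
    · simp only [ContinuousLinearMap.comp_apply, _root_.add_apply, derX_x0, aut_x0, euler_x0,
        zero_add]
    · intro σ
      simp only [ContinuousLinearMap.comp_apply, _root_.add_apply, derX_x, map_add, map_sub,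
        aut_mul, euler_x]
      have h1 : euler _ 𝕜 (t σ k) = t σ k * aut k (t σ ξ) := by
        rw [← (homog_t σ).map_euler, ← hξ, SX_apply, t_mul, t_aut σ hk]
      have hu := t_mul_inverse hk σ
      have hv := inverse_t_mul hk σ
      -- Derivative of an inverse, from differentiating t_σ(k)⁻¹ t_σ(k) = 1.
      have h2 : euler _ 𝕜 (Ring.inverse (t σ k)) =
          -(aut k (t σ ξ) * Ring.inverse (t σ k)) := by
        have h3 := congrArg (euler _ 𝕜) hv
        rw [euler_mul, euler_one, h1, ← mul_assoc, hv, one_mul] at h3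
        calc euler _ 𝕜 (Ring.inverse (t σ k))
            = euler _ 𝕜 (Ring.inverse (t σ k)) * (t σ k * Ring.inverse (t σ k)) := by
              rw [hu, mul_one]
          _ = (euler _ 𝕜 (Ring.inverse (t σ k)) * t σ k + aut k (t σ ξ)) *
                Ring.inverse (t σ k) - aut k (t σ ξ) * Ring.inverse (t σ k) := by noncomm_ring
          _ = _ := by rw [h3]; noncomm_ring
      rw [aut_x, euler_mul, euler_mul, h1, h2, euler_x]
      noncomm_ring
  exact DFunLike.congr_fun this f

/-- Differential equation relating the group to its Lie algebra: ξ is the logarithmic derivative of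
k under the scaling of degrees. -/
lemma euler_SX {k ξ : SerX Γ 𝕜} (hk : k 1 = 1) (hξ : SX k ξ = euler _ 𝕜 k) (f : SerX Γ 𝕜) :
    euler _ 𝕜 (SX k f) = SX k (sX ξ f + euler _ 𝕜 f) := by
  have h : k * aut k ξ = euler _ 𝕜 k := hξ
  rw [SX_apply, euler_mul, euler_aut hk hξ, SX_apply, sX_apply, add_assoc, map_add (aut k) (ξ * f),
    aut_mul, ← h]
  noncomm_ring

/-- The operator of `𝕜⟨⟨Y⟩⟩` induced by `sX ξ`. -/
noncomputable def sY (ξ : SerX Γ 𝕜) : SerY Γ 𝕜 →L[𝕜] SerY Γ 𝕜 :=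
  kappa ∘L sX ξ ∘L embYX ∘L qInv

lemma sY_kappa (ξ f : SerX Γ 𝕜) : sY ξ (kappa f) = kappa (sX ξ f) :=
  kappa_comp_sec (sX_mul_x0 ξ) f

lemma sY_one (ξ : SerX Γ 𝕜) : sY ξ 1 = kappa ξ := by
  rw [← kappa_one, sY_kappa, sX_apply, derX_one, mul_one, add_zero]

lemma sY_sub (ξ η : SerX Γ 𝕜) : sY (ξ - η) = sY ξ - sY η :=
  clm_ext_kappa fun f => by
    rw [_root_.sub_apply, sY_kappa, sY_kappa, sY_kappa, sX_sub, map_sub]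

lemma raises_sY {ξ : SerX Γ 𝕜} {n : ℕ} (hξ : ξ ∈ Filt _ 𝕜 n) : Raises (sY ξ) n := by
  intro w
  rw [← kappa_single_psi, sY_kappa, ← deg_psi w]
  exact raises_kappa.mem_filt (raises_sX hξ (psi w))

lemma euler_SY {k ξ : SerX Γ 𝕜} (hk : k 1 = 1) (hξ : SX k ξ = euler _ 𝕜 k) (f : SerY Γ 𝕜) :
    euler _ 𝕜 (SY k f) = SY k (sY ξ f + euler _ 𝕜 f) := by
  rw [← kappa_sec f]
  generalize embYX (qInv f) = g
  rw [SY_kappa, ← homog_kappa.map_euler, euler_SX hk hξ, sY_kappa, ← homog_kappa.map_euler,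
    ← map_add, SY_kappa]

/-- The derivation `D` of `𝕜⟨⟨Y⟩⟩` with `s^Y_ξ(v) = D(v) + v κ(ξ)`, on letters. -/
noncomputable def derY (ξ : SerX Γ 𝕜) (a : AlphY Γ) : SerY Γ 𝕜 :=
  kappa ((ξ * x0 ^ ((a.idx : ℕ) - 1) - x0 ^ ((a.idx : ℕ) - 1) * t a.col ξ) * x a.col)

lemma kappa_letter_mul (a : AlphY Γ) (v : SerX Γ 𝕜) :
    kappa (x0 ^ ((a.idx : ℕ) - 1) * x a.col * t a.col v) = single (FreeMonoid.of a) * kappa v := by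
  rw [kappa_wordX_mul, y]
  congr 3
  obtain ⟨i, c⟩ := a
  congr 1
  have := i.pos
  exact PNat.eq (by simp only [Nat.succPNat_coe, Nat.succ_eq_add_one]; omega)

lemma derX_x0_pow (ξ : SerX Γ 𝕜) (m : ℕ) : derX ξ (x0 ^ m) = 0 := by
  induction m with
  | zero => rw [pow_zero, derX_one]
  | succ m ih => rw [pow_succ, derX_mul, ih, derX_x0, zero_mul, mul_zero, add_zero]

/-- In s_ξ(x_0^m x_σ t_σ(v)), left multiplication by ξ and one half of the bracket [x_σ, t_σ(ξ)]
combine into `derY`; the other half together with d_ξ(t_σ(v)) is t_σ(s_ξ(v)) preceded by x_0^m x_σ.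
-/
lemma sY_letter_mul (ξ : SerX Γ 𝕜) (a : AlphY Γ) (v : SerY Γ 𝕜) :
    sY ξ (single (FreeMonoid.of a) * v) =
      derY ξ a * v + single (FreeMonoid.of a) * sY ξ v := by
  obtain ⟨v, rfl⟩ := kappa_surjective v
  rw [← kappa_letter_mul, sY_kappa, sX_apply, derX_mul, derX_mul, derX_x0_pow, derX_x, derY,
    ← kappa_mul_x_mul, sY_kappa, ← kappa_letter_mul, ← map_add]
  congr 1
  rw [sX_apply, map_add, t_mul, t_derX]
  noncomm_ring

end LogDerivative

/-! ### The harmonic coproduct -/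

section Harmonic

variable {Γ : Type*} [CommGroup Γ] [Finite Γ] {𝕜 : Type*} [CommRing 𝕜]

lemma DeltaStar_mul (f g : SerY Γ 𝕜) : DeltaStar (f * g) = DeltaStar f * DeltaStar g :=
  subst_mul _ _ f g

lemma DeltaStar_one : DeltaStar (1 : SerY Γ 𝕜) = 1 := subst_one _ _

lemma DeltaStar_of (a : AlphY Γ) :
    DeltaStar (single (FreeMonoid.of a) : SerY Γ 𝕜) = harmonicLetter a := subst_of _ _ a

lemma raises_DeltaStar : Raises (DeltaStar : SerY Γ 𝕜 →L[𝕜] SerYY Γ 𝕜) 0 := raises_subst _ _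

lemma splittings_wt {a : AlphY Γ} {p : AlphY Γ × AlphY Γ}
    (h : p ∈ (finite_splittings a).toFinset) : (p.1.idx : ℕ) + p.2.idx = a.idx := by
  rw [Set.Finite.mem_toFinset] at h
  rw [← PNat.add_coe, h.1]

lemma homog_DeltaStar : Homog (DeltaStar : SerY Γ 𝕜 →L[𝕜] SerYY Γ 𝕜) :=
  Series.homog_of_mul DeltaStar_one DeltaStar_mul fun a p h => by
    rw [DeltaStar_of] at h
    by_cases h1 : primitive (y a.idx a.col : SerY Γ 𝕜) p = 0
    · rw [harmonicLetter, Series.add_apply, h1, zero_add, Series.sum_apply] at h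
      obtain ⟨s, hs, h2⟩ := Finset.exists_ne_zero_of_sum_ne_zero h
      have h3 := single_apply_ne_zero (left_ne_zero_of_mul h2)
      have h4 := single_apply_ne_zero (right_ne_zero_of_mul h2)
      change wt a = deg p.1 + deg p.2
      rw [h3, h4, deg_of, deg_of]
      exact (splittings_wt hs).symm
    · rw [← primitive_single_ne_zero _ _ h1, deg_of]

/-- The letter `y_{m+n,στ}`. -/
def merge (a b : AlphY Γ) : AlphY Γ := ⟨a.idx + b.idx, a.col * b.col⟩

lemma mem_splittings {a : AlphY Γ} {p : AlphY Γ × AlphY Γ} :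
    p ∈ (finite_splittings a).toFinset ↔ merge p.1 p.2 = a := by
  rw [Set.Finite.mem_toFinset]
  obtain ⟨i, c⟩ := a
  simp [splittings, merge]

section Coeff

variable {A B : Type*} [WeightedAlphabet A] [WeightedAlphabet B]

lemma clm_apply_ext_tensor {M N : Type*} {P : Type*} {Q : Type*}
    {S : Series (M × N) 𝕜 →L[𝕜] Series P 𝕜} {T : Series (M × N) 𝕜 →L[𝕜] Series Q 𝕜} {p : P} {q : Q}
    (h : ∀ f g, S (tensor f g) p = T (tensor f g) q) (F : Series (M × N) 𝕜) : S F p = T F q := by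
  have : (comap fun _ : Unit => p).comp S = (comap fun _ : Unit => q).comp T :=
    clm_ext_tensor fun f g => by
      ext
      exact h f g
  exact congrArg (fun s : Series Unit 𝕜 => s ()) (DFunLike.congr_fun this F)

open Classical in
lemma tensor_letter_one_mul (a b : A) (u : FreeMonoid A) (v : FreeMonoid B)
    (F : Series (FreeMonoid A × FreeMonoid B) 𝕜) :
    (tensor (single (FreeMonoid.of a)) 1 * F : Series (FreeMonoid A × FreeMonoid B) 𝕜)
        (FreeMonoid.of b * u, v) =
      if b = a then F (u, v) else 0 := by
  have := clm_apply_ext_tensor (S := mulLeft (tensor (single (FreeMonoid.of a))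
      (1 : Series (FreeMonoid B) 𝕜))) (T := (if b = a then (1 : 𝕜) else 0) •
      ContinuousLinearMap.id 𝕜 (Series (FreeMonoid A × FreeMonoid B) 𝕜))
    (p := (FreeMonoid.of b * u, v)) (q := (u, v)) (fun f g => by
      rw [mulLeft_apply, tensor_mul_tensor, one_mul, tensor_apply, single_mul_apply]
      change _ = _ * tensor f g (u, v)
      rw [tensor_apply]
      split_ifs <;> simp) F
  refine this.trans ?_
  change _ * F (u, v) = _
  split_ifs <;> simp

open Classical in
lemma tensor_one_letter_mul (a b : B) (u : FreeMonoid A) (v : FreeMonoid B)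
    (F : Series (FreeMonoid A × FreeMonoid B) 𝕜) :
    (tensor 1 (single (FreeMonoid.of a)) * F : Series (FreeMonoid A × FreeMonoid B) 𝕜)
        (u, FreeMonoid.of b * v) =
      if b = a then F (u, v) else 0 := by
  have := clm_apply_ext_tensor (S := mulLeft (tensor (1 : Series (FreeMonoid A) 𝕜)
      (single (FreeMonoid.of a)))) (T := (if b = a then (1 : 𝕜) else 0) •
      ContinuousLinearMap.id 𝕜 (Series (FreeMonoid A × FreeMonoid B) 𝕜))
    (p := (u, FreeMonoid.of b * v)) (q := (u, v)) (fun f g => by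
      rw [mulLeft_apply, tensor_mul_tensor, one_mul, tensor_apply, single_mul_apply]
      change _ = _ * tensor f g (u, v)
      rw [tensor_apply]
      split_ifs <;> simp) F
  refine this.trans ?_
  change _ * F (u, v) = _
  split_ifs <;> simp

lemma tensor_letters (a : A) (b : B) : tensor (single (FreeMonoid.of a) : Series (FreeMonoid A) 𝕜)
    (single (FreeMonoid.of b) : Series (FreeMonoid B) 𝕜) =
      tensor (single (FreeMonoid.of a)) 1 * tensor 1 (single (FreeMonoid.of b)) := by
  rw [tensor_mul_tensor, mul_one, one_mul]

end Coeff

lemma lam_one (a : AlphY Γ) : lam a (1 : SerY Γ 𝕜) = 0 := by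
  ext w
  rw [lam_apply, one_def, single_of_ne (of_mul_ne_one a w)]
  rfl

/-- Quasi-shuffle recursion: the first letter of a word contributing to this coefficient is a, or b,
or the two letters merged. -/
lemma DeltaStar_apply_of_mul_of_mul (F : SerY Γ 𝕜) (a b : AlphY Γ) (u v : FreeMonoid (AlphY Γ)) :
    DeltaStar F (FreeMonoid.of a * u, FreeMonoid.of b * v) =
      DeltaStar (lam a F) (u, FreeMonoid.of b * v) + DeltaStar (lam b F) (FreeMonoid.of a * u, v) +
      DeltaStar (lam (merge a b) F) (u, v) := by
  classical
  let ev : FreeMonoid (AlphY Γ) × FreeMonoid (AlphY Γ) → SerYY Γ 𝕜 →L[𝕜] Series Unit 𝕜 :=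
    fun p => comap fun _ => p
  have : (ev (FreeMonoid.of a * u, FreeMonoid.of b * v)).comp DeltaStar =
      (ev (u, FreeMonoid.of b * v)).comp (DeltaStar.comp (lam a)) +
      (ev (FreeMonoid.of a * u, v)).comp (DeltaStar.comp (lam b)) +
      (ev (u, v)).comp (DeltaStar.comp (lam (merge a b))) := by
    refine clm_ext fun z => ?_
    ext
    change DeltaStar (single z : SerY Γ 𝕜) _ = DeltaStar (lam a (single z : SerY Γ 𝕜)) _ +
      DeltaStar (lam b (single z : SerY Γ 𝕜)) _ +
      DeltaStar (lam (merge a b) (single z : SerY Γ 𝕜)) _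
    induction z using FreeMonoid.inductionOn' with
    | one =>
      rw [← one_def, lam_one, lam_one, lam_one, map_zero, DeltaStar_one, ← tensor_one_one,
        tensor_apply, one_def, single_of_ne (of_mul_ne_one _ _)]
      simp
    | of_mul c z _ =>
      rw [single_of_mul, lam_single_mul, lam_single_mul, lam_single_mul, DeltaStar_mul,
        DeltaStar_of, harmonicLetter, primitive, add_mul, add_mul, Finset.sum_mul,
        Series.add_apply, Series.add_apply, Series.sum_apply]
      have e1 : ∀ p : AlphY Γ × AlphY Γ, (tensor (y p.1.idx p.1.col) (y p.2.idx p.2.col) *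
          DeltaStar (single z : SerY Γ 𝕜) : SerYY Γ 𝕜) (FreeMonoid.of a * u, FreeMonoid.of b * v) =
          if p = (a, b) then DeltaStar (single z : SerY Γ 𝕜) (u, v) else 0 := by
        intro p
        change (tensor (single (FreeMonoid.of p.1)) (single (FreeMonoid.of p.2)) * _ : SerYY Γ 𝕜)
          _ = _
        rw [tensor_letters, mul_assoc, tensor_letter_one_mul, tensor_one_letter_mul]
        by_cases h1 : a = p.1 <;> by_cases h2 : b = p.2 <;> simp [Prod.ext_iff, h1, h2, Eq.comm]
      simp only [e1]
      change (tensor (single (FreeMonoid.of c)) 1 * DeltaStar (single z) : SerYY Γ 𝕜) _ +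
        (tensor 1 (single (FreeMonoid.of c)) * DeltaStar (single z) : SerYY Γ 𝕜) _ + _ = _
      rw [tensor_letter_one_mul, tensor_one_letter_mul]
      have e2 : ∑ p ∈ (finite_splittings c).toFinset,
          (if p = (a, b) then DeltaStar (single z : SerY Γ 𝕜) (u, v) else 0) =
          if merge a b = c then DeltaStar (single z : SerY Γ 𝕜) (u, v) else 0 := by
        rw [Finset.sum_ite_eq' _ (a, b)]
        simp only [mem_splittings]
      rw [e2]
      congr 1
      · congr 1 <;> split_ifs <;> simp
      · split_ifs <;> simp
  exact congrArg (fun s : Series Unit 𝕜 => s ()) (DFunLike.congr_fun this F)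

lemma constTerm_mul_tensor {M : Type*} [Monoid M] [FinGraded M]
    (F G : Series (M × M) 𝕜) :
    (comap fun m : M => ((1 : M), m)) (F * G) =
      (comap fun m : M => ((1 : M), m)) F * (comap fun m : M => ((1 : M), m)) G := by
  refine bilin_ext (fun p r => ?_) F G
  have e : ∀ p : M × M, (comap fun m : M => ((1 : M), m)) (single p : Series (M × M) 𝕜) =
      ((single p.1 : Series M 𝕜) 1) • single p.2 := by
    intro p
    ext m
    rw [show p = (p.1, p.2) from rfl, ← tensor_single]
    rfl
  rw [e, e, e, smul_mul_smul_comm, single_mul_single, Prod.fst_mul, Prod.snd_mul,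
    ← single_mul_single, mul_apply_one]

lemma constTerm_mul_tensor' {M : Type*} [Monoid M] [FinGraded M]
    (F G : Series (M × M) 𝕜) :
    (comap fun m : M => (m, (1 : M))) (F * G) =
      (comap fun m : M => (m, (1 : M))) F * (comap fun m : M => (m, (1 : M))) G := by
  refine bilin_ext (fun p r => ?_) F G
  have e : ∀ p : M × M, (comap fun m : M => (m, (1 : M))) (single p : Series (M × M) 𝕜) =
      ((single p.2 : Series M 𝕜) 1) • single p.1 := by
    intro p
    ext m
    rw [show p = (p.1, p.2) from rfl, ← tensor_single]
    exact mul_comm _ _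
  rw [e, e, e, smul_mul_smul_comm, single_mul_single, Prod.fst_mul, Prod.snd_mul,
    ← single_mul_single, mul_apply_one]

lemma single_of_apply_one {A : Type*} [WeightedAlphabet A] (a : A) :
    (single (FreeMonoid.of a) : Series (FreeMonoid A) 𝕜) 1 = 0 := by
  refine single_of_ne fun h => ?_
  have := of_mul_ne_one a 1
  rw [mul_one] at this
  exact this h.symm

lemma DeltaStar_apply_one_left (F : SerY Γ 𝕜) (v : FreeMonoid (AlphY Γ)) :
    DeltaStar F (1, v) = F v := by
  have : (comap fun m => (1, m)).comp DeltaStar = ContinuousLinearMap.id 𝕜 (SerY Γ 𝕜) := by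
    refine clm_ext_letters ?_ rfl (fun f g => ?_) (fun _ _ => rfl) fun a => ?_
    · rw [ContinuousLinearMap.comp_apply, DeltaStar_one, ← tensor_one_one]
      ext v
      change (1 : SerY Γ 𝕜) 1 * (1 : SerY Γ 𝕜) v = _
      rw [one_apply_one, one_mul]
    · rw [ContinuousLinearMap.comp_apply, DeltaStar_mul, constTerm_mul_tensor]
      rfl
    · rw [ContinuousLinearMap.comp_apply, DeltaStar_of]
      ext v
      rw [comap_apply, harmonicLetter, primitive, Series.add_apply, Series.add_apply,
        Series.sum_apply, Finset.sum_eq_zero fun p _ => ?_]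
      · change (single (FreeMonoid.of a) : SerY Γ 𝕜) 1 * _ + (1 : SerY Γ 𝕜) 1 * _ + 0 = _
        rw [single_of_apply_one, one_apply_one, zero_mul, zero_add, one_mul, add_zero]
        rfl
      · change (single (FreeMonoid.of _) : SerY Γ 𝕜) 1 * _ = _
        rw [single_of_apply_one, zero_mul]
  exact congrArg (fun s : SerY Γ 𝕜 => s v) (DFunLike.congr_fun this F)

lemma DeltaStar_apply_one_right (F : SerY Γ 𝕜) (v : FreeMonoid (AlphY Γ)) :
    DeltaStar F (v, 1) = F v := by
  have : (comap fun m => (m, 1)).comp DeltaStar = ContinuousLinearMap.id 𝕜 (SerY Γ 𝕜) := by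
    refine clm_ext_letters ?_ rfl (fun f g => ?_) (fun _ _ => rfl) fun a => ?_
    · rw [ContinuousLinearMap.comp_apply, DeltaStar_one, ← tensor_one_one]
      ext v
      change (1 : SerY Γ 𝕜) v * (1 : SerY Γ 𝕜) 1 = _
      rw [one_apply_one, mul_one]
    · rw [ContinuousLinearMap.comp_apply, DeltaStar_mul, constTerm_mul_tensor']
      rfl
    · rw [ContinuousLinearMap.comp_apply, DeltaStar_of]
      ext v
      rw [comap_apply, harmonicLetter, primitive, Series.add_apply, Series.add_apply,
        Series.sum_apply, Finset.sum_eq_zero fun p _ => ?_]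
      · change _ * (1 : SerY Γ 𝕜) 1 + _ * (single (FreeMonoid.of a) : SerY Γ 𝕜) 1 + 0 = _
        rw [single_of_apply_one, one_apply_one, mul_zero, add_zero, mul_one, add_zero]
        rfl
      · change _ * (single (FreeMonoid.of _) : SerY Γ 𝕜) 1 = _
        rw [single_of_apply_one, mul_zero]
  exact congrArg (fun s : SerY Γ 𝕜 => s v) (DFunLike.congr_fun this F)

lemma DeltaStar_apply_letters (F : SerY Γ 𝕜) (a b : AlphY Γ) :
    DeltaStar F (FreeMonoid.of a, FreeMonoid.of b) =
      F (FreeMonoid.of a * FreeMonoid.of b) + F (FreeMonoid.of b * FreeMonoid.of a) +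
        F (FreeMonoid.of (merge a b)) := by
  have := DeltaStar_apply_of_mul_of_mul F a b 1 1
  rw [mul_one, mul_one, DeltaStar_apply_one_left, DeltaStar_apply_one_right,
    DeltaStar_apply_one_left, lam_apply, lam_apply, lam_apply, mul_one] at this
  exact this

end Harmonic

/-! ### The obstruction to compatibility with the harmonic coproduct -/

section Obstruction

variable {Γ : Type*} [CommGroup Γ] [Finite Γ] {𝕜 : Type*} [CommRing 𝕜]

/-- The operator `S ⊗ 1 + 1 ⊗ S`. -/
noncomputable def leib {M : Type*} (S : Series M 𝕜 →L[𝕜] Series M 𝕜) :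
    Series (M × M) 𝕜 →L[𝕜] Series (M × M) 𝕜 :=
  tmap S (ContinuousLinearMap.id 𝕜 _) + tmap (ContinuousLinearMap.id 𝕜 _) S

lemma leib_tensor {M : Type*} (S : Series M 𝕜 →L[𝕜] Series M 𝕜) (f g : Series M 𝕜) :
    leib S (tensor f g) = tensor (S f) g + tensor f (S g) := by
  rw [leib, _root_.add_apply, tmap_tensor, tmap_tensor]
  rfl

lemma leib_sub {M : Type*} (S T : Series M 𝕜 →L[𝕜] Series M 𝕜) :
    leib (S - T) = leib S - leib T :=
  clm_ext_tensor fun f g => by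
    rw [_root_.sub_apply, leib_tensor, leib_tensor, leib_tensor, _root_.sub_apply,
      _root_.sub_apply, sub_tensor, tensor_sub]
    abel

lemma raises_leib {M : Type*} [Monoid M] [FinGraded M] {S : Series M 𝕜 →L[𝕜] Series M 𝕜} {n : ℕ}
    (hS : Raises S n) : Raises (leib S) n :=
  Raises.add (Raises.tmap hS raises_id) (by simpa using Raises.tmap raises_id hS)

/-- The failure of `s^Y_ξ` to be a coderivation for `Δ_*`. -/
noncomputable def eps (ξ : SerX Γ 𝕜) : SerY Γ 𝕜 →L[𝕜] SerYY Γ 𝕜 :=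
  DeltaStar.comp (sY ξ) - (leib (sY ξ)).comp DeltaStar

lemma eps_apply (ξ : SerX Γ 𝕜) (f : SerY Γ 𝕜) :
    eps ξ f = DeltaStar (sY ξ f) - leib (sY ξ) (DeltaStar f) := rfl

lemma eps_sub (ξ η : SerX Γ 𝕜) : eps (ξ - η) = eps ξ - eps η := by
  ext1 f
  rw [_root_.sub_apply, eps_apply, eps_apply, eps_apply, sY_sub, leib_sub, _root_.sub_apply,
    _root_.sub_apply, map_sub]
  abel

lemma raises_eps {ξ : SerX Γ 𝕜} {n : ℕ} (hξ : ξ ∈ Filt _ 𝕜 n) : Raises (eps ξ) n := by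
  refine Raises.sub ?_ ?_
  · simpa using raises_DeltaStar.comp (raises_sY hξ)
  · simpa using (raises_leib (raises_sY hξ)).comp raises_DeltaStar

lemma eps_one (ξ : SerX Γ 𝕜) : eps ξ 1 = DeltaStar (kappa ξ) - primitive (kappa ξ) := by
  rw [eps_apply, DeltaStar_one, ← tensor_one_one, leib_tensor, sY_one, primitive]

/-- The value at the letter `a` of the coderivation `D ⊗ 1 + 1 ⊗ D`, composed with `Δ_*`. -/
noncomputable def coderY (ξ : SerX Γ 𝕜) (a : AlphY Γ) : SerYY Γ 𝕜 :=
  primitive (derY ξ a) + ∑ p ∈ (finite_splittings a).toFinset,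
    (tensor (derY ξ p.1) (single (FreeMonoid.of p.2)) +
      tensor (single (FreeMonoid.of p.1)) (derY ξ p.2))

lemma leib_sY_harmonicLetter_mul (ξ : SerX Γ 𝕜) (a : AlphY Γ) (F : SerYY Γ 𝕜) :
    leib (sY ξ) (harmonicLetter a * F) = coderY ξ a * F + harmonicLetter a * leib (sY ξ) F := by
  have : (leib (sY ξ)).comp (mulLeft (harmonicLetter a)) =
      mulLeft (coderY ξ a) + (mulLeft (harmonicLetter a)).comp (leib (sY ξ)) := by
    refine clm_ext_tensor fun f g => ?_
    simp only [ContinuousLinearMap.comp_apply, mulLeft_apply, _root_.add_apply, harmonicLetter,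
      primitive, coderY, add_mul, Finset.sum_mul, map_add, map_sum, tensor_mul_tensor, one_mul,
      leib_tensor, y, sY_letter_mul, add_tensor, tensor_add, Finset.sum_add_distrib]
    abel
  exact DFunLike.congr_fun this F

lemma eps_letter_mul (ξ : SerX Γ 𝕜) (a : AlphY Γ) (v : SerY Γ 𝕜) :
    eps ξ (single (FreeMonoid.of a) * v) =
      (DeltaStar (derY ξ a) - coderY ξ a) * DeltaStar v + harmonicLetter a * eps ξ v := by
  rw [eps_apply, eps_apply, sY_letter_mul, map_add, DeltaStar_mul, DeltaStar_mul, DeltaStar_mul,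
    DeltaStar_of, leib_sY_harmonicLetter_mul]
  noncomm_ring

/-- By `eps_letter_mul`, `eps` on words is generated by its value at 1 and by the defect on single
letters. -/
lemma eps_eq_zero_iff (ξ : SerX Γ 𝕜) : eps ξ = 0 ↔
    DeltaStar (kappa ξ) = primitive (kappa ξ) ∧ ∀ a, DeltaStar (derY ξ a) = coderY ξ a := by
  constructor
  · intro h
    have h1 : eps ξ 1 = 0 := by rw [h]; rfl
    refine ⟨sub_eq_zero.1 (by rw [← eps_one, h1]), fun a => sub_eq_zero.1 ?_⟩
    have h2 := eps_letter_mul ξ a 1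
    rw [h1, mul_zero, add_zero, DeltaStar_one, mul_one, mul_one, h] at h2
    exact h2.symm
  · rintro ⟨h1, h2⟩
    refine clm_ext fun w => ?_
    induction w using FreeMonoid.inductionOn' with
    | one =>
      rw [← one_def, eps_one, h1, sub_self]
      rfl
    | of_mul a w ih =>
      rw [single_of_mul, eps_letter_mul, h2, ih, sub_self, zero_mul]
      simp

/-- The failure of `S^Y_k` to be a coalgebra morphism for `Δ_*`. -/
noncomputable def obst (k : SerX Γ 𝕜) : SerY Γ 𝕜 →L[𝕜] SerYY Γ 𝕜 :=
  DeltaStar.comp (SY k) - (tensorSq (SY k)).comp DeltaStar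

lemma obst_apply (k : SerX Γ 𝕜) (f : SerY Γ 𝕜) :
    obst k f = DeltaStar (SY k f) - tensorSq (SY k) (DeltaStar f) := rfl

lemma obst_eq_zero_iff (k : SerX Γ 𝕜) :
    obst k = 0 ↔ tensorSq (SY k) ∘L DeltaStar = DeltaStar ∘L SY k := by
  rw [obst, sub_eq_zero, eq_comm]

variable {k ξ : SerX Γ 𝕜}

lemma euler_tensorSq_SY (hk : k 1 = 1) (hξ : SX k ξ = euler _ 𝕜 k) (F : SerYY Γ 𝕜) :
    euler _ 𝕜 (tensorSq (SY k) F) = tensorSq (SY k) (leib (sY ξ) F + euler _ 𝕜 F) := by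
  have : (euler _ 𝕜).comp (tensorSq (SY k)) =
      (tensorSq (SY k)).comp (leib (sY ξ) + euler _ 𝕜) := by
    refine clm_ext_tensor fun f g => ?_
    simp only [ContinuousLinearMap.comp_apply, _root_.add_apply, tensorSq_tensor, euler_tensor,
      euler_SY hk hξ, leib_tensor, map_add, add_tensor, tensor_add]
    abel
  exact DFunLike.congr_fun this F

/-- Commute E past both composites by `euler_SY` and its tensor square. Since Δ_* is homogeneous,
the E-terms cancel and only the defect of s^Y_ξ is left. -/
lemma euler_obst (hk : k 1 = 1) (hξ : SX k ξ = euler _ 𝕜 k) (f : SerY Γ 𝕜) :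
    euler _ 𝕜 (obst k f) - obst k (euler _ 𝕜 f) =
      obst k (sY ξ f) + tensorSq (SY k) (eps ξ f) := by
  simp only [obst_apply, eps_apply, map_sub, euler_tensorSq_SY hk hξ,
    ← homog_DeltaStar.map_euler, euler_SY hk hξ, map_add]
  abel

lemma tensorSq_SY_inv (g : MT Γ 𝕜) (F : SerYY Γ 𝕜) :
    tensorSq (SY (g⁻¹).1) (tensorSq (SY g.1) F) = F := by
  rw [← ContinuousLinearMap.comp_apply, ← tensorSq_comp, SY_inv_comp, tensorSq_id]
  rfl

/-- With the obstruction zero the differential equation leaves (S^Y_k)^{⊗2} ∘ eps = 0, and the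
tensor square is injective. -/
lemma eps_eq_zero_of_obst_eq_zero (hk : k 1 = 1) (hξ : SX k ξ = euler _ 𝕜 k)
    (h : obst k = 0) : eps ξ = 0 := by
  ext1 f
  have h1 := euler_obst hk hξ f
  rw [h] at h1
  simp only [_root_.zero_apply, map_zero, sub_zero, zero_add] at h1
  have h2 := tensorSq_SY_inv ⟨k, hk⟩ (eps ξ f)
  rw [← h1, map_zero] at h2
  exact h2.symm

lemma raises_SY (hk : k 1 = 1) : Raises (SY k) 0 := by
  have := Raises.add ((raises_SY_sub_id hk).mono (Nat.zero_le 1)) raises_id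
  rwa [sub_add_cancel] at this

/-- To leading order S^Y_k is the identity, whose obstruction is zero. -/
lemma raises_obst_one (hk : k 1 = 1) : Raises (obst k) 1 := by
  have h := raises_SY_sub_id hk
  have e : obst k = DeltaStar.comp (SY k - ContinuousLinearMap.id 𝕜 (SerY Γ 𝕜)) -
      (tmap (SY k - ContinuousLinearMap.id 𝕜 (SerY Γ 𝕜)) (SY k) +
        tmap (ContinuousLinearMap.id 𝕜 (SerY Γ 𝕜))
          (SY k - ContinuousLinearMap.id 𝕜 (SerY Γ 𝕜))).comp DeltaStar := by
    have e1 : tmap (SY k - ContinuousLinearMap.id 𝕜 (SerY Γ 𝕜)) (SY k) +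
        tmap (ContinuousLinearMap.id 𝕜 (SerY Γ 𝕜))
          (SY k - ContinuousLinearMap.id 𝕜 (SerY Γ 𝕜)) =
        tensorSq (SY k) - ContinuousLinearMap.id 𝕜 (SerYY Γ 𝕜) :=
      clm_ext_tensor fun f g => by
        simp only [_root_.add_apply, _root_.sub_apply, tmap_tensor, tensorSq_tensor,
          ContinuousLinearMap.id_apply, sub_tensor, tensor_sub]
        abel
    rw [e1]
    ext1 f
    simp only [obst_apply, _root_.sub_apply, ContinuousLinearMap.comp_apply,
      ContinuousLinearMap.id_apply, map_sub]
    abel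
  rw [e]
  refine Raises.sub ?_ ?_
  · simpa using raises_DeltaStar.comp h
  · have h1 := Raises.tmap h (raises_SY hk)
    have h2 := Raises.tmap (raises_id (M := FreeMonoid (AlphY Γ)) (𝕜 := 𝕜)) h
    rw [zero_add] at h2
    simpa using (Raises.add h1 h2).comp raises_DeltaStar

lemma mem_filt_one_of_SX (hξ : SX k ξ = euler _ 𝕜 k) (hk : k 1 = 1) : ξ ∈ Filt _ 𝕜 1 := by
  have h := congrArg (fun s : SerX Γ 𝕜 => s 1) hξ
  simp only [SX_apply, mul_apply_one, hk, aut_apply_one, one_mul, euler_apply, deg_one] at h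
  rw [mem_filt_one, h]
  simp

variable [Algebra ℚ 𝕜]

lemma eq_zero_of_natCast_mul {n : ℕ} (hn : n ≠ 0) {r : 𝕜} (h : (n : 𝕜) * r = 0) : r = 0 := by
  have h2 : algebraMap ℚ 𝕜 (1 / n) * (n : 𝕜) = 1 := by
    rw [← map_natCast (algebraMap ℚ 𝕜), ← map_mul, one_div_mul_cancel (by exact_mod_cast hn),
      map_one]
  calc r = algebraMap ℚ 𝕜 (1 / n) * ((n : 𝕜) * r) := by rw [← mul_assoc, h2, one_mul]
    _ = 0 := by rw [h, mul_zero]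

/-- Degree induction on `euler_obst`. As ξ has no constant term, composing the obstruction with
s^Y_ξ gains a degree, so the part of the obstruction of a given shift below n has zero commutator
with E. -/
lemma raises_obst (hk : k 1 = 1) (hξ : SX k ξ = euler _ 𝕜 k) {n : ℕ} (h : Raises (eps ξ) n) :
    Raises (obst k) n := by
  have hξ1 := mem_filt_one_of_SX hξ hk
  have key : ∀ j, j < n → Raises (obst k) (j + 1) := by
    intro j
    induction j with
    | zero => exact fun _ => raises_obst_one hk
    | succ j ih =>
      intro hj w p hp
      have ih := ih (by omega)
      rcases Nat.lt_or_ge (deg p) (deg w + (j + 1)) with hlt | hge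
      · exact ih w p hlt
      · have hp' : deg p = deg w + (j + 1) := by omega
        have h1 : obst k (sY ξ (single w)) + tensorSq (SY k) (eps ξ (single w)) ∈
            Filt _ 𝕜 (deg w + (j + 1) + 1) := by
          refine add_mem (filt_anti (by omega) (ih.mem_filt (raises_sY hξ1 w))) ?_
          exact filt_anti (by omega)
            ((Raises.tmap (raises_SY hk) (raises_SY hk)).mem_filt (h w))
        rw [← euler_obst hk hξ] at h1
        -- The commutator with E multiplies the part of shift j + 1 by j + 1, which is invertible.
        have h2 := h1 p (by omega)
        rw [Series.sub_apply, euler_apply, euler_single, map_smul, Series.smul_apply, hp',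
          ← sub_mul, Nat.cast_add, add_sub_cancel_left] at h2
        exact eq_zero_of_natCast_mul (by omega) h2
  rcases n with _ | n
  · exact (raises_obst_one hk).mono (Nat.zero_le 1)
  · exact key n (Nat.lt_succ_self n)

/-- Evaluating the differential equation at 1, where the obstruction vanishes, expresses `eps` at 1
through the obstruction at κ(ξ), which has no constant term; one degree is gained over the general
bound. -/
lemma eps_one_mem_filt (hk : k 1 = 1) (hξ : SX k ξ = euler _ 𝕜 k) {n : ℕ} (h : Raises (eps ξ) n)
    (h1 : obst k 1 = 0) : eps ξ 1 ∈ Filt _ 𝕜 (n + 1) := by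
  have hξ1 := mem_filt_one_of_SX hξ hk
  have h2 := euler_obst hk hξ 1
  rw [h1, euler_one, map_zero, map_zero, sub_zero] at h2
  have h3 : obst k (sY ξ 1) ∈ Filt _ 𝕜 (n + 1) := by
    rw [sY_one]
    have := (raises_obst hk hξ h).mem_filt (raises_kappa.mem_filt hξ1)
    exact filt_anti (by omega) this
  have h4 : tensorSq (SY k) (eps ξ 1) = -obst k (sY ξ 1) :=
    eq_neg_of_add_eq_zero_right h2.symm
  let g : MT Γ 𝕜 := ⟨k, hk⟩
  have h5 := tensorSq_SY_inv g (eps ξ 1)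
  have h6 := raises_SY (g⁻¹).2
  rw [← h5]
  refine (Raises.tmap h6 h6).mem_filt ?_
  change tensorSq (SY k) (eps ξ 1) ∈ _
  rw [h4]
  exact neg_mem h3

/-- If the homogeneous components of `ξ` satisfying the harmonic primitivity condition satisfy
`eps = 0`, then `S^Y_k` is a coalgebra morphism as soon as `S^Y_k(1)` is group-like. -/
lemma obst_eq_zero (hk : k 1 = 1) (hξ : SX k ξ = euler _ 𝕜 k) (h1 : obst k 1 = 0)
    (hcore : ∀ n, DeltaStar (kappa (component n ξ)) = primitive (kappa (component n ξ)) →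
      eps (component n ξ) = 0) : obst k = 0 := by
  -- `eps` is additive in ξ, so the components already known to have vanishing defect can be
  -- subtracted, leaving a series that starts in degree n.
  have tail : ∀ n, (∀ j < n, eps (component j ξ) = 0) → Raises (eps ξ) n := by
    intro n hn
    have key : ∀ m ≤ n, ∃ η ∈ Filt (FreeMonoid (AlphX Γ)) 𝕜 m,
        eps η = eps ξ ∧ ∀ w, m ≤ deg w → η w = ξ w := by
      intro m
      induction m with
      | zero => exact fun _ => ⟨ξ, filt_zero ξ, rfl, fun _ _ => rfl⟩
      | succ m ih =>
        intro hm
        obtain ⟨η, h2, h3, h4⟩ := ih (by omega)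
        refine ⟨η - component m ξ, fun w hw => ?_, ?_, fun w hw => ?_⟩
        · rw [Series.sub_apply, component_apply]
          split_ifs with hd
          · rw [h4 w hd.ge, sub_self]
          · rw [h2 w (by omega), sub_zero]
        · rw [eps_sub, hn m (by omega), sub_zero, h3]
        · rw [Series.sub_apply, component_apply, if_neg (by omega), sub_zero, h4 w (by omega)]
    obtain ⟨η, h2, h3, -⟩ := key n le_rfl
    rw [← h3]
    exact raises_eps h2
  have all : ∀ n, ∀ j < n, eps (component j ξ) = 0 := by
    intro n
    induction n with
    | zero => exact fun j hj => absurd hj (Nat.not_lt_zero j)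
    | succ n ih =>
      intro j hj
      rcases Nat.lt_succ_iff_lt_or_eq.1 hj with hj | rfl
      · exact ih j hj
      -- The gained degree says that the degree j part of Δ_*(κ(ξ)) - κ(ξ) ⊗ 1 - 1 ⊗ κ(ξ) is zero,
      -- which is exactly the input for the component of degree j.
      · refine hcore j (Series.eq_of_component fun m => ?_)
        have h2 := eps_one_mem_filt hk hξ (tail j ih) h1
        rw [homog_kappa.map_component, homog_DeltaStar.map_component, Series.primitive_component]
        congr 1
        ext p
        rw [component_apply, component_apply]
        split_ifs with hp
        · have := h2 p (by omega)
          rw [eps_one, Series.sub_apply, sub_eq_zero] at this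
          exact this
        · rfl
  exact eq_zero_of_forall_raises fun n => raises_obst hk hξ (tail n (all n))

end Obstruction

/-! ### Logarithmic derivatives of group-like series -/

section LogGroupLike

variable {Γ : Type*} [CommGroup Γ] [Finite Γ] {𝕜 : Type*} [CommRing 𝕜]

/-- The logarithmic derivative of `g` in `MT(𝕜)`. -/
noncomputable def logDer (g : MT Γ 𝕜) : SerX Γ 𝕜 := SX (g⁻¹).1 (euler _ 𝕜 g.1)

lemma SX_logDer (g : MT Γ 𝕜) : SX g.1 (logDer g) = euler _ 𝕜 g.1 := SX_SX_inv g _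

/-- Differentiating Δ(g) = g ⊗ g gives the primitivity relation after applying S_g^{⊗2}, which is
injective. -/
lemma IsGroupLike.DeltaX_logDer {g : MT Γ 𝕜} (hg : IsGroupLike g.1) :
    DeltaX (logDer g) = primitive (logDer g) := by
  have h4 : (SX (g⁻¹).1).comp (SX g.1) = ContinuousLinearMap.id 𝕜 (SerX Γ 𝕜) :=
    ContinuousLinearMap.ext fun f => SX_inv_SX g f
  have h5 : SX g.1 1 = g.1 := by rw [SX_apply, aut_one, mul_one]
  have h6 : tensorSq (SX g.1) (DeltaX (logDer g)) = tensorSq (SX g.1) (primitive (logDer g)) := by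
    rw [← hg.DeltaX_SX, SX_logDer, homog_DeltaX.map_euler, hg.2, euler_tensor, primitive, map_add,
      tensorSq_tensor, tensorSq_tensor, SX_logDer, h5]
  have h8 : ∀ F, tensorSq (SX (g⁻¹).1) (tensorSq (SX g.1) F) = F := fun F => by
    rw [← ContinuousLinearMap.comp_apply, ← tensorSq_comp, h4, tensorSq_id]
    rfl
  rw [← h8 (DeltaX (logDer g)), h6, h8]

/-- S_g does not alter these coefficients of a series without constant term, by `depthOne_SX`; the
factor m + 1 is the degree of x_0^m x_1. -/
lemma logDer_apply_wordX (g : MT Γ 𝕜) (m : ℕ) :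
    logDer g (wordX m 1) = ((m + 1 : ℕ) : 𝕜) * g.1 (wordX m 1) := by
  have h0 := mem_filt_one.1 (mem_filt_one_of_SX (SX_logDer g) g.2)
  have h := depthOne_SX g.2 (logDer g)
  rw [SX_logDer, h0, zero_smul, add_zero] at h
  have h1 := congrArg (fun s : SerX Γ 𝕜 => s (FreeMonoid.of AlphX.zero ^ m)) h
  simp only [depthOne_apply_pow, euler_apply, deg_wordX] at h1
  exact h1.symm

lemma logDer_apply_of (g : MT Γ 𝕜) (a : AlphX Γ) :
    logDer g (FreeMonoid.of a) = g.1 (FreeMonoid.of a) := by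
  have hf := mem_filt_one_of_SX (SX_logDer g) g.2
  have h := congrArg (fun s : SerX Γ 𝕜 => s (FreeMonoid.of a)) (SX_logDer g)
  have h2 := (raises_aut_sub_id g.2).mem_filt hf (FreeMonoid.of a)
    (by rw [deg_letterX]; omega)
  rw [_root_.sub_apply, Series.sub_apply, sub_eq_zero, ContinuousLinearMap.id_apply] at h2
  simp only [SX_apply, mul_apply_of, g.2, one_mul, aut_apply_one, mem_filt_one.1 hf, mul_zero,
    add_zero, euler_apply, deg_letterX, Nat.cast_one, h2] at h
  exact h

/-- The convolution of the antipode with the identity, evaluated on a primitive element, is S(f) +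
f, and the counit of f is zero. -/
lemma antipode_of_primitive {f : SerX Γ 𝕜} (hf : f ∈ Filt _ 𝕜 1) (h : DeltaX f = primitive f) :
    antipode f = -f := by
  have : mulMap.comp ((tmap antipode (ContinuousLinearMap.id 𝕜 (SerX Γ 𝕜))).comp DeltaX) =
      weight (fun w : FreeMonoid (AlphX Γ) => (single w : SerX Γ 𝕜) 1) :=
    clm_ext fun w => by
      rw [ContinuousLinearMap.comp_apply, ContinuousLinearMap.comp_apply, mulMap_antipode_id,
        weight_single]
      by_cases hw : w = 1
      · rw [hw, one_def]
      · rw [single_of_ne (Ne.symm hw), zero_smul, zero_smul]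
  have h1 := DFunLike.congr_fun this f
  rw [ContinuousLinearMap.comp_apply, ContinuousLinearMap.comp_apply, h, primitive, map_add,
    tmap_tensor, tmap_tensor, map_add, mulMap_tensor, mulMap_tensor, antipode_one] at h1
  have h2 : weight (fun w : FreeMonoid (AlphX Γ) => (single w : SerX Γ 𝕜) 1) f = 0 := by
    ext w
    rw [weight_apply]
    by_cases hw : w = 1
    · rw [hw, mem_filt_one.1 hf, mul_zero]
      rfl
    · rw [single_of_ne (Ne.symm hw), zero_mul]
      rfl
  rw [h2] at h1
  simp only [ContinuousLinearMap.id_apply, mul_one, one_mul] at h1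
  exact eq_neg_of_add_eq_zero_left h1

lemma antipode_apply {A : Type*} [WeightedAlphabet A] (f : Series (FreeMonoid A) 𝕜)
    (w : FreeMonoid A) : antipode f w = (-1) ^ w.length * f w.reverse := by
  have : antipode = (weight fun w : FreeMonoid A => (-1 : 𝕜) ^ w.length).comp
      (comap FreeMonoid.reverse) := clm_ext fun v => by
    ext w
    rw [ContinuousLinearMap.comp_apply, antipode, mapOfImages_single, Series.smul_apply,
      weight_apply, comap_apply]
    by_cases h : w = v.reverse
    · subst h
      rw [single_self, FreeMonoid.reverse_reverse, single_self]
      simp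
    · rw [single_of_ne h, single_of_ne, mul_zero, mul_zero]
      rintro rfl
      exact h (FreeMonoid.reverse_reverse).symm
  rw [this]
  rfl

variable [Algebra ℚ 𝕜]

/-- The derivative of the exponent in `Θ`. -/
noncomputable def thetaDer (g : MT Γ 𝕜) : SerX Γ 𝕜 :=
  powSum (fun n => (n : 𝕜) * thetaCoeff g.1 n) (x 1)

/-- Without an x_0 term, Θ(g) is g with a left factor in x_1, so aut_{Θ(g)} = aut_g. On series in
x_1 this map is conjugation by g, which carries the logarithmic derivative of the left factor past
g. -/
lemma SX_Theta (g : MT Γ 𝕜) (h0 : g.1 (FreeMonoid.of AlphX.zero) = 0) :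
    SX (Theta g.1) (logDer g + thetaDer g) = euler _ 𝕜 (Theta g.1) := by
  have hc := thetaCoeff_zero g.1
  have h1 : aut (Theta g.1) = aut g.1 := by
    ext1 f
    have := aut_dressed hc g.2 0 f
    rwa [zero_smul, exp_zero, mul_one, ← Theta_of_apply_x0 h0,
      conj_of_commute one_apply_one (by simp)] at this
  have h2 : aut g.1 (thetaDer g) = conj g.1 (thetaDer g) := by
    rw [thetaDer, map_powSum (raises_aut _) (aut_one _) (aut_mul _) _ (x_mem_filt 1),
      map_powSum (raises_conj _) (conj_one g.2) (conj_mul g.2) _ (x_mem_filt 1), aut_x, t_one_left,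
      conj_apply, mul_assoc]
  have h3 : euler _ 𝕜 (powSum (thetaCoeff g.1) (x 1)) = thetaDer g :=
    euler_powSum_single (deg_letterX _) _
  have h4 : powSum (thetaCoeff g.1) (x (1 : Γ)) * thetaDer g =
      thetaDer g * powSum (thetaCoeff g.1) (x 1) :=
    powSum_mul_comm (x_mem_filt 1) (powSum_mul_comm (x_mem_filt 1) rfl _).symm _
  have h5 := euler_exp (powSum_mem_filt_one hc (x_mem_filt (𝕜 := 𝕜) (1 : Γ))) (by rw [h3]; exact h4)
  have h6 : g.1 * aut g.1 (logDer g) = euler _ 𝕜 g.1 := SX_logDer g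
  have h7 := Ring.mul_inverse_cancel _ (isUnit_of_constCoeff g.2)
  rw [SX_apply, h1, map_add, h2, Theta_of_apply_x0 h0, euler_mul, h5, h3, ← h6, conj_apply]
  calc exp (powSum (thetaCoeff g.1) (x 1)) * g.1 *
        (aut g.1 (logDer g) + Ring.inverse g.1 * (thetaDer g * g.1))
      = exp (powSum (thetaCoeff g.1) (x 1)) * g.1 * aut g.1 (logDer g) +
          exp (powSum (thetaCoeff g.1) (x 1)) * (g.1 * Ring.inverse g.1) * thetaDer g * g.1 := by
        noncomm_ring
    _ = _ := by rw [h7]; noncomm_ring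

end LogGroupLike

/-! ### Derivations lowering the degree -/

section Lowering

variable {Γ : Type*} [CommGroup Γ] [Fintype Γ] {𝕜 : Type*} [CommRing 𝕜]

/-- The derivation `x_0 ↦ 1`, `x_σ ↦ 0`. -/
noncomputable def dX : SerX Γ 𝕜 →L[𝕜] SerX Γ 𝕜 :=
  deriv (fun a => match a with
    | AlphX.zero => 1
    | AlphX.of _ => 0) 1 fun _ => filt_zero _

lemma dX_mul (f g : SerX Γ 𝕜) : dX (f * g) = dX f * g + f * dX g := deriv_mul _ _ _ f g

lemma dX_one : dX (1 : SerX Γ 𝕜) = 0 := deriv_one _ _ _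

lemma dX_x0 : dX (x0 : SerX Γ 𝕜) = 1 := deriv_of _ _ _ _

lemma dX_x (σ : Γ) : dX (x σ : SerX Γ 𝕜) = 0 := deriv_of _ _ _ _

lemma dX_x0_pow (m : ℕ) : dX (x0 ^ m : SerX Γ 𝕜) = (m : 𝕜) • x0 ^ (m - 1) := by
  induction m with
  | zero => simp [dX_one]
  | succ m ih =>
    rw [pow_succ, dX_mul, ih, dX_x0, mul_one, smul_mul_assoc, Nat.cast_succ, add_smul, one_smul,
      Nat.add_sub_cancel]
    rcases m with _ | m
    · simp
    · rw [Nat.add_sub_cancel, ← pow_succ]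

lemma t_dX (σ : Γ) (f : SerX Γ 𝕜) : t σ (dX f) = dX (t σ f) := by
  have : (t σ).comp (dX : SerX Γ 𝕜 →L[𝕜] SerX Γ 𝕜) = dX.comp (t σ) := by
    refine clm_ext_deriv (φ := t σ) (ψ := t σ) (by simp [dX_one]) (by simp [dX_one, t_one])
      (fun f g => by simp [dX_mul, t_mul]) (fun f g => by simp [dX_mul, t_mul])
      (letterX_cases (P := fun l => (t σ) ((dX : SerX Γ 𝕜 →L[𝕜] SerX Γ 𝕜) l) = dX (t σ l)) ?_ ?_)
    · simp [dX_x0, t_x0, t_one]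
    · intro τ
      simp [dX_x, t_x]
  exact DFunLike.congr_fun this f

lemma DeltaX_apply_one_left (F : SerX Γ 𝕜) (v : FreeMonoid (AlphX Γ)) :
    DeltaX F (1, v) = F v := by
  have : (comap fun m => (1, m)).comp DeltaX = ContinuousLinearMap.id 𝕜 (SerX Γ 𝕜) := by
    refine clm_ext_letters ?_ rfl (fun f g => ?_) (fun _ _ => rfl) fun a => ?_
    · rw [ContinuousLinearMap.comp_apply, DeltaX_one, ← tensor_one_one]
      ext v
      change (1 : SerX Γ 𝕜) 1 * (1 : SerX Γ 𝕜) v = _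
      rw [one_apply_one, one_mul]
    · rw [ContinuousLinearMap.comp_apply, DeltaX_mul, constTerm_mul_tensor]
      rfl
    · rw [ContinuousLinearMap.comp_apply, DeltaX_of]
      ext v
      change (single (FreeMonoid.of a) : SerX Γ 𝕜) 1 * _ + (1 : SerX Γ 𝕜) 1 * _ = _
      rw [single_of_apply_one, one_apply_one, zero_mul, zero_add, one_mul]
      rfl
  exact congrArg (fun s : SerX Γ 𝕜 => s v) (DFunLike.congr_fun this F)

/-- Letters are primitive, so the component of Δ with x_0 on the left is a derivation; it sends x_0
to 1 and the other letters to 0. -/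
lemma DeltaX_apply_x0_left (F : SerX Γ 𝕜) (v : FreeMonoid (AlphX Γ)) :
    DeltaX F (FreeMonoid.of AlphX.zero, v) = dX F v := by
  let ev : FreeMonoid (AlphX Γ) → SerXX Γ 𝕜 →L[𝕜] SerX Γ 𝕜 := fun u => comap fun m => (u, m)
  have h1 : ∀ a : AlphX Γ, (ev (FreeMonoid.of AlphX.zero)).comp
      (mulLeft (tensor 1 (single (FreeMonoid.of a)))) =
      (mulLeft (single (FreeMonoid.of a))).comp (ev (FreeMonoid.of AlphX.zero)) := by
    intro a
    refine clm_ext_tensor fun f g => ?_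
    rw [ContinuousLinearMap.comp_apply, mulLeft_apply, tensor_mul_tensor, one_mul]
    change f (FreeMonoid.of AlphX.zero) • (single (FreeMonoid.of a) * g : SerX Γ 𝕜) =
      (single (FreeMonoid.of a) : SerX Γ 𝕜) * (f (FreeMonoid.of AlphX.zero) • g)
    rw [mul_smul_comm]
  have h2 : ∀ a : AlphX Γ, (ev (FreeMonoid.of AlphX.zero)).comp
      (mulLeft (tensor (single (FreeMonoid.of a)) 1)) =
      (single (FreeMonoid.of a) : SerX Γ 𝕜) (FreeMonoid.of AlphX.zero) • ev 1 := by
    intro a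
    refine clm_ext_tensor fun f g => ?_
    rw [ContinuousLinearMap.comp_apply, mulLeft_apply, tensor_mul_tensor, one_mul]
    change ((single (FreeMonoid.of a) : SerX Γ 𝕜) * f) (FreeMonoid.of AlphX.zero) • g =
      (single (FreeMonoid.of a) : SerX Γ 𝕜) (FreeMonoid.of AlphX.zero) • (f 1 • g)
    rw [mul_apply_of, single_of_apply_one, zero_mul, zero_add, smul_smul]
  have : (ev (FreeMonoid.of AlphX.zero)).comp DeltaX = (dX : SerX Γ 𝕜 →L[𝕜] SerX Γ 𝕜) := by
    refine clm_ext fun w => ?_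
    induction w using FreeMonoid.inductionOn' with
    | one =>
      rw [← one_def, dX_one, ContinuousLinearMap.comp_apply, DeltaX_one, ← tensor_one_one]
      ext v
      change (1 : SerX Γ 𝕜) (FreeMonoid.of AlphX.zero) * (1 : SerX Γ 𝕜) v = 0
      rw [one_def, single_of_ne, zero_mul]
      intro h
      exact of_mul_ne_one AlphX.zero (1 : FreeMonoid (AlphX Γ)) (by rw [mul_one]; exact h)
    | of_mul a w ih =>
      have e1 := DFunLike.congr_fun (h1 a) (DeltaX (single w : SerX Γ 𝕜))
      have e2 := DFunLike.congr_fun (h2 a) (DeltaX (single w : SerX Γ 𝕜))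
      simp only [ContinuousLinearMap.comp_apply, mulLeft_apply] at e1 e2 ih
      have e3 : ev 1 (DeltaX (single w)) = (single w : SerX Γ 𝕜) := by
        ext v
        exact DeltaX_apply_one_left _ v
      rw [ContinuousLinearMap.comp_apply, single_of_mul, DeltaX_mul, DeltaX_of, primitive, add_mul,
        map_add, e1, e2, ih, dX_mul, _root_.smul_apply, e3]
      congr 1
      refine letterX_cases (P := fun l => l (FreeMonoid.of AlphX.zero) • (single w : SerX Γ 𝕜) =
        dX l * single w) ?_ (fun σ => ?_) a
      · rw [dX_x0, x0, single_self, one_smul, one_mul]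
      · rw [dX_x, zero_mul, x, single_of_ne, zero_smul]
        intro h
        have := congrArg FreeMonoid.toList h
        simp at this
  exact congrArg (fun s : SerX Γ 𝕜 => s v) (DFunLike.congr_fun this F)

lemma dX_eq_zero {f : SerX Γ 𝕜} (h : DeltaX f = primitive f)
    (h0 : f (FreeMonoid.of AlphX.zero) = 0) : dX f = 0 := by
  ext v
  rw [← DeltaX_apply_x0_left, h, primitive, Series.add_apply, tensor_apply, tensor_apply, h0,
    zero_mul, zero_add, one_def, single_of_ne, zero_mul]
  · rfl
  · intro h
    exact of_mul_ne_one AlphX.zero (1 : FreeMonoid (AlphX Γ)) (by rw [mul_one]; exact h)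

lemma rho_x0_mul_x (f : SerX Γ 𝕜) (σ : Γ) : rho AlphX.zero (f * x σ) = 0 := by
  classical
  rw [x, rho_mul_single, if_neg (by simp)]

lemma rho_x0_mul_x0 (f : SerX Γ 𝕜) : rho AlphX.zero (f * x0) = f := by
  classical
  rw [x0, rho_mul_single, if_pos rfl]

/-- The derivation may remove the final x_0 itself, after which a further x_0 is stripped; this
accounts for the square. -/
lemma rho_dX (f : SerX Γ 𝕜) :
    rho AlphX.zero (dX f) = dX (rho AlphX.zero f) + rho AlphX.zero (rho AlphX.zero f) := by
  classical
  have : (rho AlphX.zero).comp dX =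
      (dX.comp (rho AlphX.zero) + (rho AlphX.zero).comp (rho AlphX.zero) :
        SerX Γ 𝕜 →L[𝕜] SerX Γ 𝕜) := by
    refine clm_ext fun w => ?_
    rcases eq_one_or_mul_of w with rfl | ⟨v, a, rfl⟩
    · have e : rho AlphX.zero (1 : SerX Γ 𝕜) = 0 := by
        ext v
        rw [rho_apply, one_def, single_of_ne (mul_of_ne_one _ _)]
        rfl
      rw [← one_def]
      simp [dX_one, e]
    · rw [← single_mul_single]
      refine letterX_cases (P := fun l => rho AlphX.zero (dX (single v * l : SerX Γ 𝕜)) =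
        dX (rho AlphX.zero (single v * l : SerX Γ 𝕜)) +
          rho AlphX.zero (rho AlphX.zero (single v * l : SerX Γ 𝕜))) ?_ (fun σ => ?_) a
      · rw [dX_mul, map_add, rho_x0_mul_x0, rho_x0_mul_x0, dX_x0, mul_one]
      · rw [dX_mul, map_add, rho_x0_mul_x, rho_x0_mul_x, dX_x, mul_zero]
        simp
  exact DFunLike.congr_fun this f

lemma dX_iterate_rho {f : SerX Γ 𝕜} (hf : dX f = 0) (i : ℕ) :
    dX ((rho AlphX.zero)^[i] f) = -((i : 𝕜) • (rho AlphX.zero)^[i + 1] f) := by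
  induction i with
  | zero => simp [hf]
  | succ i ih =>
    have h := rho_dX ((rho AlphX.zero)^[i] f)
    rw [ih, map_neg, map_smul] at h
    simp only [← Function.iterate_succ_apply'] at h
    rw [eq_sub_of_add_eq h.symm, Nat.cast_succ]
    module

/-- The letter `y_{m+1,σ}`. -/
noncomputable def yN (m : ℕ) (σ : Γ) : SerY Γ 𝕜 := kappa (x0 ^ m * x σ)

lemma yN_eq (m : ℕ) (σ : Γ) :
    (yN m σ : SerY Γ 𝕜) = single (FreeMonoid.of ⟨m.succPNat, σ⟩) := kappa_x0_pow_mul_x m σ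

lemma single_of_eq_yN (a : AlphY Γ) :
    (single (FreeMonoid.of a) : SerY Γ 𝕜) = yN ((a.idx : ℕ) - 1) a.col := by
  have := kappa_letter_mul (𝕜 := 𝕜) a 1
  rwa [t_one, mul_one, kappa_one, mul_one, eq_comm] at this

lemma yN_mem_filt (m : ℕ) (σ : Γ) : (yN m σ : SerY Γ 𝕜) ∈ Filt _ 𝕜 (m + 1) := by
  rw [yN_eq]
  have h := single_mem_filt (𝕜 := 𝕜) (FreeMonoid.of (⟨m.succPNat, σ⟩ : AlphY Γ))
  rwa [deg_of] at h

/-- The derivation `y_{n,σ} ↦ (n-1) y_{n-1,σ}`. -/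
noncomputable def dY : SerY Γ 𝕜 →L[𝕜] SerY Γ 𝕜 :=
  deriv (fun a => (((a.idx : ℕ) - 1 : ℕ) : 𝕜) • yN ((a.idx : ℕ) - 1 - 1) a.col) 1 fun a => by
    change _ ∈ Filt _ 𝕜 ((a.idx : ℕ) - 1)
    rcases h : ((a.idx : ℕ) - 1) with _ | m
    · exact filt_zero _
    · exact Submodule.smul_mem _ _ (yN_mem_filt _ _)

lemma dY_mul (f g : SerY Γ 𝕜) : dY (f * g) = dY f * g + f * dY g := deriv_mul _ _ _ f g

lemma dY_one : dY (1 : SerY Γ 𝕜) = 0 := deriv_one _ _ _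

lemma dY_yN (m : ℕ) (σ : Γ) : dY (yN m σ : SerY Γ 𝕜) = (m : 𝕜) • yN (m - 1) σ := by
  rw [yN_eq]
  refine (deriv_of _ _ _ _).trans ?_
  simp

lemma kappa_x0_pow_succ (m : ℕ) : kappa (x0 ^ (m + 1) : SerX Γ 𝕜) = 0 := by
  rw [pow_succ, kappa_mul_x0]

lemma t_rho (σ : Γ) (a : AlphX Γ) (f : SerX Γ 𝕜) :
    t σ (rho a f) = rho (shiftLetter σ a) (t σ f) := by
  ext w
  rw [t_apply, rho_apply, rho_apply, t_apply, map_mul]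
  congr 2
  change _ = FreeMonoid.of (shiftLetter σ⁻¹ (shiftLetter σ a))
  rw [shiftLetter_mul, inv_mul_cancel, shiftLetter_one]

lemma t_lam (σ : Γ) (a : AlphX Γ) (f : SerX Γ 𝕜) :
    t σ (lam a f) = lam (shiftLetter σ a) (t σ f) := by
  ext w
  rw [t_apply, lam_apply, lam_apply, t_apply, map_mul]
  congr 2
  change _ = FreeMonoid.of (shiftLetter σ⁻¹ (shiftLetter σ a))
  rw [shiftLetter_mul, inv_mul_cancel, shiftLetter_one]

/-- Removing an x_0 from the block before a coloured letter lowers the index of the corresponding y.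
Removing one from the final block of x_0 is visible to κ only if that block is a single x_0, which
is the term with ρ_0. -/
lemma kappa_dX (f : SerX Γ 𝕜) :
    kappa (dX f) = dY (kappa f) + kappa (rho AlphX.zero f) := by
  have : kappa.comp dX = dY.comp kappa + kappa.comp (rho AlphX.zero : SerX Γ 𝕜 →L[𝕜] _) := by
    refine clm_ext fun w => ?_
    simp only [ContinuousLinearMap.comp_apply, _root_.add_apply]
    induction w using wordX_induction with
    | h0 m =>
      have e : (single (FreeMonoid.of AlphX.zero ^ m) : SerX Γ 𝕜) = x0 ^ m := by
        rw [← single_pow]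
        rfl
      rw [e, dX_x0_pow, map_smul]
      rcases m with _ | _ | m
      · have e : rho AlphX.zero (1 : SerX Γ 𝕜) = 0 := by
          ext v
          rw [rho_apply, one_def, single_of_ne (mul_of_ne_one _ _)]
          rfl
        rw [pow_zero, e, kappa_one, dY_one]
        simp
      · rw [kappa_x0_pow_succ, pow_succ, rho_x0_mul_x0]
        simp
      · rw [kappa_x0_pow_succ, pow_succ, rho_x0_mul_x0, kappa_x0_pow_succ]
        simp [kappa_x0_pow_succ]
    | h m σ v ih =>
      rw [← single_mul_single, ← t_single, single_wordX, dX_mul, dX_mul, dX_x, mul_zero, add_zero,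
        dX_x0_pow, kappa_mul_x_mul, ← yN, dY_mul, dY_yN, rho_mul, rho_x0_mul_x, smul_zero, add_zero,
        ← t_dX, map_add, kappa_mul_x_mul (x0 ^ m), ih, smul_mul_assoc, smul_mul_assoc, map_smul,
        kappa_mul_x_mul, ← yN, ← yN, mul_add, smul_mul_assoc]
      have e : rho AlphX.zero (t σ (single v : SerX Γ 𝕜)) = t σ (rho AlphX.zero (single v)) := by
        rw [t_rho]
        rfl
      rw [e, kappa_mul_x_mul, ← yN]
      abel
  exact DFunLike.congr_fun this f

/-- A sum over the splittings of a letter of `Y`. -/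
lemma sum_splittings {R : Type*} [AddCommMonoid R] (m : ℕ) (σ : Γ)
    (f : AlphY Γ × AlphY Γ → R) :
    ∑ p ∈ (finite_splittings (⟨m.succPNat, σ⟩ : AlphY Γ)).toFinset, f p =
      ∑ i ∈ Finset.range m, ∑ c : Γ,
        f (⟨i.succPNat, c⟩, ⟨(m - 1 - i).succPNat, c⁻¹ * σ⟩) := by
  rw [← Finset.sum_product']
  refine Finset.sum_nbij' (fun p => ((p.1.idx : ℕ) - 1, p.1.col))
    (fun q => (⟨q.1.succPNat, q.2⟩, ⟨(m - 1 - q.1).succPNat, q.2⁻¹ * σ⟩)) ?_ ?_ ?_ ?_ ?_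
  · rintro ⟨a, b⟩ h
    have h1 := splittings_wt h
    have h2 := a.idx.pos
    have h3 := b.idx.pos
    simp only [Nat.succPNat_coe] at h1
    simp only [Finset.mem_product, Finset.mem_range, Finset.mem_univ, and_true]
    omega
  · rintro ⟨i, c⟩ h
    simp only [Finset.mem_product, Finset.mem_range, Finset.mem_univ, and_true] at h
    rw [mem_splittings, merge]
    simp only [mul_inv_cancel_left, AlphY.mk.injEq, and_true]
    apply PNat.eq
    simp only [PNat.add_coe, Nat.succPNat_coe]
    omega
  · rintro ⟨⟨a, c⟩, ⟨b, d⟩⟩ h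
    have h1 := splittings_wt h
    rw [mem_splittings, merge, AlphY.mk.injEq] at h
    have h2 := a.pos
    have h3 := b.pos
    simp only [Nat.succPNat_coe] at h1
    simp only [Prod.mk.injEq, AlphY.mk.injEq, and_true]
    refine ⟨PNat.eq ?_, PNat.eq ?_, ?_⟩
    · simp only [Nat.succPNat_coe]
      omega
    · simp only [Nat.succPNat_coe]
      omega
    · rw [← h.2, inv_mul_cancel_left]
  · rintro ⟨i, c⟩ _
    simp
  · rintro ⟨⟨a, c⟩, ⟨b, d⟩⟩ h
    have h1 := splittings_wt h
    rw [mem_splittings, merge, AlphY.mk.injEq] at h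
    have h2 := a.pos
    have h3 := b.pos
    simp only [Nat.succPNat_coe] at h1
    congr 1
    simp only [Prod.mk.injEq, AlphY.mk.injEq, and_true]
    refine ⟨PNat.eq ?_, PNat.eq ?_, ?_⟩
    · simp only [Nat.succPNat_coe]
      omega
    · simp only [Nat.succPNat_coe]
      omega
    · rw [← h.2, inv_mul_cancel_left]

lemma DeltaStar_yN (m : ℕ) (σ : Γ) : DeltaStar (yN m σ : SerY Γ 𝕜) = primitive (yN m σ) +
    ∑ i ∈ Finset.range m, ∑ c : Γ, tensor (yN i c) (yN (m - 1 - i) (c⁻¹ * σ)) := by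
  rw [yN_eq, DeltaStar_of, harmonicLetter, sum_splittings]
  simp only [yN_eq]
  rfl

lemma leib_mul {M : Type*} [Monoid M] [FinGraded M] {D : Series M 𝕜 →L[𝕜] Series M 𝕜}
    (hD : ∀ f g, D (f * g) = D f * g + f * D g) (F G : Series (M × M) 𝕜) :
    leib D (F * G) = leib D F * G + F * leib D G := by
  have h1 : ∀ f g, (leib D).comp (mulLeft (tensor f g)) =
      mulLeft (leib D (tensor f g)) + (mulLeft (tensor f g)).comp (leib D) := fun f g => by
    refine clm_ext_tensor fun f' g' => ?_
    simp only [ContinuousLinearMap.comp_apply, mulLeft_apply, _root_.add_apply, tensor_mul_tensor,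
      leib_tensor, hD, add_tensor, tensor_add, add_mul, mul_add]
    abel
  have h2 : (leib D).comp (mulRight G) = (mulRight G).comp (leib D) + mulRight (leib D G) :=
    clm_ext_tensor fun f g => by simpa using DFunLike.congr_fun (h1 f g) G
  simpa using DFunLike.congr_fun h2 F

/-- On a letter, a given pair on the right receives one contribution from lowering each of its two
indices, and the two coefficients add up to the one on the left. -/
lemma DeltaStar_dY (f : SerY Γ 𝕜) : DeltaStar (dY f) = leib dY (DeltaStar f) := by
  have : DeltaStar.comp dY = (leib dY).comp (DeltaStar : SerY Γ 𝕜 →L[𝕜] SerYY Γ 𝕜) := by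
    refine clm_ext_deriv (φ := DeltaStar) (ψ := DeltaStar)
      (by rw [ContinuousLinearMap.comp_apply, dY_one, map_zero])
      (by rw [ContinuousLinearMap.comp_apply, DeltaStar_one, ← tensor_one_one, leib_tensor, dY_one,
        zero_tensor, tensor_zero, add_zero])
      (fun f g => by simp [dY_mul, DeltaStar_mul])
      (fun f g => by simp [DeltaStar_mul, leib_mul dY_mul]) fun a => ?_
    rw [single_of_eq_yN, ContinuousLinearMap.comp_apply, ContinuousLinearMap.comp_apply, dY_yN,
      map_smul, DeltaStar_yN, DeltaStar_yN]
    generalize (a.idx : ℕ) - 1 = m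
    generalize a.col = σ
    simp only [primitive, map_add, leib_tensor, dY_one, tensor_zero, zero_tensor, zero_add,
      add_zero, dY_yN, smul_tensor, tensor_smul, map_sum, smul_add, Finset.sum_add_distrib]
    congr 1
    rcases m with _ | m
    · simp
    · rw [Nat.add_sub_cancel, Finset.sum_range_succ' (fun i => ∑ c : Γ, (i : 𝕜) • _),
        Finset.sum_range_succ (fun i => ∑ c : Γ, ((m - i : ℕ) : 𝕜) • _)]
      simp only [Nat.cast_zero, zero_smul, Finset.sum_const_zero, add_zero, Nat.sub_self,
        ← Finset.sum_add_distrib, Finset.smul_sum]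
      refine Finset.sum_congr rfl fun i hi => Finset.sum_congr rfl fun c _ => ?_
      rw [Finset.mem_range] at hi
      rw [Nat.add_sub_cancel, show m - (i + 1) = m - 1 - i by omega,
        show m - i - 1 = m - 1 - i by omega, ← add_smul]
      congr 1
      have : m - i + (i + 1) = m + 1 := by omega
      rw [← this]
      push_cast
      ring
  exact DFunLike.congr_fun this f

variable [Algebra ℚ 𝕜]

lemma primitive_dY {p : SerY Γ 𝕜} (h : DeltaStar p = primitive p) :
    DeltaStar (dY p) = primitive (dY p) := by
  rw [DeltaStar_dY, h, primitive, map_add, leib_tensor, leib_tensor, dY_one, primitive]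
  simp

/-- By `kappa_dX` and `dX_iterate_rho`, the coderivation `dY` sends κ(ρ_0^i η) to -(i+1) κ(ρ_0^{i+1}
η). Coderivations of this kind preserve primitivity and i + 1 is invertible. -/
lemma primitive_kappa_iterate_rho {η : SerX Γ 𝕜} (hη : dX η = 0)
    (h : DeltaStar (kappa η) = primitive (kappa η)) (i : ℕ) :
    DeltaStar (kappa ((rho AlphX.zero)^[i] η)) = primitive (kappa ((rho AlphX.zero)^[i] η)) := by
  induction i with
  | zero => exact h
  | succ i ih =>
    have h1 := kappa_dX ((rho AlphX.zero)^[i] η)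
    rw [dX_iterate_rho hη, ← Function.iterate_succ_apply' (rho AlphX.zero) i η, map_neg,
      map_smul] at h1
    have h2 : dY (kappa ((rho AlphX.zero)^[i] η)) =
        (-((i : 𝕜) + 1)) • kappa ((rho AlphX.zero)^[i + 1] η) := by
      rw [← sub_eq_iff_eq_add] at h1
      rw [← h1]
      module
    have h3 := primitive_dY ih
    rw [h2, map_smul, primitive_smul] at h3
    have h4 : ∀ {M : Type _} {f g : Series M 𝕜}, (-((i : 𝕜) + 1)) • f = (-((i : 𝕜) + 1)) • g →
        f = g := by
      intro M f g hfg
      ext m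
      have h5 := congrArg (fun s : Series M 𝕜 => s m) hfg
      simp only [Series.smul_apply] at h5
      refine sub_eq_zero.1 (eq_zero_of_natCast_mul (Nat.succ_ne_zero i) ?_)
      push_cast
      linear_combination -h5
    exact h4 h3

end Lowering

/-! ### Reversal of words -/

section Reversal

variable {A : Type*} [WeightedAlphabet A] {𝕜 : Type*} [CommRing 𝕜]

/-- Reversal of words. -/
def revSer : Series (FreeMonoid A) 𝕜 →L[𝕜] Series (FreeMonoid A) 𝕜 :=
  comap FreeMonoid.reverse

lemma revSer_apply (f : Series (FreeMonoid A) 𝕜) (w : FreeMonoid A) :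
    revSer f w = f w.reverse := rfl

lemma revSer_revSer (f : Series (FreeMonoid A) 𝕜) : revSer (revSer f) = f := by
  ext w
  rw [revSer_apply, revSer_apply, FreeMonoid.reverse_reverse]

lemma revSer_single (w : FreeMonoid A) :
    revSer (single w : Series (FreeMonoid A) 𝕜) = single w.reverse := by
  ext v
  rw [revSer_apply]
  by_cases h : v = w.reverse
  · rw [h, FreeMonoid.reverse_reverse, single_self, single_self]
  · rw [single_of_ne h, single_of_ne]
    rintro rfl
    exact h FreeMonoid.reverse_reverse.symm

lemma revSer_of (a : A) : revSer (single (FreeMonoid.of a) : Series (FreeMonoid A) 𝕜) =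
    single (FreeMonoid.of a) := revSer_single _

lemma revSer_one : revSer (1 : Series (FreeMonoid A) 𝕜) = 1 := revSer_single _

lemma revSer_mul (f g : Series (FreeMonoid A) 𝕜) : revSer (f * g) = revSer g * revSer f :=
  bilin_ext_anti (fun a b => by
    rw [revSer_single, revSer_single, revSer_single, single_mul_single, FreeMonoid.reverse_mul]) f g

lemma lam_revSer (a : A) (f : Series (FreeMonoid A) 𝕜) :
    lam a (revSer f) = revSer (rho a f) := by
  ext w
  rw [lam_apply, revSer_apply, revSer_apply, rho_apply, FreeMonoid.reverse_mul,
    FreeMonoid.reverse_of]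

lemma revSer_iterate_rho (a : A) (i : ℕ) (f : Series (FreeMonoid A) 𝕜) :
    revSer ((rho a)^[i] f) = (lam a)^[i] (revSer f) := by
  induction i with
  | zero => rfl
  | succ i ih => rw [Function.iterate_succ_apply', Function.iterate_succ_apply', ← ih, lam_revSer]

/-- Two continuous algebra anti-morphisms agreeing on letters coincide. -/
lemma clm_ext_letters_anti {N : Type*} [Monoid N] [FinGraded N]
    {S T : Series (FreeMonoid A) 𝕜 →L[𝕜] Series N 𝕜} (hS1 : S 1 = 1)
    (hT1 : T 1 = 1) (hS : ∀ f g, S (f * g) = S g * S f) (hT : ∀ f g, T (f * g) = T g * T f)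
    (h : ∀ a, S (single (FreeMonoid.of a)) = T (single (FreeMonoid.of a))) : S = T := by
  refine clm_ext fun w => ?_
  induction w using FreeMonoid.inductionOn' with
  | one => rw [← one_def, hS1, hT1]
  | of_mul a w ih => rw [single_of_mul, hS, hT, ih, h]

lemma Series.tensorSq_mul_anti {M N : Type*} [Monoid M] [FinGraded M] [Monoid N] [FinGraded N]
    {S : Series M 𝕜 →L[𝕜] Series N 𝕜} (hS : ∀ f g, S (f * g) = S g * S f)
    (F G : Series (M × M) 𝕜) : tensorSq S (F * G) = tensorSq S G * tensorSq S F := by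
  refine bilin_ext_anti (fun a b => ?_) F G
  rw [← single_mul_single, ← tensor_single, ← tensor_single, tensor_mul_tensor, tensorSq_tensor,
    tensorSq_tensor, tensorSq_tensor, hS, hS, tensor_mul_tensor]

end Reversal

/-! ### A duality for the primitive elements of the harmonic coproduct. -/

section Duality

variable {Γ : Type*} [CommGroup Γ] [Fintype Γ] {𝕜 : Type*} [CommRing 𝕜]

lemma revSer_x0 : revSer (x0 : SerX Γ 𝕜) = x0 := revSer_of _

lemma revSer_x (σ : Γ) : revSer (x σ : SerX Γ 𝕜) = x σ := revSer_of _

lemma revSer_x0_pow (m : ℕ) : revSer (x0 ^ m : SerX Γ 𝕜) = x0 ^ m := by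
  induction m with
  | zero => rw [pow_zero, revSer_one]
  | succ m ih => rw [pow_succ, revSer_mul, ih, revSer_x0, ← pow_succ', pow_succ]

lemma t_x0_pow (σ : Γ) (m : ℕ) : t σ (x0 ^ m : SerX Γ 𝕜) = x0 ^ m := by
  induction m with
  | zero => rw [pow_zero, t_one]
  | succ m ih => rw [pow_succ, t_mul, ih, t_x0]

lemma t_revSer (σ : Γ) (f : SerX Γ 𝕜) : t σ (revSer f) = revSer (t σ f) := by
  have : (t σ).comp (revSer : SerX Γ 𝕜 →L[𝕜] SerX Γ 𝕜) = revSer.comp (t σ) :=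
    clm_ext_letters_anti (by simp [revSer_one, t_one]) (by simp [revSer_one, t_one])
      (fun f g => by simp [revSer_mul, t_mul]) (fun f g => by simp [revSer_mul, t_mul])
      (letterX_cases (P := fun l => t σ (revSer l) = revSer (t σ l))
        (by rw [revSer_x0, t_x0, revSer_x0]) fun τ => by rw [revSer_x, t_x, revSer_x])
  exact DFunLike.congr_fun this f

/-- Induction for identities about `kappa (f * x σ)`. -/
lemma clm_ext_kappa_x {N : Type*} {S T : Γ → SerX Γ 𝕜 →L[𝕜] Series N 𝕜}
    (h0 : ∀ m σ, S σ (x0 ^ m) = T σ (x0 ^ m))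
    (h : ∀ m τ v, (∀ σ, S σ v = T σ v) → ∀ σ, S σ (x0 ^ m * x τ * t τ v) =
      T σ (x0 ^ m * x τ * t τ v)) (σ : Γ) : S σ = T σ := by
  refine clm_ext fun w => ?_
  induction w using wordX_induction generalizing σ with
  | h0 m =>
    have e : (single (FreeMonoid.of AlphX.zero ^ m) : SerX Γ 𝕜) = x0 ^ m := by
      rw [← single_pow]
      rfl
    rw [e, h0]
  | h m τ v ih =>
    rw [← single_mul_single, ← t_single, single_wordX]
    exact h m τ _ ih σ

/-! #### The anti-automorphism inverting the colours -/

/-- Inverts the colour of a letter. -/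
def invLetter (a : AlphY Γ) : AlphY Γ := ⟨a.idx, a.col⁻¹⟩

lemma invLetter_invLetter (a : AlphY Γ) : invLetter (invLetter a) = a := by
  simp [invLetter]

/-- Reversal of words, together with the inversion of the colours. -/
def antiY : SerY Γ 𝕜 →L[𝕜] SerY Γ 𝕜 :=
  comap fun w => (FreeMonoid.map invLetter w).reverse

lemma antiWord_antiWord (w : FreeMonoid (AlphY Γ)) :
    (FreeMonoid.map invLetter (FreeMonoid.map invLetter w).reverse).reverse = w := by
  induction w using FreeMonoid.inductionOn' with
  | one => rfl
  | of_mul a w ih =>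
    rw [map_mul, FreeMonoid.map_of, FreeMonoid.reverse_mul, map_mul, FreeMonoid.reverse_mul, ih,
      FreeMonoid.reverse_of, FreeMonoid.map_of, invLetter_invLetter, FreeMonoid.reverse_of]

lemma antiY_apply (f : SerY Γ 𝕜) (w : FreeMonoid (AlphY Γ)) :
    antiY f w = f (FreeMonoid.map invLetter w).reverse := rfl

lemma antiY_antiY (f : SerY Γ 𝕜) : antiY (antiY f) = f := by
  ext w
  rw [antiY_apply, antiY_apply, antiWord_antiWord]

lemma antiY_single (w : FreeMonoid (AlphY Γ)) :
    antiY (single w : SerY Γ 𝕜) = single (FreeMonoid.map invLetter w).reverse := by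
  ext v
  rw [antiY_apply]
  by_cases h : v = (FreeMonoid.map invLetter w).reverse
  · rw [h, antiWord_antiWord, single_self, single_self]
  · rw [single_of_ne h, single_of_ne]
    rintro rfl
    exact h (antiWord_antiWord v).symm

lemma antiY_one : antiY (1 : SerY Γ 𝕜) = 1 := antiY_single _

lemma antiY_mul (f g : SerY Γ 𝕜) : antiY (f * g) = antiY g * antiY f :=
  bilin_ext_anti (fun a b => by
    rw [antiY_single, antiY_single, antiY_single, single_mul_single, map_mul,
      FreeMonoid.reverse_mul]) f g

lemma antiY_yN (m : ℕ) (σ : Γ) : antiY (yN m σ : SerY Γ 𝕜) = yN m σ⁻¹ := by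
  rw [yN_eq, yN_eq, antiY_single]
  rfl

lemma DeltaStar_antiY (f : SerY Γ 𝕜) : DeltaStar (antiY f) = tensorSq antiY (DeltaStar f) := by
  have : DeltaStar.comp antiY = (tensorSq antiY).comp (DeltaStar : SerY Γ 𝕜 →L[𝕜] _) := by
    refine clm_ext_letters_anti
      (by rw [ContinuousLinearMap.comp_apply, antiY_one, DeltaStar_one])
      (by rw [ContinuousLinearMap.comp_apply, DeltaStar_one, ← tensor_one_one, tensorSq_tensor,
        antiY_one])
      (fun f g => by simp [antiY_mul, DeltaStar_mul])
      (fun f g => by simp [DeltaStar_mul, tensorSq_mul_anti antiY_mul]) fun a => ?_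
    rw [single_of_eq_yN]
    simp only [ContinuousLinearMap.comp_apply, antiY_yN, DeltaStar_yN, primitive, map_add, map_sum,
      tensorSq_tensor, antiY_one]
    congr 1
    refine Finset.sum_congr rfl fun i _ => Fintype.sum_equiv (Equiv.inv Γ) _ _ fun c => ?_
    rw [Equiv.inv_apply, inv_inv, mul_inv]
  exact DFunLike.congr_fun this f

/-- On the X side colours are partial products from the left. Reversing a word over Y with inverted
colours makes them partial products from the right divided by the total colour σ, hence the shift by
σ⁻¹ of the reversed prefix. -/
lemma antiY_kappa (f : SerX Γ 𝕜) (σ : Γ) :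
    antiY (kappa (f * x σ)) = kappa (t σ⁻¹ (revSer f) * x σ⁻¹) := by
  refine DFunLike.congr_fun (clm_ext_kappa_x
    (S := fun σ => antiY.comp (kappa.comp (mulRight (x σ))))
    (T := fun σ => (kappa.comp (mulRight (x σ⁻¹))).comp ((t σ⁻¹).comp revSer))
    (fun m σ => ?_) (fun m τ v ih σ => ?_) σ) f
  · simp only [ContinuousLinearMap.comp_apply, mulRight_apply]
    rw [← yN, antiY_yN, revSer_x0_pow, t_x0_pow, ← yN]
  · have h := ih (τ⁻¹ * σ)
    simp only [ContinuousLinearMap.comp_apply, mulRight_apply] at h ⊢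
    have e1 : x0 ^ m * x τ * t τ v * x σ = x0 ^ m * x τ * t τ (v * x (τ⁻¹ * σ)) := by
      rw [t_mul, t_x, mul_inv_cancel_left, mul_assoc]
    have e2 : t σ⁻¹ (revSer (x0 ^ m * x τ * t τ v)) * x σ⁻¹ =
        t (τ⁻¹ * σ)⁻¹ (revSer v) * x (τ⁻¹ * σ)⁻¹ * t (τ⁻¹ * σ)⁻¹ (x0 ^ m * x τ⁻¹) := by
      rw [revSer_mul, revSer_mul, revSer_x0_pow, revSer_x, ← t_revSer, t_mul, t_mul, t_t, t_x,
        t_x0_pow, t_mul, t_x0_pow, t_x, mul_inv_rev, inv_inv, mul_inv_cancel_right]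
      simp only [mul_assoc]
    rw [e1, kappa_mul_x_mul, ← yN, antiY_mul, antiY_yN, h, e2, kappa_mul_x_mul, ← yN]

/-! #### The involution `ν` and the antipode-like map -/

/-- The involution `x_0 ↦ x_0 - ∑ x_τ`, `x_σ ↦ -x_{σ⁻¹}`. -/
noncomputable def nuX : SerX Γ 𝕜 →L[𝕜] SerX Γ 𝕜 :=
  subst (fun a => match a with
    | AlphX.zero => x0 - ∑ τ, x τ
    | AlphX.of σ => -x σ⁻¹) fun a n hn => by
      by_contra h
      refine hn (mem_filt.1 (?_ : _ ∈ Filt _ 𝕜 1) n (not_le.1 h))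
      cases a with
      | zero => exact sub_mem x0_mem_filt (Submodule.sum_mem _ fun τ _ => x_mem_filt τ)
      | of σ => exact neg_mem (x_mem_filt _)

lemma nuX_mul (f g : SerX Γ 𝕜) : nuX (f * g) = nuX f * nuX g := subst_mul _ _ f g

lemma nuX_one : nuX (1 : SerX Γ 𝕜) = 1 := subst_one _ _

lemma nuX_x0 : nuX (x0 : SerX Γ 𝕜) = x0 - ∑ τ, x τ := subst_of _ _ _

lemma nuX_x (σ : Γ) : nuX (x σ : SerX Γ 𝕜) = -x σ⁻¹ := subst_of _ _ _

lemma raises_nuX : Raises (nuX : SerX Γ 𝕜 →L[𝕜] SerX Γ 𝕜) 0 := raises_subst _ _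

lemma sum_x_inv : ∑ τ : Γ, (x τ⁻¹ : SerX Γ 𝕜) = ∑ τ, x τ :=
  Fintype.sum_equiv (Equiv.inv Γ) _ _ fun _ => rfl

lemma sum_x_mul_left (σ : Γ) : ∑ τ : Γ, (x (σ * τ) : SerX Γ 𝕜) = ∑ τ, x τ :=
  Fintype.sum_equiv (Equiv.mulLeft σ) _ _ fun _ => rfl

lemma nuX_nuX (f : SerX Γ 𝕜) : nuX (nuX f) = f := by
  have : (nuX.comp nuX : SerX Γ 𝕜 →L[𝕜] SerX Γ 𝕜) = ContinuousLinearMap.id 𝕜 _ :=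
    clm_ext_letters (by simp [nuX_one]) rfl (by simp [nuX_mul]) (fun _ _ => rfl)
      (letterX_cases (P := fun l => nuX (nuX l) = l)
        (by simp only [nuX_x0, map_sub, map_sum, nuX_x, Finset.sum_neg_distrib, sum_x_inv]; abel)
        fun σ => by rw [nuX_x, map_neg, nuX_x, inv_inv, neg_neg])
  exact DFunLike.congr_fun this f

lemma nuX_t (σ : Γ) (f : SerX Γ 𝕜) : nuX (t σ f) = t σ⁻¹ (nuX f) := by
  have : (nuX.comp (t σ) : SerX Γ 𝕜 →L[𝕜] SerX Γ 𝕜) = (t σ⁻¹).comp nuX :=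
    clm_ext_letters (by simp [nuX_one, t_one]) (by simp [nuX_one, t_one])
      (by simp [nuX_mul, t_mul]) (by simp [nuX_mul, t_mul])
      (letterX_cases (P := fun l => nuX (t σ l) = t σ⁻¹ (nuX l))
        (by rw [t_x0, nuX_x0, map_sub, map_sum, t_x0]; simp only [t_x, sum_x_mul_left])
        fun τ => by rw [t_x, nuX_x, nuX_x, map_neg, t_x, mul_inv])
  exact DFunLike.congr_fun this f

lemma nuX_revSer (f : SerX Γ 𝕜) : nuX (revSer f) = revSer (nuX f) := by
  have : (nuX.comp revSer : SerX Γ 𝕜 →L[𝕜] SerX Γ 𝕜) = revSer.comp nuX :=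
    clm_ext_letters_anti (by simp [nuX_one, revSer_one]) (by simp [nuX_one, revSer_one])
      (by simp [nuX_mul, revSer_mul]) (by simp [nuX_mul, revSer_mul])
      (letterX_cases (P := fun l => nuX (revSer l) = revSer (nuX l))
        (by rw [revSer_x0, nuX_x0, map_sub, map_sum, revSer_x0]; simp only [revSer_x])
        fun τ => by rw [revSer_x, nuX_x, map_neg, revSer_x])
  exact DFunLike.congr_fun this f

lemma rho_of_mul_x0 (f : SerX Γ 𝕜) (σ : Γ) : rho (AlphX.of σ) (f * x0) = 0 := by
  classical
  rw [x0, rho_mul_single, if_neg (by simp)]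

lemma rho_of_mul_x [DecidableEq Γ] (f : SerX Γ 𝕜) (σ τ : Γ) :
    rho (AlphX.of σ) (f * x τ) = if σ = τ then f else 0 := by
  classical
  rw [x, rho_mul_single]
  simp

lemma rho_one (a : AlphX Γ) : rho a (1 : SerX Γ 𝕜) = 0 := by
  ext v
  rw [rho_apply, one_def, single_of_ne (mul_of_ne_one _ _)]
  rfl

lemma clm_ext_rho {N : Type*} {S T : SerX Γ 𝕜 →L[𝕜] Series N 𝕜} (h1 : S 1 = T 1)
    (h0 : ∀ f, S (f * x0) = T (f * x0)) (h : ∀ f σ, S (f * x σ) = T (f * x σ)) : S = T := by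
  refine clm_ext fun w => ?_
  rcases eq_one_or_mul_of w with rfl | ⟨v, a, rfl⟩
  · exact h1
  · rw [← single_mul_single]
    exact letterX_cases (P := fun l => S (single v * l) = T (single v * l)) (h0 _) (h _) a

lemma rho_zero_nuX (f : SerX Γ 𝕜) :
    rho AlphX.zero (nuX f) = nuX (rho AlphX.zero f) := by
  have : (rho AlphX.zero).comp nuX = (nuX.comp (rho AlphX.zero) : SerX Γ 𝕜 →L[𝕜] SerX Γ 𝕜) := by
    refine clm_ext_rho ?_ (fun f => ?_) fun f σ => ?_ <;>
      simp only [ContinuousLinearMap.comp_apply, nuX_mul, nuX_one, nuX_x0, nuX_x, rho_one,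
        mul_sub, map_sub, rho_x0_mul_x0, Finset.mul_sum, map_sum, rho_x0_mul_x, map_zero, mul_neg,
        map_neg, neg_zero, Finset.sum_const_zero, sub_zero]
  exact DFunLike.congr_fun this f

/-- A final x_σ in ν(f) comes either from x_{σ⁻¹} or from the sum subtracted in ν(x_0). The latter
contribution is minus what ρ_0 detects, so adding ρ_0 removes it. -/
lemma rho_of_nuX (σ : Γ) (f : SerX Γ 𝕜) :
    rho (AlphX.of σ) (nuX f) + rho AlphX.zero (nuX f) = -nuX (rho (AlphX.of σ⁻¹) f) := by
  classical
  have : (rho (AlphX.of σ)).comp nuX + (rho AlphX.zero).comp nuX =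
      -(nuX.comp (rho (AlphX.of σ⁻¹)) : SerX Γ 𝕜 →L[𝕜] SerX Γ 𝕜) := by
    refine clm_ext_rho ?_ (fun f => ?_) fun f τ => ?_
    · simp [nuX_one, rho_one]
    · simp only [_root_.add_apply, _root_.neg_apply, ContinuousLinearMap.comp_apply, nuX_mul,
        nuX_x0, mul_sub, map_sub, Finset.mul_sum, map_sum, rho_of_mul_x, rho_of_mul_x0,
        rho_x0_mul_x0, rho_x0_mul_x]
      simp
    · simp only [_root_.add_apply, _root_.neg_apply, ContinuousLinearMap.comp_apply, nuX_mul,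
        nuX_x, mul_neg, map_neg, rho_of_mul_x, rho_x0_mul_x, neg_zero, add_zero]
      by_cases h : σ = τ⁻¹
      · rw [if_pos h, if_pos (by rw [h, inv_inv])]
      · rw [if_neg h, if_neg (fun h' => h (by rw [← h', inv_inv])), map_zero]
  exact DFunLike.congr_fun this f

lemma lam_zero_nuX (f : SerX Γ 𝕜) : lam AlphX.zero (nuX f) = nuX (lam AlphX.zero f) := by
  rw [← revSer_revSer f, nuX_revSer, lam_revSer, lam_revSer, rho_zero_nuX, nuX_revSer]

lemma lam_of_nuX (σ : Γ) (f : SerX Γ 𝕜) :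
    lam (AlphX.of σ) (nuX f) + lam AlphX.zero (nuX f) = -nuX (lam (AlphX.of σ⁻¹) f) := by
  rw [← revSer_revSer f, nuX_revSer, lam_revSer, lam_revSer, lam_revSer, nuX_revSer, ← map_add,
    ← nuX_revSer, rho_of_nuX, map_neg, nuX_revSer]

/-- The algebra morphism of `𝕜⟨⟨Y⟩⟩` sending `kappa (f x_σ)` to `-kappa (ν(f) x_{σ⁻¹})`. -/
noncomputable def nuY : SerY Γ 𝕜 →L[𝕜] SerY Γ 𝕜 :=
  subst (fun a => -kappa (nuX (x0 ^ ((a.idx : ℕ) - 1)) * x a.col⁻¹)) fun a n hn => by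
    by_contra h
    refine hn (mem_filt.1 (neg_mem (raises_kappa.mem_filt (mul_mem_filt (raises_nuX.mem_filt
      (pow_mem_filt x0_mem_filt _)) (x_mem_filt _)))) n ?_)
    have h1 := not_le.1 h
    have h2 := a.idx.pos
    simp only [wt] at h1
    omega

lemma nuY_mul (f g : SerY Γ 𝕜) : nuY (f * g) = nuY f * nuY g := subst_mul _ _ f g

lemma nuY_one : nuY (1 : SerY Γ 𝕜) = 1 := subst_one _ _

lemma nuY_yN (m : ℕ) (σ : Γ) :
    nuY (yN m σ : SerY Γ 𝕜) = -kappa (nuX (x0 ^ m) * x σ⁻¹) := by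
  rw [yN_eq]
  refine (subst_of _ _ _).trans ?_
  simp

/-- The involution ν satisfies ν ∘ t_σ = t_{σ⁻¹} ∘ ν, so it respects the twisted multiplicativity of
κ; each block ending in a coloured letter contributes one sign. -/
lemma nuY_kappa (f : SerX Γ 𝕜) (σ : Γ) :
    nuY (kappa (f * x σ)) = -kappa (nuX f * x σ⁻¹) := by
  refine DFunLike.congr_fun (clm_ext_kappa_x
    (S := fun σ => nuY.comp (kappa.comp (mulRight (x σ))))
    (T := fun σ => -((kappa.comp (mulRight (x σ⁻¹))).comp nuX))
    (fun m σ => ?_) (fun m τ v ih σ => ?_) σ) f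
  · simp only [ContinuousLinearMap.comp_apply, mulRight_apply, _root_.neg_apply]
    rw [← yN, nuY_yN]
  · have h := ih (τ⁻¹ * σ)
    simp only [ContinuousLinearMap.comp_apply, mulRight_apply, _root_.neg_apply] at h ⊢
    have e1 : x0 ^ m * x τ * t τ v * x σ = x0 ^ m * x τ * t τ (v * x (τ⁻¹ * σ)) := by
      rw [t_mul, t_x, mul_inv_cancel_left, mul_assoc]
    have e2 : nuX (x0 ^ m * x τ * t τ v) * x σ⁻¹ =
        -(nuX (x0 ^ m) * x τ⁻¹ * t τ⁻¹ (nuX v * x (τ⁻¹ * σ)⁻¹)) := by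
      rw [nuX_mul, nuX_mul, nuX_x, nuX_t, t_mul, t_x]
      have : τ⁻¹ * (τ⁻¹ * σ)⁻¹ = σ⁻¹ := by
        rw [mul_inv, inv_inv, inv_mul_cancel_left]
      rw [this]
      noncomm_ring
    rw [e1, kappa_mul_x_mul, ← yN, nuY_mul, nuY_yN, h, e2, map_neg, kappa_mul_x_mul, neg_mul_neg,
      neg_neg]

/-- `u ⊗ v ↦ antiY v * nuY u` -/
noncomputable def antiMulMap : SerYY Γ 𝕜 →L[𝕜] SerY Γ 𝕜 :=
  mulMap.comp ((tmap antiY nuY).comp (comap Prod.swap))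

lemma antiMulMap_tensor (f g : SerY Γ 𝕜) : antiMulMap (tensor f g) = antiY g * nuY f := by
  have : comap Prod.swap (tensor f g) = tensor g f := by
    ext p
    exact mul_comm _ _
  rw [antiMulMap, ContinuousLinearMap.comp_apply, ContinuousLinearMap.comp_apply, this,
    tmap_tensor, mulMap_tensor]

/-- Noncommutative form of the factorization of a^m - b^m, with a - b = ∑ x_τ. -/
lemma nuX_x0_pow_telescope (m : ℕ) : (x0 : SerX Γ 𝕜) ^ m - nuX (x0 ^ m) =
    ∑ i ∈ Finset.range m, x0 ^ (m - 1 - i) * (∑ τ, x τ) * nuX (x0 ^ i) := by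
  induction m with
  | zero => simp [nuX_one]
  | succ m ih =>
    have h : ∀ i ∈ Finset.range m, x0 ^ (m + 1 - 1 - i) * (∑ τ : Γ, x τ) * nuX (x0 ^ i) =
        (x0 : SerX Γ 𝕜) * (x0 ^ (m - 1 - i) * (∑ τ, x τ) * nuX (x0 ^ i)) := fun i hi => by
      have := Finset.mem_range.1 hi
      rw [show m + 1 - 1 - i = (m - 1 - i) + 1 by omega, pow_succ', mul_assoc, mul_assoc, mul_assoc]
    rw [Finset.sum_range_succ, Finset.sum_congr rfl h, ← Finset.mul_sum, ← ih, pow_succ', nuX_mul,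
      nuX_x0, Nat.add_sub_cancel, Nat.sub_self, pow_zero, one_mul]
    noncomm_ring

/-- The quadratic part of Δ_* on a letter becomes the telescoping sum above and cancels the two
linear terms. -/
lemma antiMulMap_DeltaStar_yN (m : ℕ) (σ : Γ) :
    antiMulMap (DeltaStar (yN m σ : SerY Γ 𝕜)) = 0 := by
  have h1 : ∀ (i : ℕ) (c : Γ), antiY (yN (m - 1 - i) (c⁻¹ * σ) : SerY Γ 𝕜) * nuY (yN i c) =
      -kappa (x0 ^ (m - 1 - i) * x (σ⁻¹ * c) * nuX (x0 ^ i) * x σ⁻¹) := fun i c => by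
    rw [antiY_yN, nuY_yN, yN, mul_neg, ← kappa_mul_x_mul, t_mul, t_x]
    have e1 : (c⁻¹ * σ)⁻¹ = σ⁻¹ * c := by rw [mul_inv_rev, inv_inv]
    have e2 : t (σ⁻¹ * c) (nuX (x0 ^ i) : SerX Γ 𝕜) = nuX (x0 ^ i) := by
      have := nuX_t (𝕜 := 𝕜) (σ⁻¹ * c)⁻¹ (x0 ^ i)
      rw [inv_inv, t_x0_pow] at this
      exact this.symm
    rw [e1, e2, mul_inv_cancel_right, ← mul_assoc]
  have h2 : ∀ i, ∑ c : Γ, kappa (x0 ^ (m - 1 - i) * x (σ⁻¹ * c) * nuX (x0 ^ i) * x σ⁻¹) =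
      kappa (x0 ^ (m - 1 - i) * (∑ τ, x τ) * nuX (x0 ^ i) * x σ⁻¹ : SerX Γ 𝕜) := fun i => by
    rw [← map_sum, ← Finset.sum_mul, ← Finset.sum_mul, ← Finset.mul_sum, sum_x_mul_left]
  rw [DeltaStar_yN, primitive]
  simp only [map_add, map_sum, antiMulMap_tensor, antiY_one, nuY_one, one_mul, mul_one, h1, h2,
    Finset.sum_neg_distrib]
  rw [antiY_yN, nuY_yN, yN, ← map_sum, ← Finset.sum_mul, ← nuX_x0_pow_telescope, sub_mul, map_sub]
  abel

lemma antiMulMap_mul_tensor (H : SerYY Γ 𝕜) (f g : SerY Γ 𝕜) :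
    antiMulMap (H * tensor f g) = antiY g * antiMulMap H * nuY f := by
  have : antiMulMap.comp (mulRight (tensor f g)) =
      ((mulRight (nuY f)).comp (mulLeft (antiY g))).comp (antiMulMap : SerYY Γ 𝕜 →L[𝕜] _) :=
    clm_ext_tensor fun f' g' => by
      simp only [ContinuousLinearMap.comp_apply, mulRight_apply, mulLeft_apply, tensor_mul_tensor,
        antiMulMap_tensor, antiY_mul, nuY_mul, mul_assoc]
  exact DFunLike.congr_fun this H

/-- Convolution identity of antipode type, with `antiY` an anti-morphism and `nuY` a morphism: the
image of the first letter of a word ends up in the middle of the product, where it is zero. -/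
lemma antiMulMap_DeltaStar {f : SerY Γ 𝕜} (hf : f 1 = 0) : antiMulMap (DeltaStar f) = 0 := by
  classical
  have h1 : ∀ a : AlphY Γ, antiMulMap.comp (mulLeft (DeltaStar (single (FreeMonoid.of a)))) =
      (0 : SerYY Γ 𝕜 →L[𝕜] SerY Γ 𝕜) := fun a => clm_ext_tensor fun f g => by
    rw [ContinuousLinearMap.comp_apply, mulLeft_apply, antiMulMap_mul_tensor, single_of_eq_yN,
      antiMulMap_DeltaStar_yN, mul_zero, zero_mul, _root_.zero_apply]
  have h2 : antiMulMap.comp DeltaStar =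
      (weight fun w => if w = 1 then 1 else 0 : SerY Γ 𝕜 →L[𝕜] SerY Γ 𝕜) := by
    refine clm_ext fun w => ?_
    rw [weight_single, ContinuousLinearMap.comp_apply]
    rcases eq_one_or_of_mul w with rfl | ⟨a, v, rfl⟩
    · rw [← one_def, DeltaStar_one, ← tensor_one_one, antiMulMap_tensor, antiY_one, nuY_one,
        mul_one, if_pos rfl, one_smul]
    · rw [if_neg (of_mul_ne_one a v), zero_smul, single_of_mul, DeltaStar_mul]
      exact DFunLike.congr_fun (h1 a) _
  have h3 := DFunLike.congr_fun h2 f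
  rw [ContinuousLinearMap.comp_apply] at h3
  rw [h3]
  ext w
  rw [weight_apply]
  split_ifs with h
  · rw [h, hf, mul_zero]
    rfl
  · rw [zero_mul]
    rfl

lemma apply_one_of_DeltaStar {p : SerY Γ 𝕜} (h : DeltaStar p = primitive p) : p 1 = 0 := by
  have h1 := DeltaStar_apply_one_left p 1
  rw [h, primitive, Series.add_apply, tensor_apply, tensor_apply, one_apply_one, mul_one,
    one_mul] at h1
  linear_combination h1

/-- For a primitive element only the two outer terms of the convolution identity remain. -/
lemma antiY_add_nuY {p : SerY Γ 𝕜} (h : DeltaStar p = primitive p) : antiY p + nuY p = 0 := by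
  have h1 := antiMulMap_DeltaStar (apply_one_of_DeltaStar h)
  rw [h, primitive, map_add, antiMulMap_tensor, antiMulMap_tensor, antiY_one, nuY_one, one_mul,
    mul_one] at h1
  rw [add_comm, h1]

lemma kappa_eq_sum (f : SerX Γ 𝕜) :
    kappa f = f 1 • 1 + ∑ σ, kappa (rho (AlphX.of σ) f * x σ) := by
  classical
  ext w
  rw [Series.add_apply, Series.smul_apply, Series.sum_apply]
  rcases eq_one_or_mul_of w with rfl | ⟨v, a, rfl⟩
  · rw [kappa_apply_one, one_apply_one, mul_one, Finset.sum_eq_zero, add_zero]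
    intro σ _
    rw [kappa_apply_one, mul_apply_one, x, single_of_apply_one, mul_zero]
  · have h : ∀ (g : SerX Γ 𝕜) (τ : Γ), kappa (g * x τ) (v * FreeMonoid.of a) =
        if col v * a.col = τ then g (psi v * FreeMonoid.of AlphX.zero ^ ((a.idx : ℕ) - 1)) else 0 :=
      fun g τ => by
        rw [kappa_apply, psi_mul_of, wordX, ← mul_assoc, x, mul_single_apply]
        simp
    simp only [h]
    rw [Finset.sum_ite_eq, if_pos (Finset.mem_univ _), kappa_apply, psi_mul_of, one_def,
      single_of_ne (mul_of_ne_one _ _), mul_zero, zero_add, rho_apply, wordX, mul_assoc]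

lemma eq_of_sum_kappa {f g : Γ → SerX Γ 𝕜}
    (h : ∑ σ, kappa (f σ * x σ) = ∑ σ, kappa (g σ * x σ)) (σ : Γ) : f σ = g σ := by
  classical
  ext v
  obtain ⟨w, hw, -⟩ := exists_psi_eq v σ
  have h1 := congrArg (fun s : SerY Γ 𝕜 => s w) h
  have h2 : ∀ (f : SerX Γ 𝕜) (τ : Γ), kappa (f * x τ) w = if σ = τ then f v else 0 := fun f τ => by
    rw [kappa_apply, hw, x, mul_single_apply]
    simp
  simpa [h2] using h1

/-- The duality satisfied by a series with primitive image. -/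
lemma t_revSer_rho {g : SerX Γ 𝕜} (h : DeltaStar (kappa g) = primitive (kappa g)) (σ : Γ) :
    t σ⁻¹ (revSer (rho (AlphX.of σ) g)) = nuX (rho (AlphX.of σ) g) := by
  have h1 := antiY_add_nuY h
  have h2 := apply_one_of_DeltaStar h
  rw [kappa_apply_one] at h2
  rw [kappa_eq_sum, h2, zero_smul, zero_add, map_sum, map_sum] at h1
  simp only [antiY_kappa, nuY_kappa, Finset.sum_neg_distrib] at h1
  have h3 : ∀ f : Γ → SerX Γ 𝕜, ∑ τ, kappa (f τ * x τ⁻¹) = ∑ τ, kappa (f τ⁻¹ * x τ) := fun f =>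
    Fintype.sum_equiv (Equiv.inv Γ) _ _ fun τ => by rw [Equiv.inv_apply, inv_inv]
  rw [h3 (fun τ => t τ⁻¹ (revSer (rho (AlphX.of τ) g))), h3 (fun τ => nuX (rho (AlphX.of τ) g)),
    add_neg_eq_zero] at h1
  simpa using eq_of_sum_kappa h1 σ⁻¹

end Duality

/-! ### Generating sums of the derivatives of the letters -/

section Generating

variable {Γ : Type*} [CommGroup Γ] [Fintype Γ] {𝕜 : Type*} [CommRing 𝕜]

variable (Γ 𝕜) in
/-- The sums `∑_σ y_{k,σ}`, extended by `1` at `k = 0` and by `0` at `k < 0`. -/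
noncomputable def yh : ℤ → SerY Γ 𝕜
  | Int.ofNat 0 => 1
  | Int.ofNat (m + 1) => ∑ σ, yN m σ
  | Int.negSucc _ => 0

lemma yh_zero : yh Γ 𝕜 0 = 1 := rfl

lemma yh_succ (m : ℕ) : yh Γ 𝕜 ((m : ℤ) + 1) = ∑ σ, yN m σ := rfl

lemma yh_neg {k : ℤ} (hk : k < 0) : yh Γ 𝕜 k = 0 := by
  rcases k with k | k
  · exact absurd hk (by simp)
  · rfl

lemma sum_yN_mul_left (m : ℕ) (σ : Γ) : ∑ τ, (yN m (σ * τ) : SerY Γ 𝕜) = ∑ τ, yN m τ :=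
  Fintype.sum_equiv (Equiv.mulLeft σ) _ _ fun _ => rfl

lemma antiY_yh (k : ℤ) : antiY (yh Γ 𝕜 k) = yh Γ 𝕜 k := by
  rcases k with (_ | m) | m
  · exact antiY_one
  · change antiY (∑ σ, yN m σ) = ∑ σ, yN m σ
    rw [map_sum]
    exact Fintype.sum_equiv (Equiv.inv Γ) _ _ fun σ => antiY_yN m σ
  · exact map_zero _

lemma sum_tensor_split {M : Type*} (F G : Γ → Series M 𝕜) :
    ∑ σ, ∑ c, tensor (F c) (G (c⁻¹ * σ)) = tensor (∑ σ, F σ) (∑ σ, G σ) := by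
  rw [Finset.sum_comm, sum_tensor]
  refine Finset.sum_congr rfl fun c _ => ?_
  rw [← tensor_sum]
  congr 1
  exact Fintype.sum_equiv (Equiv.mulLeft c⁻¹) _ _ fun _ => rfl

/-- Summation over σ frees the colours σ', σ'' from the constraint σ'σ'' = σ, so the sums over
colours form a divided-power sequence. -/
lemma DeltaStar_yh_natCast (m : ℕ) : DeltaStar (yh Γ 𝕜 m) =
    ∑ c ∈ Finset.range (m + 1), tensor (yh Γ 𝕜 (m - c)) (yh Γ 𝕜 c) := by
  rcases m with _ | m
  · rw [Finset.sum_range_one]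
    exact DeltaStar_one.trans tensor_one_one.symm
  · have h : ∀ i ∈ Finset.range m,
        tensor (yh Γ 𝕜 (((m + 1 : ℕ) : ℤ) - (i + 1 : ℕ))) (yh Γ 𝕜 (i + 1 : ℕ)) =
        tensor (∑ σ, yN (m - 1 - i) σ) (∑ σ, yN i σ : SerY Γ 𝕜) := fun i hi => by
      have := Finset.mem_range.1 hi
      rw [show ((m + 1 : ℕ) : ℤ) - (i + 1 : ℕ) = ((m - 1 - i : ℕ) : ℤ) + 1 by omega, yh_succ,
        Nat.cast_succ, yh_succ]
    rw [Finset.sum_range_succ, Finset.sum_range_succ', Finset.sum_congr rfl h, Nat.cast_zero,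
      sub_zero, sub_self, yh_zero, Nat.cast_succ, yh_succ, map_sum]
    have h2 : ∑ σ : Γ, ∑ i ∈ Finset.range m, ∑ c : Γ,
        tensor (yN i c : SerY Γ 𝕜) (yN (m - 1 - i) (c⁻¹ * σ) : SerY Γ 𝕜) =
        ∑ i ∈ Finset.range m, tensor (∑ σ, yN (m - 1 - i) σ) (∑ σ, yN i σ) := by
      rw [Finset.sum_comm, ← Finset.sum_range_reflect]
      refine Finset.sum_congr rfl fun i hi => ?_
      rw [sum_tensor_split]
      have := Finset.mem_range.1 hi
      rw [show m - 1 - (m - 1 - i) = i by omega]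
    simp only [DeltaStar_yN, primitive, Finset.sum_add_distrib, ← sum_tensor, ← tensor_sum, h2]
    abel

/-- Terms with c > k vanish since the sequence is zero at negative indices. A range independent of k
allows sums over several k to be interchanged. -/
lemma DeltaStar_yh {k : ℤ} {L : ℕ} (hk : k < L) : DeltaStar (yh Γ 𝕜 k) =
    ∑ c ∈ Finset.range L, tensor (yh Γ 𝕜 (k - c)) (yh Γ 𝕜 c) := by
  rcases lt_or_ge k 0 with h | h
  · rw [yh_neg h, map_zero, Finset.sum_eq_zero]
    intro c _
    rw [yh_neg (by omega), zero_tensor]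
  · lift k to ℕ using h
    rw [DeltaStar_yh_natCast]
    refine Finset.sum_subset (fun c hc => ?_) fun c _ hc => ?_
    · rw [Finset.mem_range] at hc ⊢
      omega
    · rw [Finset.mem_range] at hc
      rw [yh_neg (by omega), zero_tensor]

lemma DeltaStar_yh' {k : ℤ} {L : ℕ} (hk : k < L) : DeltaStar (yh Γ 𝕜 k) =
    ∑ c ∈ Finset.range L, tensor (yh Γ 𝕜 c) (yh Γ 𝕜 (k - c)) := by
  rcases lt_or_ge k 0 with h | h
  · rw [yh_neg h, map_zero, Finset.sum_eq_zero]
    intro c _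
    rw [yh_neg (k := k - c) (by omega), tensor_zero]
  · lift k to ℕ using h
    rw [DeltaStar_yh_natCast, ← Finset.sum_range_reflect]
    refine (Finset.sum_congr rfl fun c hc => ?_).trans
      (Finset.sum_subset (s₁ := Finset.range (k + 1)) (fun c hc => ?_) fun c _ hc => ?_)
    · rw [Finset.mem_range] at hc
      rw [show ((k : ℤ) - (k + 1 - 1 - c : ℕ)) = c by omega,
        show ((k + 1 - 1 - c : ℕ) : ℤ) = k - c by omega]
    · rw [Finset.mem_range] at hc ⊢
      omega
    · rw [Finset.mem_range] at hc
      rw [yh_neg (k := k - c) (by omega), tensor_zero]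

lemma kappa_eq_sum_of_apply_one {f : SerX Γ 𝕜} (h : kappa f 1 = 0) :
    kappa f = ∑ σ, kappa (rho (AlphX.of σ) f * x σ) := by
  rw [kappa_apply_one] at h
  rw [kappa_eq_sum, h, zero_smul, zero_add]

/-- `∑_{i ≤ n} kappa (ρ_0^i η) yh_{i+k}` -/
noncomputable def genW (n : ℕ) (η : SerX Γ 𝕜) (k : ℤ) : SerY Γ 𝕜 :=
  ∑ i ∈ Finset.range (n + 1), kappa ((rho AlphX.zero)^[i] η) * yh Γ 𝕜 (i + k)

/-- The symmetrized sum, which for `k > 0` is the sum of the derivatives of the `y_{k,σ}`. -/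
noncomputable def genD (n : ℕ) (e : 𝕜) (η : SerX Γ 𝕜) (k : ℤ) : SerY Γ 𝕜 :=
  genW n η k + e • antiY (genW n η k)

/-- Each summand is a primitive element times a member of a divided-power sequence, and subtracting
c from the index is the same operation in all summands. -/
lemma DeltaStar_genW {n : ℕ} {η : SerX Γ 𝕜} (h : ∀ i, DeltaStar (kappa ((rho AlphX.zero)^[i] η)) =
    primitive (kappa ((rho AlphX.zero)^[i] η))) {k : ℤ} {L : ℕ} (hk : n + k < L) :
    DeltaStar (genW n η k) = ∑ c ∈ Finset.range L,
      (tensor (genW n η (k - c)) (yh Γ 𝕜 c) + tensor (yh Γ 𝕜 c) (genW n η (k - c))) := by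
  have h1 : ∀ i ∈ Finset.range (n + 1),
      DeltaStar (kappa ((rho AlphX.zero)^[i] η) * yh Γ 𝕜 (i + k)) =
      ∑ c ∈ Finset.range L, (tensor (kappa ((rho AlphX.zero)^[i] η) * yh Γ 𝕜 (i + (k - c)))
        (yh Γ 𝕜 c) +
        tensor (yh Γ 𝕜 c) (kappa ((rho AlphX.zero)^[i] η) * yh Γ 𝕜 (i + (k - c)))) := fun i hi => by
    have := Finset.mem_range.1 hi
    have hL : (i : ℤ) + k < L := by omega
    rw [DeltaStar_mul, h, primitive, add_mul, Finset.sum_add_distrib]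
    congr 1
    · rw [DeltaStar_yh hL, Finset.mul_sum]
      simp only [tensor_mul_tensor, one_mul, add_sub_assoc]
    · rw [DeltaStar_yh' hL, Finset.mul_sum]
      simp only [tensor_mul_tensor, one_mul, add_sub_assoc]
  rw [genW, map_sum, Finset.sum_congr rfl h1, Finset.sum_comm]
  simp only [Finset.sum_add_distrib, genW, sum_tensor, tensor_sum]

lemma DeltaStar_genD {n : ℕ} {η : SerX Γ 𝕜} (e : 𝕜)
    (h : ∀ i, DeltaStar (kappa ((rho AlphX.zero)^[i] η)) =
      primitive (kappa ((rho AlphX.zero)^[i] η))) {k : ℤ} {L : ℕ} (hk : n + k < L) :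
    DeltaStar (genD n e η k) = ∑ c ∈ Finset.range L,
      (tensor (genD n e η (k - c)) (yh Γ 𝕜 c) + tensor (yh Γ 𝕜 c) (genD n e η (k - c))) := by
  rw [genD, map_add, map_smul, DeltaStar_antiY, DeltaStar_genW h hk, map_sum, Finset.smul_sum,
    ← Finset.sum_add_distrib]
  refine Finset.sum_congr rfl fun c _ => ?_
  simp only [map_add, tensorSq_tensor, antiY_yh, genD, add_tensor, tensor_add, smul_tensor,
    tensor_smul, smul_add]
  abel

/-- If f ends in x_0, that letter joins the block x_0^j and κ(f) = 0; otherwise κ splits as a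
product after f, and the sum over colours absorbs the shift. -/
lemma sum_kappa_x0_pow_x (j : ℕ) (f : SerX Γ 𝕜) : ∑ σ, kappa (f * x0 ^ j * x σ) =
    kappa f * yh Γ 𝕜 (j + 1) + ∑ σ, kappa (rho AlphX.zero f * x0 ^ (j + 1) * x σ) := by
  have : ∑ σ, kappa.comp ((mulRight (x σ)).comp (mulRight (x0 ^ j))) =
      (mulRight (yh Γ 𝕜 (j + 1))).comp kappa +
        ∑ σ, kappa.comp (((mulRight (x σ)).comp (mulRight (x0 ^ (j + 1)))).comp
          (rho AlphX.zero : SerX Γ 𝕜 →L[𝕜] SerX Γ 𝕜)) := by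
    refine clm_ext_rho ?_ (fun f => ?_) fun f τ => ?_ <;>
      simp only [_root_.add_apply, _root_.sum_apply, ContinuousLinearMap.comp_apply,
        mulRight_apply, rho_one, map_zero, Finset.sum_const_zero, add_zero, kappa_one,
        one_mul, rho_x0_mul_x0, kappa_mul_x0, zero_add, rho_x0_mul_x]
    · rw [yh_succ]
      rfl
    · simp only [mul_assoc, pow_succ']
    · rw [yh_succ, ← sum_yN_mul_left j τ⁻¹, Finset.mul_sum]
      refine Finset.sum_congr rfl fun σ _ => ?_
      rw [yN, ← kappa_mul_x_mul, t_mul, t_x, t_x0_pow, mul_inv_cancel_left]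
      simp only [mul_assoc]
  simpa using DFunLike.congr_fun this f

lemma sum_kappa_x0_pow_x_iterate (j N : ℕ) (f : SerX Γ 𝕜) : ∑ σ, kappa (f * x0 ^ j * x σ) =
    ∑ i ∈ Finset.range N, kappa ((rho AlphX.zero)^[i] f) * yh Γ 𝕜 (i + (j + 1)) +
      ∑ σ, kappa ((rho AlphX.zero)^[N] f * x0 ^ (j + N) * x σ) := by
  induction N with
  | zero => simp
  | succ N ih =>
    rw [ih, sum_kappa_x0_pow_x, Finset.sum_range_succ, Function.iterate_succ_apply', add_assoc,
      add_assoc]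
    congr 3
    push_cast
    ring_nf

/-- The support of a homogeneous series. -/
lemma apply_eq_zero_of_component {M : Type*} [Monoid M] [FinGraded M] {n : ℕ} {f : Series M 𝕜}
    (hf : component n f = f) {m : M} (hm : deg m ≠ n) : f m = 0 := by
  rw [← hf, component_apply, if_neg hm]

lemma iterate_rho_apply {A : Type*} [WeightedAlphabet A] (a : A) (i : ℕ)
    (f : Series (FreeMonoid A) 𝕜) (w : FreeMonoid A) :
    (rho a)^[i] f w = f (w * FreeMonoid.of a ^ i) := by
  induction i generalizing f with
  | zero => simp
  | succ i ih => rw [Function.iterate_succ_apply, ih, rho_apply, pow_succ, mul_assoc]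

lemma iterate_lam_apply {A : Type*} [WeightedAlphabet A] (a : A) (i : ℕ)
    (f : Series (FreeMonoid A) 𝕜) (w : FreeMonoid A) :
    (lam a)^[i] f w = f (FreeMonoid.of a ^ i * w) := by
  induction i generalizing f with
  | zero => simp
  | succ i ih => rw [Function.iterate_succ_apply, ih, lam_apply, pow_succ', mul_assoc]

lemma deg_x0_pow (i : ℕ) : deg (FreeMonoid.of (AlphX.zero : AlphX Γ) ^ i) = i := by
  rw [deg_pow, deg_letterX, mul_one]

lemma iterate_rho_eq_zero {n : ℕ} {η : SerX Γ 𝕜} (hη : component n η = η) {i : ℕ} (hi : n < i) :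
    (rho AlphX.zero)^[i] η = 0 := by
  ext w
  rw [iterate_rho_apply, apply_eq_zero_of_component hη, Series.zero_apply]
  rw [deg_mul, deg_x0_pow]
  omega

lemma sum_kappa_eq_genW {n : ℕ} {η : SerX Γ 𝕜} (hη : component n η = η) (j : ℕ) :
    ∑ σ, kappa (η * x0 ^ j * x σ) = genW n η (j + 1) := by
  rw [sum_kappa_x0_pow_x_iterate j (n + 1), iterate_rho_eq_zero hη (Nat.lt_succ_self n)]
  simp [genW]

/-- Negative indices of `yh` kill the terms with i < j. The term i = j is κ(ρ_0^j η) itself, split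
by its last letter, and the terms with i > j resum by telescoping to the part coming from ρ_0^{j+1}
η. -/
lemma genW_neg {n : ℕ} {η : SerX Γ 𝕜} (hη : component n η = η)
    (h1 : ∀ i, kappa ((rho AlphX.zero)^[i] η) 1 = 0) (j : ℕ) :
    genW n η (-j) = ∑ σ, kappa (((rho AlphX.zero)^[j + 1] η +
      rho (AlphX.of σ) ((rho AlphX.zero)^[j] η)) * x σ) := by
  have e1 : genW n η (-j) = ∑ i ∈ Finset.range (j + 1 + (n + 1)),
      kappa ((rho AlphX.zero)^[i] η) * yh Γ 𝕜 (i + -j) := by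
    refine Finset.sum_subset (fun c hc => ?_) fun c _ hc => ?_
    · rw [Finset.mem_range] at hc ⊢
      omega
    · rw [Finset.mem_range] at hc
      rw [iterate_rho_eq_zero hη (by omega), map_zero, zero_mul]
  have e2 : ∑ i ∈ Finset.range j, kappa ((rho AlphX.zero)^[i] η) * yh Γ 𝕜 (i + -j) = 0 := by
    refine Finset.sum_eq_zero fun i hi => ?_
    rw [Finset.mem_range] at hi
    rw [yh_neg (by omega), mul_zero]
  have e3 := sum_kappa_x0_pow_x_iterate 0 (n + 1) ((rho AlphX.zero)^[j + 1] η)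
  rw [← Function.iterate_add_apply,
    iterate_rho_eq_zero hη (show n < n + 1 + (j + 1) by omega)] at e3
  simp only [pow_zero, mul_one, zero_mul, map_zero, Finset.sum_const_zero, add_zero] at e3
  rw [e1, Finset.sum_range_add, Finset.sum_range_succ, e2, zero_add, add_neg_cancel, yh_zero,
    mul_one, kappa_eq_sum_of_apply_one (h1 j)]
  simp only [add_mul, map_add, Finset.sum_add_distrib, e3]
  rw [add_comm]
  congr 1
  refine Finset.sum_congr rfl fun i _ => ?_
  rw [← Function.iterate_add_apply, add_comm i (j + 1)]
  congr 2
  push_cast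
  ring

/-- The data of the infinitesimal stabilizer problem in degree `n`, with `e = (-1)^n`. -/
structure IsDihedral (n : ℕ) (e : 𝕜) (η : SerX Γ 𝕜) : Prop where
  homog : component n η = η
  sq : e * e = 1
  rev : revSer η = -(e • η)
  prim : ∀ i, DeltaStar (kappa ((rho AlphX.zero)^[i] η)) =
    primitive (kappa ((rho AlphX.zero)^[i] η))

variable {n : ℕ} {e : 𝕜} {η : SerX Γ 𝕜}

/-- The series `f_{j,σ}` with `genD (-j) = ∑ kappa (f_{j,σ} x_σ)`. -/
noncomputable def negPart (η : SerX Γ 𝕜) (j : ℕ) (σ : Γ) : SerX Γ 𝕜 :=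
  ((rho AlphX.zero)^[j + 1] η + rho (AlphX.of σ) ((rho AlphX.zero)^[j] η)) -
    t σ ((lam AlphX.zero)^[j + 1] η + lam (AlphX.of σ⁻¹) ((lam AlphX.zero)^[j] η))

lemma IsDihedral.smul_revSer (h : IsDihedral n e η) : e • revSer η = -η := by
  rw [h.rev, smul_neg, smul_smul, h.sq, one_smul]

/-- The reversal symmetry of η turns the `antiY` half, which strips letters at the end, into one
that strips letters at the beginning. -/
lemma IsDihedral.genD_neg (h : IsDihedral n e η) (j : ℕ) :
    genD n e η (-j) = ∑ σ, kappa (negPart η j σ * x σ) := by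
  have h1 : ∀ i, kappa ((rho AlphX.zero)^[i] η) 1 = 0 := fun i => apply_one_of_DeltaStar (h.prim i)
  have h2 : ∀ σ : Γ, e • antiY (kappa (((rho AlphX.zero)^[j + 1] η +
      rho (AlphX.of σ) ((rho AlphX.zero)^[j] η)) * x σ)) =
      -kappa (t σ⁻¹ ((lam AlphX.zero)^[j + 1] η + lam (AlphX.of σ) ((lam AlphX.zero)^[j] η)) *
        x σ⁻¹) := fun σ => by
    rw [antiY_kappa, map_add, revSer_iterate_rho, ← lam_revSer, revSer_iterate_rho, h.rev]
    have e1 : ∀ i, (lam AlphX.zero)^[i] (-(e • η)) = -(e • (lam AlphX.zero)^[i] η) := fun i => by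
      induction i with
      | zero => rfl
      | succ i ih => rw [Function.iterate_succ_apply', ih, map_neg, map_smul,
          ← Function.iterate_succ_apply' (lam AlphX.zero) i η]
    rw [e1, e1, map_neg, map_smul, ← neg_add, ← smul_add, map_neg, map_smul, neg_mul,
      smul_mul_assoc, map_neg, map_smul, smul_neg, smul_smul, h.sq, one_smul]
  rw [genD, genW_neg h.homog h1, map_sum, Finset.smul_sum]
  simp only [h2]
  have h3 : ∑ σ : Γ, -kappa (t σ⁻¹ ((lam AlphX.zero)^[j + 1] η +
      lam (AlphX.of σ) ((lam AlphX.zero)^[j] η)) * x σ⁻¹) =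
      ∑ σ : Γ, -kappa (t σ ((lam AlphX.zero)^[j + 1] η +
        lam (AlphX.of σ⁻¹) ((lam AlphX.zero)^[j] η)) * x σ) :=
    Fintype.sum_equiv (Equiv.inv Γ) _ _ fun σ => by rw [Equiv.inv_apply, inv_inv]
  rw [h3, ← Finset.sum_add_distrib]
  refine Finset.sum_congr rfl fun σ _ => ?_
  rw [negPart, sub_mul, map_sub, sub_eq_add_neg]

lemma derY_succPNat (ξ : SerX Γ 𝕜) (j : ℕ) (σ : Γ) :
    derY ξ ⟨j.succPNat, σ⟩ = kappa ((ξ * x0 ^ j - x0 ^ j * t σ ξ) * x σ) := by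
  simp [derY]

/-- The two halves of `derY` are exchanged by `antiY` up to the sign -e because η is an eigenvector
of reversal; each half telescopes to `genW`. -/
lemma IsDihedral.sum_derY (h : IsDihedral n e η) (j : ℕ) :
    ∑ σ, derY η ⟨j.succPNat, σ⟩ = genD n e η (j + 1) := by
  have h1 : ∀ σ : Γ, e • antiY (kappa (η * x0 ^ j * x σ)) =
      -kappa (x0 ^ j * t σ⁻¹ η * x σ⁻¹) := fun σ => by
    rw [antiY_kappa, revSer_mul, revSer_x0_pow, t_mul, t_x0_pow, ← map_smul,
      ← smul_mul_assoc, ← mul_smul_comm, ← map_smul, h.smul_revSer, map_neg, mul_neg, neg_mul,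
      map_neg]
  simp only [derY_succPNat, sub_mul, map_sub, Finset.sum_sub_distrib]
  rw [genD, ← sum_kappa_eq_genW h.homog, map_sum, Finset.smul_sum]
  simp only [h1]
  rw [Finset.sum_neg_distrib, ← sub_eq_add_neg]
  congr 1
  exact Fintype.sum_equiv (Equiv.inv Γ) _ _ fun σ => by rw [Equiv.inv_apply, inv_inv]

lemma IsDihedral.sum_coderY (h : IsDihedral n e η) (m : ℕ) :
    ∑ σ, coderY η ⟨m.succPNat, σ⟩ = primitive (genD n e η (m + 1)) +
      ∑ i ∈ Finset.range m, (tensor (genD n e η (i + 1)) (yh Γ 𝕜 (m - i)) +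
        tensor (yh Γ 𝕜 (i + 1)) (genD n e η (m - i))) := by
  simp only [coderY, sum_splittings, Finset.sum_add_distrib]
  congr 1
  · simp only [primitive, Finset.sum_add_distrib, ← sum_tensor, ← tensor_sum, h.sum_derY]
  · have h1 : ∀ i ∈ Finset.range m, (yh Γ 𝕜 (m - i)) = ∑ σ, yN (m - 1 - i) σ := fun i hi => by
      have := Finset.mem_range.1 hi
      rw [show (m : ℤ) - i = (m - 1 - i : ℕ) + 1 by omega, yh_succ]
    have h2 : ∀ i ∈ Finset.range m, genD n e η (m - i) =
        ∑ σ, derY η ⟨(m - 1 - i).succPNat, σ⟩ := fun i hi => by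
      have := Finset.mem_range.1 hi
      rw [show (m : ℤ) - i = (m - 1 - i : ℕ) + 1 by omega, h.sum_derY]
    congr 1
    · rw [Finset.sum_comm]
      refine Finset.sum_congr rfl fun i hi => ?_
      rw [h1 i hi, ← h.sum_derY, ← sum_tensor_split]
      simp only [yN_eq]
    · rw [Finset.sum_comm]
      refine Finset.sum_congr rfl fun i hi => ?_
      rw [h2 i hi, yh_succ,
        ← sum_tensor_split (fun σ => yN i σ) (fun σ => derY η ⟨(m - 1 - i).succPNat, σ⟩)]
      simp only [yN_eq]

/-- The coproduct of genD(m+1) has terms genD(m+1-c) for all c ≥ 0, while the coderivation formula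
stops at c = m. The excess consists of members with index at most 0. -/
lemma IsDihedral.sum_DeltaStar_derY (h : IsDihedral n e η) (h0 : ∀ j : ℕ, genD n e η (-j) = 0)
    (m : ℕ) : ∑ σ, DeltaStar (derY η ⟨m.succPNat, σ⟩) = ∑ σ, coderY η ⟨m.succPNat, σ⟩ := by
  have h1 : ∀ k : ℤ, k ≤ 0 → genD n e η k = 0 := fun k hk => by
    have := h0 k.natAbs
    rwa [show -(k.natAbs : ℤ) = k by omega] at this
  have hL : (n : ℤ) + (m + 1) < ((m + 1 + (n + 1) : ℕ) : ℤ) := by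
    push_cast
    omega
  rw [h.sum_coderY, ← map_sum, h.sum_derY, DeltaStar_genD e h.prim hL, Finset.sum_range_add,
    add_comm, Finset.sum_eq_zero (s := Finset.range (n + 1)), zero_add, Finset.sum_range_succ',
    add_comm]
  · congr 1
    rw [Finset.sum_add_distrib, Finset.sum_add_distrib, ← Finset.sum_range_reflect]
    congr 1 <;> refine Finset.sum_congr rfl fun i hi => ?_
    · have := Finset.mem_range.1 hi
      rw [show (m : ℤ) + 1 - (m - 1 - i + 1 : ℕ) = i + 1 by omega,
        show ((m - 1 - i + 1 : ℕ) : ℤ) = m - i by omega]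
    · rw [show (m : ℤ) + 1 - (i + 1 : ℕ) = m - i by omega, Nat.cast_succ]
  · intro c _
    rw [h1 _ (by push_cast; omega), tensor_zero, zero_tensor, add_zero]

/-! #### The total colour -/

/-- The projection on the words of total colour `σ`. -/
noncomputable def colPart [DecidableEq Γ] (σ : Γ) : SerY Γ 𝕜 →L[𝕜] SerY Γ 𝕜 :=
  weight fun w => if col w = σ then 1 else 0

/-- The projection on the pairs of words of total colour `σ`. -/
noncomputable def colPartPair [DecidableEq Γ] (σ : Γ) : SerYY Γ 𝕜 →L[𝕜] SerYY Γ 𝕜 :=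
  weight fun p => if col p.1 * col p.2 = σ then 1 else 0

lemma colPartPair_tensor [DecidableEq Γ] {σ τ τ' : Γ} {f g : SerY Γ 𝕜} (hf : colPart τ f = f)
    (hg : colPart τ' g = g) :
    colPartPair σ (tensor f g) = if τ * τ' = σ then tensor f g else 0 := by
  ext p
  rw [← hf, ← hg, colPartPair, weight_apply, tensor_apply, colPart, colPart, weight_apply,
    weight_apply]
  by_cases h1 : col p.1 = τ
  · by_cases h2 : col p.2 = τ'
    · rw [h1, h2, if_pos rfl, if_pos rfl]
      split_ifs
      · simp [tensor_apply, weight_apply, h1, h2]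
      · simp
    · rw [if_neg h2]
      split_ifs <;> simp [tensor_apply, weight_apply, h2]
  · rw [if_neg h1]
    split_ifs <;> simp [tensor_apply, weight_apply, h1]

lemma colPart_one [DecidableEq Γ] : colPart 1 (1 : SerY Γ 𝕜) = 1 := by
  rw [one_def, colPart, weight_single, map_one, if_pos rfl, one_smul]

lemma colPart_kappa [DecidableEq Γ] (f : SerX Γ 𝕜) (σ τ : Γ) :
    colPart τ (kappa (f * x σ)) = if σ = τ then kappa (f * x σ) else 0 := by
  classical
  ext w
  rw [colPart, weight_apply]
  rcases eq_one_or_mul_of w with rfl | ⟨v, a, rfl⟩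
  · have : kappa (f * x σ) 1 = 0 := by
      rw [kappa_apply_one, mul_apply_one, x, single_of_apply_one, mul_zero]
    rw [this, mul_zero]
    split_ifs
    · exact this.symm
    · rfl
  · have h : kappa (f * x σ) (v * FreeMonoid.of a) =
        if col v * a.col = σ then f (psi v * FreeMonoid.of AlphX.zero ^ ((a.idx : ℕ) - 1)) else 0 := by
      rw [kappa_apply, psi_mul_of, wordX, ← mul_assoc, x, mul_single_apply]
      simp
    rw [h, map_mul, col_of]
    by_cases h1 : col v * a.col = σ
    · rw [if_pos h1, h1]
      split_ifs
      · rw [h, if_pos h1, one_mul]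
      · rw [zero_mul]
        rfl
    · rw [if_neg h1, mul_zero]
      split_ifs
      · rw [h, if_neg h1]
      · rfl

lemma colPart_yN [DecidableEq Γ] (m : ℕ) (σ : Γ) : colPart σ (yN m σ : SerY Γ 𝕜) = yN m σ := by
  rw [yN, colPart_kappa, if_pos rfl]

lemma colPartPair_harmonicLetter [DecidableEq Γ] (m : ℕ) (σ τ : Γ) :
    colPartPair τ (DeltaStar (yN m σ : SerY Γ 𝕜)) =
      if σ = τ then DeltaStar (yN m σ) else 0 := by
  rw [DeltaStar_yN, primitive]
  simp only [map_add, map_sum, colPartPair_tensor (colPart_yN _ _) (colPart_yN _ _),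
    colPartPair_tensor (colPart_yN _ _) colPart_one, colPartPair_tensor colPart_one (colPart_yN _ _),
    mul_one, one_mul, mul_inv_cancel_left]
  split_ifs <;> simp

lemma colPartPair_mul [DecidableEq Γ] {F : SerYY Γ 𝕜} {σ : Γ}
    (hF : ∀ τ, colPartPair τ F = if σ = τ then F else 0) (G : SerYY Γ 𝕜) (τ : Γ) :
    colPartPair τ (F * G) = F * colPartPair (σ⁻¹ * τ) G := by
  have hF' : ∀ p, F p ≠ 0 → col p.1 * col p.2 = σ := fun p hp => by
    by_contra h
    have h1 := congrArg (fun s : SerYY Γ 𝕜 => s p) (hF σ)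
    simp only [if_true, colPartPair, weight_apply, if_neg h, zero_mul] at h1
    exact hp h1.symm
  ext p
  rw [colPartPair, weight_apply, mul_apply, mul_apply, Finset.mul_sum]
  refine Finset.sum_congr rfl fun q hq => ?_
  rw [colPartPair, weight_apply]
  by_cases h : F q.1 = 0
  · rw [h, zero_mul, zero_mul, mul_zero]
  · have h1 := hF' _ h
    rw [mem_fac] at hq
    rw [← hq, Prod.fst_mul, Prod.snd_mul, map_mul, map_mul, mul_mul_mul_comm, h1]
    by_cases h2 : col q.2.1 * col q.2.2 = σ⁻¹ * τ
    · rw [if_pos h2, h2, mul_inv_cancel_left, if_pos rfl, one_mul, one_mul]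
    · rw [if_neg h2, if_neg, zero_mul, zero_mul, mul_zero]
      intro h3
      exact h2 (by rw [← h3, inv_mul_cancel_left])

/-- The harmonic coproduct of a letter preserves the product of colours; since Γ is commutative this
passes to products. -/
lemma DeltaStar_colPart [DecidableEq Γ] (σ : Γ) (f : SerY Γ 𝕜) :
    DeltaStar (colPart σ f) = colPartPair σ (DeltaStar f) := by
  have : DeltaStar.comp (colPart σ) = (colPartPair σ).comp
      (DeltaStar : SerY Γ 𝕜 →L[𝕜] SerYY Γ 𝕜) := by
    refine clm_ext fun w => ?_
    rw [ContinuousLinearMap.comp_apply, ContinuousLinearMap.comp_apply, colPart, weight_single,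
      map_smul]
    induction w using FreeMonoid.inductionOn' generalizing σ with
    | one =>
      rw [← one_def, DeltaStar_one, ← tensor_one_one, colPartPair_tensor colPart_one colPart_one,
        map_one, mul_one]
      split_ifs <;> simp
    | of_mul a w ih =>
      rw [single_of_mul, DeltaStar_mul, single_of_eq_yN,
        colPartPair_mul (colPartPair_harmonicLetter _ _), ← ih, map_mul, col_of, mul_smul_comm]
      congr 2
      exact propext ⟨fun h => by rw [← h, inv_mul_cancel_left], fun h => by
        rw [h, mul_inv_cancel_left]⟩
  exact DFunLike.congr_fun this f

lemma colPart_derY [DecidableEq Γ] (ξ : SerX Γ 𝕜) (a : AlphY Γ) (τ : Γ) :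
    colPart τ (derY ξ a) = if a.col = τ then derY ξ a else 0 := colPart_kappa _ _ _

lemma colPart_letter [DecidableEq Γ] (a : AlphY Γ) : colPart a.col
    (single (FreeMonoid.of a) : SerY Γ 𝕜) = single (FreeMonoid.of a) := by
  rw [single_of_eq_yN, colPart_yN]

lemma colPartPair_coderY [DecidableEq Γ] (ξ : SerX Γ 𝕜) (a : AlphY Γ) (τ : Γ) :
    colPartPair τ (coderY ξ a) = if a.col = τ then coderY ξ a else 0 := by
  have h : ∀ b, colPart b.col (derY ξ b) = derY ξ b := fun b => by
    rw [colPart_derY, if_pos rfl]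
  have h1 : ∀ p ∈ (finite_splittings a).toFinset, colPartPair τ
      (tensor (derY ξ p.1) (single (FreeMonoid.of p.2)) +
        tensor (single (FreeMonoid.of p.1)) (derY ξ p.2)) = if a.col = τ then
      (tensor (derY ξ p.1) (single (FreeMonoid.of p.2)) +
        tensor (single (FreeMonoid.of p.1)) (derY ξ p.2)) else 0 := fun p hp => by
    rw [mem_splittings] at hp
    have : p.1.col * p.2.col = a.col := by rw [← hp, merge]
    rw [map_add, colPartPair_tensor (h _) (colPart_letter _),
      colPartPair_tensor (colPart_letter _) (h _), this]
    split_ifs <;> simp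
  rw [coderY, map_add, map_sum, Finset.sum_congr rfl h1, primitive, map_add,
    colPartPair_tensor (h _) colPart_one, colPartPair_tensor colPart_one (h _), mul_one, one_mul]
  split_ifs <;> simp

/-- The vanishing of `genD` in degrees `≤ 0` solves the stabilizer problem. -/
lemma IsDihedral.eps_eq_zero (h : IsDihedral n e η) (h0 : ∀ j : ℕ, genD n e η (-j) = 0) :
    eps η = 0 := by
  classical
  refine (eps_eq_zero_iff η).2 ⟨h.prim 0, fun a => ?_⟩
  have h1 : a = ⟨((a.idx : ℕ) - 1).succPNat, a.col⟩ := by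
    obtain ⟨i, c⟩ := a
    congr 1
    have := i.pos
    exact PNat.eq (by simp only [Nat.succPNat_coe, Nat.succ_eq_add_one]; omega)
  -- The identity is known only after summation over the colours of the letter; the summands have
  -- distinct total colours, so projecting isolates one.
  have h2 := congrArg (colPartPair a.col) (h.sum_DeltaStar_derY h0 ((a.idx : ℕ) - 1))
  rw [map_sum, map_sum] at h2
  simp only [← DeltaStar_colPart, colPart_derY, colPartPair_coderY, apply_ite DeltaStar, map_zero,
    Finset.sum_ite_eq', Finset.mem_univ, if_true] at h2
  rwa [← h1] at h2

end Generating

/-! ### The duality between the two ends of a word -/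

section Ends

variable {Γ : Type*} [CommGroup Γ] [Fintype Γ] {𝕜 : Type*} [CommRing 𝕜]

lemma rho_t (σ τ : Γ) (f : SerX Γ 𝕜) :
    rho (AlphX.of τ) (t σ f) = t σ (rho (AlphX.of (σ⁻¹ * τ)) f) := by
  rw [t_rho, shiftLetter, mul_inv_cancel_left]

lemma lam_t (σ τ : Γ) (f : SerX Γ 𝕜) :
    lam (AlphX.of τ) (t σ f) = t σ (lam (AlphX.of (σ⁻¹ * τ)) f) := by
  rw [t_lam, shiftLetter, mul_inv_cancel_left]

lemma iterate_map_add {M : Type*} (S : Series M 𝕜 →L[𝕜] Series M 𝕜) (i : ℕ) (f g : Series M 𝕜) :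
    S^[i] (f + g) = S^[i] f + S^[i] g := by
  induction i with
  | zero => rfl
  | succ i ih => simp only [Function.iterate_succ_apply', ih, map_add]

lemma iterate_map_sub {M : Type*} (S : Series M 𝕜 →L[𝕜] Series M 𝕜) (i : ℕ) (f g : Series M 𝕜) :
    S^[i] (f - g) = S^[i] f - S^[i] g := by
  induction i with
  | zero => rfl
  | succ i ih => simp only [Function.iterate_succ_apply', ih, map_sub]

lemma iterate_map_smul {M : Type*} (S : Series M 𝕜 →L[𝕜] Series M 𝕜) (i : ℕ) (c : 𝕜)
    (f : Series M 𝕜) : S^[i] (c • f) = c • S^[i] f := by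
  induction i with
  | zero => rfl
  | succ i ih => simp only [Function.iterate_succ_apply', ih, map_smul]

lemma iterate_comm {M : Type*} {S T : Series M 𝕜 →L[𝕜] Series M 𝕜} (h : ∀ f, S (T f) = T (S f))
    (i : ℕ) (f : Series M 𝕜) : S^[i] (T f) = T (S^[i] f) := by
  induction i with
  | zero => rfl
  | succ i ih => rw [Function.iterate_succ_apply', Function.iterate_succ_apply', ih, h]

lemma iterate_rho_zero_t (σ : Γ) (i : ℕ) (f : SerX Γ 𝕜) :
    (rho AlphX.zero)^[i] (t σ f) = t σ ((rho AlphX.zero)^[i] f) :=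
  iterate_comm (fun f => (t_rho σ AlphX.zero f).symm) i f

lemma iterate_lam_zero_t (σ : Γ) (i : ℕ) (f : SerX Γ 𝕜) :
    (lam AlphX.zero)^[i] (t σ f) = t σ ((lam AlphX.zero)^[i] f) :=
  iterate_comm (fun f => (t_lam σ AlphX.zero f).symm) i f

lemma iterate_rho_zero_nuX (i : ℕ) (f : SerX Γ 𝕜) :
    (rho AlphX.zero)^[i] (nuX f) = nuX ((rho AlphX.zero)^[i] f) :=
  iterate_comm rho_zero_nuX i f

lemma iterate_lam_zero_nuX (i : ℕ) (f : SerX Γ 𝕜) :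
    (lam AlphX.zero)^[i] (nuX f) = nuX ((lam AlphX.zero)^[i] f) :=
  iterate_comm lam_zero_nuX i f

lemma iterate_rho_lam (a b : AlphX Γ) (i : ℕ) (f : SerX Γ 𝕜) :
    (rho a)^[i] (lam b f) = lam b ((rho a)^[i] f) := iterate_comm (rho_lam a b) i f

lemma iterate_rho_iterate_lam (a b : AlphX Γ) (i j : ℕ) (f : SerX Γ 𝕜) :
    (rho a)^[i] ((lam b)^[j] f) = (lam b)^[j] ((rho a)^[i] f) := by
  induction j with
  | zero => rfl
  | succ j ih =>
    rw [Function.iterate_succ_apply', Function.iterate_succ_apply', iterate_rho_lam, ih]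

lemma rho_iterate_lam (a b : AlphX Γ) (j : ℕ) (f : SerX Γ 𝕜) :
    rho a ((lam b)^[j] f) = (lam b)^[j] (rho a f) := iterate_rho_iterate_lam a b 1 j f

/-- The part of `η` ending in `x_σ x_0^i`. -/
noncomputable def endPart (η : SerX Γ 𝕜) (i : ℕ) (σ : Γ) : SerX Γ 𝕜 :=
  rho (AlphX.of σ) ((rho AlphX.zero)^[i] η)

/-- The part of `η` beginning with `x_0^i x_{σ⁻¹}`. -/
noncomputable def startPart (η : SerX Γ 𝕜) (i : ℕ) (σ : Γ) : SerX Γ 𝕜 :=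
  t σ (lam (AlphX.of σ⁻¹) ((lam AlphX.zero)^[i] η))

variable {n : ℕ} {e : 𝕜} {η : SerX Γ 𝕜}

/-- Duality for the primitive element κ(ρ_0^i η), with the reversal of η eliminated by its symmetry.
-/
lemma IsDihedral.nuX_endPart (h : IsDihedral n e η) (i : ℕ) (σ : Γ) :
    nuX (endPart η i σ⁻¹) = -(e • startPart η i σ) := by
  have h1 := t_revSer_rho (h.prim i) σ⁻¹
  rw [← lam_revSer, revSer_iterate_rho, h.rev, ← smul_neg, iterate_map_smul, inv_inv] at h1
  rw [endPart, ← h1, startPart, map_smul, map_smul, ← smul_neg]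
  congr 1
  rw [← map_neg, ← map_neg, ← neg_one_smul 𝕜 η, iterate_map_smul, neg_one_smul]

lemma IsDihedral.nuX_startPart (h : IsDihedral n e η) (i : ℕ) (σ : Γ) :
    nuX (startPart η i σ⁻¹) = -(e • endPart η i σ) := by
  have h1 := h.nuX_endPart i σ⁻¹
  have h2 := congrArg nuX h1
  rw [nuX_nuX, inv_inv, map_neg, map_smul] at h2
  rw [h2, smul_neg, neg_neg, smul_smul, h.sq, one_smul]

/-- The obstruction to the cyclic antisymmetry. -/
noncomputable def cycObst (η : SerX Γ 𝕜) (a a' : ℕ) (σ τ : Γ) : SerX Γ 𝕜 :=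
  rho (AlphX.of τ) ((rho AlphX.zero)^[a'] (negPart η a σ)) +
    t σ (lam (AlphX.of σ⁻¹) ((lam AlphX.zero)^[a] (negPart η a' (σ⁻¹ * τ))))

lemma rho_startPart (η : SerX Γ 𝕜) (a a' : ℕ) (σ τ : Γ) :
    rho (AlphX.of τ) ((rho AlphX.zero)^[a'] (startPart η a σ)) =
      t σ (lam (AlphX.of σ⁻¹) ((lam AlphX.zero)^[a] (endPart η a' (σ⁻¹ * τ)))) := by
  rw [startPart, endPart, iterate_rho_zero_t, rho_t, iterate_rho_lam, rho_lam,
    iterate_rho_iterate_lam, rho_iterate_lam]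

lemma negPart_eq (η : SerX Γ 𝕜) (j : ℕ) (σ : Γ) : negPart η j σ =
    (rho AlphX.zero)^[j + 1] η + endPart η j σ - t σ ((lam AlphX.zero)^[j + 1] η) -
      startPart η j σ := by
  rw [negPart, map_add, endPart, startPart, sub_sub]

/-- The terms that strip both a coloured end and a coloured start of η occur twice with opposite
signs, by `rho_startPart`, and cancel. -/
lemma cycObst_eq (η : SerX Γ 𝕜) (a a' : ℕ) (σ τ : Γ) : cycObst η a a' σ τ =
    endPart η (a' + (a + 1)) τ - startPart η (a' + (a + 1)) τ +
    (rho (AlphX.of τ) ((rho AlphX.zero)^[a'] (endPart η a σ)) -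
      t σ ((lam AlphX.zero)^[a + 1] (endPart η a' (σ⁻¹ * τ))) +
      (rho AlphX.zero)^[a' + 1] (startPart η a σ) -
      t σ (lam (AlphX.of σ⁻¹) ((lam AlphX.zero)^[a] (startPart η a' (σ⁻¹ * τ))))) := by
  have e1 : rho (AlphX.of τ) ((rho AlphX.zero)^[a'] ((rho AlphX.zero)^[a + 1] η)) =
      endPart η (a' + (a + 1)) τ := by
    rw [endPart, Function.iterate_add_apply _ a' (a + 1)]
  have e2 : rho (AlphX.of τ) ((rho AlphX.zero)^[a'] (t σ ((lam AlphX.zero)^[a + 1] η))) =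
      t σ ((lam AlphX.zero)^[a + 1] (endPart η a' (σ⁻¹ * τ))) := by
    rw [iterate_rho_zero_t, rho_t, iterate_rho_iterate_lam, rho_iterate_lam, endPart]
  have e3 : t σ (lam (AlphX.of σ⁻¹) ((lam AlphX.zero)^[a] ((rho AlphX.zero)^[a' + 1] η))) =
      (rho AlphX.zero)^[a' + 1] (startPart η a σ) := by
    rw [startPart, iterate_rho_zero_t, iterate_rho_lam, iterate_rho_iterate_lam]
  have e4 : t σ (lam (AlphX.of σ⁻¹) ((lam AlphX.zero)^[a]
      (t (σ⁻¹ * τ) ((lam AlphX.zero)^[a' + 1] η)))) = startPart η (a' + (a + 1)) τ := by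
    rw [iterate_lam_zero_t, lam_t, t_t, mul_inv_cancel_left, startPart,
      ← Function.iterate_add_apply]
    congr 3
    · rw [mul_inv_rev, inv_inv, mul_inv_cancel_right]
    · rw [show a + (a' + 1) = a' + (a + 1) by omega]
  rw [cycObst, negPart_eq, negPart_eq]
  simp only [iterate_map_sub, iterate_map_add, map_sub, map_add, e1, e2, e3, e4, rho_startPart]
  abel

lemma rho_add_rho (σ : Γ) (i : ℕ) (f : SerX Γ 𝕜) :
    rho (AlphX.of σ) ((rho AlphX.zero)^[i] (nuX f)) + (rho AlphX.zero)^[i + 1] (nuX f) =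
      -nuX (rho (AlphX.of σ⁻¹) ((rho AlphX.zero)^[i] f)) := by
  rw [Function.iterate_succ_apply', iterate_rho_zero_nuX, rho_of_nuX]

lemma lam_add_lam (σ : Γ) (i : ℕ) (f : SerX Γ 𝕜) :
    lam (AlphX.of σ) ((lam AlphX.zero)^[i] (nuX f)) + (lam AlphX.zero)^[i + 1] (nuX f) =
      -nuX (lam (AlphX.of σ⁻¹) ((lam AlphX.zero)^[i] f)) := by
  rw [Function.iterate_succ_apply', iterate_lam_zero_nuX, lam_of_nuX]

lemma IsDihedral.eq_nuX (h : IsDihedral n e η) (i : ℕ) (σ : Γ) :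
    startPart η i σ = -(e • nuX (endPart η i σ⁻¹)) := by
  rw [h.nuX_endPart, smul_neg, neg_neg, smul_smul, h.sq, one_smul]

lemma IsDihedral.eq_nuX' (h : IsDihedral n e η) (i : ℕ) (σ : Γ) :
    endPart η i σ = -(e • nuX (startPart η i σ⁻¹)) := by
  rw [h.nuX_startPart, smul_neg, neg_neg, smul_smul, h.sq, one_smul]

lemma iterate_map_neg {M : Type*} (S : Series M 𝕜 →L[𝕜] Series M 𝕜) (i : ℕ) (f : Series M 𝕜) :
    S^[i] (-f) = -S^[i] f := by
  rw [← neg_one_smul 𝕜 f, iterate_map_smul, neg_one_smul]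

/-- ν exchanges end parts and start parts up to the factor -e and commutes with stripping x_0, but
stripping a coloured letter from ν(f) creates an extra term (`rho_add_rho`, `lam_add_lam`). The
extra terms balance because stripping both ends can be computed in two ways, which is `k5`. -/
lemma IsDihedral.nuX_cycObst (h : IsDihedral n e η) (a a' : ℕ) (σ τ : Γ) :
    nuX (cycObst η a a' σ⁻¹ τ⁻¹) = e • cycObst η a a' σ τ := by
  have r1 : (σ⁻¹)⁻¹ * τ⁻¹ = (σ⁻¹ * τ)⁻¹ := by rw [mul_inv]
  -- the images of the four terms
  have k1 : nuX (rho (AlphX.of τ⁻¹) ((rho AlphX.zero)^[a'] (endPart η a σ⁻¹))) =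
      e • (rho (AlphX.of τ) ((rho AlphX.zero)^[a'] (startPart η a σ)) +
        (rho AlphX.zero)^[a' + 1] (startPart η a σ)) := by
    have := rho_add_rho τ a' (endPart η a σ⁻¹)
    rw [h.nuX_endPart, iterate_map_neg, iterate_map_neg, iterate_map_smul, iterate_map_smul,
      map_neg, map_smul, ← neg_add, neg_inj, ← smul_add] at this
    exact this.symm
  have k2 : nuX (t σ⁻¹ ((lam AlphX.zero)^[a + 1] (endPart η a' (σ⁻¹ * τ)⁻¹))) =
      -(e • t σ ((lam AlphX.zero)^[a + 1] (startPart η a' (σ⁻¹ * τ)))) := by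
    rw [nuX_t, inv_inv, ← iterate_lam_zero_nuX, h.nuX_endPart, iterate_map_neg, iterate_map_smul,
      map_neg, map_smul]
  have k3 : nuX ((rho AlphX.zero)^[a' + 1] (startPart η a σ⁻¹)) =
      -(e • (rho AlphX.zero)^[a' + 1] (endPart η a σ)) := by
    rw [← iterate_rho_zero_nuX, h.nuX_startPart, iterate_map_neg, iterate_map_smul]
  have k4 : ∀ f : SerX Γ 𝕜, nuX (t σ⁻¹ (lam (AlphX.of σ) ((lam AlphX.zero)^[a] f))) =
      -(t σ (lam (AlphX.of σ⁻¹) ((lam AlphX.zero)^[a] (nuX f))) +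
        t σ ((lam AlphX.zero)^[a + 1] (nuX f))) := fun f => by
    have := lam_add_lam σ⁻¹ a f
    rw [inv_inv] at this
    rw [nuX_t, inv_inv, ← map_add, this, map_neg, neg_neg]
  -- the relation between the two ends
  have k5 : rho (AlphX.of τ) ((rho AlphX.zero)^[a'] (endPart η a σ)) +
      (rho AlphX.zero)^[a' + 1] (endPart η a σ) =
      t σ (lam (AlphX.of σ⁻¹) ((lam AlphX.zero)^[a] (startPart η a' (σ⁻¹ * τ)))) +
        t σ ((lam AlphX.zero)^[a + 1] (startPart η a' (σ⁻¹ * τ))) := by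
    have e1 : endPart η a σ = nuX (-(e • startPart η a σ⁻¹)) := by
      rw [map_neg, map_smul, ← h.eq_nuX']
    have e2 : startPart η a' (σ⁻¹ * τ) = nuX (-(e • endPart η a' (σ⁻¹ * τ)⁻¹)) := by
      rw [map_neg, map_smul, ← h.eq_nuX]
    have e3 := k4 (-(e • endPart η a' (σ⁻¹ * τ)⁻¹))
    rw [← e2] at e3
    rw [← neg_eq_iff_eq_neg] at e3
    rw [← e3, e1, rho_add_rho]
    congr 2
    rw [iterate_map_neg, iterate_map_neg, iterate_map_smul, iterate_map_smul, map_neg, map_neg,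
      map_smul, map_smul, rho_startPart, r1, inv_inv, map_neg, map_smul]
  rw [cycObst_eq, cycObst_eq, r1, inv_inv]
  simp only [map_sub, map_add, k1, k2, k3, k4, h.nuX_endPart, h.nuX_startPart, rho_startPart,
    iterate_map_neg, iterate_map_smul, map_neg, map_smul]
  have k6 := congrArg (fun f => e • f) k5
  simp only [smul_add, smul_sub] at k6 ⊢
  rw [← sub_eq_zero] at k6 ⊢
  rw [← neg_eq_zero, ← k6]
  abel

end Ends

/-! ### The length filtration -/

section Length

variable {A : Type*} [WeightedAlphabet A] {𝕜 : Type*} [CommRing 𝕜]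

variable (A 𝕜) in
/-- The series without words of length `< d`. -/
def LenFilt (d : ℕ) : Submodule 𝕜 (Series (FreeMonoid A) 𝕜) where
  carrier := {f | ∀ w, w.length < d → f w = 0}
  add_mem' hf hg m hm := by simp [hf m hm, hg m hm]
  zero_mem' _ _ := rfl
  smul_mem' c f hf m hm := by simp [hf m hm]

lemma lenFilt_anti {a b : ℕ} (h : a ≤ b) : LenFilt A 𝕜 b ≤ LenFilt A 𝕜 a :=
  fun _ hf w hw => hf w (by omega)

lemma lenFilt_zero (f : Series (FreeMonoid A) 𝕜) : f ∈ LenFilt A 𝕜 0 :=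
  fun _ hw => absurd hw (by omega)

lemma mem_lenFilt_one {f : Series (FreeMonoid A) 𝕜} : f ∈ LenFilt A 𝕜 1 ↔ f 1 = 0 := by
  refine ⟨fun h => h 1 (by simp), fun h w hw => ?_⟩
  rw [Nat.lt_one_iff, FreeMonoid.length_eq_zero] at hw
  rw [hw, h]

lemma single_mem_lenFilt (w : FreeMonoid A) :
    (single w : Series (FreeMonoid A) 𝕜) ∈ LenFilt A 𝕜 w.length := fun v hv =>
  single_of_ne fun h => by
    rw [h] at hv
    omega

lemma mul_mem_lenFilt {a b : ℕ} {f g : Series (FreeMonoid A) 𝕜} (hf : f ∈ LenFilt A 𝕜 a)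
    (hg : g ∈ LenFilt A 𝕜 b) : f * g ∈ LenFilt A 𝕜 (a + b) := by
  intro w hw
  rw [mul_apply]
  refine Finset.sum_eq_zero fun p hp => ?_
  rw [mem_fac] at hp
  have h1 : w.length = p.1.length + p.2.length := by rw [← hp, FreeMonoid.length_mul]
  rcases lt_or_ge p.1.length a with h | h
  · rw [hf _ h, zero_mul]
  · rw [hg p.2 (by omega), mul_zero]

lemma clm_mem_lenFilt {S : Series (FreeMonoid A) 𝕜 →L[𝕜] Series (FreeMonoid A) 𝕜} {k : ℕ}
    (hS : ∀ w, S (single w) ∈ LenFilt A 𝕜 (w.length + k)) {d : ℕ} {f : Series (FreeMonoid A) 𝕜}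
    (hf : f ∈ LenFilt A 𝕜 d) : S f ∈ LenFilt A 𝕜 (d + k) := by
  intro w hw
  rw [clm_apply_eq_sum S f w (finite_of_continuous S w).toFinset (by simp)]
  refine Finset.sum_eq_zero fun m _ => ?_
  rcases lt_or_ge m.length d with h | h
  · rw [hf m h, zero_mul]
  · rw [hS m w (by omega), mul_zero]

end Length

/-! ### Parity and cyclic antisymmetry of the part of lowest length. -/

section Parity

variable {Γ : Type*} [CommGroup Γ] [Fintype Γ] {𝕜 : Type*} [CommRing 𝕜]

lemma length_map_invLetter (w : FreeMonoid (AlphY Γ)) :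
    (FreeMonoid.map invLetter w).length = w.length := List.length_map _

lemma map_invLetter_map_invLetter (w : FreeMonoid (AlphY Γ)) :
    FreeMonoid.map invLetter (FreeMonoid.map invLetter w) = w := by
  induction w using FreeMonoid.inductionOn' with
  | one => rfl
  | of_mul a w ih => rw [map_mul, map_mul, ih, FreeMonoid.map_of, FreeMonoid.map_of,
      invLetter_invLetter]

/-- The automorphism `y_{n,σ} ↦ -y_{n,σ⁻¹}`. -/
noncomputable def signInv : SerY Γ 𝕜 →L[𝕜] SerY Γ 𝕜 :=
  (weight fun w => (-1) ^ w.length).comp (comap (FreeMonoid.map invLetter))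

lemma signInv_apply (f : SerY Γ 𝕜) (w : FreeMonoid (AlphY Γ)) :
    signInv f w = (-1) ^ w.length * f (FreeMonoid.map invLetter w) := rfl

lemma signInv_single (w : FreeMonoid (AlphY Γ)) : signInv (single w : SerY Γ 𝕜) =
    (-1 : 𝕜) ^ w.length • (single (FreeMonoid.map invLetter w) : SerY Γ 𝕜) := by
  ext v
  rw [signInv_apply, Series.smul_apply]
  by_cases h : v = FreeMonoid.map invLetter w
  · rw [h, map_invLetter_map_invLetter, single_self, single_self, length_map_invLetter]
  · rw [single_of_ne h, single_of_ne, mul_zero, mul_zero]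
    rintro rfl
    exact h (map_invLetter_map_invLetter v).symm

lemma signInv_mul (f g : SerY Γ 𝕜) : signInv (f * g) = signInv f * signInv g :=
  bilin_ext (fun a b => by
    rw [signInv_single, signInv_single, signInv_single, smul_mul_smul_comm, single_mul_single,
      FreeMonoid.length_mul, pow_add, map_mul]) f g

lemma signInv_single_mem_lenFilt (w : FreeMonoid (AlphY Γ)) :
    signInv (single w : SerY Γ 𝕜) ∈ LenFilt _ 𝕜 w.length := by
  rw [signInv_single]
  refine Submodule.smul_mem _ _ ?_
  have := single_mem_lenFilt (𝕜 := 𝕜) (FreeMonoid.map invLetter w)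
  rwa [length_map_invLetter] at this

lemma kappa_mul_x_mem_lenFilt (f : SerX Γ 𝕜) (σ : Γ) : kappa (f * x σ) ∈ LenFilt _ 𝕜 1 := by
  rw [mem_lenFilt_one, kappa_apply_one, mul_apply_one, x, single_of_apply_one, mul_zero]

/-- The difference between ν(x_0^m) and x_0^m contains coloured letters, so the correction to
-y_{m+1,σ⁻¹} has length at least two. -/
lemma nuY_yN_sub_signInv (m : ℕ) (σ : Γ) :
    nuY (yN m σ : SerY Γ 𝕜) - signInv (yN m σ) ∈ LenFilt _ 𝕜 2 := by
  have h1 : signInv (yN m σ : SerY Γ 𝕜) = -kappa (x0 ^ m * x σ⁻¹) := by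
    rw [← yN, yN_eq, yN_eq, signInv_single]
    simp [invLetter]
  rw [h1, nuY_yN, neg_sub_neg, ← map_sub, ← sub_mul, nuX_x0_pow_telescope, Finset.sum_mul, map_sum]
  refine Submodule.sum_mem _ fun i _ => ?_
  rw [Finset.mul_sum, Finset.sum_mul, Finset.sum_mul, map_sum]
  refine Submodule.sum_mem _ fun τ _ => ?_
  have h2 : x0 ^ (m - 1 - i) * x τ * nuX (x0 ^ i) * x σ⁻¹ =
      x0 ^ (m - 1 - i) * x τ * t τ (t τ⁻¹ (nuX (x0 ^ i)) * x (τ⁻¹ * σ⁻¹) : SerX Γ 𝕜) := by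
    rw [t_mul, t_t, mul_inv_cancel, t_one_left, t_x, mul_inv_cancel_left, mul_assoc]
  rw [h2, kappa_mul_x_mul]
  exact mul_mem_lenFilt (kappa_mul_x_mem_lenFilt _ _) (kappa_mul_x_mem_lenFilt _ _)

lemma nuY_sub_signInv_single (w : FreeMonoid (AlphY Γ)) :
    (nuY - signInv : SerY Γ 𝕜 →L[𝕜] SerY Γ 𝕜) (single w) ∈ LenFilt _ 𝕜 (w.length + 1) := by
  rw [_root_.sub_apply]
  induction w using FreeMonoid.inductionOn' with
  | one =>
    rw [signInv_single, ← one_def, nuY_one, map_one, ← one_def, FreeMonoid.length_one, pow_zero,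
      one_smul, sub_self]
    exact Submodule.zero_mem _
  | of_mul a w ih =>
    rw [single_of_mul, nuY_mul, signInv_mul, FreeMonoid.length_mul, FreeMonoid.length_of]
    have e : ∀ A B C D : SerY Γ 𝕜, A * B - C * D = (A - C) * (B - D) + (A - C) * D + C * (B - D) :=
      fun A B C D => by noncomm_ring
    have h1 : nuY (single (FreeMonoid.of a) : SerY Γ 𝕜) - signInv (single (FreeMonoid.of a)) ∈
        LenFilt _ 𝕜 2 := by
      rw [single_of_eq_yN]
      exact nuY_yN_sub_signInv _ _
    have h2 := signInv_single_mem_lenFilt (𝕜 := 𝕜) (FreeMonoid.of a)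
    have h3 := signInv_single_mem_lenFilt (𝕜 := 𝕜) w
    rw [FreeMonoid.length_of] at h2
    rw [e]
    refine add_mem (add_mem ?_ ?_) ?_
    · exact lenFilt_anti (by omega) (mul_mem_lenFilt h1 ih)
    · exact lenFilt_anti (by omega) (mul_mem_lenFilt h1 h3)
    · exact lenFilt_anti (by omega) (mul_mem_lenFilt h2 ih)

/-- The part of lowest length of `nuY f`. -/
lemma nuY_apply_of_length {d : ℕ} {f : SerY Γ 𝕜} (hf : f ∈ LenFilt _ 𝕜 d)
    {w : FreeMonoid (AlphY Γ)} (hw : w.length = d) :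
    nuY f w = (-1) ^ d * f (FreeMonoid.map invLetter w) := by
  have h := clm_mem_lenFilt nuY_sub_signInv_single hf w (by omega)
  rw [_root_.sub_apply, Series.sub_apply, signInv_apply, hw, sub_eq_zero] at h
  exact h

lemma nuY_mem_lenFilt {d : ℕ} {f : SerY Γ 𝕜} (hf : f ∈ LenFilt _ 𝕜 d) :
    nuY f ∈ LenFilt _ 𝕜 d := by
  refine clm_mem_lenFilt (k := 0) (fun w => ?_) hf
  have h1 := add_mem (lenFilt_anti (Nat.le_succ _) (nuY_sub_signInv_single (𝕜 := 𝕜) w))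
    (signInv_single_mem_lenFilt w)
  rwa [_root_.sub_apply, sub_add_cancel] at h1

lemma yh_succ_mem_lenFilt (m : ℕ) : yh Γ 𝕜 ((m : ℤ) + 1) ∈ LenFilt _ 𝕜 1 := by
  rw [yh_succ]
  exact Submodule.sum_mem _ fun σ _ => kappa_mul_x_mem_lenFilt _ _

variable {n : ℕ} {e : 𝕜} {η : SerX Γ 𝕜}

lemma IsDihedral.antiY_genD (h : IsDihedral n e η) (k : ℤ) :
    antiY (genD n e η k) = e • genD n e η k := by
  rw [genD, map_add, map_smul, antiY_antiY, smul_add, smul_smul, h.sq, one_smul, add_comm]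

lemma IsDihedral.genD_neg_mem_lenFilt_one (h : IsDihedral n e η) (j : ℕ) :
    genD n e η (-j) ∈ LenFilt _ 𝕜 1 := by
  rw [h.genD_neg]
  exact Submodule.sum_mem _ fun σ _ => kappa_mul_x_mem_lenFilt _ _

/-- The parity of the part of lowest length. -/
lemma IsDihedral.genD_parity (h : IsDihedral n e η) {d : ℕ}
    (hd : ∀ j : ℕ, genD n e η (-j) ∈ LenFilt _ 𝕜 d) (j : ℕ) {w : FreeMonoid (AlphY Γ)}
    (hw : w.length = d) : genD n e η (-j) w =
      -(e * (-1) ^ d * genD n e η (-j) (FreeMonoid.map invLetter w)) := by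
  have h1 := antiMulMap_DeltaStar (mem_lenFilt_one.1 (h.genD_neg_mem_lenFilt_one j))
  have hL : (n : ℤ) + -j < ((n + 1 : ℕ) : ℤ) := by omega
  rw [DeltaStar_genD e h.prim hL, Finset.sum_range_succ', Nat.cast_zero, sub_zero, yh_zero, map_add,
    map_sum] at h1
  have h2 := congrArg (fun s : SerY Γ 𝕜 => s w) h1
  simp only [Series.add_apply, map_add, antiMulMap_tensor, antiY_yh, antiY_one, nuY_one, one_mul,
    mul_one, h.antiY_genD, Series.sum_apply, Series.zero_apply, Series.smul_apply] at h2
  -- The terms with c ≥ 1 in the coproduct carry an extra factor of length at least one, so they do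
  -- not reach length d.
  have h3 : ∀ c ∈ Finset.range n, (yh Γ 𝕜 (c + 1 : ℕ) * nuY (genD n e η (-j - (c + 1 : ℕ)))) w +
      (e • genD n e η (-j - (c + 1 : ℕ)) * nuY (yh Γ 𝕜 (c + 1 : ℕ))) w = 0 := fun c _ => by
    have e1 : genD n e η (-j - (c + 1 : ℕ)) ∈ LenFilt _ 𝕜 d := by
      rw [show -(j : ℤ) - (c + 1 : ℕ) = -((j + (c + 1) : ℕ) : ℤ) by push_cast; ring]
      exact hd _
    have e2 : yh Γ 𝕜 (c + 1 : ℕ) ∈ LenFilt _ 𝕜 1 := by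
      rw [Nat.cast_succ]
      exact yh_succ_mem_lenFilt c
    rw [mul_mem_lenFilt e2 (nuY_mem_lenFilt e1) w (by omega),
      mul_mem_lenFilt (Submodule.smul_mem _ e e1) (nuY_mem_lenFilt e2) w (by omega), add_zero]
  rw [Finset.sum_eq_zero h3, zero_add, nuY_apply_of_length (hd j) hw] at h2
  linear_combination e * h2 - genD n e η (-j) w * h.sq

/-- `∑ kappa (X_{σ,τ} x_τ)` restricted to its part of colour `τ` -/
noncomputable def cycY (η : SerX Γ 𝕜) (a a' : ℕ) (σ τ : Γ) : SerY Γ 𝕜 :=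
  kappa (cycObst η a a' σ τ * x τ)

lemma IsDihedral.cycY_eq (h : IsDihedral n e η) (a a' : ℕ) (σ τ : Γ) :
    cycY η a a' σ τ = -(e • nuY (cycY η a a' σ⁻¹ τ⁻¹)) := by
  rw [cycY, cycY, nuY_kappa, h.nuX_cycObst, inv_inv, smul_mul_assoc, map_smul, smul_neg, neg_neg,
    smul_smul, h.sq, one_smul]

lemma kappa_mul_x_apply [DecidableEq Γ] (f : SerX Γ 𝕜) (σ : Γ) (v : FreeMonoid (AlphY Γ))
    (a : AlphY Γ) : kappa (f * x σ) (v * FreeMonoid.of a) = if col v * a.col = σ then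
      f (psi v * FreeMonoid.of AlphX.zero ^ ((a.idx : ℕ) - 1)) else 0 := by
  classical
  rw [kappa_apply, psi_mul_of, wordX, ← mul_assoc, x, mul_single_apply]
  simp

lemma IsDihedral.genD_neg_apply (h : IsDihedral n e η) (j : ℕ) (v : FreeMonoid (AlphY Γ))
    (a : AlphY Γ) : genD n e η (-j) (v * FreeMonoid.of a) =
      negPart η j (col v * a.col) (psi v * FreeMonoid.of AlphX.zero ^ ((a.idx : ℕ) - 1)) := by
  classical
  rw [h.genD_neg, Series.sum_apply]
  simp only [kappa_mul_x_apply]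
  rw [Finset.sum_ite_eq, if_pos (Finset.mem_univ _)]

/-- The stripped letters are reinserted after w in one term and before w in the other. If the
indices a and a' of `genD` are read as letters y_{a+1} and y_{a'+1}, the two terms are evaluations
on rotations of one cyclic word. -/
lemma IsDihedral.cycY_apply (h : IsDihedral n e η) (a a' : ℕ) (σ : Γ) {w : FreeMonoid (AlphY Γ)}
    (hw : w ≠ 1) : cycY η a a' σ (col w) w =
      genD n e η (-a) (w * FreeMonoid.of ⟨a'.succPNat, (col w)⁻¹ * σ⟩) +
        genD n e η (-a') (FreeMonoid.of ⟨a.succPNat, σ⁻¹⟩ * w) := by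
  classical
  obtain ⟨v, b, rfl⟩ := (eq_one_or_mul_of w).resolve_left hw
  rw [cycY, h.genD_neg_apply, ← mul_assoc (FreeMonoid.of _) v, h.genD_neg_apply]
  set u := psi v * FreeMonoid.of AlphX.zero ^ ((b.idx : ℕ) - 1) with hu
  have e1 : kappa (cycObst η a a' σ (col (v * FreeMonoid.of b)) * x (col (v * FreeMonoid.of b)))
      (v * FreeMonoid.of b) = cycObst η a a' σ (col (v * FreeMonoid.of b)) u := by
    rw [kappa_mul_x_apply, map_mul, col_of, if_pos rfl]
  rw [e1, cycObst, Series.add_apply]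
  congr 1
  · rw [rho_apply, iterate_rho_apply]
    have e2 : u * FreeMonoid.of (AlphX.of (col (v * FreeMonoid.of b))) =
        psi (v * FreeMonoid.of b) := by
      rw [psi_mul_of, wordX, hu, mul_assoc, map_mul, col_of]
    rw [e2, mul_inv_cancel_left]
    simp
  · have e4 : col (FreeMonoid.of (⟨a.succPNat, σ⁻¹⟩ : AlphY Γ) * v) * b.col =
        σ⁻¹ * col (v * FreeMonoid.of b) := by
      rw [map_mul, map_mul, col_of, col_of, mul_assoc]
    rw [t_apply, lam_apply, iterate_lam_apply, psi_of_mul, wordX, e4]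
    have e3 : shiftWord σ⁻¹ u = shiftWord σ⁻¹ (psi v) *
        FreeMonoid.of AlphX.zero ^ ((b.idx : ℕ) - 1) := by
      rw [hu, map_mul (shiftWord σ⁻¹), map_pow]
      rfl
    rw [e3]
    simp only [mul_assoc, Nat.succPNat_coe, Nat.succ_eq_add_one, Nat.add_sub_cancel]

lemma col_map_invLetter (w : FreeMonoid (AlphY Γ)) :
    col (FreeMonoid.map invLetter w) = (col w)⁻¹ := by
  induction w using FreeMonoid.inductionOn' with
  | one => simp
  | of_mul a w ih => rw [map_mul, map_mul, map_mul, ih, FreeMonoid.map_of, col_of, col_of, mul_inv,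
      invLetter]

/-- One letter has been stripped, so the bound on the length drops by one; this shift of one
reverses the parity sign in `genD_rotate`. -/
lemma IsDihedral.cycY_mem_lenFilt (h : IsDihedral n e η) {d : ℕ}
    (hd : ∀ j : ℕ, genD n e η (-j) ∈ LenFilt _ 𝕜 (d + 1)) (a a' : ℕ) (σ τ : Γ) :
    cycY η a a' σ τ ∈ LenFilt _ 𝕜 d := by
  classical
  intro v hv
  by_cases h1 : v = 1
  · rw [h1]
    exact mem_lenFilt_one.1 (kappa_mul_x_mem_lenFilt _ _)
  by_cases h2 : col v = τ
  · rw [← h2, h.cycY_apply a a' σ h1, hd, hd, add_zero] <;>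
      rw [FreeMonoid.length_mul, FreeMonoid.length_of] <;> omega
  · obtain ⟨u, b, rfl⟩ := (eq_one_or_mul_of v).resolve_left h1
    rw [map_mul, col_of] at h2
    rw [cycY, kappa_mul_x_apply, if_neg h2]

variable [Algebra ℚ 𝕜]

/-- The antisymmetry of the part of lowest length under cyclic rotation. -/
lemma IsDihedral.genD_rotate (h : IsDihedral n e η) {w : FreeMonoid (AlphY Γ)} (hw : w ≠ 1)
    (hd : ∀ j : ℕ, genD n e η (-j) ∈ LenFilt _ 𝕜 (w.length + 1)) (a a' : ℕ) (σ : Γ) :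
    genD n e η (-a) (w * FreeMonoid.of ⟨a'.succPNat, (col w)⁻¹ * σ⟩) +
      genD n e η (-a') (FreeMonoid.of ⟨a.succPNat, σ⁻¹⟩ * w) = 0 := by
  have hw' : FreeMonoid.map invLetter w ≠ 1 := by
    intro h1
    exact hw (by rw [← map_invLetter_map_invLetter w, h1, map_one])
  have h1 := congrArg (fun s : SerY Γ 𝕜 => s w) (h.cycY_eq a a' σ (col w))
  simp only [Series.neg_apply, Series.smul_apply] at h1
  rw [nuY_apply_of_length (h.cycY_mem_lenFilt hd a a' σ⁻¹ (col w)⁻¹) rfl, ← col_map_invLetter,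
    h.cycY_apply a a' σ hw, h.cycY_apply a a' σ⁻¹ hw', col_map_invLetter] at h1
  have h2 := h.genD_parity hd a (w := w * FreeMonoid.of ⟨a'.succPNat, (col w)⁻¹ * σ⟩)
    (by rw [FreeMonoid.length_mul, FreeMonoid.length_of])
  have h3 := h.genD_parity hd a' (w := FreeMonoid.of ⟨a.succPNat, σ⁻¹⟩ * w)
    (by rw [FreeMonoid.length_mul, FreeMonoid.length_of, add_comm])
  rw [map_mul, FreeMonoid.map_of, invLetter] at h2 h3
  simp only [mul_inv, inv_inv] at h1 h2 h3
  -- The sum of the two rotations has parity -e(-1)^d from `cycY`, in length d, and -e(-1)^{d+1}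
  -- from `genD`, in length d + 1. Opposite signs make twice the sum vanish.
  refine eq_zero_of_natCast_mul (n := 2) (by norm_num) ?_
  have h4 : ((-1 : 𝕜) ^ w.length) * (-1) ^ w.length = 1 := by
    rw [← mul_pow]
    simp
  rw [pow_succ] at h2 h3
  push_cast
  linear_combination h1 + h2 + h3

end Parity

/-! ### Cyclic words -/

section Cyclic

variable {α 𝕜 : Type*} [CommRing 𝕜] [Algebra ℚ 𝕜]

/-- A function on cyclic words, antisymmetric under rotation, for which the sum over the insertions
of a letter vanishes, is zero. -/
lemma eq_zero_of_cyclic {F : List α → 𝕜} {Q : List α → Prop} {d : ℕ} (hd : d ≠ 0)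
    (hQ : ∀ {M M'}, M.Perm M' → Q M → Q M')
    (hrot : ∀ M, M.length = d + 1 → Q M → F (M.rotate 1) = -F M)
    (hins : ∀ b C, C.length = d → Q (b :: C) →
      ∑ j ∈ Finset.range d, F (C.take (j + 1) ++ b :: C.drop (j + 1)) = 0)
    (M : List α) (hM : M.length = d + 1) (hQM : Q M) : F M = 0 := by
  have hrotk : ∀ k M, M.length = d + 1 → Q M → F (M.rotate k) = (-1) ^ k * F M := by
    intro k M hM hQM
    induction k with
    | zero => simp
    | succ k ih =>
      rw [← List.rotate_rotate, hrot _ (by rw [List.length_rotate, hM])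
        (hQ (List.rotate_perm M k).symm hQM), ih, pow_succ]
      ring
  have htwo : ∀ r : 𝕜, r = -r → r = 0 := fun r hr =>
    eq_zero_of_natCast_mul (n := 2) (by norm_num) (by push_cast; linear_combination hr)
  -- For d even, the full rotation has odd order d + 1 and already gives F = -F. For d odd, the
  -- insertion relation is needed.
  rcases Nat.even_or_odd d with hev | hodd
  · have h1 := hrotk (d + 1) M hM hQM
    rw [← hM, List.rotate_length, hM, hev.add_one.neg_one_pow] at h1
    exact htwo _ (by linear_combination h1)
  -- Rotating each inserted word until b comes first turns the insertion relation into an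
  -- alternating sum over the rotations of C.
  · have key : ∀ b C, C.length = d → Q (b :: C) → ∑ j ∈ Finset.range d,
        (-1) ^ (j + 1) * F (b :: C.rotate (j + 1)) = 0 := by
      intro b C hC hQC
      rw [← hins b C hC hQC]
      refine Finset.sum_congr rfl fun j hj => ?_
      have hj' := Finset.mem_range.1 hj
      have hp : (C.take (j + 1) ++ b :: C.drop (j + 1)).Perm (b :: C) := by
        have := (List.perm_middle (a := b) (l₁ := C.take (j + 1)) (l₂ := C.drop (j + 1)))
        rwa [List.take_append_drop] at this
      have h1 := hrotk (j + 1) (C.take (j + 1) ++ b :: C.drop (j + 1))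
        (by rw [hp.length_eq, List.length_cons, hC]) (hQ hp.symm hQC)
      have h2 : (C.take (j + 1) ++ b :: C.drop (j + 1)).rotate (j + 1) = b :: C.rotate (j + 1) := by
        have h3 : (C.take (j + 1)).length = j + 1 := by
          rw [List.length_take]
          omega
        have h4 := List.rotate_append_length_eq (C.take (j + 1)) (b :: C.drop (j + 1))
        rw [h3] at h4
        rw [h4, List.rotate_eq_drop_append_take (by omega), List.cons_append]
      rw [← h2, h1, ← mul_assoc, ← mul_pow]
      simp
    obtain ⟨b, C', rfl⟩ : ∃ b C', M = b :: C' := by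
      rcases M with _ | ⟨b, C'⟩
      · simp at hM
      · exact ⟨b, C', rfl⟩
    have hC' : C'.length = d := by simpa using hM
    -- Chosen so that one more rotation gives C' back; the alternating sums for C and for C' then
    -- contain the same rotations with indices shifted by one.
    set C := C'.rotate (d - 1) with hCdef
    have hC : C.length = d := by rw [hCdef, List.length_rotate, hC']
    have hrC : C.rotate 1 = C' := by
      rw [hCdef, List.rotate_rotate, Nat.sub_add_cancel (Nat.one_le_iff_ne_zero.2 hd), ← hC',
        List.rotate_length]
    have hQC : Q (b :: C) := hQ ((List.rotate_perm C' (d - 1)).symm.cons b) hQM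
    have k1 := key b C hC hQC
    have k2 := key b C' hC' hQM
    obtain ⟨m, rfl⟩ : ∃ m, d = m + 1 := ⟨d - 1, by omega⟩
    rw [Finset.sum_range_succ'] at k1
    rw [Finset.sum_range_succ] at k2
    have k3 : ∀ j, C'.rotate (j + 1) = C.rotate (j + 1 + 1) := fun j => by
      rw [← hrC, List.rotate_rotate, add_comm 1]
    have k4 : C'.rotate (m + 1) = C' := by rw [← hC', List.rotate_length]
    rw [k4, hodd.neg_one_pow, Finset.sum_congr rfl fun j _ => by rw [k3]] at k2
    rw [zero_add, pow_one, hrC] at k1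
    have k5 : ∑ j ∈ Finset.range m, (-1 : 𝕜) ^ (j + 1 + 1) * F (b :: C.rotate (j + 1 + 1)) =
        -∑ j ∈ Finset.range m, (-1 : 𝕜) ^ (j + 1) * F (b :: C.rotate (j + 1 + 1)) := by
      rw [← Finset.sum_neg_distrib]
      refine Finset.sum_congr rfl fun j _ => ?_
      rw [pow_succ (-1 : 𝕜) (j + 1)]
      ring
    rw [k5] at k1
    -- On adding the two alternating sums everything cancels except the two outer terms, which
    -- coincide and have equal signs since d is odd.
    exact htwo _ (by linear_combination -k1 - k2)

end Cyclic

/-! ### Vanishing of the obstruction in length at least two. -/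

section Vanishing

variable {Γ : Type*} [CommGroup Γ] [Fintype Γ] {𝕜 : Type*} [CommRing 𝕜]

lemma lam_mem_lenFilt {A : Type*} [WeightedAlphabet A] (a : A) {d : ℕ}
    {f : Series (FreeMonoid A) 𝕜} (hf : f ∈ LenFilt A 𝕜 (d + 1)) : lam a f ∈ LenFilt A 𝕜 d :=
  fun w hw => hf _ (by rw [FreeMonoid.length_mul, FreeMonoid.length_of]; omega)

/-- The coproduct, at a letter and a word, of a series without shorter words. -/
lemma DeltaStar_apply_of_lowest (b : AlphY Γ) (C : List (AlphY Γ)) {f : SerY Γ 𝕜}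
    (hf : f ∈ LenFilt _ 𝕜 (C.length + 1)) :
    DeltaStar f (FreeMonoid.of b, FreeMonoid.ofList C) = ∑ j ∈ Finset.range (C.length + 1),
      f (FreeMonoid.ofList (C.take j ++ b :: C.drop j)) := by
  induction C generalizing f with
  | nil =>
    rw [List.length_nil, zero_add, Finset.sum_range_one]
    exact DeltaStar_apply_one_right f _
  | cons a C ih =>
    have h := DeltaStar_apply_of_mul_of_mul f b a 1 (FreeMonoid.ofList C)
    -- In the quasi-shuffle recursion the merged letter yields a word shorter than the lowest
    -- length, so only the shuffle terms survive.
    rw [mul_one, DeltaStar_apply_one_left, DeltaStar_apply_one_left, ih (lam_mem_lenFilt a hf),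
      lam_apply, lam_apply, hf (FreeMonoid.of (merge b a) * FreeMonoid.ofList C) (by
        rw [FreeMonoid.length_mul, FreeMonoid.length_of, List.length_cons]
        exact lt_of_eq_of_lt (add_comm _ _) (Nat.lt_succ_self _)), add_zero] at h
    rw [List.length_cons, Finset.sum_range_succ']
    refine h.trans ?_
    rw [add_comm]
    rfl

variable [Algebra ℚ 𝕜] {n : ℕ} {e : 𝕜} {η : SerX Γ 𝕜}

/-- The values of `genD`, the first letter being used as an index. -/
noncomputable def genDList (n : ℕ) (e : 𝕜) (η : SerX Γ 𝕜) : List (AlphY Γ) → 𝕜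
  | [] => 0
  | l :: w => genD n e η (-(((l.idx : ℕ) - 1 : ℕ) : ℤ)) (FreeMonoid.ofList w)

/-- The index j is encoded as an additional first letter y_{j+1}, coloured so that the product of
all colours is 1. This makes `genD` a function on cyclic words of length d + 1 to which
`eq_zero_of_cyclic` applies. -/
lemma IsDihedral.genD_lowest_eq_zero (h : IsDihedral n e η) {d : ℕ} (hd2 : 2 ≤ d)
    (hd : ∀ j : ℕ, genD n e η (-j) ∈ LenFilt _ 𝕜 d) (j : ℕ) {w : FreeMonoid (AlphY Γ)}
    (hw : w.length = d) : genD n e η (-j) w = 0 := by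
  -- Total colour 1 is invariant under permutation of the letters, as Γ is commutative, and
  -- determines the colour of the letter that carries the index.
  let Q : List (AlphY Γ) → Prop := fun M => (M.map AlphY.col).prod = 1
  have hQ : ∀ {M M'}, M.Perm M' → Q M → Q M' := fun hp hM => by
    change (List.map _ _).prod = 1
    rw [← (hp.map AlphY.col).prod_eq]
    exact hM
  have hcol : ∀ M : List (AlphY Γ), col (FreeMonoid.ofList M) = (M.map AlphY.col).prod := fun M => by
    rw [col, FreeMonoid.lift_apply, FreeMonoid.toList_ofList]
  have hletter : ∀ (a : AlphY Γ) (c : Γ), c = a.col → (⟨((a.idx : ℕ) - 1).succPNat, c⟩ : AlphY Γ) = a := by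
    rintro ⟨i, c⟩ _ rfl
    congr 1
    have := i.pos
    exact PNat.eq (by simp only [Nat.succPNat_coe, Nat.succ_eq_add_one]; omega)
  have key := eq_zero_of_cyclic (F := genDList n e η) (Q := Q) (d := d) (by omega) hQ ?_ ?_
    (⟨j.succPNat, (col w)⁻¹⟩ :: w.toList) (by rw [List.length_cons, ← hw]; rfl) (by
      change (List.map _ _).prod = 1
      rw [List.map_cons, List.prod_cons, ← hcol, FreeMonoid.ofList_toList, inv_mul_cancel])
  · simpa [genDList] using key
  · intro M hM hQM
    obtain ⟨l', l, V, rfl⟩ : ∃ l' l V, M = l' :: l :: V := by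
      rcases M with _ | ⟨l', _ | ⟨l, V⟩⟩
      · simp at hM
      · simp at hM
        omega
      · exact ⟨l', l, V, rfl⟩
    have hV : V.length + 1 = d := by simpa using hM
    have hw1 : (FreeMonoid.ofList V : FreeMonoid (AlphY Γ)) ≠ 1 := fun h1 => by
      have h2 : V.length = 0 := congrArg FreeMonoid.length h1
      omega
    have h1 := h.genD_rotate hw1 (by
      rw [show (FreeMonoid.ofList V : FreeMonoid (AlphY Γ)).length + 1 = d from hV]
      exact hd) ((l.idx : ℕ) - 1) ((l'.idx : ℕ) - 1) l.col⁻¹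
    have hQM' : l'.col * (l.col * (V.map AlphY.col).prod) = 1 := by
      simpa [Q] using hQM
    rw [hletter l' _ (by
      rw [hcol, ← mul_inv, inv_eq_iff_mul_eq_one, mul_comm _ l.col, mul_comm]
      exact hQM'), hletter l _ (inv_inv _)] at h1
    rw [List.rotate_cons_succ, List.rotate_zero]
    exact eq_neg_of_add_eq_zero_left h1
  -- The first letter of C carries the index, so b is inserted only after it. The sum is the
  -- coefficient of Δ_*(genD) at a letter and a word of length d - 1; both are shorter than d, as d
  -- ≥ 2, so every term of the coproduct formula vanishes there.
  · intro b C hC hQC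
    obtain ⟨l, V, rfl⟩ : ∃ l V, C = l :: V := by
      rcases C with _ | ⟨l, V⟩
      · simp at hC
        omega
      · exact ⟨l, V, rfl⟩
    have hV : V.length + 1 = d := by simpa using hC
    have h1 := DeltaStar_apply_of_lowest b V (f := genD n e η (-(((l.idx : ℕ) - 1 : ℕ) : ℤ)))
      (by rw [hV]; exact hd _)
    have hL : (n : ℤ) + -(((l.idx : ℕ) - 1 : ℕ) : ℤ) < ((n + 1 : ℕ) : ℤ) := by omega
    rw [DeltaStar_genD e h.prim hL, Series.sum_apply, Finset.sum_eq_zero, hV] at h1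
    · exact h1.symm
    · intro c _
      have e1 : genD n e η (-(((l.idx : ℕ) - 1 : ℕ) : ℤ) - c) ∈ LenFilt _ 𝕜 d := by
        rw [show -(((l.idx : ℕ) - 1 : ℕ) : ℤ) - c = -((((l.idx : ℕ) - 1) + c : ℕ) : ℤ) by
          push_cast; ring]
        exact hd _
      rw [Series.add_apply, tensor_apply, tensor_apply, e1 (FreeMonoid.of b) (by
        rw [FreeMonoid.length_of]; omega), e1 (FreeMonoid.ofList V) (by
        change V.length < d; omega), zero_mul, mul_zero, add_zero]

/-- Induction on the length: length zero is excluded by the form κ(f x_σ), length one is the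
hypothesis, and greater lengths follow from the cyclic argument. -/
lemma IsDihedral.genD_neg_eq_zero (h : IsDihedral n e η)
    (h1 : ∀ (j : ℕ) (a : AlphY Γ), genD n e η (-j) (FreeMonoid.of a) = 0) (j : ℕ) :
    genD n e η (-j) = 0 := by
  have key : ∀ d, ∀ j : ℕ, genD n e η (-j) ∈ LenFilt _ 𝕜 d := by
    intro d
    induction d with
    | zero => exact fun j => lenFilt_zero _
    | succ d ih =>
      intro j w hw
      rcases Nat.lt_or_ge w.length d with h2 | h2
      · exact ih j w h2
      · have h3 : w.length = d := by omega
        rcases d with _ | _ | d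
        · exact h.genD_neg_mem_lenFilt_one j w (by omega)
        · obtain ⟨a, rfl⟩ := FreeMonoid.length_eq_one.1 h3
          exact h1 j a
        · exact h.genD_lowest_eq_zero (by omega) ih j h3
  ext w
  exact key (w.length + 1) j w (Nat.lt_succ_self _)

end Vanishing

/-! ### The words with at most two coloured letters -/

section DepthTwo

variable {Γ : Type*} [CommGroup Γ] [Fintype Γ] {𝕜 : Type*} [CommRing 𝕜]

lemma dY_apply_of (m : ℕ) (σ : Γ) (f : SerY Γ 𝕜) :
    dY f (FreeMonoid.of ⟨m.succPNat, σ⟩) =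
      ((m : 𝕜) + 1) * f (FreeMonoid.of ⟨(m + 1).succPNat, σ⟩) := by
  have h0 : ∀ a : AlphY Γ, dY (single (FreeMonoid.of a) : SerY Γ 𝕜) 1 = 0 := fun a => by
    rw [single_of_eq_yN, dY_yN, Series.smul_apply, yN_eq, single_of_apply_one, mul_zero]
  have h1 : ∀ w : FreeMonoid (AlphY Γ), dY (single w : SerY Γ 𝕜) 1 = 0 := by
    intro w
    induction w using FreeMonoid.inductionOn' with
    | one => rw [← one_def, dY_one]; rfl
    | of_mul a w ih => rw [single_of_mul, dY_mul, Series.add_apply, mul_apply_one, mul_apply_one,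
        h0, ih, zero_mul, mul_zero, add_zero]
  have : (comap fun _ : Unit => FreeMonoid.of (⟨m.succPNat, σ⟩ : AlphY Γ)).comp dY =
      ((m : 𝕜) + 1) • (comap fun _ : Unit => FreeMonoid.of (⟨(m + 1).succPNat, σ⟩ : AlphY Γ) :
        SerY Γ 𝕜 →L[𝕜] Series Unit 𝕜) := by
    refine clm_ext fun w => ?_
    ext u
    change dY (single w : SerY Γ 𝕜) (FreeMonoid.of ⟨m.succPNat, σ⟩) =
      ((m : 𝕜) + 1) * (single w : SerY Γ 𝕜) (FreeMonoid.of ⟨(m + 1).succPNat, σ⟩)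
    rcases eq_one_or_of_mul w with rfl | ⟨a, v, rfl⟩
    · rw [← one_def, dY_one, one_def, single_of_ne, mul_zero]
      · rfl
      · intro h
        exact of_mul_ne_one (⟨(m + 1).succPNat, σ⟩ : AlphY Γ) 1 (by rw [mul_one]; exact h)
    · rw [single_of_mul, dY_mul, Series.add_apply, mul_apply_of, mul_apply_of, mul_apply_of, h0, h1,
        single_of_apply_one, zero_mul, zero_mul, zero_mul, zero_add, mul_zero, zero_add, add_zero,
        zero_add, ← mul_assoc]
      congr 1
      obtain ⟨i, c⟩ := a
      rw [single_of_eq_yN, dY_yN, Series.smul_apply]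
      simp only
      rcases hi : (i : ℕ) - 1 with _ | k
      · rw [Nat.cast_zero, zero_mul, yN_eq, single_of_ne, mul_zero]
        intro h
        have h2 := FreeMonoid.of_injective h
        rw [AlphY.mk.injEq] at h2
        have h3 := congrArg PNat.val h2.1
        simp at h3
      · rw [Nat.add_sub_cancel, yN_eq, yN_eq]
        by_cases h : m = k ∧ σ = c
        · rw [h.1, h.2, single_self, single_self]
          push_cast
          ring
        · rw [single_of_ne, single_of_ne, mul_zero, mul_zero]
          · intro h2
            have h3 := FreeMonoid.of_injective h2
            rw [AlphY.mk.injEq] at h3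
            have h4 := congrArg PNat.val h3.1
            simp at h4
            exact h ⟨h4, h3.2⟩
          · intro h2
            have h3 := FreeMonoid.of_injective h2
            rw [AlphY.mk.injEq] at h3
            have h4 := congrArg PNat.val h3.1
            simp at h4
            exact h ⟨h4, h3.2⟩
  exact congrArg (fun s : Series Unit 𝕜 => s ()) (DFunLike.congr_fun this f)

/-- The word `x_0^k`. -/
def zeros (k : ℕ) : FreeMonoid (AlphX Γ) := FreeMonoid.of AlphX.zero ^ k

lemma psi_letter (m : ℕ) (σ : Γ) :
    psi (FreeMonoid.of (⟨m.succPNat, σ⟩ : AlphY Γ)) = wordX m σ := by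
  rw [psi_of]
  simp

lemma kappa_iterate_rho_apply (η : SerX Γ 𝕜) (k : ℕ) (w : FreeMonoid (AlphY Γ)) :
    kappa ((rho AlphX.zero)^[k] η) w = η (psi w * zeros k) := by
  rw [kappa_apply, iterate_rho_apply, zeros]

/-- The effect of `∂ η = 0` on the words with one coloured letter. -/
lemma apply_wordX_zeros {η : SerX Γ 𝕜} (hη : dX η = 0) (m k : ℕ) (σ : Γ) :
    ((m : 𝕜) + 1) * η (wordX (m + 1) σ * zeros k) =
      -(((k : 𝕜) + 1) * η (wordX m σ * zeros (k + 1))) := by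
  have h1 := kappa_dX ((rho AlphX.zero)^[k] η)
  rw [dX_iterate_rho hη, ← Function.iterate_succ_apply' (rho AlphX.zero) k η, map_neg,
    map_smul] at h1
  have h2 := congrArg (fun s : SerY Γ 𝕜 => s (FreeMonoid.of ⟨m.succPNat, σ⟩)) h1
  simp only [Series.neg_apply, Series.smul_apply, Series.add_apply, dY_apply_of,
    kappa_iterate_rho_apply, psi_letter] at h2
  linear_combination -h2

/-- The harmonic relation for the words with two coloured letters. -/
lemma apply_wordX_wordX {η : SerX Γ 𝕜} (hη : ∀ k, DeltaStar (kappa ((rho AlphX.zero)^[k] η)) =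
    primitive (kappa ((rho AlphX.zero)^[k] η))) (i j k : ℕ) (σ τ : Γ) :
    η (wordX i σ * wordX j (σ * τ) * zeros k) + η (wordX j τ * wordX i (σ * τ) * zeros k) +
      η (wordX (i + j + 1) (σ * τ) * zeros k) = 0 := by
  have h1 := DeltaStar_apply_letters (kappa ((rho AlphX.zero)^[k] η)) (⟨i.succPNat, σ⟩ : AlphY Γ)
    ⟨j.succPNat, τ⟩
  have h2 : (1 : SerY Γ 𝕜) (FreeMonoid.of ⟨i.succPNat, σ⟩) = 0 :=
    single_of_ne fun h => of_mul_ne_one (⟨i.succPNat, σ⟩ : AlphY Γ) 1 (by rw [mul_one]; exact h)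
  have h3 : (1 : SerY Γ 𝕜) (FreeMonoid.of ⟨j.succPNat, τ⟩) = 0 :=
    single_of_ne fun h => of_mul_ne_one (⟨j.succPNat, τ⟩ : AlphY Γ) 1 (by rw [mul_one]; exact h)
  rw [hη, primitive, Series.add_apply, tensor_apply, tensor_apply, h2, h3, mul_zero, zero_mul,
    add_zero, kappa_iterate_rho_apply, kappa_iterate_rho_apply, kappa_iterate_rho_apply, psi_mul,
    psi_mul, psi_letter, psi_letter, col_of, col_of, shiftWord_wordX, shiftWord_wordX,
    show merge (⟨i.succPNat, σ⟩ : AlphY Γ) ⟨j.succPNat, τ⟩ = ⟨(i + j + 1).succPNat, σ * τ⟩ by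
      rw [merge]
      congr 1
      exact PNat.eq (by simp only [PNat.add_coe, Nat.succPNat_coe]; omega),
    psi_letter] at h1
  simp only [mul_comm τ σ] at h1
  exact h1.symm

variable [Algebra ℚ 𝕜]

/-- The symmetry of the coefficients of `x_0^{n-1} x_σ`. -/
lemma apply_wordX_add {n : ℕ} {e : 𝕜} {η : SerX Γ 𝕜} (he : e * e = 1) (hη : dX η = 0)
    (hp : ∀ k, DeltaStar (kappa ((rho AlphX.zero)^[k] η)) =
      primitive (kappa ((rho AlphX.zero)^[k] η)))
    (hr1 : ∀ i k σ, i + k = n + 1 → η (wordX i σ * zeros k) = -(e * η (wordX k σ * zeros i)))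
    (hr2 : ∀ i j k σ τ, i + j + k = n → η (wordX i σ * wordX j τ * zeros k) =
      -(e * η (wordX k τ * wordX j σ * zeros i))) (σ : Γ) :
    η (wordX (n + 1) σ * zeros 0) + e * η (wordX (n + 1) σ⁻¹ * zeros 0) = 0 := by
  have hsum : ∀ δ : Γ, e * ((n : 𝕜) + 2) *
      (η (wordX (n + 1) δ * zeros 0) + e * η (wordX (n + 1) δ⁻¹ * zeros 0)) +
      (η (wordX (n + 1) 1 * zeros 0) + e * η (wordX (n + 1) 1 * zeros 0)) = 0 := by
    intro δ
    -- the letters `(0, 1)`, `(0, δ)`, `(n, δ⁻¹)` and their inverses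
    have a1 := apply_wordX_wordX hp 0 0 n 1 δ
    have a2 := apply_wordX_wordX hp 0 n 0 1 δ⁻¹
    have a3 := apply_wordX_wordX hp 0 n 0 δ δ⁻¹
    have b1 := apply_wordX_wordX hp 0 0 n 1 δ⁻¹
    have b2 := apply_wordX_wordX hp 0 n 0 1 δ
    have b3 := apply_wordX_wordX hp 0 n 0 δ⁻¹ δ
    have r1 := hr2 0 0 n 1 δ (by omega)
    have r2 := hr2 0 0 n δ δ (by omega)
    have r3 := hr2 0 n 0 1 δ⁻¹ (by omega)
    have r4 := hr2 n 0 0 δ⁻¹ δ⁻¹ (by omega)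
    have r5 := hr2 0 n 0 δ 1 (by omega)
    have r6 := hr2 n 0 0 δ⁻¹ 1 (by omega)
    have d1 := apply_wordX_zeros hη n 0 δ
    have d2 := apply_wordX_zeros hη n 0 δ⁻¹
    have s1 := hr1 1 n δ (by omega)
    have s2 := hr1 1 n δ⁻¹ (by omega)
    simp only [one_mul, mul_inv_cancel, inv_mul_cancel, zero_add, Nat.cast_zero]
      at a1 a2 a3 b1 b2 b3 d1 d2
    linear_combination a1 + a2 + a3 + e * (b1 + b2 + b3) - r1 - r2 - r3 - r4 - r5 - r6 +
      (e * d1 - s1) + e * (e * d2 - s2) + η (wordX (n + 1) δ⁻¹ * zeros 0) * he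
  -- At δ = 1 the unknown u = (1 + e) η(x_0^{n+1} x_1) satisfies eu = u, so the relation reads (n +
  -- 3) u = 0. For general σ the second summand has then disappeared, and e(n + 2) is invertible.
  have h1 := hsum 1
  rw [inv_one] at h1
  have h2 : η (wordX (n + 1) (1 : Γ) * zeros 0) + e * η (wordX (n + 1) 1 * zeros 0) = 0 := by
    refine eq_zero_of_natCast_mul (n := n + 3) (by omega) ?_
    push_cast
    linear_combination h1 - ((n : 𝕜) + 2) * η (wordX (n + 1) 1 * zeros 0) * he
  have h3 := hsum σ
  rw [h2, add_zero] at h3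
  refine eq_zero_of_natCast_mul (n := n + 2) (by omega) ?_
  push_cast
  linear_combination e * h3 - ((n : 𝕜) + 2) *
    (η (wordX (n + 1) σ * zeros 0) + e * η (wordX (n + 1) σ⁻¹ * zeros 0)) * he

/-! ### The infinitesimal stabilizer -/

lemma length_eq_deg (w : FreeMonoid (AlphX Γ)) : w.length = deg w := by
  induction w using FreeMonoid.inductionOn' with
  | one => rw [FreeMonoid.length_one, deg_one]
  | of_mul a w ih => rw [FreeMonoid.length_mul, FreeMonoid.length_of, deg_mul, deg_letterX, ih]

variable (Γ) in
/-- The number of coloured letters of a word. -/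
def depthX : FreeMonoid (AlphX Γ) →* Multiplicative ℕ :=
  FreeMonoid.lift fun a => match a with
    | AlphX.zero => 1
    | AlphX.of _ => Multiplicative.ofAdd 1

lemma depthX_zeros (k : ℕ) : depthX Γ (zeros k) = 1 := by
  rw [zeros, map_pow, depthX, FreeMonoid.lift_eval_of]
  exact one_pow k

lemma depthX_wordX (k : ℕ) (σ : Γ) : depthX Γ (wordX k σ) = Multiplicative.ofAdd 1 := by
  rw [wordX, map_mul, ← zeros, depthX_zeros, one_mul, depthX, FreeMonoid.lift_eval_of]

lemma x_one_pow_apply_eq_zero {n : ℕ} {w : FreeMonoid (AlphX Γ)}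
    (h : depthX Γ w ≠ Multiplicative.ofAdd n) : (x 1 ^ n : SerX Γ 𝕜) w = 0 := by
  rw [x, single_pow, single_of_ne]
  rintro rfl
  refine h ?_
  rw [map_pow, depthX, FreeMonoid.lift_eval_of, ← ofAdd_nsmul]
  simp

lemma reverse_zeros (k : ℕ) : (zeros k : FreeMonoid (AlphX Γ)).reverse = zeros k := by
  induction k with
  | zero => rfl
  | succ k ih =>
    rw [zeros, pow_succ, FreeMonoid.reverse_mul, FreeMonoid.reverse_of, ← zeros, ih, zeros,
      ← pow_succ', pow_succ]

lemma reverse_wordX (k : ℕ) (σ : Γ) :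
    (wordX k σ).reverse = FreeMonoid.of (AlphX.of σ) * zeros k := by
  rw [wordX, ← zeros, FreeMonoid.reverse_mul, reverse_zeros, FreeMonoid.reverse_of]

lemma revSer_x_pow (σ : Γ) (m : ℕ) : revSer (x σ ^ m : SerX Γ 𝕜) = x σ ^ m := by
  induction m with
  | zero => rw [pow_zero, revSer_one]
  | succ m ih => rw [pow_succ, revSer_mul, ih, revSer_x, ← pow_succ', pow_succ]

lemma dX_x_pow (σ : Γ) (m : ℕ) : dX (x σ ^ m : SerX Γ 𝕜) = 0 := by
  induction m with
  | zero => rw [pow_zero, dX_one]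
  | succ m ih => rw [pow_succ, dX_mul, ih, dX_x, zero_mul, mul_zero, add_zero]

lemma reverse_wordX_mul_zeros (i k : ℕ) (σ : Γ) :
    (wordX k σ * zeros i).reverse = wordX i σ * zeros k := by
  rw [FreeMonoid.reverse_mul, reverse_zeros, reverse_wordX, wordX, ← zeros, mul_assoc]

/-- The antipode is -1 on primitive elements, and on words it is reversal with the sign of the
length. -/
lemma revSer_eq_of_primitive {n : ℕ} (hn : n ≠ 0) {ψ : SerX Γ 𝕜} (hψ : component n ψ = ψ)
    (h : DeltaX ψ = primitive ψ) : revSer ψ = -((-1 : 𝕜) ^ n • ψ) := by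
  have h1 : ψ ∈ Filt _ 𝕜 1 := by
    rw [mem_filt_one, apply_eq_zero_of_component hψ]
    rw [deg_one]
    exact hn.symm
  have h2 := antipode_of_primitive h1 h
  ext w
  have h3 := congrArg (fun s : SerX Γ 𝕜 => s w) h2
  simp only [antipode_apply, Series.neg_apply] at h3
  rw [revSer_apply, Series.neg_apply, Series.smul_apply]
  by_cases hw : w.length = n
  · rw [hw] at h3
    have h4 : (-1 : 𝕜) ^ n * (-1) ^ n = 1 := by
      rw [← mul_pow]
      simp
    linear_combination (-1 : 𝕜) ^ n * h3 - ψ w.reverse * h4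
  · rw [apply_eq_zero_of_component hψ, apply_eq_zero_of_component hψ, mul_zero, neg_zero]
    · rwa [← length_eq_deg]
    · rwa [← length_eq_deg, FreeMonoid.length_reverse]

/-- The Lie algebra version of the stabilizer property. -/
theorem eps_eq_zero_of_primitive {n : ℕ} (hn : n ≠ 0) {ψ : SerX Γ 𝕜} {c : 𝕜}
    (hψ : component n ψ = ψ) (hΔ : DeltaX ψ = primitive ψ)
    (h0 : ψ (FreeMonoid.of AlphX.zero) = 0)
    (h1 : n = 1 → ∀ σ : Γ, ψ (FreeMonoid.of (AlphX.of σ)) = ψ (FreeMonoid.of (AlphX.of σ⁻¹)))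
    (h2 : n = 2 → ψ (wordX 1 1) = 0)
    (hc : (n : 𝕜) * c = (-1) ^ (n - 1) * ψ (wordX (n - 1) 1))
    (hp : DeltaStar (kappa (ψ + c • x 1 ^ n)) = primitive (kappa (ψ + c • x 1 ^ n))) :
    eps (ψ + c • x 1 ^ n) = 0 := by
  set η := ψ + c • x 1 ^ n with hη
  set e : 𝕜 := (-1) ^ n with he
  have hsq : e * e = 1 := by
    rw [he, ← mul_pow]
    simp
  have hd : dX η = 0 := by
    rw [hη, map_add, map_smul, dX_x_pow, dX_eq_zero hΔ h0, smul_zero, add_zero]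
  have hprim := primitive_kappa_iterate_rho hd hp
  have hrev := revSer_eq_of_primitive hn hψ hΔ
  have hhomog : component n η = η := by
    ext w
    rw [component_apply]
    split_ifs with hw
    · rfl
    · rw [hη, Series.add_apply, Series.smul_apply, apply_eq_zero_of_component hψ hw, x, single_pow,
        single_of_ne, mul_zero, add_zero]
      rintro rfl
      exact hw (by rw [deg_pow, deg_letterX, mul_one])
  -- The correction c x_1^n is supported on a word with n coloured letters, so η and ψ agree on
  -- words with any other number of them.
  have hx : ∀ w, depthX Γ w ≠ Multiplicative.ofAdd n → η w = ψ w := fun w hw => by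
    rw [hη, Series.add_apply, Series.smul_apply, x_one_pow_apply_eq_zero hw, mul_zero, add_zero]
  have hψrev : ∀ w, ψ w.reverse = -(e * ψ w) := fun w =>
    congrArg (fun s : SerX Γ 𝕜 => s w) hrev
  have hx1 : 2 ≤ n → ∀ i k (σ : Γ), η (wordX i σ * zeros k) = ψ (wordX i σ * zeros k) :=
    fun h i k σ => hx _ (by
      rw [map_mul, depthX_wordX, depthX_zeros, mul_one]
      intro h3
      have : 1 = n := Multiplicative.ofAdd.injective h3
      omega)
  have hr1 : 2 ≤ n → ∀ i k (σ : Γ), η (wordX i σ * zeros k) = -(e * η (wordX k σ * zeros i)) :=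
    fun h i k σ => by rw [hx1 h, hx1 h, ← hψrev, reverse_wordX_mul_zeros]
  -- In degree two the correction would affect words with two coloured letters; the vanishing of the
  -- coefficient of x_0 x_1 prevents this.
  have hc2 : n = 2 → c = 0 := by
    rintro rfl
    rw [h2 rfl, mul_zero] at hc
    exact eq_zero_of_natCast_mul two_ne_zero hc
  have hx2 : 2 ≤ n → ∀ i j k (σ τ : Γ),
      η (wordX i σ * wordX j τ * zeros k) = ψ (wordX i σ * wordX j τ * zeros k) := by
    intro h i j k σ τ
    by_cases hn2 : n = 2
    · rw [hη, hc2 hn2, zero_smul, add_zero]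
    · refine hx _ ?_
      rw [map_mul, map_mul, depthX_wordX, depthX_wordX, depthX_zeros, mul_one, ← ofAdd_add]
      intro h3
      have : 1 + 1 = n := Multiplicative.ofAdd.injective h3
      omega
  have hr2 : 2 ≤ n → ∀ i j k (σ τ : Γ), η (wordX i σ * wordX j τ * zeros k) =
      -(e * η (wordX k τ * wordX j σ * zeros i)) := fun h i j k σ τ => by
    rw [hx2 h, hx2 h, ← hψrev, mul_assoc (wordX k τ), FreeMonoid.reverse_mul,
      reverse_wordX_mul_zeros, reverse_wordX]
    simp only [wordX, zeros, mul_assoc]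
  have hu : 2 ≤ n → ∀ σ : Γ, η (wordX (n - 1) σ) + e * η (wordX (n - 1) σ⁻¹) = 0 := by
    intro h σ
    have h3 := apply_wordX_add (n := n - 2) hsq hd hprim (fun i k σ _ => hr1 h i k σ)
      (fun i j k σ τ _ => hr2 h i j k σ τ) σ
    rwa [show n - 2 + 1 = n - 1 by omega, zeros, pow_zero, mul_one, mul_one] at h3
  -- Needed for η to inherit the reversal symmetry of ψ, as x_1^n is its own reversal. For n even,
  -- the symmetry `hu` at the neutral colour gives twice the coefficient of x_0^{n-1} x_1, so c = 0;
  -- for n odd there is no condition.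
  have hce : c = -(e * c) := by
    rcases Nat.even_or_odd n with hev | hodd
    · have hn2 : 2 ≤ n := by
        obtain ⟨k, hk⟩ := hev
        omega
      have he1 : e = 1 := hev.neg_one_pow
      have h3 := hu hn2 1
      have h4 := hx1 hn2 (n - 1) 0 1
      rw [zeros, pow_zero, mul_one] at h4
      rw [inv_one, he1, one_mul, h4] at h3
      have h5 : ψ (wordX (n - 1) 1) = 0 := by
        refine eq_zero_of_natCast_mul two_ne_zero ?_
        push_cast
        linear_combination h3
      rw [h5, mul_zero] at hc
      rw [eq_zero_of_natCast_mul hn hc, mul_zero, neg_zero]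
    · rw [he, hodd.neg_one_pow, neg_one_mul, neg_neg]
  have hD : IsDihedral n e η := ⟨hhomog, hsq, by
    rw [hη, map_add, map_smul, hrev, revSer_x_pow, smul_add, smul_smul, neg_add]
    congr 1
    rw [← neg_smul, ← hce], hprim⟩
  -- What remains is length one, where the value is the difference of two coefficients of words with
  -- one coloured letter.
  refine hD.eps_eq_zero (hD.genD_neg_eq_zero fun j a => ?_)
  obtain ⟨m, hm⟩ : ∃ m, (a.idx : ℕ) - 1 = m := ⟨_, rfl⟩
  have h3 := hD.genD_neg_apply j 1 a
  rw [one_mul, map_one, one_mul, psi_one, one_mul, hm] at h3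
  have h4 : negPart η j a.col (FreeMonoid.of AlphX.zero ^ m) =
      η (wordX m a.col * zeros j) - η (wordX j a.col⁻¹ * zeros m) := by
    rw [negPart]
    change ((rho AlphX.zero)^[j + 1] η (FreeMonoid.of AlphX.zero ^ m) +
      (rho AlphX.zero)^[j] η (FreeMonoid.of AlphX.zero ^ m * FreeMonoid.of (AlphX.of a.col))) -
      (t a.col ((lam AlphX.zero)^[j + 1] η + lam (AlphX.of a.col⁻¹) ((lam AlphX.zero)^[j] η)))
        (FreeMonoid.of AlphX.zero ^ m) = _
    have h5 : shiftWord a.col⁻¹ (FreeMonoid.of AlphX.zero ^ m) = FreeMonoid.of AlphX.zero ^ m := by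
      rw [map_pow]
      rfl
    rw [t_apply, h5, Series.add_apply, lam_apply, iterate_rho_apply, iterate_rho_apply,
      iterate_lam_apply, iterate_lam_apply, ← pow_add, ← pow_add, add_comm m, wordX, wordX, zeros,
      zeros, ← mul_assoc]
    ring
  rw [h3, h4]
  by_cases hmj : m + j + 1 = n
  -- Degree one is the only case not covered by the harmonic relations and uses the imposed symmetry
  -- under σ ↦ σ⁻¹.
  · rcases (by omega : n = 1 ∨ 2 ≤ n) with h6 | h6
    · obtain ⟨rfl, rfl⟩ : m = 0 ∧ j = 0 := by omega
      rw [zeros, pow_zero, mul_one, mul_one, wordX, wordX, pow_zero, one_mul, one_mul, hη,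
        Series.add_apply, Series.add_apply, Series.smul_apply, Series.smul_apply, h1 h6, h6,
        pow_one]
      by_cases h7 : a.col = 1
      · rw [h7, inv_one, sub_self]
      · rw [x, single_of_ne, single_of_ne, sub_self]
        · intro h8
          have := FreeMonoid.of_injective h8
          rw [AlphX.of.injEq, inv_eq_one] at this
          exact h7 this
        · intro h8
          have := FreeMonoid.of_injective h8
          rw [AlphX.of.injEq] at this
          exact h7 this
    -- The relation from ∂η = 0 moves the trailing x_0's in front of the coloured letter, up to
    -- invertible factors, which reduces to j = 0, that is, to `hu`.
    · have h7 : ∀ j m : ℕ, m + j + 1 = n →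
          η (wordX m a.col * zeros j) + e * η (wordX m a.col⁻¹ * zeros j) = 0 := by
        intro j
        induction j with
        | zero =>
          rintro m rfl
          have := hu h6 a.col
          rwa [zeros, pow_zero, mul_one, mul_one, show m = m + 0 + 1 - 1 by omega]
        | succ j ih =>
          intro m hmj
          have h8 := ih (m + 1) (by omega)
          have h9 := apply_wordX_zeros hd m j a.col
          have h10 := apply_wordX_zeros hd m j a.col⁻¹
          refine eq_zero_of_natCast_mul (n := j + 1) (by omega) ?_
          push_cast
          linear_combination h9 + e * h10 - ((m : 𝕜) + 1) * h8
      rw [hr1 h6 j m, sub_neg_eq_add, h7 j m hmj]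
  · have h5 : ∀ i k (σ : Γ), i + k + 1 ≠ n → η (wordX i σ * zeros k) = 0 := fun i k σ h => by
      refine apply_eq_zero_of_component hhomog ?_
      rw [deg_mul, deg_wordX, zeros, deg_x0_pow]
      omega
    rw [h5 m j _ hmj, h5 j m _ (by omega), sub_zero]

end DepthTwo

/-! ### The series `G_⋆` and the constant term of `S^Y` -/

section PowSumSingle

variable {M : Type*} [Monoid M] [FinGraded M] {𝕜 : Type*} [CommRing 𝕜]

lemma Series.powSum_single_apply {m : M} (hm : deg m = 1) (c : ℕ → 𝕜) (w : M) :
    powSum c (single m : Series M 𝕜) w = c (deg w) * ((single m : Series M 𝕜) ^ deg w) w := by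
  rw [powSum, Finset.sum_eq_single (deg w)]
  · intro i _ hi
    rw [single_pow, single_of_ne, mul_zero]
    rintro rfl
    exact hi (by rw [deg_pow, hm, mul_one])
  · intro h
    exact absurd (Finset.mem_range.2 (Nat.lt_succ_self _)) h

lemma Series.component_powSum_single {m : M} (hm : deg m = 1) (c : ℕ → 𝕜) (n : ℕ) :
    component n (powSum c (single m : Series M 𝕜)) = c n • (single m : Series M 𝕜) ^ n := by
  ext w
  rw [component_apply, Series.smul_apply]
  split_ifs with h
  · rw [powSum_single_apply hm, h]
  · rw [single_pow, single_of_ne, mul_zero]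
    rintro rfl
    exact h (by rw [deg_pow, hm, mul_one])

end PowSumSingle

section Star

variable {Γ : Type*} [CommGroup Γ] [Finite Γ] {𝕜 : Type*} [CommRing 𝕜]

lemma kappa_x_one_mul (f : SerX Γ 𝕜) : kappa (x 1 * f) = y 1 1 * kappa f := by
  have := kappa_wordX_mul 0 1 f
  rwa [pow_zero, one_mul, t_one_left] at this

lemma kappa_powSum_mul {F : SerX Γ 𝕜} {G : SerY Γ 𝕜} (hF : F ∈ Filt _ 𝕜 1) (hG : G ∈ Filt _ 𝕜 1)
    (h : ∀ f, kappa (F * f) = G * kappa f) (c : ℕ → 𝕜) (f : SerX Γ 𝕜) :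
    kappa (powSum c F * f) = powSum c G * kappa f := by
  have hpow : ∀ i f, kappa (F ^ i * f) = G ^ i * kappa f := by
    intro i
    induction i with
    | zero => exact fun f => by rw [pow_zero, pow_zero, one_mul, one_mul]
    | succ i ih => exact fun f => by rw [pow_succ, mul_assoc, ih, h, pow_succ, mul_assoc]
  refine eq_of_forall_sub_mem_filt fun n => ?_
  have a1 := raises_kappa.mem_filt (mul_mem_filt_left (powSum_sub_mem_filt c hF n) f)
  have a2 := mul_mem_filt_left (powSum_sub_mem_filt c hG n) (kappa f)
  rw [sub_mul, map_sub, Finset.sum_mul, map_sum] at a1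
  rw [sub_mul, Finset.sum_mul] at a2
  simp only [smul_mul_assoc, map_smul, hpow] at a1 a2
  simpa using sub_mem a1 a2

lemma y_one_mem_filt : (y 1 1 : SerY Γ 𝕜) ∈ Filt _ 𝕜 1 := by
  have := single_mem_filt (𝕜 := 𝕜) (FreeMonoid.of (⟨1, 1⟩ : AlphY Γ))
  rwa [deg_of] at this

lemma SY_apply_one (k : SerX Γ 𝕜) : SY k 1 = kappa k := by
  rw [← kappa_one, SY_kappa, SX_apply, aut_one, mul_one]

lemma obst_one (k : SerX Γ 𝕜) :
    obst k 1 = DeltaStar (kappa k) - tensor (kappa k) (kappa k) := by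
  rw [obst_apply, DeltaStar_one, ← tensor_one_one, tensorSq_tensor, SY_apply_one]

lemma splittings_one (γ : Γ) : (finite_splittings (⟨1, γ⟩ : AlphY Γ)).toFinset = ∅ := by
  refine Finset.eq_empty_of_forall_notMem fun p hp => ?_
  have h := splittings_wt hp
  have h1 := p.1.idx.pos
  have h2 := p.2.idx.pos
  simp only [PNat.one_coe] at h
  omega

lemma DeltaStar_y_one : DeltaStar (y 1 1 : SerY Γ 𝕜) = primitive (y 1 1) := by
  rw [y, DeltaStar_of, harmonicLetter, splittings_one, Finset.sum_empty, add_zero]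
  rfl

variable [Algebra ℚ 𝕜]

lemma kappa_exp_powSum_mul {c : ℕ → 𝕜} (hc : c 0 = 0) (f : SerX Γ 𝕜) :
    kappa (exp (powSum c (x 1)) * f) = exp (powSum c (y 1 1)) * kappa f :=
  kappa_powSum_mul (powSum_mem_filt_one hc (x_mem_filt 1)) (powSum_mem_filt_one hc y_one_mem_filt)
    (kappa_powSum_mul (x_mem_filt 1) y_one_mem_filt kappa_x_one_mul c) _ f

lemma thetaCoeff_one (G : SerX Γ 𝕜) : thetaCoeff G 1 = G (FreeMonoid.of (AlphX.of 1)) := by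
  simp [thetaCoeff, wordX]

/-- κ turns left multiplication by x_1 into left multiplication by y_{1,1}. The exponent of Θ starts
at n = 1 and that of G_⋆ at n = 2; the extra term is the coefficient of x_1, which is zero here. -/
lemma kappa_Theta {G : SerX Γ 𝕜} (h0 : G (FreeMonoid.of AlphX.zero) = 0)
    (h1 : G (FreeMonoid.of (AlphX.of 1)) = 0) : kappa (Theta G) = starMul G := by
  rw [Theta_of_apply_x0 h0, kappa_exp_powSum_mul (thetaCoeff_zero G), starMul]
  have : thetaCoeff G = fun n : ℕ => if h : 2 ≤ n then
      algebraMap ℚ 𝕜 ((-1) ^ (n - 1) / (n : ℚ)) *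
        piY G (FreeMonoid.of ⟨⟨n, by omega⟩, 1⟩) else 0 := by
    funext n
    rcases n with _ | _ | n
    · rfl
    · rw [dif_neg (by omega)]
      exact (thetaCoeff_one G).trans h1
    · rw [dif_pos (by omega), thetaCoeff, if_pos (by omega)]
      congr 1
  rw [this]
  rfl

lemma tensorSq_mulLeft {M : Type*} [Monoid M] [FinGraded M] (f : Series M 𝕜)
    (F : Series (M × M) 𝕜) : tensorSq (mulLeft f) F = tensor f f * F := by
  have : tensorSq (mulLeft f) = mulLeft (tensor f f) := clm_ext_tensor fun a b => by
    rw [tensorSq_tensor, mulLeft_apply, mulLeft_apply, mulLeft_apply, tensor_mul_tensor]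
  rw [this, mulLeft_apply]

/-- For this series aut is the identity, so S^Y is left multiplication by e^{βy_{1,1}}, which is
group-like for Δ_* because y_{1,1} is primitive. -/
lemma obst_exp_x1 (β : 𝕜) : obst (exp (β • x 1 : SerX Γ 𝕜)) = 0 := by
  have h1 : β • (y 1 1 : SerY Γ 𝕜) ∈ Filt _ 𝕜 1 := Submodule.smul_mem _ _ y_one_mem_filt
  have h2 : SY (exp (β • x 1 : SerX Γ 𝕜)) = mulLeft (exp (β • y 1 1)) :=
    clm_ext_kappa fun f => by
      rw [SY_kappa, mulLeft_apply, SX_apply, aut_exp_x1]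
      exact kappa_powSum_mul (smul_x1_mem_filt β) h1
        (fun f => by rw [smul_mul_assoc, map_smul, kappa_x_one_mul, smul_mul_assoc]) _ f
  ext1 f
  rw [obst_apply, h2, tensorSq_mulLeft, mulLeft_apply, DeltaStar_mul,
    map_exp raises_DeltaStar DeltaStar_one DeltaStar_mul h1, map_smul, DeltaStar_y_one,
    ← primitive_smul, exp_primitive h1, sub_self]
  rfl

lemma eps_zero : eps (0 : SerX Γ 𝕜) = 0 := by
  have := eps_sub (0 : SerX Γ 𝕜) 0
  rwa [sub_zero, sub_self] at this

end Star

/-! ### The stabilizer of the harmonic coproduct -/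

section Stabilizer

variable {Γ : Type*} [CommGroup Γ] [Fintype Γ] {𝕜 : Type*} [CommRing 𝕜] [Algebra ℚ 𝕜]

lemma component_component {M : Type*} [Monoid M] [FinGraded M] (n : ℕ) (f : Series M 𝕜) :
    component n (component n f) = component n f := by
  ext w
  rw [component_apply]
  split_ifs with h
  · rfl
  · rw [component_apply, if_neg h]

lemma natCast_mul_thetaCoeff (G : SerX Γ 𝕜) {n : ℕ} (hn : n ≠ 0) :
    (n : 𝕜) * thetaCoeff G n = (-1) ^ (n - 1) * G (wordX (n - 1) 1) := by
  rw [thetaCoeff, if_pos (by omega), ← mul_assoc]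
  congr 1
  rw [← map_natCast (algebraMap ℚ 𝕜), ← map_mul, mul_div_cancel₀ _ (by exact_mod_cast hn), map_pow,
    map_neg, map_one]

/-- Elements of `DMR_0(𝕜)` stabilize the harmonic coproduct. -/
theorem IsDMR0.obst_Theta {G : SerX Γ 𝕜} (h : IsDMR0 Γ 𝕜 G) : obst (Theta G) = 0 := by
  let g : MT Γ 𝕜 := ⟨G, h.coeff_one⟩
  have hg : IsGroupLike g.1 := ⟨h.coeff_one, h.grouplike⟩
  have hk : Theta G 1 = 1 := Theta_apply_one h.coeff_one
  have hξ : SX (Theta G) (logDer g + thetaDer g) = euler _ 𝕜 (Theta G) := SX_Theta g h.coeff_x0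
  -- The value at 1 is the harmonic group-likeness of G_⋆. The rest is the infinitesimal statement
  -- for each component of the logarithmic derivative, with c = n times the n-th coefficient of the
  -- exponent of Θ.
  refine obst_eq_zero hk hξ ?_ fun n hn => ?_
  · rw [obst_one, kappa_Theta h.coeff_x0 h.coeff_x1, h.grouplike_star, sub_self]
  · rcases Nat.eq_zero_or_pos n with rfl | hpos
    · have : component 0 (logDer g + thetaDer g) = 0 := by
        ext w
        rw [component_apply]
        split_ifs with hw
        · rw [eq_one_of_deg w hw]
          exact mem_filt_one.1 (mem_filt_one_of_SX hξ hk)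
        · rfl
      rw [this, eps_zero]
    · have hn0 : n ≠ 0 := by omega
      have e : component n (logDer g + thetaDer g) =
          component n (logDer g) + ((n : 𝕜) * thetaCoeff G n) • x 1 ^ n := by
        have h1 := component_powSum_single (𝕜 := 𝕜) (deg_letterX (AlphX.of (1 : Γ)))
          (fun n => (n : 𝕜) * thetaCoeff G n) n
        rw [← Series.comp_apply_eq, map_add, Series.comp_apply_eq, Series.comp_apply_eq]
        exact congrArg _ h1
      rw [e] at hn ⊢
      refine eps_eq_zero_of_primitive hn0 (component_component n _) ?_ ?_ ?_ ?_ ?_ hn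
      · rw [homog_DeltaX.map_component, hg.DeltaX_logDer, Series.primitive_component]
      · rw [component_apply, logDer_apply_of]
        split_ifs
        · exact h.coeff_x0
        · rfl
      · rintro rfl σ
        rw [component_apply, component_apply, deg_letterX, deg_letterX, logDer_apply_of,
          logDer_apply_of, if_pos rfl, if_pos rfl]
        exact sub_eq_zero.1 (h.coeff_symm σ)
      · rintro rfl
        rw [component_apply, deg_wordX, if_pos rfl, logDer_apply_wordX, wordX, pow_one]
        exact mul_eq_zero_of_right _ h.coeff_x0x1
      · rw [component_apply, deg_wordX, Nat.sub_add_cancel hpos, if_pos rfl, logDer_apply_wordX,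
          Nat.sub_add_cancel hpos, natCast_mul_thetaCoeff G hn0]
        exact mul_left_comm _ _ _

lemma primitive_apply_letters (F : SerY Γ 𝕜) (a b : AlphY Γ) :
    primitive F (FreeMonoid.of a, FreeMonoid.of b) = 0 := by
  have h : ∀ c : AlphY Γ, (1 : SerY Γ 𝕜) (FreeMonoid.of c) = 0 := fun c =>
    single_of_ne fun h => of_mul_ne_one c 1 (by rw [mul_one]; exact h)
  rw [primitive, Series.add_apply, tensor_apply, tensor_apply, h, h, mul_zero, zero_mul, add_zero]

/-- The coderivation property of `derY ξ` in degrees two and three. -/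
lemma apply_sub_apply_inv_add {ξ : SerX Γ 𝕜} (h : ∀ a, DeltaStar (derY ξ a) = coderY ξ a)
    (α β : Γ) : ξ (FreeMonoid.of (AlphX.of α)) - ξ (FreeMonoid.of (AlphX.of α⁻¹)) +
      (ξ (FreeMonoid.of (AlphX.of β)) - ξ (FreeMonoid.of (AlphX.of β⁻¹))) = 0 := by
  classical
  have h1 := DeltaStar_apply_letters (derY ξ ⟨1, α * β⟩) (⟨1, α⟩ : AlphY Γ) ⟨1, β⟩
  -- A letter of index one has no splittings, so the right-hand side is primitive and has
  -- coefficient zero at a pair of letters.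
  rw [h, coderY, splittings_one, Finset.sum_empty, add_zero, primitive_apply_letters] at h1
  have h2 := kappa_mul_x_apply (ξ - t (α * β) ξ) (α * β) 1 (merge (⟨1, α⟩ : AlphY Γ) ⟨1, β⟩)
  have h3 := kappa_mul_x_apply (ξ - t (α * β) ξ) (α * β) (FreeMonoid.of ⟨1, α⟩)
    (⟨1, β⟩ : AlphY Γ)
  have h4 := kappa_mul_x_apply (ξ - t (α * β) ξ) (α * β) (FreeMonoid.of ⟨1, β⟩)
    (⟨1, α⟩ : AlphY Γ)
  have hs : ∀ γ δ : Γ, shiftWord γ (FreeMonoid.of (AlphX.of δ)) =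
    FreeMonoid.of (AlphX.of (γ * δ)) := fun γ δ => rfl
  have hs0 : ∀ γ : Γ, shiftWord γ (FreeMonoid.of AlphX.zero) =
    FreeMonoid.of AlphX.zero := fun γ => rfl
  simp only [derY, PNat.one_coe, Nat.sub_self, pow_zero, mul_one, one_mul] at h1
  simp only [merge, psi_of, wordX, t_apply, hs, hs0, psi_one, map_one, col_of, Series.sub_apply,
    PNat.add_coe, PNat.one_coe, Nat.add_sub_cancel, Nat.sub_self, pow_zero, pow_one, one_mul,
    mul_one, mul_comm β α, mul_inv_rev, inv_mul_cancel_right, sub_self, ite_true] at h2 h3 h4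
  rw [mul_comm β⁻¹ α⁻¹, inv_mul_cancel_right] at h4
  rw [h3, h4] at h1
  change 0 = _ + kappa ((ξ - (t (α * β)) ξ) * x (α * β)) (FreeMonoid.of ⟨1 + 1, α * β⟩) at h1
  rw [h2] at h1
  linear_combination -h1

/-- Tested on y_{2,1} at the pair (y_{2,1}, y_{2,1}). The splittings of y_{2,1} involve only letters
of index one and do not contribute, and the merged letter y_{4,1} contributes the coefficient of
x_0^3 in [ξ, x_0], which is zero. -/
lemma apply_x0_mul_x1_eq {ξ : SerX Γ 𝕜} (h : ∀ a, DeltaStar (derY ξ a) = coderY ξ a) :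
    ξ (FreeMonoid.of AlphX.zero * FreeMonoid.of (AlphX.of 1)) =
      ξ (FreeMonoid.of (AlphX.of 1) * FreeMonoid.of AlphX.zero) := by
  classical
  set b : AlphY Γ := ⟨2, 1⟩ with hb
  have h1 := DeltaStar_apply_letters (derY ξ b) b b
  rw [h, coderY, Series.add_apply, primitive_apply_letters, Series.sum_apply,
    Finset.sum_eq_zero fun p hp => ?_] at h1
  · have h2 := kappa_mul_x_apply (ξ * x0 - x0 * ξ) (1 : Γ) 1 (merge b b)
    have h3 := kappa_mul_x_apply (ξ * x0 - x0 * ξ) (1 : Γ) (FreeMonoid.of b) b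
    have e2 : (ξ * x0 - x0 * ξ : SerX Γ 𝕜) (FreeMonoid.of AlphX.zero ^ 3) = 0 := by
      have a1 := mul_single_apply ξ AlphX.zero AlphX.zero (FreeMonoid.of AlphX.zero ^ 2)
      have a2 := single_mul_apply ξ AlphX.zero AlphX.zero (FreeMonoid.of AlphX.zero ^ 2)
      rw [if_pos rfl] at a1 a2
      rw [← pow_succ] at a1
      rw [← pow_succ'] at a2
      exact sub_eq_zero.2 (a1.trans a2.symm)
    have e3 : (ξ * x0 - x0 * ξ : SerX Γ 𝕜) (FreeMonoid.of AlphX.zero * FreeMonoid.of (AlphX.of 1) *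
        FreeMonoid.of AlphX.zero) =
        ξ (FreeMonoid.of AlphX.zero * FreeMonoid.of (AlphX.of 1)) -
          ξ (FreeMonoid.of (AlphX.of 1) * FreeMonoid.of AlphX.zero) := by
      rw [Series.sub_apply, x0, mul_single_apply, mul_assoc, single_mul_apply, if_pos rfl,
        if_pos rfl]
    have hd : derY ξ b = kappa ((ξ * x0 - x0 * ξ) * x 1) := by
      rw [derY, hb, t_one_left, show ((2 : ℕ+) : ℕ) - 1 = 1 from rfl, pow_one]
    have hm : ((merge b b).idx : ℕ) - 1 = 3 := rfl
    rw [if_pos (by rw [map_one, one_mul]; exact one_mul 1), one_mul, psi_one, one_mul, hm, e2] at h2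
    rw [if_pos (by rw [col_of]; exact one_mul 1), psi_of, wordX,
      show ((b.idx : ℕ) - 1) = 1 from rfl, pow_one, e3] at h3
    rw [hd, h2, h3] at h1
    refine sub_eq_zero.1 (eq_zero_of_natCast_mul two_ne_zero ?_)
    push_cast
    linear_combination -h1
  · have h2 := splittings_wt hp
    have hne : ∀ c : AlphY Γ, (c.idx : ℕ) < 2 → (single (FreeMonoid.of c) : SerY Γ 𝕜)
        (FreeMonoid.of b) = 0 := fun c hc => single_of_ne fun he => by
      rw [← FreeMonoid.of_injective he] at hc
      exact absurd hc (lt_irrefl 2)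
    have p1 := p.1.idx.pos
    have p2 := p.2.idx.pos
    have h3 : (b.idx : ℕ) = 2 := rfl
    rw [Series.add_apply, tensor_apply, tensor_apply, hne p.2 (by omega), hne p.1 (by omega),
      mul_zero, zero_mul, add_zero]

/-- Normalized stabilizers of the harmonic coproduct lie in `DMR_0(𝕜)`. -/
theorem isDMR0_of_obst_Theta {G : SerX Γ 𝕜} (hG : IsGroupLike G)
    (h0 : G (FreeMonoid.of AlphX.zero) = 0) (h1 : G (FreeMonoid.of (AlphX.of 1)) = 0)
    (h : obst (Theta G) = 0) : IsDMR0 Γ 𝕜 G := by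
  let g : MT Γ 𝕜 := ⟨G, hG.1⟩
  have hk : Theta G 1 = 1 := Theta_apply_one hG.1
  have hξ : SX (Theta G) (logDer g + thetaDer g) = euler _ 𝕜 (Theta G) := SX_Theta g h0
  have hder := ((eps_eq_zero_iff _).1 (eps_eq_zero_of_obst_eq_zero hk hξ h)).2
  -- The exponent of Θ contributes only powers of x_1. Its linear term is the coefficient (G|x_1) =
  -- 0, and x_1² does not meet x_0 x_1 or x_1 x_0, so the low-degree relations for ξ are relations
  -- for the logarithmic derivative of G.
  have hθ : ∀ w, deg w = 1 → thetaDer g w = 0 := fun w hw => by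
    rw [thetaDer, x, powSum_single_apply (deg_letterX _), hw, thetaCoeff_one]
    simp only [g, h1, mul_zero, zero_mul]
  have hθ2 : ∀ w, deg w = 2 → depthX Γ w = Multiplicative.ofAdd 1 → thetaDer g w = 0 :=
    fun w hw hd => by
      have := x_one_pow_apply_eq_zero (𝕜 := 𝕜) (n := 2) (w := w) (by rw [hd]; decide)
      rw [thetaDer, x, powSum_single_apply (deg_letterX _), hw]
      rw [x] at this
      rw [this, mul_zero]
  have hanti := antipode_of_primitive (mem_filt_one_of_SX (SX_logDer g) g.2)
    (IsGroupLike.DeltaX_logDer (g := g) hG)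
  refine ⟨isUnit_of_constCoeff hG.1, hG.1, h0, h1, ?_, fun σ => ?_, hG.2, ?_⟩
  · have e := apply_x0_mul_x1_eq hder
    have d1 : depthX Γ (FreeMonoid.of AlphX.zero) = 1 := FreeMonoid.lift_eval_of _ _
    have d2 : depthX Γ (FreeMonoid.of (AlphX.of 1)) = Multiplicative.ofAdd 1 :=
      FreeMonoid.lift_eval_of _ _
    rw [Series.add_apply, Series.add_apply,
      hθ2 _ (by rw [deg_mul, deg_letterX, deg_letterX]) (by rw [map_mul, d1, d2, one_mul]),
      hθ2 _ (by rw [deg_mul, deg_letterX, deg_letterX]) (by rw [map_mul, d1, d2, mul_one]),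
      add_zero, add_zero] at e
    have e2 := congrArg (fun s : SerX Γ 𝕜 => s (FreeMonoid.of AlphX.zero *
      FreeMonoid.of (AlphX.of 1))) hanti
    simp only [antipode_apply, Series.neg_apply, FreeMonoid.reverse_mul, FreeMonoid.reverse_of,
      FreeMonoid.length_mul, FreeMonoid.length_of] at e2
    have e3 := logDer_apply_wordX g 1
    rw [wordX, pow_one] at e3
    -- The coefficients at x_0 x_1 and x_1 x_0 are equal by the coderivation property and opposite
    -- by the antipode, which gives one factor 2; the other is the degree in the logarithmic
    -- derivative.
    refine eq_zero_of_natCast_mul (n := 2) two_ne_zero (eq_zero_of_natCast_mul (n := 2)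
      two_ne_zero ?_)
    push_cast at e3 ⊢
    change _ = 2 * G _ at e3
    linear_combination e2 + e - 2 * e3
  -- Both letters are taken of colour σ, so the relation is twice the wanted difference.
  · have e := apply_sub_apply_inv_add hder σ σ
    simp only [Series.add_apply, hθ _ (deg_letterX _), add_zero, logDer_apply_of] at e
    refine eq_zero_of_natCast_mul (n := 2) two_ne_zero ?_
    push_cast
    linear_combination e
  · have e : obst (Theta G) 1 = 0 := by rw [h]; rfl
    rw [obst_one, kappa_Theta h0 h1, sub_eq_zero] at e
    exact e

variable (Γ 𝕜) in
/-- The stabilizer of the harmonic coproduct. -/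
noncomputable def stab : Subgroup (groupLike Γ 𝕜) :=
  @MulAction.stabilizer (groupLike Γ 𝕜) (HomCont Γ 𝕜) _
    (MulAction.compHom (HomCont Γ 𝕜) (ThetaHom Γ 𝕜)) DeltaStar

lemma mem_stab {g : groupLike Γ 𝕜} : g ∈ stab Γ 𝕜 ↔
    tensorSq (SY (Theta g.1.1)) ∘L DeltaStar = DeltaStar ∘L SY (Theta g.1.1) :=
  MT_smul_eq_iff (ThetaHom Γ 𝕜 g) DeltaStar

lemma mem_stab_iff_obst {g : groupLike Γ 𝕜} : g ∈ stab Γ 𝕜 ↔ obst (Theta g.1.1) = 0 :=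
  mem_stab.trans (obst_eq_zero_iff _).symm

variable (Γ) in
/-- `e^{α x_0}` -/
noncomputable def expX0 (α : 𝕜) : groupLike Γ 𝕜 :=
  ⟨⟨exp (α • x0), exp_apply_one _⟩, isGroupLike_exp_x0 α⟩

variable (Γ) in
/-- `e^{β x_1}` -/
noncomputable def expX1 (β : 𝕜) : groupLike Γ 𝕜 :=
  ⟨⟨exp (β • x 1), exp_apply_one _⟩, isGroupLike_exp_x1 β⟩

lemma expX1_mul_mul_expX0_val (α β : 𝕜) (g : groupLike Γ 𝕜) :
    (expX1 Γ β * g * expX0 Γ α).1.1 = exp (β • x 1) * g.1.1 * exp (α • x0) := by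
  change circ (circ (exp (β • x 1)) g.1.1) (exp (α • x0)) = _
  rw [circ_exp_x0, circ_exp_x1]

lemma expX0_mem_stab (α : 𝕜) : expX0 Γ α ∈ stab Γ 𝕜 := by
  rw [mem_stab]
  change tensorSq (SY (Theta (exp (α • x0)))) ∘L DeltaStar =
    DeltaStar ∘L SY (Theta (exp (α • x0)))
  rw [Theta_exp_x0, SY_one, tensorSq_id]
  rfl

lemma expX1_mem_stab (β : 𝕜) : expX1 Γ β ∈ stab Γ 𝕜 := by
  rw [mem_stab_iff_obst]
  change obst (Theta (exp (β • x 1))) = 0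
  rw [Theta_exp_x1, obst_exp_x1]

/-- Multiplying by e^{-βx_1} on the left and e^{-αx_0} on the right stays in the stabilizer and, by
additivity of the coefficients of x_0 and x_1 under ⊛, reaches the normalized case. For these
factors ⊛ is the ordinary product, which gives the shape of the elements. -/
lemma image_stab : (fun g : groupLike Γ 𝕜 => g.1.1) '' (stab Γ 𝕜 : Set (groupLike Γ 𝕜)) =
    DMR0tilde Γ 𝕜 := by
  ext h
  constructor
  · rintro ⟨g, hg, rfl⟩
    set α := g.1.1 (FreeMonoid.of AlphX.zero) with hα
    set β := g.1.1 (FreeMonoid.of (AlphX.of 1)) with hβ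
    set k := expX1 Γ (-β) * g * expX0 Γ (-α) with hk
    have hmem : k ∈ stab Γ 𝕜 :=
      mul_mem (mul_mem (expX1_mem_stab _) hg) (expX0_mem_stab _)
    have hval := expX1_mul_mul_expX0_val (-α) (-β) g
    rw [neg_smul, neg_smul] at hval
    have c1 : circ (exp ((-β) • x 1)) g.1.1 1 = 1 := circ_apply_one (exp_apply_one _) g.1.2
    have h0 : k.1.1 (FreeMonoid.of AlphX.zero) = 0 := by
      change circ (circ (exp ((-β) • x 1)) g.1.1) (exp ((-α) • x0)) _ = 0
      rw [circ_apply_x0 c1 (exp_apply_one _), circ_apply_x0 (exp_apply_one _) g.1.2,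
        exp_x1_apply_zero, exp_x0_apply_x0, ← hα]
      ring
    have hw : wordX 0 (1 : Γ) = FreeMonoid.of (AlphX.of 1) := by rw [wordX, pow_zero, one_mul]
    have h1 : k.1.1 (FreeMonoid.of (AlphX.of 1)) = 0 := by
      change circ (circ (exp ((-β) • x 1)) g.1.1) (exp ((-α) • x0)) _ = 0
      rw [← hw, circ_apply_wordX c1 (exp_apply_one _), circ_apply_wordX (exp_apply_one _) g.1.2,
        exp_x0_apply_wordX, hw, exp_x1_apply_x1, ← hβ]
      ring
    refine ⟨α, β, k.1.1, isDMR0_of_obst_Theta k.2 h0 h1 (mem_stab_iff_obst.1 hmem), ?_⟩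
    rw [hval, mul_assoc, mul_assoc, exp_neg_mul_exp (smul_x0_mem_filt α), mul_one, ← mul_assoc,
      exp_mul_exp_neg (smul_x1_mem_filt β), one_mul]
  · rintro ⟨α, β, G, hG, rfl⟩
    let g : groupLike Γ 𝕜 := ⟨⟨G, hG.coeff_one⟩, ⟨hG.coeff_one, hG.grouplike⟩⟩
    have hg : g ∈ stab Γ 𝕜 := mem_stab_iff_obst.2 hG.obst_Theta
    exact ⟨expX1 Γ β * g * expX0 Γ α, mul_mem (mul_mem (expX1_mem_stab β) hg) (expX0_mem_stab α),
      expX1_mul_mul_expX0_val α β g⟩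

lemma SY_apply_apply_one {k : SerX Γ 𝕜} (hk : k 1 = 1) (K : SerY Γ 𝕜) : SY k K 1 = K 1 := by
  have := (raises_SY_sub_id hk).mem_filt (filt_zero K) 1 (by rw [deg_one]; omega)
  rwa [_root_.sub_apply, Series.sub_apply, sub_eq_zero] at this

lemma mem_stab_iff_isCoalgebraAut {g : groupLike Γ 𝕜} :
    g ∈ stab Γ 𝕜 ↔ IsCoalgebraAut (SY (Theta g.1.1)) :=
  mem_stab.trans ⟨fun h => ⟨SY_isInvertible (ThetaHom Γ 𝕜 g), h,
    SY_apply_apply_one (Theta_apply_one g.1.2)⟩, fun h => h.2.1⟩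

lemma image_groupLike :
    Subtype.val '' (groupLike Γ 𝕜 : Set (MT Γ 𝕜)) = expLib Γ 𝕜 := by
  ext G
  rw [mem_expLib]
  exact ⟨fun ⟨g, hg, h⟩ => h ▸ hg, fun h => ⟨⟨G, h.1⟩, h, rfl⟩⟩

end Stabilizer
end DoubleShuffle

open DoubleShuffle Series in
theorem mainTheorem1 (Γ : Type*) [CommGroup Γ] [Finite Γ]
    (𝕜 : Type*) [CommRing 𝕜] [Algebra ℚ 𝕜] :
    ∃ (_ : Group (MT Γ 𝕜)) (_ : MulAction (MT Γ 𝕜) (HomCont Γ 𝕜))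
      (E : Subgroup (MT Γ 𝕜)) (Θ : E →* MT Γ 𝕜) (D : Subgroup E),
      -- the group law of `MT(𝕜)` is `⊛`
      (∀ g h : MT Γ 𝕜, (g * h : MT Γ 𝕜).1 = circ g.1 h.1) ∧
      -- `S^Y_g` is the automorphism induced by `S_g`, and `g ↦ S^Y_g` is a morphism
      (∀ g : MT Γ 𝕜, (SY g.1).IsInvertible ∧ SY g.1 ∘L (q ∘L piY) = (q ∘L piY) ∘L SX g.1) ∧
      (∀ g h : MT Γ 𝕜, SY (g * h : MT Γ 𝕜).1 = SY g.1 ∘L SY h.1) ∧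
      -- the natural action of `MT(𝕜)` on continuous linear maps
      (∀ (g : MT Γ 𝕜) (u : HomCont Γ 𝕜), g • u = tensorSq (SY g.1) ∘L u ∘L (SY g.1).inverse) ∧
      -- `E` is the group `exp` of the completed free Lie algebra, and `Θ` is given by its formula
      Subtype.val '' (E : Set (MT Γ 𝕜)) = expLib Γ 𝕜 ∧
      (∀ g : E, (Θ g).1 = Theta g.1.1) ∧
      -- `D` is the subgroup with underlying set `{e^{β x_1} · g · e^{α x_0}}`
      (fun g : E => g.1.1) '' (D : Set E) = DMR0tilde Γ 𝕜 ∧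
      -- `D` is the stabilizer of `Δ_*` for the action of `E` pulled back by `Θ`
      D = @MulAction.stabilizer E (HomCont Γ 𝕜) _ (MulAction.compHom (HomCont Γ 𝕜) Θ)
        DeltaStar ∧
      (∀ g : E, g ∈ D ↔
        tensorSq (SY (Theta g.1.1)) ∘L DeltaStar = DeltaStar ∘L SY (Theta g.1.1)) ∧
      (∀ g : E, g ∈ D ↔ IsCoalgebraAut (SY (Theta g.1.1))) := by
  -- An enumeration of Γ is only needed for the sums over colours in the stabilizer argument.
  obtain ⟨_⟩ := nonempty_fintype Γ
  exact ⟨instGroupMT, instMulActionMT, groupLike Γ 𝕜, ThetaHom Γ 𝕜, stab Γ 𝕜, MT_mul_val,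
    fun g => ⟨SY_isInvertible g, ContinuousLinearMap.ext fun f => SY_kappa g.1 f⟩, SY_mul,
    MT_smul_def, image_groupLike, fun _ => rfl, image_stab, rfl, fun _ => mem_stab,
    fun _ => mem_stab_iff_isCoalgebraAut⟩
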